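/- Let $M$ be a smooth manifold with boundary (Hausdorff, second countable, of dimension $k+2$ with $k\ge 0$), equipped with a free smooth action of the circle $S^1$ on an open neighbourhood $U_M$ of its boundary $\partial M$ (then $\partial M$ is $S^1$-invariant). Let $M_{\mathrm{red}}=(\partial M)/S^1$, and let $c\colon M\to M_{\mathrm{cut}}$ be the quotient of $M$ by the equivalence relation in which distinct points are equivalent if and only if they both lie in $\partial M$ and in the same $S^1$-orbit; both spaces carry the quotient topology. An *invariant boundary defining function* is a smooth $f\colon M\to\mathbb R_{\ge 0}$ with $f^{-1}(0)=\partial M$, with $df\neq 0$ at every point of $\partial M$, and which is $S^1$-invariant on an $S^1$-invariant neighbourhood of $\partial M$ in $U_M$. Let $\mathcal F_M$ be the set of functions $h\colon M_{\mathrm{cut}}\to\mathbb R$ such that $h\circ c$ is smooth on the interior $\mathring M$ and such that, for some invariant boundary defining function $f$, some $S^1$-invariant open neighbourhood $V$ of $\partial M$ in $U_M$, and some smooth $H\colon V\times\mathbb C\to\mathbb R$, one has $H(a\cdot x,z)=H(x,az)$ for all $a\in S^1$, $x\in V$, $z\in\mathbb C$, and $h(c(x))=H(x,\sqrt{f(x)})$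 for all $x\in V$. Let $\beta$ be a symplectic two-form on $M$ (smooth, closed, and non-degenerate at every point, including boundary points) whose pullback to $\partial M$ is basic (invariant, and annihilated by contraction with the vector field generating the circle action on $\partial M$) and whose restriction to some $S^1$-invariant open neighbourhood of $\partial M$ in $U_M$ is $S^1$-invariant. Then $M_{\mathrm{red}}$ has a (necessarily unique) structure of a smooth $k$-dimensional manifold for which the quotient map $\pi\colon\partial M\to M_{\mathrm{red}}$ is a submersion, and $M_{\mathrm{cut}}$ has a (necessarily unique) structure of a smooth $(k+2)$-dimensional manifold whose set of smooth real-valued functions is $\mathcal F_M$. With these structures there is a unique smooth two-form $\beta_{\mathrm{red}}$ on $M_{\mathrm{red}}$ such that $\pi^*\beta_{\mathrm{red}}$ is the pullback of $\beta$ to $\partial M$, there is a unique smooth two-form $\beta_{\mathrm{cut}}$ on $M_{\mathrm{cut}}$ whose pullback by $c|_{\mathring M}$ is $\beta|_{\mathring M}$, and: 1. $\beta_{\mathrm{red}}$ is a symplectic form on $M_{\mathrm{red}}$. 2. Hence $M_{\mathrm{red}}$ is a symplectic submanifold of $M_{\mathrm{cut}}$: the map $M_{\mathrm{red}}\to M_{\mathrm{cut}}$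 induced by the inclusion $\partial M\subset M$ is a smooth embedding, $\beta_{\mathrm{cut}}$ is a symplectic form on $M_{\mathrm{cut}}$, and the pullback of $\beta_{\mathrm{cut}}$ to $M_{\mathrm{red}}$ is $\beta_{\mathrm{red}}$. -/

import Mathlib

open Set Topology Manifold ContDiff

-- This instance applies to every type and would hide the standard ones (`chartedSpaceSelf`,
-- open subsets, products) behind a definitionally equal wrapper.
attribute [-instance] TopCat.of.chartedSpace

noncomputable section

/-! ### Differential forms on manifolds (possibly with boundary) -/

section Forms

/-- A (not necessarily smooth) differential form of degree `m` on the manifold `N`. -/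
abbrev DiffForm {E H : Type*} [NormedAddCommGroup E] [NormedSpace ℝ E] [TopologicalSpace H]
    (I : ModelWithCorners ℝ E H) (N : Type*) [TopologicalSpace N] [ChartedSpace H N] (m : ℕ) :=
  (x : N) → (TangentSpace I x) [⋀^Fin m]→L[ℝ] ℝ

variable {E H : Type*} [NormedAddCommGroup E] [NormedSpace ℝ E] [TopologicalSpace H]
  {I : ModelWithCorners ℝ E H} {N : Type*} [TopologicalSpace N] [ChartedSpace H N]
  {E' H' : Type*} [NormedAddCommGroup E'] [NormedSpace ℝ E'] [TopologicalSpace H']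
  {I' : ModelWithCorners ℝ E' H'} {N' : Type*} [TopologicalSpace N'] [ChartedSpace H' N']
  {m : ℕ}

namespace DiffForm

/-- The pullback `f^* β`. -/
def pullback (I : ModelWithCorners ℝ E H) (I' : ModelWithCorners ℝ E' H') (f : N → N')
    (β : DiffForm I' N' m) : DiffForm I N m :=
  fun x => (β (f x)).compContinuousLinearMap (mfderiv I I' f x)

/-- The expression of `β` in the preferred chart around `x₀`: the pullback of `β` under the
inverse of the chart, a form on (a subset of) the model vector space. -/
def inChart (β : DiffForm I N m) (x₀ : N) : E → E [⋀^Fin m]→L[ℝ] ℝ :=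
  fun y => (β ((extChartAt I x₀).symm y)).compContinuousLinearMap
    (mfderivWithin 𝓘(ℝ, E) I (extChartAt I x₀).symm (range I) y)

/-- `β` is smooth: all its chart expressions are smooth (up to the boundary). -/
def IsSmooth (β : DiffForm I N m) : Prop :=
  ∀ x₀ : N, ContDiffOn ℝ ∞ (β.inChart x₀) (extChartAt I x₀).target

/-- `dβ = 0`, expressed in charts. -/
def IsClosed (β : DiffForm I N m) : Prop :=
  ∀ x₀ : N, ∀ y ∈ (extChartAt I x₀).target, extDerivWithin (β.inChart x₀) (range I) y = 0

/-- A two-form is non-degenerate if each `v ↦ β_x(v, ·)` is injective. -/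
def IsNondegenerate (β : DiffForm I N 2) : Prop :=
  ∀ (x : N) (v : TangentSpace I x), (∀ w : TangentSpace I x, β x ![v, w] = 0) → v = 0

/-- A symplectic form: a smooth closed non-degenerate two-form. -/
structure IsSymplectic (β : DiffForm I N 2) : Prop where
  smooth : β.IsSmooth
  closed : β.IsClosed
  nondegenerate : β.IsNondegenerate

end DiffForm

/-- The vector field generating a circle action `act` on `N`: its value at `x` is the velocity at
`t = 0` of the curve `t ↦ exp(it) · x`. -/
def generatingField (I : ModelWithCorners ℝ E H) (act : Circle → N → N) (x : N) :
    TangentSpace I x :=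
  (mfderiv 𝓘(ℝ, ℝ) I (fun t : ℝ => act (Circle.exp t) x) 0 (1 : ℝ) : E)

/-- A form on a manifold with a circle action is basic if it is horizontal (its contraction with
the generating vector field vanishes) and invariant. -/
structure DiffForm.IsBasic (act : Circle → N → N) (β : DiffForm I N (m + 1)) : Prop where
  horizontal : ∀ (x : N) (w : Fin m → TangentSpace I x),
    β x (Matrix.vecCons (generatingField I act x) w) = 0
  invariant : ∀ a : Circle, DiffForm.pullback I I (act a) β = β

end Forms

/-! ### The boundary as a manifold

`M` is a manifold with boundary of dimension `k + 2`, modelled on the half-space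
`{x ∈ ℝ^{k+2} | 0 ≤ x 0}`. Its boundary is charted by the last `k + 1` coordinates of the charts
of `M`. -/

section Boundary

/-- The boundary of `M`, as a type. -/
abbrev Bdry (k : ℕ) (M : Type*) [TopologicalSpace M]
    [ChartedSpace (EuclideanHalfSpace (k + 2)) M] : Type _ :=
  ((𝓡∂ (k + 2)).boundary M : Set M)

/-- The inclusion `y ↦ (0, y)` of `ℝ^{k+1}` in `ℝ^{k+2}`. -/
def consZero (k : ℕ) (y : EuclideanSpace ℝ (Fin (k + 1))) : EuclideanSpace ℝ (Fin (k + 2)) :=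
  WithLp.toLp 2 (Fin.cons 0 (fun i => y i))

/-- The projection `(x₀, y) ↦ y` of `ℝ^{k+2}` to `ℝ^{k+1}`. -/
def tailCoord (k : ℕ) (x : EuclideanSpace ℝ (Fin (k + 2))) : EuclideanSpace ℝ (Fin (k + 1)) :=
  WithLp.toLp 2 (fun i => x i.succ)

/-- `y ↦ (0, y)` as a map to the half-space. -/
def consZeroHalf (k : ℕ) (y : EuclideanSpace ℝ (Fin (k + 1))) : EuclideanHalfSpace (k + 2) :=
  ⟨consZero k y, by simp [consZero]⟩

theorem tailCoord_consZero (k : ℕ) (y : EuclideanSpace ℝ (Fin (k + 1))) :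
    tailCoord k (consZero k y) = y := by
  ext i; simp [tailCoord, consZero]

theorem consZero_tailCoord (k : ℕ) (x : EuclideanSpace ℝ (Fin (k + 2))) (hx : x 0 = 0) :
    consZero k (tailCoord k x) = x := by
  ext i
  refine Fin.cases ?_ (fun j => ?_) i <;> simp [tailCoord, consZero, hx]

theorem contDiff_consZero (k : ℕ) : ContDiff ℝ ∞ (consZero k) := by
  rw [contDiff_euclidean]
  intro i
  refine Fin.cases ?_ (fun j => ?_) i
  · simpa [consZero] using contDiff_const
  · simp only [consZero, Fin.cons_succ]
    fun_prop

theorem contDiff_tailCoord (k : ℕ) : ContDiff ℝ ∞ (tailCoord k) := by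
  rw [contDiff_euclidean]
  intro i
  simp only [tailCoord]
  fun_prop

theorem continuous_consZeroHalf (k : ℕ) : Continuous (consZeroHalf k) :=
  (contDiff_consZero k).continuous.subtype_mk _

variable {k : ℕ} {M : Type*} [TopologicalSpace M] [ChartedSpace (EuclideanHalfSpace (k + 2)) M]
  [IsManifold (𝓡∂ (k + 2)) ∞ M]

theorem mem_boundary_iff_of_mem_atlas {e : OpenPartialHomeomorph M (EuclideanHalfSpace (k + 2))}
    (he : e ∈ atlas (EuclideanHalfSpace (k + 2)) M) {x : M} (hx : x ∈ e.source) :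
    x ∈ (𝓡∂ (k + 2)).boundary M ↔ (e x).1 0 = 0 := by
  have h := ModelWithCorners.isBoundaryPoint_iff_of_mem_atlas (I := 𝓡∂ (k + 2)) (n := ∞)
    (by simp) he hx
  change (𝓡∂ (k + 2)).IsBoundaryPoint x ↔ _
  rw [h]
  have hy : e.extend (𝓡∂ (k + 2)) x = (e x).1 := by simp
  have hmem : e.extend (𝓡∂ (k + 2)) x ∈ (e.extend (𝓡∂ (k + 2))).target :=
    (e.extend (𝓡∂ (k + 2))).map_source (by simpa using hx)
  have hint := e.mem_interior_extend_target (I := 𝓡∂ (k + 2)) (y := e x)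
  have hsub := e.interior_extend_target_subset_interior_range (I := 𝓡∂ (k + 2))
  have h1 : e.extend (𝓡∂ (k + 2)) x ∈ interior (e.extend (𝓡∂ (k + 2))).target ↔
      0 < (e x).1 0 := by
    rw [← hy]
    constructor
    · intro hh
      have := hsub hh
      rw [interior_range_modelWithCornersEuclideanHalfSpace] at this
      exact this
    · intro hh
      refine hint (e.map_source hx) ?_
      rw [interior_range_modelWithCornersEuclideanHalfSpace]
      exact hh
  have h0 : 0 ≤ (e x).1 0 := (e x).2
  rw [frontier, mem_sdiff, h1]
  constructor
  · rintro ⟨-, hh⟩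
    linarith [not_lt.mp hh]
  · intro hh
    exact ⟨subset_closure hmem, by linarith⟩

open Classical in
/-- The chart of the boundary induced by a chart `e` of `M`: the last `k + 1` coordinates of `e`,
with inverse `y ↦ e⁻¹(0, y)`. The point `p` is only used as a default value. -/
def bdryChart (e : OpenPartialHomeomorph M (EuclideanHalfSpace (k + 2)))
    (he : e ∈ atlas (EuclideanHalfSpace (k + 2)) M) (p : Bdry k M) :
    OpenPartialHomeomorph (Bdry k M) (EuclideanSpace ℝ (Fin (k + 1))) where
  toFun q := tailCoord k (e q.1).1
  invFun y := if h : consZeroHalf k y ∈ e.target then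
      ⟨e.symm (consZeroHalf k y), (mem_boundary_iff_of_mem_atlas he (e.map_target h)).2
        (by rw [e.right_inv h]; simp [consZeroHalf, consZero])⟩
    else p
  source := {q | q.1 ∈ e.source}
  target := {y | consZeroHalf k y ∈ e.target}
  map_source' q hq := by
    have h0 := (mem_boundary_iff_of_mem_atlas he hq).1 q.2
    have : consZeroHalf k (tailCoord k (e q.1).1) = e q.1 :=
      Subtype.ext (consZero_tailCoord k _ h0)
    simp [this, e.map_source hq]
  map_target' y hy := by
    have hy' : consZeroHalf k y ∈ e.target := hy
    simp [hy', e.map_target hy']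
  left_inv' q hq := by
    have h0 := (mem_boundary_iff_of_mem_atlas he hq).1 q.2
    have h1 : consZeroHalf k (tailCoord k (e q.1).1) = e q.1 :=
      Subtype.ext (consZero_tailCoord k _ h0)
    have hq' : q.1 ∈ e.source := hq
    apply Subtype.ext
    simp [h1, e.map_source hq', e.left_inv hq']
  right_inv' y hy := by
    have hy' : consZeroHalf k y ∈ e.target := hy
    simp only [hy', dite_true, e.right_inv hy']
    exact tailCoord_consZero k y
  open_source := e.open_source.preimage continuous_subtype_val
  open_target := e.open_target.preimage (continuous_consZeroHalf k)
  continuousOn_toFun := by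
    refine (contDiff_tailCoord k).continuous.comp_continuousOn
      (continuous_subtype_val.comp_continuousOn ?_)
    exact e.continuousOn.comp continuous_subtype_val.continuousOn (fun q hq => hq)
  continuousOn_invFun := by
    rw [IsInducing.subtypeVal.continuousOn_iff]
    have : ContinuousOn (fun y => e.symm (consZeroHalf k y)) {y | consZeroHalf k y ∈ e.target} :=
      e.continuousOn_symm.comp (continuous_consZeroHalf k).continuousOn (fun y hy => hy)
    refine this.congr (fun y hy => ?_)
    have hy' : consZeroHalf k y ∈ e.target := hy
    simp [hy']

instance Bdry.chartedSpace : ChartedSpace (EuclideanSpace ℝ (Fin (k + 1))) (Bdry k M) where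
  atlas := {c | ∃ (e : OpenPartialHomeomorph M (EuclideanHalfSpace (k + 2)))
    (he : e ∈ atlas (EuclideanHalfSpace (k + 2)) M) (p : Bdry k M), c = bdryChart e he p}
  chartAt p := bdryChart (chartAt (EuclideanHalfSpace (k + 2)) p.1) (chart_mem_atlas _ _) p
  mem_chart_source p := mem_chart_source (EuclideanHalfSpace (k + 2)) p.1
  chart_mem_atlas p := ⟨_, chart_mem_atlas _ _, p, rfl⟩

instance Bdry.isManifold : IsManifold (𝓡 (k + 1)) ∞ (Bdry k M) := by
  refine isManifold_of_contDiffOn _ _ _ ?_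
  rintro c c' ⟨e, he, p, rfl⟩ ⟨e', he', p', rfl⟩
  have key := ModelWithCorners.contDiffOn_extendCoordChange (I := 𝓡∂ (k + 2)) (n := ∞)
    (IsManifold.subset_maximalAtlas he) (IsManifold.subset_maximalAtlas he')
  have hmem : ∀ y, ((𝓡∂ (k + 2)).symm (consZero k y)) = consZeroHalf k y := by
    intro y
    have : consZero k y = (𝓡∂ (k + 2)) (consZeroHalf k y) := rfl
    rw [this, ModelWithCorners.left_inv]
  have := (contDiff_tailCoord k).comp_contDiffOn
    (key.comp (contDiff_consZero k).contDiffOn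
      (s := {y | consZeroHalf k y ∈ e.target ∧ e.symm (consZeroHalf k y) ∈ e'.source}) ?_)
  · refine (this.congr (f₁ := (𝓡 (k + 1)) ∘ ((bdryChart e he p).symm ≫ₕ bdryChart e' he' p') ∘
      (𝓡 (k + 1)).symm) fun y hy => ?_).mono ?_
    · have hy1 : consZeroHalf k y ∈ e.target := hy.1
      simp [bdryChart, hy1, ModelWithCorners.extendCoordChange, hmem]
    · intro y hy
      have h1 : consZeroHalf k y ∈ e.target := by
        have := hy.1.1
        simpa [bdryChart] using this
      have h2 := hy.1.2
      simp [bdryChart, h1] at h2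
      exact ⟨h1, h2⟩
  · intro y hy
    have h0 : consZero k y ∈ range (𝓡∂ (k + 2)) := ⟨consZeroHalf k y, rfl⟩
    have h1 : consZeroHalf k y ∈ e.target := hy.1
    have h2 : e.symm (consZeroHalf k y) ∈ e'.source := hy.2
    simp only [ModelWithCorners.extendCoordChange, PartialEquiv.trans_source, mem_inter_iff,
      mem_preimage, PartialEquiv.symm_source, OpenPartialHomeomorph.extend_target,
      OpenPartialHomeomorph.extend_source, OpenPartialHomeomorph.extend_coe_symm,
      Function.comp_apply, hmem]
    exact ⟨⟨h1, h0⟩, h2⟩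

/-- The inclusion of the boundary. -/
def bdryIncl (k : ℕ) (M : Type*) [TopologicalSpace M]
    [ChartedSpace (EuclideanHalfSpace (k + 2)) M] : Bdry k M → M := Subtype.val

end Boundary

/-! ### Circle actions near the boundary, reduction and cutting -/

section Cutting

/-- A free smooth circle action on an open neighbourhood `U` of the boundary of `M`. -/
structure BoundaryCircleAction (k : ℕ) (M : Type*) [TopologicalSpace M]
    [ChartedSpace (EuclideanHalfSpace (k + 2)) M] [IsManifold (𝓡∂ (k + 2)) ∞ M] where
  U : TopologicalSpace.Opens M
  boundary_subset : ∀ x ∈ (𝓡∂ (k + 2)).boundary M, x ∈ U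
  act : MulAction Circle U
  smooth : ContMDiffSMul (𝓡 1) (𝓡∂ (k + 2)) ∞ Circle U
  free : ∀ (a : Circle) (x : U), a • x = x → a = 1

attribute [instance] BoundaryCircleAction.act BoundaryCircleAction.smooth

variable {k : ℕ} {M : Type*} [TopologicalSpace M] [ChartedSpace (EuclideanHalfSpace (k + 2)) M]
  [IsManifold (𝓡∂ (k + 2)) ∞ M]

namespace BoundaryCircleAction

variable (A : BoundaryCircleAction k M)

/-- The boundary is invariant under the action. -/
theorem smul_mem_boundary (a : Circle) (x : A.U) (hx : x.1 ∈ (𝓡∂ (k + 2)).boundary M) :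
    (a • x : A.U).1 ∈ (𝓡∂ (k + 2)).boundary M := by
  have h1 : x ∈ (𝓡∂ (k + 2)).boundary A.U := by
    rw [ModelWithCorners.boundary_open]; exact hx
  have h2 := Diffeomorph.preimage_boundary (n := ∞) (by simp)
    (Diffeomorph.smul (𝓡 1) (𝓡∂ (k + 2)) ∞ a : A.U ≃ₘ^∞⟮𝓡∂ (k + 2), 𝓡∂ (k + 2)⟯ A.U)
  rw [← h2, mem_preimage, Diffeomorph.smul_apply, ModelWithCorners.boundary_open] at h1
  exact h1

/-- The induced circle action on the boundary. -/
def bdryAct (a : Circle) (p : Bdry k M) : Bdry k M :=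
  ⟨(a • (⟨p.1, A.boundary_subset p.1 p.2⟩ : A.U) : A.U).1, A.smul_mem_boundary a _ p.2⟩

theorem bdryAct_one (p : Bdry k M) : A.bdryAct 1 p = p := by
  simp [bdryAct]

theorem bdryAct_mul (a b : Circle) (p : Bdry k M) :
    A.bdryAct (a * b) p = A.bdryAct a (A.bdryAct b p) := by
  simp [bdryAct, mul_smul]

/-- The orbit relation on the boundary. -/
def redSetoid : Setoid (Bdry k M) where
  r p q := ∃ a : Circle, A.bdryAct a p = q
  iseqv :=
    { refl := fun p => ⟨1, A.bdryAct_one p⟩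
      symm := by
        rintro p q ⟨a, rfl⟩
        exact ⟨a⁻¹, by rw [← A.bdryAct_mul, inv_mul_cancel, A.bdryAct_one]⟩
      trans := by
        rintro p q r ⟨a, rfl⟩ ⟨b, rfl⟩
        exact ⟨b * a, A.bdryAct_mul b a p⟩ }

/-- The reduced space `M_red = ∂M / S¹`. -/
def Red : Type _ := Quotient A.redSetoid

instance : TopologicalSpace A.Red := inferInstanceAs (TopologicalSpace (Quotient A.redSetoid))

/-- The quotient map `∂M → M_red`. -/
def toRed : Bdry k M → A.Red := Quotient.mk A.redSetoid

/-- The relation on `M` in which distinct points are equivalent if and only if they are both in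
the boundary and in the same circle orbit. -/
def cutSetoid : Setoid M where
  r x y := x = y ∨ ∃ p q : Bdry k M, p.1 = x ∧ q.1 = y ∧ ∃ a : Circle, A.bdryAct a p = q
  iseqv :=
    { refl := fun x => Or.inl rfl
      symm := by
        rintro x y (rfl | ⟨p, q, hp, hq, h⟩)
        · exact Or.inl rfl
        · exact Or.inr ⟨q, p, hq, hp, A.redSetoid.symm h⟩
      trans := by
        rintro x y z (rfl | ⟨p, q, hp, hq, h⟩) (rfl | ⟨p', q', hp', hq', h'⟩)
        · exact Or.inl rfl
        · exact Or.inr ⟨p', q', hp', hq', h'⟩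
        · exact Or.inr ⟨p, q, hp, hq, h⟩
        · obtain rfl : q = p' := Subtype.ext (hq.trans hp'.symm)
          exact Or.inr ⟨p, q', hp, hq', A.redSetoid.trans h h'⟩ }

/-- The cut space `M_cut = M / ∼`. -/
def Cut : Type _ := Quotient A.cutSetoid

instance : TopologicalSpace A.Cut := inferInstanceAs (TopologicalSpace (Quotient A.cutSetoid))

/-- The quotient map `c : M → M_cut`. -/
def toCut : M → A.Cut := Quotient.mk A.cutSetoid

/-- The inclusion `M_red → M_cut`, induced by the inclusion `∂M → M`; its image is `c(∂M)`. -/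
def redToCut : A.Red → A.Cut :=
  Quotient.map' (s₁ := A.redSetoid) (s₂ := A.cutSetoid) (bdryIncl k M)
    (fun p q h => Or.inr ⟨p, q, rfl, rfl, h⟩)

/-- `V` is an invariant open neighbourhood of the boundary in `U`. -/
structure IsInvariantNhd (V : Set A.U) : Prop where
  isOpen : IsOpen V
  boundary_subset : ∀ x : A.U, x.1 ∈ (𝓡∂ (k + 2)).boundary M → x ∈ V
  smul_mem : ∀ (a : Circle), ∀ x ∈ V, a • x ∈ V

/-- Invariant boundary defining functions. -/
structure IsInvariantBoundaryDefining (f : M → ℝ) : Prop where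
  smooth : ContMDiff (𝓡∂ (k + 2)) 𝓘(ℝ, ℝ) ∞ f
  nonneg : ∀ x, 0 ≤ f x
  zero_iff : ∀ x, f x = 0 ↔ x ∈ (𝓡∂ (k + 2)).boundary M
  deriv_ne_zero : ∀ x ∈ (𝓡∂ (k + 2)).boundary M, mfderiv (𝓡∂ (k + 2)) 𝓘(ℝ, ℝ) f x ≠ 0
  invariant : ∃ V : Set A.U, A.IsInvariantNhd V ∧ ∀ (a : Circle), ∀ x ∈ V, f (a • x).1 = f x.1

/-- The set `ℱ_M` of real-valued functions `h` on `M_cut` such that `h ∘ c` is smooth on the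
interior of `M` and, for some invariant boundary defining function `f` (any two give the same
set), is near the boundary of the form `x ↦ H(x, √(f x))` with `H : V × ℂ → ℝ` smooth and
`H(a • x, z) = H(x, a z)`. -/
def cutFunctions : Set (A.Cut → ℝ) :=
  {h | ContMDiffOn (𝓡∂ (k + 2)) 𝓘(ℝ, ℝ) ∞ (h ∘ A.toCut) ((𝓡∂ (k + 2)).interior M) ∧
    ∃ f : M → ℝ, A.IsInvariantBoundaryDefining f ∧
    ∃ V : Set A.U, A.IsInvariantNhd V ∧
    ∃ H : A.U × ℂ → ℝ,
      ContMDiffOn ((𝓡∂ (k + 2)).prod 𝓘(ℝ, ℂ)) 𝓘(ℝ, ℝ) ∞ H (V ×ˢ univ) ∧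
      (∀ (a : Circle), ∀ x ∈ V, ∀ z : ℂ, H (a • x, z) = H (x, (a : ℂ) * z)) ∧
      ∀ x ∈ V, h (A.toCut x.1) = H (x, ((√(f x.1) : ℝ) : ℂ))}

/-- The given charts make `M_red` into a manifold for which the quotient map `∂M → M_red` is a
submersion. -/
structure IsReducedManifold [ChartedSpace (EuclideanSpace ℝ (Fin k)) A.Red] : Prop where
  t2 : T2Space A.Red
  secondCountable : SecondCountableTopology A.Red
  isManifold : IsManifold (𝓡 k) ∞ A.Red
  submersion : IsSubmersion (𝓡 (k + 1)) (𝓡 k) ∞ A.toRed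

/-- The given charts make `M_cut` into a manifold whose smooth real-valued functions are exactly
the elements of `ℱ_M`. -/
structure IsCutManifold [ChartedSpace (EuclideanSpace ℝ (Fin (k + 2))) A.Cut] : Prop where
  t2 : T2Space A.Cut
  secondCountable : SecondCountableTopology A.Cut
  isManifold : IsManifold (𝓡 (k + 2)) ∞ A.Cut
  smooth_iff : ∀ h : A.Cut → ℝ, ContMDiff (𝓡 (k + 2)) 𝓘(ℝ, ℝ) ∞ h ↔ h ∈ A.cutFunctions

variable {m : ℕ}

/-- The pullback of `β` to the boundary is basic. -/
def BasicOnBoundary (β : DiffForm (𝓡∂ (k + 2)) M (m + 1)) : Prop :=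
  DiffForm.IsBasic A.bdryAct (DiffForm.pullback (𝓡 (k + 1)) (𝓡∂ (k + 2)) (bdryIncl k M) β)

/-- `β` is invariant on an invariant neighbourhood of the boundary. -/
def InvariantNearBoundary (β : DiffForm (𝓡∂ (k + 2)) M m) : Prop :=
  ∃ V : Set A.U, A.IsInvariantNhd V ∧ ∀ (a : Circle), ∀ x ∈ V,
    DiffForm.pullback (𝓡∂ (k + 2)) (𝓡∂ (k + 2)) (fun y : A.U => a • y)
      (DiffForm.pullback (𝓡∂ (k + 2)) (𝓡∂ (k + 2)) (fun y : A.U => y.1) β) x =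
    DiffForm.pullback (𝓡∂ (k + 2)) (𝓡∂ (k + 2)) (fun y : A.U => y.1) β x

/-- `βred` is a smooth form on `M_red` whose pullback to `∂M` is the pullback of `β`. -/
structure IsReducedForm [ChartedSpace (EuclideanSpace ℝ (Fin k)) A.Red]
    (β : DiffForm (𝓡∂ (k + 2)) M m) (βred : DiffForm (𝓡 k) A.Red m) : Prop where
  smooth : βred.IsSmooth
  pullback_eq : DiffForm.pullback (𝓡 (k + 1)) (𝓡 k) A.toRed βred =
    DiffForm.pullback (𝓡 (k + 1)) (𝓡∂ (k + 2)) (bdryIncl k M) β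

/-- `βcut` is a smooth form on `M_cut` whose pullback to the interior of `M` is `β`. -/
structure IsCutForm [ChartedSpace (EuclideanSpace ℝ (Fin (k + 2))) A.Cut]
    (β : DiffForm (𝓡∂ (k + 2)) M m) (βcut : DiffForm (𝓡 (k + 2)) A.Cut m) : Prop where
  smooth : βcut.IsSmooth
  pullback_eq : ∀ x ∈ (𝓡∂ (k + 2)).interior M,
    DiffForm.pullback (𝓡∂ (k + 2)) (𝓡 (k + 2)) A.toCut βcut x = β x

end BoundaryCircleAction

end Cutting

end

/-! ### Smoothness of parametric integrals, and Hadamard's lemma -/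

section ParametricIntegral

universe u

open MeasureTheory

/-! Near a boundary orbit `M` has coordinates `(s, θ, t)`: `s` in `ℝᵏ` and `t` are invariant, `θ` is
the angle along the orbit, and `t = f` is an invariant boundary defining function. Collapsing the
orbits in `t = 0` amounts to replacing `(θ, t)` by the complex number `z = √t e^{iθ}`. Thus `(s, z)`
are coordinates on the cut space, `s` are coordinates on the reduced space, and the latter sits in
the former as `z = 0`. Such coordinates come from averaging over the circle, which produces `f` and
an equivariant phase (`exists_invariant_boundaryDefining`, `exists_equivariant_complex`), and from
an inverse function theorem on half-spaces (`exists_contDiffOn_leftInverse_halfSpace`,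
`exists_slice`).

The smooth structures are defined by declaring which functions are smooth at each point; a chart is
admitted when it detects this notion (`IsCompatibleChart`), so transition maps need no separate
computation. That the smooth functions on the cut space are exactly `ℱ_M`, for any choice of `f`,
rests on Hadamard's lemma: a second boundary defining function is `f₁ = t u(s, t)` with `u > 0` at
`t = 0`, hence `√f₁ e^{iθ} = √u(s, |z|²) z` is smooth in `(s, z)` near `z = 0`.

For the forms, invariance makes the coefficients of `β` in `(s, θ, t)` independent of `θ`.
Horizontality of the boundary pullback gives `β(∂θ, v) = 0` at `t = 0` for `v` in the
`s`-directions, so by Hadamard's lemma `β(∂θ, v) = t γ(v)`. Since `t dθ = Im(z̄ dz)`, `dt = 2 Re(z̄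
dz)` and `dθ ∧ dt = -2 dx ∧ dy`, rewriting `β` in `(s, z)` leaves no singularity at `z = 0`
(`cutModel_eq_comp_polarDeriv`). Closedness extends from `z ≠ 0` by continuity. At `t = 0` the
vector `∂θ` pairs to zero with every `s`-direction and with itself, so non-degeneracy forces `β(∂θ,
∂t) ≠ 0`, and the `s`-part of `β` is non-degenerate. At `z = 0` the cut form is this `s`-part plus a
non-zero multiple of the area form on `ℂ` (`AltNondegenerate.cutModel_zero`). The `s`-part is the
reduced form, which is therefore the restriction of the cut form. Uniqueness holds because the
interior is dense in the cut space and because `∂M → M_red` has surjective derivative. -/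

theorem hasFDerivWithinAt_intervalIntegral_of_convex {E F : Type*} [NormedAddCommGroup E]
    [NormedSpace ℝ E] [NormedAddCommGroup F] [NormedSpace ℝ F] [CompleteSpace F]
    {s : Set E} (hs : Convex ℝ s)
    {a b : ℝ} (hab : a ≤ b) {f : E → ℝ → F} {f' : E → ℝ → E →L[ℝ] F}
    (hf : ContinuousOn (Function.uncurry f) (s ×ˢ Icc a b))
    (hf' : ContinuousOn (Function.uncurry f') (s ×ˢ Icc a b))
    (hd : ∀ x ∈ s, ∀ θ ∈ Icc a b, HasFDerivWithinAt (fun y => f y θ) (f' x θ) s x)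
    {x : E} (hx : x ∈ s) :
    HasFDerivWithinAt (fun y => ∫ θ in a..b, f y θ) (∫ θ in a..b, f' x θ) s x := by
  have hint : ∀ y ∈ s, IntervalIntegrable (f y) volume a b := by
    intro y hy
    apply ContinuousOn.intervalIntegrable
    rw [uIcc_of_le hab]
    exact hf.comp (f := fun θ => (y, θ)) (by fun_prop) (fun θ hθ => ⟨hy, hθ⟩)
  have hint' : ∀ y ∈ s, IntervalIntegrable (f' y) volume a b := by
    intro y hy
    apply ContinuousOn.intervalIntegrable
    rw [uIcc_of_le hab]
    exact hf'.comp (f := fun θ => (y, θ)) (by fun_prop) (fun θ hθ => ⟨hy, hθ⟩)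
  rw [hasFDerivWithinAt_iff_isLittleO, Asymptotics.isLittleO_iff]
  intro c hc
  -- The bound `ε * ‖y - x‖` will be integrated over an interval of length `|b - a|`; the summand
  -- `1` keeps the denominator positive when `a = b`.
  set ε : ℝ := c / (|b - a| + 1) with hε
  have hεpos : 0 < ε := by positivity
  -- Compactness of the interval makes `f' y θ` close to `f' x θ` uniformly in `θ`. The mean value
  -- inequality then applies on ball ∩ `s`, which is where convexity of `s` enters.
  obtain ⟨v, hv, hvk⟩ := isCompact_Icc.mem_uniformity_of_prod (f := f') hf' hx
    (Metric.dist_mem_uniformity hεpos)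
  obtain ⟨r, hr, hrv⟩ := Metric.mem_nhdsWithin_iff.1 hv
  have hb : Metric.ball x r ∩ s ∈ 𝓝[s] x :=
    Filter.inter_mem (mem_nhdsWithin_of_mem_nhds (Metric.ball_mem_nhds x hr))
      self_mem_nhdsWithin
  filter_upwards [hb] with y hy
  have hconv : Convex ℝ (Metric.ball x r ∩ s) := (convex_ball x r).inter hs
  have hest : ∀ θ ∈ Icc a b, ‖f y θ - f x θ - f' x θ (y - x)‖ ≤ ε * ‖y - x‖ := by
    intro θ hθ
    refine hconv.norm_image_sub_le_of_norm_hasFDerivWithin_le' (f := fun y => f y θ)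
      (f' := fun y => f' y θ) (fun z hz => (hd z hz.2 θ hθ).mono inter_subset_right)
      (fun z hz => ?_) ⟨Metric.mem_ball_self hr, hx⟩ hy
    have := hvk z (hrv hz) θ hθ
    simp only [mem_ofPred_eq, dist_eq_norm] at this
    exact this.le
  have hap : (∫ θ in a..b, f' x θ) (y - x) = ∫ θ in a..b, f' x θ (y - x) :=
    (ContinuousLinearMap.intervalIntegral_apply (hint' x hx) (y - x))
  rw [hap, ← intervalIntegral.integral_sub (hint y hy.2) (hint x hx),
    ← intervalIntegral.integral_sub ((hint y hy.2).sub (hint x hx))]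
  · refine (intervalIntegral.norm_integral_le_of_norm_le_const (C := ε * ‖y - x‖) ?_).trans ?_
    · intro θ hθ
      rw [uIoc_of_le hab] at hθ
      exact hest θ ⟨hθ.1.le, hθ.2⟩
    · have : ε * |b - a| ≤ c := by
        rw [hε, div_mul_eq_mul_div, div_le_iff₀ (by positivity)]
        nlinarith [abs_nonneg (b - a)]
      nlinarith [norm_nonneg (y - x)]
  · apply ContinuousOn.intervalIntegrable
    rw [uIcc_of_le hab]
    exact (hf'.comp (f := fun θ => (x, θ)) (by fun_prop) (fun θ hθ => ⟨hx, hθ⟩)).clm_apply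
      continuousOn_const

/-- Differentiation under the integral sign lowers the order by one but replaces values in `F` by
values in `E →L[ℝ] F`. This is why `F` is quantified inside the induction and shares the universe of
`E`. -/
theorem contDiffOn_nat_intervalIntegral_of_convex {E : Type u} [NormedAddCommGroup E]
    [NormedSpace ℝ E] {s : Set E} (hs : Convex ℝ s) (hsu : UniqueDiffOn ℝ s)
    {a b : ℝ} (hab : a < b) (n : ℕ) :
    ∀ {F : Type u} [NormedAddCommGroup F] [NormedSpace ℝ F] [CompleteSpace F]
    {f : E × ℝ → F} (_ : ContDiffOn ℝ n f (s ×ˢ Icc a b)),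
    ContDiffOn ℝ n (fun x => ∫ θ in a..b, f (x, θ)) s := by
  have hu : UniqueDiffOn ℝ (s ×ˢ Icc a b) := hsu.prod (uniqueDiffOn_Icc hab)
  induction n with
  | zero =>
    intro F _ _ _ f hf
    have hc : ContinuousOn f (s ×ˢ Icc a b) := hf.continuousOn
    simp only [CharP.cast_eq_zero, contDiffOn_zero]
    intro x hx
    rw [Metric.continuousWithinAt_iff']
    intro c hc0
    -- The extra factor `1/2` yields the strict inequality that continuity asks for.
    set ε : ℝ := c / (|b - a| + 1) / 2 with hε
    have hεpos : 0 < ε := by positivity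
    obtain ⟨v, hv, hvk⟩ := isCompact_Icc.mem_uniformity_of_prod (f := fun x θ => f (x, θ)) hc hx
      (Metric.dist_mem_uniformity hεpos)
    have hint : ∀ y ∈ s, IntervalIntegrable (fun θ => f (y, θ)) volume a b := by
      intro y hy
      apply ContinuousOn.intervalIntegrable
      rw [uIcc_of_le hab.le]
      exact hc.comp (f := fun θ => (y, θ)) (by fun_prop) (fun θ hθ => ⟨hy, hθ⟩)
    filter_upwards [hv, self_mem_nhdsWithin] with y hy hys
    rw [dist_eq_norm, ← intervalIntegral.integral_sub (hint y hys) (hint x hx)]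
    refine (intervalIntegral.norm_integral_le_of_norm_le_const (C := ε) ?_).trans_lt ?_
    · intro θ hθ
      rw [uIoc_of_le hab.le] at hθ
      have := hvk y hy θ ⟨hθ.1.le, hθ.2⟩
      simp only [mem_ofPred_eq, dist_eq_norm] at this
      exact this.le
    · rw [hε, div_mul_eq_mul_div, div_mul_eq_mul_div, div_lt_iff₀ two_pos,
        div_lt_iff₀ (by positivity)]
      nlinarith [abs_nonneg (b - a)]
  | succ n ih =>
    intro F _ _ _ f hf
    push_cast at hf ⊢
    rw [contDiffOn_succ_iff_fderivWithin hu] at hf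
    obtain ⟨hfd, -, hf'⟩ := hf
    set g : E × ℝ → E →L[ℝ] F := fun p =>
      (fderivWithin ℝ f (s ×ˢ Icc a b) p).comp (ContinuousLinearMap.inl ℝ E ℝ) with hg
    have hgs : ContDiffOn ℝ n g (s ×ˢ Icc a b) := hf'.clm_comp contDiffOn_const
    have hder : ∀ x ∈ s, HasFDerivWithinAt (fun y => ∫ θ in a..b, f (y, θ))
        (∫ θ in a..b, g (x, θ)) s x := by
      intro x hx
      refine hasFDerivWithinAt_intervalIntegral_of_convex (f := fun x θ => f (x, θ))
        (f' := fun x θ => g (x, θ)) hs hab.le hfd.continuousOn hgs.continuousOn ?_ hx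
      intro y hy θ hθ
      have h1 := (hfd (y, θ) ⟨hy, hθ⟩).hasFDerivWithinAt
      have h2 : HasFDerivWithinAt (fun z : E => (z, θ)) (ContinuousLinearMap.inl ℝ E ℝ) s y :=
        (hasFDerivAt_prodMk_left y θ).hasFDerivWithinAt
      exact h1.comp y h2 (fun z hz => mk_mem_prod hz hθ)
    rw [contDiffOn_succ_iff_fderivWithin hsu]
    refine ⟨fun x hx => (hder x hx).differentiableWithinAt, by simp, ?_⟩
    refine (ih hgs).congr fun x hx => ?_
    exact (hder x hx).fderivWithin (hsu x hx)

/-- Smoothness of parametric integrals over a compact interval, on a convex parameter set. -/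
theorem contDiffOn_intervalIntegral_of_convex {E F : Type u} [NormedAddCommGroup E]
    [NormedSpace ℝ E] [NormedAddCommGroup F] [NormedSpace ℝ F] [CompleteSpace F]
    {s : Set E} (hs : Convex ℝ s) (hsu : UniqueDiffOn ℝ s)
    {a b : ℝ} (hab : a < b) {f : E × ℝ → F} (hf : ContDiffOn ℝ ∞ f (s ×ˢ Icc a b)) :
    ContDiffOn ℝ ∞ (fun x => ∫ θ in a..b, f (x, θ)) s := by
  rw [contDiffOn_infty] at hf ⊢
  exact fun n => contDiffOn_nat_intervalIntegral_of_convex hs hsu hab n (hf n)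

/-- Hadamard's lemma on `B × [0, δ)`. -/
theorem ContDiffOn.exists_eq_smul_of_eq_zero {E F : Type} [NormedAddCommGroup E]
    [NormedSpace ℝ E] [NormedAddCommGroup F] [NormedSpace ℝ F] [CompleteSpace F]
    {B : Set E} (hB : Convex ℝ B) (hBo : IsOpen B) {δ : ℝ} {f : E × ℝ → F}
    (hf : ContDiffOn ℝ ∞ f (B ×ˢ Ico 0 δ)) (h0 : ∀ x ∈ B, f (x, 0) = 0) :
    ∃ g : E × ℝ → F, ContDiffOn ℝ ∞ g (B ×ˢ Ico 0 δ) ∧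
      ∀ x ∈ B, ∀ t ∈ Ico 0 δ, f (x, t) = t • g (x, t) := by
  have huI : UniqueDiffOn ℝ (Ico 0 δ) := uniqueDiffOn_Ico 0 δ
  have hu : UniqueDiffOn ℝ (B ×ˢ Ico 0 δ) := hBo.uniqueDiffOn.prod huI
  have hconv : Convex ℝ (B ×ˢ Ico 0 δ) := hB.prod (convex_Ico 0 δ)
  set d : E × ℝ → F := fun p => fderivWithin ℝ f (B ×ˢ Ico 0 δ) p (0, 1) with hd
  have hds : ContDiffOn ℝ ∞ d (B ×ˢ Ico 0 δ) :=
    (hf.fderivWithin hu (by simp)).clm_apply contDiffOn_const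
  have hmaps : MapsTo (fun q : (E × ℝ) × ℝ => (q.1.1, q.2 * q.1.2))
      ((B ×ˢ Ico 0 δ) ×ˢ Icc 0 1) (B ×ˢ Ico 0 δ) := by
    rintro ⟨⟨x, t⟩, r⟩ ⟨⟨hx, ht⟩, hr⟩
    refine ⟨hx, mul_nonneg hr.1 ht.1, ?_⟩
    have h1 := ht.1; have h2 := ht.2; have h3 := hr.2
    simp only at h1 h2 h3 ⊢
    nlinarith
  -- The quotient is the mean of the `t`-derivative over the segment from `(x, 0)` to `(x, t)`, by
  -- the fundamental theorem of calculus in `r`.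
  refine ⟨fun p => ∫ r in (0:ℝ)..1, d (p.1, r * p.2), ?_, ?_⟩
  · exact contDiffOn_intervalIntegral_of_convex
      (f := fun q : (E × ℝ) × ℝ => d (q.1.1, q.2 * q.1.2)) hconv hu one_pos
      (hds.comp (by fun_prop) hmaps)
  · intro x hx t ht
    have hder : ∀ r ∈ Icc (0:ℝ) 1, HasDerivWithinAt (fun r : ℝ => f (x, r * t))
        (t • d (x, r * t)) (Icc 0 1) r := by
      intro r hr
      have h1 := ((hf.differentiableOn (by simp)) (x, r * t)
        (hmaps (x := ((x, t), r)) ⟨⟨hx, ht⟩, hr⟩)).hasFDerivWithinAt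
      have h2 : HasDerivWithinAt (fun r : ℝ => (x, r * t)) ((0 : E), t) (Icc 0 1) r := by
        refine HasDerivAt.hasDerivWithinAt ?_
        refine (hasDerivAt_const r x).prodMk ?_
        simpa using (hasDerivAt_id r).mul_const t
      have h3 := h1.comp_hasDerivWithinAt r h2
        (fun r' hr' => hmaps (x := ((x, t), r')) ⟨⟨hx, ht⟩, hr'⟩)
      have h4 : t • d (x, r * t) =
          fderivWithin ℝ f (B ×ˢ Ico 0 δ) (x, r * t) ((0 : E), t) := by
        have h5 : ((0 : E), t) = t • ((0 : E), (1 : ℝ)) := by simp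
        rw [h5, map_smul]
      rw [h4]
      exact h3
    have hcont : ContinuousOn (fun r : ℝ => d (x, r * t)) (Icc 0 1) :=
      hds.continuousOn.comp (by fun_prop)
        (fun r hr => hmaps (x := ((x, t), r)) ⟨⟨hx, ht⟩, hr⟩)
    have hint := intervalIntegral.integral_eq_sub_of_hasDeriv_right_of_le
      (f := fun r : ℝ => f (x, r * t)) (f' := fun r => t • d (x, r * t)) zero_le_one
      (fun r hr => (hder r hr).continuousWithinAt)
      (fun r hr => ((hder r ⟨hr.1.le, hr.2.le⟩).hasDerivAt
        (Icc_mem_nhds hr.1 hr.2)).hasDerivWithinAt)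
      (by
        apply ContinuousOn.intervalIntegrable
        rw [uIcc_of_le zero_le_one]
        exact hcont.const_smul t)
    simp only [one_mul, zero_mul, h0 x hx, sub_zero] at hint
    rw [← hint, intervalIntegral.integral_smul]

end ParametricIntegral

/-! ### An inverse function theorem on half-spaces -/

section HalfSpaceInverse

variable {E E' : Type*} [NormedAddCommGroup E] [NormedSpace ℝ E] [NormedAddCommGroup E']
  [NormedSpace ℝ E']

theorem uniqueDiffOn_halfSpace (l : E →L[ℝ] ℝ) {e : E} (he : l e = 1) :
    UniqueDiffOn ℝ {x | 0 ≤ l x} := by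
  refine uniqueDiffOn_convex ?_ ?_
  · exact convex_halfSpace_ge l.toLinearMap.isLinear 0
  · refine ⟨e, mem_interior.2 ⟨{x | 0 < l x}, fun x hx => (show 0 < l x from hx).le, ?_, ?_⟩⟩
    · exact isOpen_lt continuous_const l.continuous
    · simp [he]

/-- Strict differentiability seen from inside the half-space: the derivative is continuous at `p`,
and ball ∩ half-space is convex, so the mean value inequality applies. -/
theorem exists_norm_sub_le_of_hasFDerivWithinAt_halfSpace (l : E →L[ℝ] ℝ) {e : E} (he : l e = 1)
    {O : Set E} (hO : IsOpen O) {p : E} (hpO : p ∈ O) (hp : l p = 0) {F : E → E'}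
    (hF : ContDiffOn ℝ ∞ F (O ∩ {x | 0 ≤ l x})) {A : E →L[ℝ] E'}
    (hA : HasFDerivWithinAt F A (O ∩ {x | 0 ≤ l x}) p) {c : ℝ} (hc : 0 < c) :
    ∃ r > 0, ∀ x ∈ Metric.ball p r, ∀ y ∈ Metric.ball p r, 0 ≤ l x → 0 ≤ l y →
      ‖F y - F x - A (y - x)‖ ≤ c * ‖y - x‖ := by
  set s := O ∩ {x | 0 ≤ l x} with hs
  have hps : p ∈ s := ⟨hpO, by simp [hp]⟩
  have hu : UniqueDiffOn ℝ s := by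
    rw [hs, inter_comm]; exact (uniqueDiffOn_halfSpace l he).inter hO
  have hcont := (hF.continuousOn_fderivWithin hu (by simp)) p hps
  rw [ContinuousWithinAt, hA.fderivWithin (hu p hps)] at hcont
  have h1 : ∀ᶠ x in 𝓝[s] p, ‖fderivWithin ℝ F s x - A‖ < c := by
    have := hcont (Metric.ball_mem_nhds A hc)
    filter_upwards [this] with x hx
    simpa [dist_eq_norm] using hx
  obtain ⟨r, hr, hrs⟩ := Metric.mem_nhdsWithin_iff.1 h1
  obtain ⟨r', hr', hrO⟩ := Metric.isOpen_iff.1 hO p hpO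
  refine ⟨min r r', lt_min hr hr', fun x hx y hy hlx hly => ?_⟩
  have hconv : Convex ℝ (Metric.ball p (min r r') ∩ {x | 0 ≤ l x}) :=
    (convex_ball p _).inter (convex_halfSpace_ge l.toLinearMap.isLinear 0)
  have hsub : Metric.ball p (min r r') ∩ {x | 0 ≤ l x} ⊆ s := fun z hz =>
    ⟨hrO (Metric.ball_subset_ball (min_le_right _ _) hz.1), hz.2⟩
  refine hconv.norm_image_sub_le_of_norm_hasFDerivWithin_le' (f' := fderivWithin ℝ F s)
    (fun z hz => ?_) (fun z hz => ?_) ⟨hx, hlx⟩ ⟨hy, hly⟩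
  · exact ((hF.differentiableOn (by simp)) z (hsub hz)).hasFDerivWithinAt.mono hsub
  · exact (hrs ⟨Metric.ball_subset_ball (min_le_left _ _) hz.1, hsub hz⟩).le

/-- The extension of a function from the half-space `0 ≤ l` by odd reflection. -/
def oddReflection (l : E →L[ℝ] ℝ) (e : E) (F : E → E') (x : E) : E' :=
  F (x + max (-l x) 0 • e) + F (x - l x • e) - F (x - l x • e + max (-l x) 0 • e)

omit [NormedSpace ℝ E'] in
theorem oddReflection_of_nonneg (l : E →L[ℝ] ℝ) (e : E) (F : E → E') {x : E} (hx : 0 ≤ l x) :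
    oddReflection l e F x = F x := by
  have : max (-l x) 0 = 0 := max_eq_right (by linarith)
  simp [oddReflection, this]

omit [NormedSpace ℝ E'] in
theorem oddReflection_of_nonpos (l : E →L[ℝ] ℝ) (e : E) (F : E → E') {x : E} (hx : l x ≤ 0) :
    oddReflection l e F x =
      F (x - l x • e) + F (x - l x • e) - F (x - l x • e + (-l x) • e) := by
  have : max (-l x) 0 = -l x := max_eq_left (by linarith)
  simp [oddReflection, this, sub_eq_add_neg]

/-- Across the boundary the extension is `2 F(b) - F(x')`, with `b` the projection of `x` to the
boundary along `e` and `x'` its mirror image. The formula with `max` evaluates `F` only at points of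
the half-space. These three points are Lipschitz in `x` and combine with signs `+, +, -` to `x`
itself, so three one-sided estimates add up to the strict derivative `A`. -/
theorem hasStrictFDerivAt_oddReflection (l : E →L[ℝ] ℝ) {e : E} (he : l e = 1)
    {O : Set E} (hO : IsOpen O) {p : E} (hpO : p ∈ O) (hp : l p = 0) {F : E → E'}
    (hF : ContDiffOn ℝ ∞ F (O ∩ {x | 0 ≤ l x})) {A : E →L[ℝ] E'}
    (hA : HasFDerivWithinAt F A (O ∩ {x | 0 ≤ l x}) p) :
    HasStrictFDerivAt (oddReflection l e F) A p := by
  rw [hasStrictFDerivAt_iff_isLittleO, Asymptotics.isLittleO_iff]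
  intro c hc
  -- A common Lipschitz constant of the three evaluation points; the last one moves twice along `e`,
  -- whence the factor `2`.
  set K : ℝ := 1 + 2 * (‖l‖ * ‖e‖) with hK
  have hKpos : 0 < K := by positivity
  obtain ⟨r, hr, hest⟩ := exists_norm_sub_le_of_hasFDerivWithinAt_halfSpace l he hO hpO hp hF hA
    (c := c / (3 * K)) (by positivity)
  have hc1 : Continuous fun x => x + max (-l x) 0 • e := by fun_prop
  have hc2 : Continuous fun x => x - l x • e := by fun_prop
  have hc3 : Continuous fun x => x - l x • e + max (-l x) 0 • e := by fun_prop
  have hev : ∀ᶠ x in 𝓝 p, (x + max (-l x) 0 • e) ∈ Metric.ball p r ∧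
      (x - l x • e) ∈ Metric.ball p r ∧
      (x - l x • e + max (-l x) 0 • e) ∈ Metric.ball p r := by
    refine Filter.Eventually.and ?_ (Filter.Eventually.and ?_ ?_)
    · exact hc1.continuousAt.eventually_mem (by simpa [hp] using Metric.ball_mem_nhds p hr)
    · exact hc2.continuousAt.eventually_mem (by simpa [hp] using Metric.ball_mem_nhds p hr)
    · exact hc3.continuousAt.eventually_mem (by simpa [hp] using Metric.ball_mem_nhds p hr)
  filter_upwards [hev.prod_nhds hev] with q hq
  obtain ⟨x, y⟩ := q
  obtain ⟨⟨hx1, hx2, hx3⟩, hy1, hy2, hy3⟩ := hq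
  dsimp only at hx1 hx2 hx3 hy1 hy2 hy3 ⊢
  have e1 := hest _ hy1 _ hx1 (by simp [he]; linarith [le_max_left (-l y) 0])
    (by simp [he]; linarith [le_max_left (-l x) 0])
  have e2 := hest _ hy2 _ hx2 (by simp [he]) (by simp [he])
  have e3 := hest _ hy3 _ hx3 (by simp [he]) (by simp [he])
  have hl : |l x - l y| * ‖e‖ ≤ ‖l‖ * ‖e‖ * ‖x - y‖ := by
    have := l.le_opNorm (x - y)
    rw [map_sub, Real.norm_eq_abs] at this
    nlinarith [norm_nonneg e]
  have hm : |max (-l x) 0 - max (-l y) 0| * ‖e‖ ≤ ‖l‖ * ‖e‖ * ‖x - y‖ := by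
    refine le_trans (mul_le_mul_of_nonneg_right ?_ (norm_nonneg e)) hl
    refine (abs_max_sub_max_le_abs _ _ _).trans ?_
    rw [neg_sub_neg, abs_sub_comm]
  have hpos : 0 ≤ ‖l‖ * ‖e‖ * ‖x - y‖ := by positivity
  have n1 : ‖x + max (-l x) 0 • e - (y + max (-l y) 0 • e)‖ ≤ K * ‖x - y‖ := by
    have : x + max (-l x) 0 • e - (y + max (-l y) 0 • e) =
        (x - y) + (max (-l x) 0 - max (-l y) 0) • e := by module
    rw [this]
    refine (norm_add_le _ _).trans ?_
    rw [norm_smul, Real.norm_eq_abs, hK]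
    linarith
  have n2 : ‖x - l x • e - (y - l y • e)‖ ≤ K * ‖x - y‖ := by
    have : x - l x • e - (y - l y • e) = (x - y) - (l x - l y) • e := by module
    rw [this]
    refine (norm_sub_le _ _).trans ?_
    rw [norm_smul, Real.norm_eq_abs, hK]
    linarith
  have n3 : ‖x - l x • e + max (-l x) 0 • e - (y - l y • e + max (-l y) 0 • e)‖
      ≤ K * ‖x - y‖ := by
    have : x - l x • e + max (-l x) 0 • e - (y - l y • e + max (-l y) 0 • e) =
      (x - y) - (l x - l y) • e + (max (-l x) 0 - max (-l y) 0) • e := by module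
    rw [this]
    refine (norm_add_le _ _).trans ?_
    refine (add_le_add_left (norm_sub_le _ _) _).trans ?_
    rw [norm_smul, norm_smul, Real.norm_eq_abs, Real.norm_eq_abs, hK]
    linarith
  have hA' : A (x - y) = A (x + max (-l x) 0 • e - (y + max (-l y) 0 • e))
      + A (x - l x • e - (y - l y • e))
      - A (x - l x • e + max (-l x) 0 • e - (y - l y • e + max (-l y) 0 • e)) := by
    rw [← map_add, ← map_sub]
    congr 1
    module
  have hfin : oddReflection l e F x - oddReflection l e F y - A (x - y) =
      (F (x + max (-l x) 0 • e) - F (y + max (-l y) 0 • e) -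
        A (x + max (-l x) 0 • e - (y + max (-l y) 0 • e)))
      + (F (x - l x • e) - F (y - l y • e) - A (x - l x • e - (y - l y • e)))
      - (F (x - l x • e + max (-l x) 0 • e) - F (y - l y • e + max (-l y) 0 • e) -
        A (x - l x • e + max (-l x) 0 • e - (y - l y • e + max (-l y) 0 • e))) := by
    rw [hA', oddReflection, oddReflection]
    abel
  rw [hfin]
  refine (norm_sub_le _ _).trans ((add_le_add_left (norm_add_le _ _) _).trans ?_)
  have hcc : 0 ≤ c / (3 * K) := by positivity
  have k1 := e1.trans (mul_le_mul_of_nonneg_left n1 hcc)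
  have k2 := e2.trans (mul_le_mul_of_nonneg_left n2 hcc)
  have k3 := e3.trans (mul_le_mul_of_nonneg_left n3 hcc)
  have : c / (3 * K) * (K * ‖x - y‖) = c / 3 * ‖x - y‖ := by field_simp
  rw [this] at k1 k2 k3
  linarith

/-- The derivative of `g` at `y` is the inverse of that of `F` at `g y`. As `F` and operator
inversion are smooth, the regularity of `g` climbs one order at a time, starting from continuity. -/
theorem contDiffOn_of_isLeftInverse [CompleteSpace E] {F : E → E'} {s : Set E} {t : Set E'}
    (hs : UniqueDiffOn ℝ s) (ht : UniqueDiffOn ℝ t) (hF : ContDiffOn ℝ ∞ F s)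
    (hinv : ∀ x ∈ s, fderivWithin ℝ F s x ∈ range ((↑) : (E ≃L[ℝ] E') → E →L[ℝ] E'))
    {g : E' → E} (hg : ContinuousOn g t) (hgm : MapsTo g t s) (hFg : ∀ y ∈ t, F (g y) = y) :
    ContDiffOn ℝ ∞ g t := by
  rw [contDiffOn_infty]
  intro n
  have hder : ∀ y ∈ t, HasFDerivWithinAt g
      (ContinuousLinearMap.inverse (fderivWithin ℝ F s (g y))) t y := by
    intro y hy
    obtain ⟨A, hA⟩ := hinv _ (hgm hy)
    have h1 := ((hF.differentiableOn (by simp)) _ (hgm hy)).hasFDerivWithinAt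
    rw [← hA] at h1 ⊢
    rw [ContinuousLinearMap.inverse_equiv]
    refine HasFDerivWithinAt.of_local_left_inverse
      (tendsto_nhdsWithin_iff.2 ⟨hg y hy, ?_⟩) h1 hy ?_
    · filter_upwards [self_mem_nhdsWithin] with z hz using hgm hz
    · filter_upwards [self_mem_nhdsWithin] with z hz using hFg z hz
  induction n with
  | zero => simpa using hg
  | succ n ih =>
    push_cast
    rw [contDiffOn_succ_iff_fderivWithin ht]
    refine ⟨fun y hy => (hder y hy).differentiableWithinAt, by simp, ?_⟩
    have h1 : ContDiffOn ℝ n (fderivWithin ℝ F s) s :=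
      hF.fderivWithin hs (by exact_mod_cast le_top)
    have h2 : ContDiffOn ℝ n (fun y => fderivWithin ℝ F s (g y)) t := h1.comp ih hgm
    have h3 : ContDiffOn ℝ n
        (fun y => ContinuousLinearMap.inverse (fderivWithin ℝ F s (g y))) t := by
      intro y hy
      obtain ⟨A, hA⟩ := hinv _ (hgm hy)
      have := contDiffAt_map_inverse (n := (n : WithTop ℕ∞)) A
      rw [hA] at this
      exact this.comp_contDiffWithinAt y (h2 y hy)
    exact h3.congr fun y hy => (hder y hy).fderivWithin (ht y hy)

/-- The inverse function theorem for maps between half-spaces preserving the boundaries. -/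
theorem exists_contDiffOn_leftInverse_halfSpace [CompleteSpace E]
    (l : E →L[ℝ] ℝ) {e : E} (he : l e = 1) (m : E' →L[ℝ] ℝ)
    {O : Set E} (hO : IsOpen O) {p : E} (hpO : p ∈ O) (hp : l p = 0) {F : E → E'}
    (hF : ContDiffOn ℝ ∞ F (O ∩ {x | 0 ≤ l x})) (A : E ≃L[ℝ] E')
    (hA : HasFDerivWithinAt F (A : E →L[ℝ] E') (O ∩ {x | 0 ≤ l x}) p)
    (hnonneg : ∀ x ∈ O, 0 ≤ l x → 0 ≤ m (F x))
    (hzero : ∀ x ∈ O, 0 ≤ l x → (m (F x) = 0 ↔ l x = 0)) :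
    ∃ O' ⊆ O, IsOpen O' ∧ p ∈ O' ∧ ∃ T : Set E', IsOpen T ∧ ∃ g : E' → E,
      ContDiffOn ℝ ∞ g (T ∩ {y | 0 ≤ m y}) ∧
      (∀ y ∈ T, 0 ≤ m y → g y ∈ O' ∧ 0 ≤ l (g y) ∧ F (g y) = y) ∧
      ∀ x ∈ O', 0 ≤ l x → F x ∈ T ∧ g (F x) = x := by
  set s := O ∩ {x | 0 ≤ l x} with hs
  have hps : p ∈ s := ⟨hpO, by simp [hp]⟩
  have hu : UniqueDiffOn ℝ s := by
    rw [hs, inter_comm]; exact (uniqueDiffOn_halfSpace l he).inter hO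
  have hstrict := hasStrictFDerivAt_oddReflection l he hO hpO hp hF hA
  set h := hstrict.toOpenPartialHomeomorph (oddReflection l e F) with hh
  have hhc : ∀ x, h x = oddReflection l e F x := fun x => rfl
  have hinv : ∀ᶠ x in 𝓝 p, 0 ≤ l x →
      fderivWithin ℝ F s x ∈ range ((↑) : (E ≃L[ℝ] E') → E →L[ℝ] E') := by
    have hcont := (hF.continuousOn_fderivWithin hu (by simp)) p hps
    have h1 : range ((↑) : (E ≃L[ℝ] E') → E →L[ℝ] E') ∈ 𝓝 (fderivWithin ℝ F s p) := by
      rw [hA.fderivWithin (hu p hps)]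
      exact A.nhds
    have h2 := hcont.eventually_mem h1
    rw [hs, nhdsWithin_inter_of_mem (mem_nhdsWithin_of_mem_nhds (hO.mem_nhds hpO)),
      eventually_nhdsWithin_iff] at h2
    exact h2
  have hc2 : Continuous fun x => x - l x • e := by fun_prop
  have hc3 : Continuous fun x => x - l x • e + (-l x) • e := by fun_prop
  have hev : ∀ᶠ x in 𝓝 p, x ∈ O ∧ x - l x • e ∈ O ∧ x - l x • e + (-l x) • e ∈ O ∧
      (0 ≤ l x → fderivWithin ℝ F s x ∈ range ((↑) : (E ≃L[ℝ] E') → E →L[ℝ] E')) := by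
    refine (hO.eventually_mem hpO).and (Filter.Eventually.and ?_ (Filter.Eventually.and ?_ hinv))
    · exact hc2.continuousAt.eventually_mem (by simpa [hp] using hO.mem_nhds hpO)
    · exact hc3.continuousAt.eventually_mem (by simpa [hp] using hO.mem_nhds hpO)
  obtain ⟨O₁, hO₁, hO₁o, hpO₁⟩ := eventually_nhds_iff.1 hev
  set h' := h.restrOpen O₁ hO₁o with hh'
  have hsrc : h'.source = h.source ∩ O₁ := rfl
  have hph : p ∈ h.source := hstrict.mem_toOpenPartialHomeomorph_source
  -- For `l x < 0` the extension is `2 F(b) - F(x')` with `m (F b) = 0` and `m (F x') > 0`, so it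
  -- leaves the target half-space. Hence the inverse of the extension maps half-space to half-space
  -- and inverts `F` there.
  have hsign : ∀ x ∈ O₁, 0 ≤ m (oddReflection l e F x) → 0 ≤ l x := by
    intro x hx hmx
    by_contra! hlx
    obtain ⟨-, h2, h3, -⟩ := hO₁ x hx
    rw [oddReflection_of_nonpos l e F hlx.le] at hmx
    have z1 : m (F (x - l x • e)) = 0 := (hzero _ h2 (by simp [he])).2 (by simp [he])
    have z2 := hnonneg _ h3 (by simp [he]; linarith)
    have z3 := hzero _ h3 (by simp [he]; linarith)
    simp only [map_sub, map_add, z1] at hmx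
    have z4 : m (F (x - l x • e + (-l x) • e)) = 0 := by linarith
    have z5 := z3.1 z4
    simp [he] at z5
    exact hlx.ne z5
  -- Needed for unique differentiability of the target half-space; obtained by rescaling a value of
  -- `F` at a point just inside the boundary.
  have hm : ∃ e' : E', m e' = 1 := by
    have hcl : Continuous fun t : ℝ => p + t • e := by fun_prop
    have h1 : ∀ᶠ t in 𝓝[>] (0 : ℝ), p + t • e ∈ O :=
      (hcl.continuousAt.eventually_mem (by simpa using hO.mem_nhds hpO)).filter_mono
        nhdsWithin_le_nhds
    obtain ⟨t, htO, ht⟩ := (h1.and self_mem_nhdsWithin).exists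
    have ht' : 0 < t := ht
    have h2 : l (p + t • e) = t := by simp [hp, he]
    have h3 : m (F (p + t • e)) ≠ 0 := by
      rw [Ne, hzero _ htO (by rw [h2]; exact ht'.le), h2]
      exact ht'.ne'
    exact ⟨(m (F (p + t • e)))⁻¹ • F (p + t • e), by simp [h3]⟩
  obtain ⟨e', he'⟩ := hm
  have hgT : ∀ y ∈ h'.target, 0 ≤ m y →
      h'.symm y ∈ h'.source ∧ 0 ≤ l (h'.symm y) ∧ F (h'.symm y) = y := by
    intro y hy hmy
    have h1 := h'.map_target hy
    have h2 : oddReflection l e F (h'.symm y) = y := h'.right_inv hy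
    have h3 := hsign _ (by rw [hsrc] at h1; exact h1.2) (by rw [h2]; exact hmy)
    exact ⟨h1, h3, by rw [← oddReflection_of_nonneg l e F h3, h2]⟩
  refine ⟨h'.source, ?_, h'.open_source, ⟨hph, hpO₁⟩, h'.target, h'.open_target, h'.symm,
    ?_, hgT, ?_⟩
  · intro x hx
    exact (hO₁ x hx.2).1
  · refine contDiffOn_of_isLeftInverse (F := F) (s := h'.source ∩ {x | 0 ≤ l x}) ?_ ?_ ?_ ?_
      (h'.continuousOn_symm.mono inter_subset_left) ?_ ?_
    · rw [inter_comm]; exact (uniqueDiffOn_halfSpace l he).inter h'.open_source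
    · rw [inter_comm]; exact (uniqueDiffOn_halfSpace m he').inter h'.open_target
    · exact hF.mono fun x hx => ⟨(hO₁ x hx.1.2).1, hx.2⟩
    · intro x hx
      have hxO := hO₁ x hx.1.2
      have h1 := hxO.2.2.2 hx.2
      have h2 : fderivWithin ℝ F (h'.source ∩ {x | 0 ≤ l x}) x = fderivWithin ℝ F s x := by
        rw [hs, inter_comm, inter_comm O, fderivWithin_inter (h'.open_source.mem_nhds hx.1),
          fderivWithin_inter (hO.mem_nhds hxO.1)]
      rw [h2]
      exact h1
    · exact fun y hy => ⟨(hgT y hy.1 hy.2).1, (hgT y hy.1 hy.2).2.1⟩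
    · exact fun y hy => (hgT y hy.1 hy.2).2.2
  · intro x hx hlx
    have h1 : h' x = F x := oddReflection_of_nonneg l e F hlx
    rw [← h1]
    exact ⟨h'.map_source hx, h'.left_inv hx⟩

end HalfSpaceInverse

/-! ### Two-forms as bilinear maps, and forms along parametrizations -/

noncomputable section

section AlternatingBilinear

variable (E : Type*) [NormedAddCommGroup E] [NormedSpace ℝ E]

/-- The bilinear map underlying an alternating map in two variables. -/
def altToBilin : (E [⋀^Fin 2]→L[ℝ] ℝ) →L[ℝ] (E →L[ℝ] E →L[ℝ] ℝ) :=
  (ContinuousLinearMap.compL ℝ E (E [⋀^Fin 1]→L[ℝ] ℝ) (E →L[ℝ] ℝ)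
    (ContinuousAlternatingMap.ofSubsingletonLIE (𝕜 := ℝ) (E := E) (F := ℝ)
      (0 : Fin 1)).symm.toContinuousLinearEquiv)
  ∘L (ContinuousAlternatingMap.curryLeftLI).toContinuousLinearMap

/-- The alternating part of a bilinear map. -/
def bilinToAlt : (E →L[ℝ] E →L[ℝ] ℝ) →L[ℝ] (E [⋀^Fin 2]→L[ℝ] ℝ) :=
  (2⁻¹ : ℝ) • ((ContinuousAlternatingMap.alternatizeUncurryFinCLM ℝ E ℝ) ∘L
  (ContinuousLinearMap.compL ℝ E (E →L[ℝ] ℝ) (E [⋀^Fin 1]→L[ℝ] ℝ)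
    (ContinuousAlternatingMap.ofSubsingletonLIE (𝕜 := ℝ) (E := E) (F := ℝ)
      (0 : Fin 1)).toContinuousLinearEquiv))

variable {E}

theorem altToBilin_apply (α : E [⋀^Fin 2]→L[ℝ] ℝ) (v w : E) :
    altToBilin E α v w = α ![v, w] := by
  change (α.curryLeft v) _ = _
  rw [ContinuousAlternatingMap.curryLeft_apply_apply]
  congr 1
  ext i
  fin_cases i <;> rfl

theorem bilinToAlt_apply (B : E →L[ℝ] E →L[ℝ] ℝ) (v w : E) :
    bilinToAlt E B ![v, w] = 2⁻¹ * (B v w - B w v) := by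
  simp [bilinToAlt, ContinuousAlternatingMap.alternatizeUncurryFinCLM_apply,
    ContinuousAlternatingMap.alternatizeUncurryFin_apply, Fin.sum_univ_two]
  rfl

theorem alt_two_ext {α α' : E [⋀^Fin 2]→L[ℝ] ℝ} (h : ∀ v w, α ![v, w] = α' ![v, w]) :
    α = α' := by
  ext v
  have : v = ![v 0, v 1] := by ext i; fin_cases i <;> rfl
  rw [this, h]

theorem alt_two_swap (α : E [⋀^Fin 2]→L[ℝ] ℝ) (v w : E) : α ![v, w] = -α ![w, v] := by
  have h : α (![w, v] ∘ Equiv.swap 0 1) = -α ![w, v] :=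
    α.toAlternatingMap.map_swap ![w, v] (i := 0) (j := 1) (by decide)
  rw [← h]
  congr 1
  ext i; fin_cases i <;> rfl

theorem alt_two_self (α : E [⋀^Fin 2]→L[ℝ] ℝ) (v : E) : α ![v, v] = 0 := by
  linarith [alt_two_swap α v v]

theorem alt_comp_apply_two {F : Type*} [NormedAddCommGroup F] [NormedSpace ℝ F]
    (α : F [⋀^Fin 2]→L[ℝ] ℝ) (A : E →L[ℝ] F) (v w : E) :
    α.compContinuousLinearMap A ![v, w] = α ![A v, A w] := by
  rw [ContinuousAlternatingMap.compContinuousLinearMap_apply]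
  congr 1
  ext i; fin_cases i <;> rfl

theorem contDiff_bilinToAlt {n : WithTop ℕ∞} :
    ContDiff ℝ n (fun B : E →L[ℝ] E →L[ℝ] ℝ => bilinToAlt E B) := by
  apply ContinuousLinearMap.contDiff

theorem contDiff_altToBilin {n : WithTop ℕ∞} :
    ContDiff ℝ n (fun α : E [⋀^Fin 2]→L[ℝ] ℝ => altToBilin E α) := by
  apply ContinuousLinearMap.contDiff

/-- For bilinear maps the pullback is built from bounded bilinear compositions, hence smooth in both
arguments. `altToBilin` and `bilinToAlt` transfer this to alternating maps, the factor `2⁻¹` in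
`bilinToAlt` making the round trip the identity. -/
theorem ContDiffWithinAt.alt_two_comp {X F : Type*} [NormedAddCommGroup X] [NormedSpace ℝ X]
    [NormedAddCommGroup F] [NormedSpace ℝ F] {n : WithTop ℕ∞} {α : X → F [⋀^Fin 2]→L[ℝ] ℝ}
    {A : X → E →L[ℝ] F} {s : Set X} {x : X} (hα : ContDiffWithinAt ℝ n α s x)
    (hA : ContDiffWithinAt ℝ n A s x) :
    ContDiffWithinAt ℝ n (fun y => (α y).compContinuousLinearMap (A y)) s x := by
  have h : (fun y => (α y).compContinuousLinearMap (A y)) = fun y =>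
      bilinToAlt E (((ContinuousLinearMap.compL ℝ E F ℝ).flip (A y)).comp
        ((altToBilin F (α y)).comp (A y))) := by
    ext1 y
    refine alt_two_ext fun v w => ?_
    rw [bilinToAlt_apply, alt_comp_apply_two]
    simp only [ContinuousLinearMap.comp_apply, ContinuousLinearMap.flip_apply,
      ContinuousLinearMap.compL_apply, altToBilin_apply]
    rw [alt_two_swap _ (A y w)]
    ring
  rw [h]
  refine contDiff_bilinToAlt.comp_contDiffWithinAt ?_
  refine ContDiffWithinAt.clm_comp ?_ (ContDiffWithinAt.clm_comp ?_ hA)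
  · fun_prop
  · exact contDiff_altToBilin.comp_contDiffWithinAt hα

end AlternatingBilinear

namespace DiffForm

variable {E H : Type*} [NormedAddCommGroup E] [NormedSpace ℝ E] [TopologicalSpace H]
  {I : ModelWithCorners ℝ E H} {N : Type*} [TopologicalSpace N] [ChartedSpace H N]
  {F : Type*} [NormedAddCommGroup F] [NormedSpace ℝ F] {m : ℕ}

/-- The pullback of a form along a parametrization `g`, defined on a subset `D` of a vector
space. -/
def param (β : DiffForm I N m) (g : F → N) (D : Set F) (y : F) : F [⋀^Fin m]→L[ℝ] ℝ :=
  (β (g y)).compContinuousLinearMap (mfderivWithin 𝓘(ℝ, F) I g D y)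

/-- `β x` and `β x'` live on different tangent spaces; reading both on the model space `E` allows
equal points to be exchanged. -/
theorem comp_congr_point (β : DiffForm I N m) {x x' : N} (h : x = x') {A A' : F →L[ℝ] E}
    (hA : A = A') :
    (ContinuousAlternatingMap.compContinuousLinearMap (β x : E [⋀^Fin m]→L[ℝ] ℝ) A) =
    (ContinuousAlternatingMap.compContinuousLinearMap (β x' : E [⋀^Fin m]→L[ℝ] ℝ) A') := by
  subst h hA; rfl

/-- The chain rule for `g = φ⁻¹ ∘ (φ ∘ g)`. It replaces the manifold derivative of `g` by the
ordinary derivative of its coordinate expression, so that smoothness and closedness pass from charts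
to parametrizations. -/
theorem param_eq_inChart [IsManifold I 1 N] (β : DiffForm I N m) {g : F → N} {D : Set F} {y : F}
    (hD : UniqueDiffWithinAt ℝ D y)
    (hg : MDifferentiableWithinAt 𝓘(ℝ, F) I g D y) {x₀ : N}
    (hx : g y ∈ (extChartAt I x₀).source) :
    β.param g D y = (β.inChart x₀ (extChartAt I x₀ (g y))).compContinuousLinearMap
      (fderivWithin ℝ (extChartAt I x₀ ∘ g : F → E) D y) := by
  have hφ : MDifferentiableAt I 𝓘(ℝ, E) (extChartAt I x₀) (g y) :=
    mdifferentiableAt_extChartAt (by simpa using hx)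
  have hφg : MDifferentiableWithinAt 𝓘(ℝ, F) 𝓘(ℝ, E) (extChartAt I x₀ ∘ g) D y :=
    hφ.comp_mdifferentiableWithinAt y hg
  have hs : MDifferentiableWithinAt 𝓘(ℝ, E) I (extChartAt I x₀).symm (range I)
      (extChartAt I x₀ (g y)) :=
    mdifferentiableWithinAt_extChartAt_symm ((extChartAt I x₀).map_source hx)
  have hev : ∀ᶠ z in 𝓝[D] y, g z ∈ (extChartAt I x₀).source :=
    hg.continuousWithinAt.eventually_mem ((isOpen_extChartAt_source x₀).mem_nhds hx)
  have key2 : (extChartAt I x₀).symm (extChartAt I x₀ (g y)) = g y := (extChartAt I x₀).left_inv hx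
  set A : E →L[ℝ] E := mfderivWithin 𝓘(ℝ, E) I (extChartAt I x₀).symm (range I)
    (extChartAt I x₀ (g y)) with hA
  set B : F →L[ℝ] E := fderivWithin ℝ (extChartAt I x₀ ∘ g : F → E) D y with hB
  have key : (mfderivWithin 𝓘(ℝ, F) I g D y : F →L[ℝ] E) = A.comp B := by
    rw [hB, ← mfderivWithin_eq_fderivWithin]
    have h1 := mfderivWithin_comp_of_preimage_mem_nhdsWithin (I := 𝓘(ℝ, F)) (I' := 𝓘(ℝ, E))
      (I'' := I) (M := F) (M' := E) (M'' := N) y (g := (extChartAt I x₀).symm) (f := extChartAt I x₀ ∘ g) (u := range I) (s := D)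
      hs hφg (Filter.Eventually.of_forall fun z =>
        (show extChartAt I x₀ (g z) ∈ range I from ⟨_, rfl⟩)) hD.uniqueMDiffWithinAt
    have h2 : (extChartAt I x₀).symm ∘ (extChartAt I x₀ ∘ g) =ᶠ[𝓝[D] y] g := by
      filter_upwards [hev] with z hz
      exact (extChartAt I x₀).left_inv hz
    exact (h2.mfderivWithin_eq (I := 𝓘(ℝ, F)) (I' := I) key2).symm.trans h1
  exact comp_congr_point (F := F) β key2.symm key

/-- Parametrizations of smooth two-forms are smooth. -/
theorem IsSmooth.contDiffOn_param [IsManifold I ∞ N] {β : DiffForm I N 2} (hβ : β.IsSmooth)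
    {g : F → N} {D : Set F} (hD : UniqueDiffOn ℝ D) (hg : ContMDiffOn 𝓘(ℝ, F) I ∞ g D) :
    ContDiffOn ℝ ∞ (β.param g D) D := by
  have : IsManifold I 1 N := IsManifold.of_le (n := ∞) (by simp)
  intro y hy
  set x₀ := g y
  have hev : ∀ᶠ z in 𝓝[D] y, g z ∈ (extChartAt I x₀).source :=
    (hg y hy).continuousWithinAt.eventually_mem
      ((isOpen_extChartAt_source x₀).mem_nhds (mem_extChartAt_source x₀))
  obtain ⟨O, hO, hyO, hOD⟩ := mem_nhdsWithin.1 hev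
  have hDO : UniqueDiffOn ℝ (D ∩ O) := hD.inter hO
  have hmem : ∀ z ∈ D ∩ O, g z ∈ (extChartAt I x₀).source := fun z hz => hOD ⟨hz.2, hz.1⟩
  have hsm : ContDiffOn ℝ ∞ (extChartAt I x₀ ∘ g) (D ∩ O) := by
    rw [← contMDiffOn_iff_contDiffOn]
    exact (contMDiffOn_extChartAt (n := ∞)).comp (hg.mono inter_subset_left)
      (fun z hz => by simpa using hmem z hz)
  have h1 : ContDiffWithinAt ℝ ∞ (fun z => (β.inChart x₀
      (extChartAt I x₀ (g z))).compContinuousLinearMap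
      (fderivWithin ℝ (extChartAt I x₀ ∘ g) (D ∩ O) z)) (D ∩ O) y := by
    refine ContDiffWithinAt.alt_two_comp ?_ ?_
    · exact (hβ x₀ _ ((extChartAt I x₀).map_source (hmem y ⟨hy, hyO⟩))).comp y
        (hsm y ⟨hy, hyO⟩) (fun z hz => (extChartAt I x₀).map_source (hmem z hz))
    · exact (hsm.fderivWithin hDO (by simp)) y ⟨hy, hyO⟩
  have hn : D ∩ O ∈ 𝓝[D] y := inter_mem_nhdsWithin D (hO.mem_nhds hyO)
  refine ((h1.congr_of_mem (fun z hz => ?_) ⟨hy, hyO⟩)).mono_of_mem_nhdsWithin hn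
  rw [fderivWithin_inter (hO.mem_nhds hz.2)]
  exact β.param_eq_inChart (hD z hz.1) ((hg z hz.1).mdifferentiableWithinAt (by simp)) (hmem z hz)

/-- Parametrizations of closed forms are closed. -/
theorem IsClosed.extDerivWithin_param [IsManifold I ∞ N] {β : DiffForm I N 2} (hβ : β.IsSmooth)
    (hc : β.IsClosed) {g : F → N} {D : Set F} (hD : UniqueDiffOn ℝ D)
    (hg : ContMDiffOn 𝓘(ℝ, F) I ∞ g D) {y : F} (hy : y ∈ D) (hyi : y ∈ closure (interior D)) :
    extDerivWithin (β.param g D) D y = 0 := by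
  have : IsManifold I 1 N := IsManifold.of_le (n := ∞) (by simp)
  set x₀ := g y
  have hev : ∀ᶠ z in 𝓝[D] y, g z ∈ (extChartAt I x₀).source :=
    (hg y hy).continuousWithinAt.eventually_mem
      ((isOpen_extChartAt_source x₀).mem_nhds (mem_extChartAt_source x₀))
  have hgc : ContDiffWithinAt ℝ ∞ (extChartAt I x₀ ∘ g) D y := by
    rw [← contMDiffWithinAt_iff_contDiffWithinAt]
    exact (contMDiffAt_extChartAt (n := ∞)).comp_contMDiffWithinAt y (hg y hy)
  have heq : β.param g D =ᶠ[𝓝[D] y] fun z => (β.inChart x₀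
      ((extChartAt I x₀ ∘ g) z)).compContinuousLinearMap
      (fderivWithin ℝ (extChartAt I x₀ ∘ g) D z) := by
    filter_upwards [hev, self_mem_nhdsWithin] with z hz hzD
    exact β.param_eq_inChart (hD z hzD) ((hg z hzD).mdifferentiableWithinAt (by simp)) hz
  have htgt : extChartAt I x₀ x₀ ∈ (extChartAt I x₀).target := mem_extChartAt_target x₀
  have hdw : DifferentiableWithinAt ℝ (β.inChart x₀) (range I) ((extChartAt I x₀ ∘ g) y) := by
    have := ((hβ x₀).differentiableOn (by simp)) _ htgt
    exact this.mono_of_mem_nhdsWithin (extChartAt_target_mem_nhdsWithin x₀)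
  -- The exterior derivative commutes with pullback; `y` being in the closure of the interior of `D`
  -- serves the symmetry of second derivatives within `D`.
  rw [heq.extDerivWithin_eq_of_mem hy, extDerivWithin_pullback (t := range I) hdw hgc (by simp [ENat.LEInfty.out]) hD
    hyi hy (fun z _ => ⟨_, rfl⟩)]
  have := hc x₀ _ htgt
  simp only [Function.comp_apply]
  rw [this]
  ext; simp

end DiffForm

end

/-! ### Pullback rules, and forms in arbitrary charts of the maximal atlas -/

noncomputable section

namespace DiffForm

section Param

variable {E H : Type*} [NormedAddCommGroup E] [NormedSpace ℝ E] [TopologicalSpace H]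
  {I : ModelWithCorners ℝ E H} {N : Type*} [TopologicalSpace N] [ChartedSpace H N]
  {E' H' : Type*} [NormedAddCommGroup E'] [NormedSpace ℝ E'] [TopologicalSpace H']
  {I' : ModelWithCorners ℝ E' H'} {N' : Type*} [TopologicalSpace N'] [ChartedSpace H' N']
  {F F' : Type*} [NormedAddCommGroup F] [NormedSpace ℝ F] [NormedAddCommGroup F']
  [NormedSpace ℝ F'] {m : ℕ}

theorem param_congr (β : DiffForm I N m) {g g' : F → N} {D : Set F} {y : F}
    (h : g =ᶠ[𝓝[D] y] g') (hy : g y = g' y) : β.param g D y = β.param g' D y :=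
  comp_congr_point (F := F) β hy (h.mfderivWithin_eq hy)

theorem param_congr_set (β : DiffForm I N m) {g : F → N} {D D' : Set F} {y : F}
    (h : D =ᶠ[𝓝 y] D') : β.param g D y = β.param g D' y :=
  comp_congr_point (F := F) β rfl (mfderivWithin_congr_set h)

theorem param_comp (β : DiffForm I N m) {g : F → N} {D : Set F} {h : F' → F} {D' : Set F'} {y : F'}
    (hg : MDifferentiableWithinAt 𝓘(ℝ, F) I g D (h y)) (hh : DifferentiableWithinAt ℝ h D' y)
    (hm : h ⁻¹' D ∈ 𝓝[D'] y) (hu : UniqueDiffWithinAt ℝ D' y) :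
    β.param (g ∘ h) D' y =
      (β.param g D (h y)).compContinuousLinearMap (fderivWithin ℝ h D' y) := by
  have := mfderivWithin_comp_of_preimage_mem_nhdsWithin (I := 𝓘(ℝ, F')) (I' := 𝓘(ℝ, F))
    (I'' := I) y hg hh.mdifferentiableWithinAt hm hu.uniqueMDiffWithinAt
  rw [mfderivWithin_eq_fderivWithin] at this
  exact comp_congr_point (F := F') β rfl this

theorem param_pullback (β : DiffForm I' N' m) {f : N → N'} {g : F → N} {D : Set F} {y : F}
    (hf : MDifferentiableAt I I' f (g y)) (hg : MDifferentiableWithinAt 𝓘(ℝ, F) I g D y)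
    (hu : UniqueDiffWithinAt ℝ D y) :
    (pullback I I' f β).param g D y = β.param (f ∘ g) D y :=
  (comp_congr_point (F := F) β rfl (mfderiv_comp_mfderivWithin (I := 𝓘(ℝ, F)) (I' := I)
    (I'' := I') y hf hg hu.uniqueMDiffWithinAt)).symm

end Param

section Boundaryless

variable {E : Type*} [NormedAddCommGroup E] [NormedSpace ℝ E] {N : Type*} [TopologicalSpace N]
  [ChartedSpace E N] {m : ℕ}

theorem mfderiv_comp_mfderiv_symm [IsManifold 𝓘(ℝ, E) ∞ N] {φ : OpenPartialHomeomorph N E}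
    (hφ : φ ∈ IsManifold.maximalAtlas 𝓘(ℝ, E) ∞ N) {y : E} (hy : y ∈ φ.target) :
    (mfderiv 𝓘(ℝ, E) 𝓘(ℝ, E) φ (φ.symm y) : E →L[ℝ] E).comp
      (mfderiv 𝓘(ℝ, E) 𝓘(ℝ, E) φ.symm y : E →L[ℝ] E) = ContinuousLinearMap.id ℝ E := by
  have h : φ.MDifferentiable 𝓘(ℝ, E) 𝓘(ℝ, E) :=
    ⟨(contMDiffOn_of_mem_maximalAtlas hφ).mdifferentiableOn (by simp),
      (contMDiffOn_symm_of_mem_maximalAtlas hφ).mdifferentiableOn (by simp)⟩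
  exact h.comp_symm_deriv hy

theorem mfderiv_symm_comp_mfderiv [IsManifold 𝓘(ℝ, E) ∞ N] {φ : OpenPartialHomeomorph N E}
    (hφ : φ ∈ IsManifold.maximalAtlas 𝓘(ℝ, E) ∞ N) {q : N} (hq : q ∈ φ.source) :
    (mfderiv 𝓘(ℝ, E) 𝓘(ℝ, E) φ.symm (φ q) : E →L[ℝ] E).comp
      (mfderiv 𝓘(ℝ, E) 𝓘(ℝ, E) φ q : E →L[ℝ] E) = ContinuousLinearMap.id ℝ E := by
  have h : φ.MDifferentiable 𝓘(ℝ, E) 𝓘(ℝ, E) :=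
    ⟨(contMDiffOn_of_mem_maximalAtlas hφ).mdifferentiableOn (by simp),
      (contMDiffOn_symm_of_mem_maximalAtlas hφ).mdifferentiableOn (by simp)⟩
  exact h.symm_comp_deriv hq

/-- The local expression of a form in a chart. -/
def inMaxChart (β : DiffForm 𝓘(ℝ, E) N m) (φ : OpenPartialHomeomorph N E) :
    E → E [⋀^Fin m]→L[ℝ] ℝ := β.param φ.symm univ

theorem inMaxChart_eq (β : DiffForm 𝓘(ℝ, E) N m) (φ : OpenPartialHomeomorph N E) (y : E) :
    β.inMaxChart φ y = (β (φ.symm y) : E [⋀^Fin m]→L[ℝ] ℝ).compContinuousLinearMap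
      (mfderiv 𝓘(ℝ, E) 𝓘(ℝ, E) φ.symm y : E →L[ℝ] E) := by
  rw [← mfderivWithin_univ]; rfl

theorem inMaxChart_eq_of_forall [IsManifold 𝓘(ℝ, E) ∞ N] (β : DiffForm 𝓘(ℝ, E) N m)
    {φ : OpenPartialHomeomorph N E} (hφ : φ ∈ IsManifold.maximalAtlas 𝓘(ℝ, E) ∞ N)
    {Ω : E [⋀^Fin m]→L[ℝ] ℝ} {y : E} (hy : y ∈ φ.target)
    (h : (β (φ.symm y) : E [⋀^Fin m]→L[ℝ] ℝ) = Ω.compContinuousLinearMap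
      (mfderiv 𝓘(ℝ, E) 𝓘(ℝ, E) φ (φ.symm y) : E →L[ℝ] E)) :
    β.inMaxChart φ y = Ω := by
  rw [inMaxChart_eq, h]
  have h1 := mfderiv_comp_mfderiv_symm hφ hy
  refine Eq.trans (b := Ω.compContinuousLinearMap (ContinuousLinearMap.id ℝ E)) ?_ rfl
  exact congrArg (fun B : E →L[ℝ] E => Ω.compContinuousLinearMap B) h1

theorem eq_inMaxChart_comp [IsManifold 𝓘(ℝ, E) ∞ N] (β : DiffForm 𝓘(ℝ, E) N m)
    {φ : OpenPartialHomeomorph N E} (hφ : φ ∈ IsManifold.maximalAtlas 𝓘(ℝ, E) ∞ N)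
    {q : N} (hq : q ∈ φ.source) :
    (β q : E [⋀^Fin m]→L[ℝ] ℝ) = (β.inMaxChart φ (φ q)).compContinuousLinearMap
      (mfderiv 𝓘(ℝ, E) 𝓘(ℝ, E) φ q : E →L[ℝ] E) := by
  rw [inMaxChart_eq]
  have h1 := mfderiv_symm_comp_mfderiv hφ hq
  have h2 := comp_congr_point (F := E) β (φ.left_inv hq) h1
  exact h2.symm

theorem inMaxChart_change [IsManifold 𝓘(ℝ, E) ∞ N] (β : DiffForm 𝓘(ℝ, E) N m)
    {φ ψ : OpenPartialHomeomorph N E} (hφ : φ ∈ IsManifold.maximalAtlas 𝓘(ℝ, E) ∞ N)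
    (hψ : ψ ∈ IsManifold.maximalAtlas 𝓘(ℝ, E) ∞ N) {y : E} (hy : y ∈ (ψ.symm.trans φ).source) :
    β.inMaxChart ψ y = (β.inMaxChart φ (φ (ψ.symm y))).compContinuousLinearMap
      (fderiv ℝ (φ ∘ ψ.symm) y) := by
  have hO : IsOpen (ψ.symm.trans φ).source := (ψ.symm.trans φ).open_source
  have hy1 : y ∈ ψ.target := hy.1
  have hy2 : ψ.symm y ∈ φ.source := hy.2
  have h1 : MDifferentiableAt 𝓘(ℝ, E) 𝓘(ℝ, E) (φ ∘ ψ.symm) y :=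
    ((contMDiffAt_of_mem_maximalAtlas hφ hy2).mdifferentiableAt (by simp)).comp y
      ((contMDiffAt_symm_of_mem_maximalAtlas hψ hy1).mdifferentiableAt (by simp))
  have h2 := β.param_comp (g := φ.symm) (D := univ) (h := φ ∘ ψ.symm) (D' := univ) (y := y)
    ((contMDiffAt_symm_of_mem_maximalAtlas hφ
      (φ.map_source hy2)).mdifferentiableAt (by simp)).mdifferentiableWithinAt
    h1.differentiableAt.differentiableWithinAt Filter.univ_mem uniqueDiffWithinAt_univ
  rw [fderivWithin_univ] at h2
  refine Eq.trans ?_ h2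
  refine β.param_congr ?_ (φ.left_inv hy2).symm
  rw [nhdsWithin_univ]
  filter_upwards [hO.mem_nhds hy] with z hz
  exact (φ.left_inv hz.2).symm

theorem contDiffOn_transition [IsManifold 𝓘(ℝ, E) ∞ N]
    {φ ψ : OpenPartialHomeomorph N E} (hφ : φ ∈ IsManifold.maximalAtlas 𝓘(ℝ, E) ∞ N)
    (hψ : ψ ∈ IsManifold.maximalAtlas 𝓘(ℝ, E) ∞ N) :
    ContDiffOn ℝ ∞ (φ ∘ ψ.symm) (ψ.symm.trans φ).source := by
  rw [← contMDiffOn_iff_contDiffOn]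
  exact (contMDiffOn_of_mem_maximalAtlas hφ).comp
    ((contMDiffOn_symm_of_mem_maximalAtlas hψ).mono fun y hy => hy.1) fun y hy => hy.2

theorem inChart_eq_inMaxChart (β : DiffForm 𝓘(ℝ, E) N m) (x₀ : N) :
    β.inChart x₀ = β.inMaxChart (chartAt E x₀) := by
  ext1 y
  rw [inMaxChart_eq]
  refine comp_congr_point (F := E) β rfl ?_
  simp only [modelWithCornersSelf_coe, range_id, mfderivWithin_univ]
  rfl

theorem contDiffOn_inMaxChart_of_change [IsManifold 𝓘(ℝ, E) ∞ N] (β : DiffForm 𝓘(ℝ, E) N 2)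
    {φ ψ : OpenPartialHomeomorph N E} (hφ : φ ∈ IsManifold.maximalAtlas 𝓘(ℝ, E) ∞ N)
    (hψ : ψ ∈ IsManifold.maximalAtlas 𝓘(ℝ, E) ∞ N) (h : ContDiffOn ℝ ∞ (β.inMaxChart φ) φ.target)
    {y : E} (hy : y ∈ (ψ.symm.trans φ).source) : ContDiffAt ℝ ∞ (β.inMaxChart ψ) y := by
  have hO : IsOpen (ψ.symm.trans φ).source := (ψ.symm.trans φ).open_source
  have ht := contDiffOn_transition hφ hψ
  have h1 : ContDiffAt ℝ ∞ (fun z => (β.inMaxChart φ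
      ((φ ∘ ψ.symm) z)).compContinuousLinearMap (fderiv ℝ (φ ∘ ψ.symm) z)) y := by
    have h2 : ContDiffAt ℝ ∞ (φ ∘ ψ.symm) y := ht.contDiffAt (hO.mem_nhds hy)
    refine ContDiffWithinAt.alt_two_comp ?_ ?_
    · exact ((h.contDiffAt (φ.open_target.mem_nhds (φ.map_source hy.2))).comp y
        h2).contDiffWithinAt
    · exact (h2.fderiv_right (m := ∞) (by simp)).contDiffWithinAt
  refine h1.congr_of_eventuallyEq ?_
  filter_upwards [hO.mem_nhds hy] with z hz using β.inMaxChart_change hφ hψ hz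

/-- Smoothness of a two-form can be checked on any family of charts covering the manifold. -/
theorem isSmooth_of_inMaxChart [IsManifold 𝓘(ℝ, E) ∞ N] (β : DiffForm 𝓘(ℝ, E) N 2)
    (h : ∀ q : N, ∃ φ ∈ IsManifold.maximalAtlas 𝓘(ℝ, E) ∞ N, q ∈ φ.source ∧
      ContDiffOn ℝ ∞ (β.inMaxChart φ) φ.target) : β.IsSmooth := by
  intro x₀
  rw [inChart_eq_inMaxChart]
  intro y hy
  have hy' : y ∈ (chartAt E x₀).target := by simpa using hy
  obtain ⟨φ, hφ, hq, hs⟩ := h ((chartAt E x₀).symm y)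
  exact (β.contDiffOn_inMaxChart_of_change hφ (IsManifold.chart_mem_maximalAtlas x₀) hs
    ⟨hy', hq⟩).contDiffWithinAt

theorem IsSmooth.contDiffOn_inMaxChart [IsManifold 𝓘(ℝ, E) ∞ N] {β : DiffForm 𝓘(ℝ, E) N 2}
    (h : β.IsSmooth) {φ : OpenPartialHomeomorph N E}
    (hφ : φ ∈ IsManifold.maximalAtlas 𝓘(ℝ, E) ∞ N) :
    ContDiffOn ℝ ∞ (β.inMaxChart φ) φ.target := by
  intro y hy
  have h1 := h (φ.symm y)
  rw [inChart_eq_inMaxChart] at h1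
  exact (β.contDiffOn_inMaxChart_of_change (IsManifold.chart_mem_maximalAtlas (φ.symm y)) hφ
    (by simpa using h1) ⟨hy, mem_chart_source E (φ.symm y)⟩).contDiffWithinAt

/-- Closedness of a two-form can be checked on any family of charts covering the manifold. -/
theorem isClosed_of_inMaxChart [IsManifold 𝓘(ℝ, E) ∞ N] (β : DiffForm 𝓘(ℝ, E) N 2)
    (h : ∀ q : N, ∃ φ ∈ IsManifold.maximalAtlas 𝓘(ℝ, E) ∞ N, q ∈ φ.source ∧
      ContDiffOn ℝ ∞ (β.inMaxChart φ) φ.target ∧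
      ∀ y ∈ φ.target, extDeriv (β.inMaxChart φ) y = 0) : β.IsClosed := by
  intro x₀ y hy
  rw [inChart_eq_inMaxChart]
  have hy' : y ∈ (chartAt E x₀).target := by simpa using hy
  set ψ := chartAt E x₀ with hψd
  have hψ : ψ ∈ IsManifold.maximalAtlas 𝓘(ℝ, E) ∞ N := IsManifold.chart_mem_maximalAtlas x₀
  obtain ⟨φ, hφ, hq, hs, hc⟩ := h (ψ.symm y)
  have hyt : y ∈ (ψ.symm.trans φ).source := ⟨hy', hq⟩
  have hO : IsOpen (ψ.symm.trans φ).source := (ψ.symm.trans φ).open_source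
  simp only [modelWithCornersSelf_coe, range_id, extDerivWithin_univ]
  have heq : β.inMaxChart ψ =ᶠ[𝓝 y] fun z => (β.inMaxChart φ
      ((φ ∘ ψ.symm) z)).compContinuousLinearMap (fderiv ℝ (φ ∘ ψ.symm) z) := by
    filter_upwards [hO.mem_nhds hyt] with z hz using β.inMaxChart_change hφ hψ hz
  have hty : φ (ψ.symm y) ∈ φ.target := φ.map_source hq
  have hd : DifferentiableAt ℝ (β.inMaxChart φ) ((φ ∘ ψ.symm) y) :=
    (hs.contDiffAt (φ.open_target.mem_nhds hty)).differentiableAt (by simp)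
  have hp := extDeriv_pullback (r := ∞) hd
    ((contDiffOn_transition hφ hψ).contDiffAt (hO.mem_nhds hyt)) (by simp [ENat.LEInfty.out])
  rw [heq.extDeriv_eq, hp]
  simp only [Function.comp_apply]
  rw [hc _ hty]
  ext; simp

theorem eq_of_inMaxChart_eq [IsManifold 𝓘(ℝ, E) ∞ N] {β β' : DiffForm 𝓘(ℝ, E) N m}
    {φ : OpenPartialHomeomorph N E} (hφ : φ ∈ IsManifold.maximalAtlas 𝓘(ℝ, E) ∞ N)
    {q : N} (hq : q ∈ φ.source) (h : β.inMaxChart φ (φ q) = β'.inMaxChart φ (φ q)) :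
    β q = β' q := by
  have h1 := β.eq_inMaxChart_comp hφ hq
  have h2 := β'.eq_inMaxChart_comp hφ hq
  rw [h] at h1
  exact h1.trans h2.symm

end Boundaryless

end DiffForm

end

noncomputable section

/-! ### Averages over the circle parameter -/

section Averaging

universe u

variable {E : Type u} [NormedAddCommGroup E] [NormedSpace ℝ E] {H : Type*} [TopologicalSpace H]
  {I : ModelWithCorners ℝ E H} {N : Type*} [TopologicalSpace N] [ChartedSpace H N]
  {F : Type u} [NormedAddCommGroup F] [NormedSpace ℝ F]

/-- A ball intersected with the range of the model is convex even at boundary points; this is the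
kind of parameter set that the parametric integral lemmas accept. -/
theorem exists_convex_subset_extChartAt_target (I : ModelWithCorners ℝ E H) (x : N) :
    ∃ D ⊆ (extChartAt I x).target, Convex ℝ D ∧ UniqueDiffOn ℝ D ∧
      D ∈ 𝓝[range I] (extChartAt I x x) ∧ extChartAt I x x ∈ D := by
  obtain ⟨r, hr, hD⟩ := Metric.mem_nhdsWithin_iff.1 (extChartAt_target_mem_nhdsWithin (I := I) x)
  refine ⟨Metric.ball (extChartAt I x x) r ∩ range I, hD, (convex_ball _ _).inter I.convex_range,
    ?_, ?_, Metric.mem_ball_self hr, mem_range_self _⟩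
  · rw [inter_comm]
    exact I.uniqueDiffOn.inter Metric.isOpen_ball
  · rw [inter_comm]
    exact inter_mem_nhdsWithin _ (Metric.ball_mem_nhds _ hr)

theorem contDiffOn_comp_extChartAt_symm [IsManifold I ∞ N] {f : ℝ × N → F}
    (hf : ContMDiff (𝓘(ℝ, ℝ).prod I) 𝓘(ℝ, F) ∞ f) (x : N) {D : Set E}
    (hD : D ⊆ (extChartAt I x).target) (S : Set ℝ) :
    ContDiffOn ℝ ∞ (fun z : E × ℝ => f (z.2, (extChartAt I x).symm z.1)) (D ×ˢ S) := by
  rw [← contMDiffOn_iff_contDiffOn]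
  refine hf.comp_contMDiffOn ?_
  refine ContMDiffOn.prodMk ?_ ?_
  · exact contDiff_snd.contMDiff.contMDiffOn
  · exact (contMDiffOn_extChartAt_symm x).comp contDiff_fst.contMDiff.contMDiffOn
      fun z hz => hD hz.1

theorem contMDiff_intervalIntegral [IsManifold I ∞ N] [CompleteSpace F] {f : ℝ × N → F}
    (hf : ContMDiff (𝓘(ℝ, ℝ).prod I) 𝓘(ℝ, F) ∞ f) {a b : ℝ} (hab : a < b) :
    ContMDiff I 𝓘(ℝ, F) ∞ fun x => ∫ θ in a..b, f (θ, x) := by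
  intro x
  obtain ⟨D, hDt, hDc, hDu, hDn, hDx⟩ := exists_convex_subset_extChartAt_target I x
  have h1 := contDiffOn_intervalIntegral_of_convex hDc hDu hab
    (contDiffOn_comp_extChartAt_symm hf x hDt (Icc a b))
  have hn : (extChartAt I x) ⁻¹' D ∈ 𝓝 x := by
    have h2 : ContinuousWithinAt (extChartAt I x) univ x :=
      (continuousAt_extChartAt x).continuousWithinAt
    have := h2.tendsto_nhdsWithin (t := range I) (fun z _ => mem_range_self _) hDn
    simpa using this
  have h3 : ContMDiffWithinAt I 𝓘(ℝ, F) ∞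
      ((fun y => ∫ θ in a..b, f (θ, (extChartAt I x).symm y)) ∘ extChartAt I x)
      ((extChartAt I x) ⁻¹' D) x :=
    (h1.contMDiffOn _ hDx).comp x contMDiffAt_extChartAt.contMDiffWithinAt (fun z hz => hz)
  refine (h3.contMDiffAt hn).congr_of_eventuallyEq ?_
  filter_upwards [extChartAt_source_mem_nhds (I := I) x] with z hz
  simp only [Function.comp_apply, (extChartAt I x).left_inv hz]

/-- The derivative of an average, in the preferred chart. -/
theorem exists_hasFDerivWithinAt_intervalIntegral [IsManifold I ∞ N] [CompleteSpace F]
    {f : ℝ × N → F} (hf : ContMDiff (𝓘(ℝ, ℝ).prod I) 𝓘(ℝ, F) ∞ f) {a b : ℝ} (hab : a < b) (x : N) :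
    ∃ L : ℝ → E →L[ℝ] F, ContinuousOn L (Icc a b) ∧
      (∀ θ ∈ Icc a b, HasFDerivWithinAt (fun y => f (θ, (extChartAt I x).symm y)) (L θ)
        (range I) (extChartAt I x x)) ∧
      HasFDerivWithinAt (fun y => ∫ θ in a..b, f (θ, (extChartAt I x).symm y))
        (∫ θ in a..b, L θ) (range I) (extChartAt I x x) := by
  obtain ⟨D, hDt, hDc, hDu, hDn, hDx⟩ := exists_convex_subset_extChartAt_target I x
  have h1 := contDiffOn_comp_extChartAt_symm hf x hDt (Icc a b)
  have hu : UniqueDiffOn ℝ (D ×ˢ Icc a b) := hDu.prod (uniqueDiffOn_Icc hab)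
  set f' : E → ℝ → E →L[ℝ] F := fun y θ => (fderivWithin ℝ
    (fun z : E × ℝ => f (z.2, (extChartAt I x).symm z.1)) (D ×ˢ Icc a b) (y, θ)).comp
    (ContinuousLinearMap.inl ℝ E ℝ) with hf'
  have hc : ContinuousOn (Function.uncurry f') (D ×ˢ Icc a b) := by
    have := h1.continuousOn_fderivWithin hu (by simp)
    exact this.clm_comp continuousOn_const
  have hd : ∀ y ∈ D, ∀ θ ∈ Icc a b,
      HasFDerivWithinAt (fun y => f (θ, (extChartAt I x).symm y)) (f' y θ) D y := by
    intro y hy θ hθ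
    have h2 := (h1.differentiableOn (by simp) (y, θ) ⟨hy, hθ⟩).hasFDerivWithinAt
    exact h2.comp (f := fun y => (y, θ)) y (hasFDerivAt_prodMk_left y θ).hasFDerivWithinAt
      (fun z hz => ⟨hz, hθ⟩)
  refine ⟨fun θ => f' (extChartAt I x x) θ, ?_, fun θ hθ => ?_, ?_⟩
  · exact hc.comp (f := fun θ => (extChartAt I x x, θ)) (by fun_prop) fun θ hθ => ⟨hDx, hθ⟩
  · exact (hd _ hDx θ hθ).mono_of_mem_nhdsWithin hDn
  · exact (hasFDerivWithinAt_intervalIntegral_of_convex hDc hab.le (s := D)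
      (f := fun y θ => f (θ, (extChartAt I x).symm y)) h1.continuousOn hc hd
      hDx).mono_of_mem_nhdsWithin hDn

end Averaging

/-! ### Boundary defining functions -/

section HalfSpaceManifold

variable {k : ℕ} {N : Type*} [TopologicalSpace N] [ChartedSpace (EuclideanHalfSpace (k + 2)) N]

/-- The inward unit normal vector in the model. -/
def inwardNormal (k : ℕ) : EuclideanSpace ℝ (Fin (k + 2)) := EuclideanSpace.single 0 1

/-- The normal coordinate in the model. -/
def normalCoord (k : ℕ) : EuclideanSpace ℝ (Fin (k + 2)) →L[ℝ] ℝ := EuclideanSpace.proj 0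

theorem normalCoord_apply (k : ℕ) (v : EuclideanSpace ℝ (Fin (k + 2))) :
    normalCoord k v = v 0 := rfl

theorem inwardNormal_zero (k : ℕ) : inwardNormal k 0 = 1 := by simp [inwardNormal]

theorem mem_range_halfSpace {y : EuclideanSpace ℝ (Fin (k + 2))} :
    y ∈ range (𝓡∂ (k + 2)) ↔ 0 ≤ y 0 := by
  rw [range_modelWithCornersEuclideanHalfSpace]; rfl

theorem ray_eventually_mem_target {p : N} {y v : EuclideanSpace ℝ (Fin (k + 2))}
    (hy : y ∈ (extChartAt (𝓡∂ (k + 2)) p).target) (hv : 0 ≤ v 0) :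
    ∀ᶠ t in 𝓝[≥] (0 : ℝ), y + t • v ∈ (extChartAt (𝓡∂ (k + 2)) p).target := by
  have h0 : 0 ≤ y 0 := mem_range_halfSpace.1 (extChartAt_target_subset_range p hy)
  have hc : Continuous fun t : ℝ => y + t • v := by fun_prop
  have h1 : Filter.Tendsto (fun t : ℝ => y + t • v) (𝓝[≥] 0)
      (𝓝[range (𝓡∂ (k + 2))] y) := by
    refine tendsto_nhdsWithin_iff.2 ⟨?_, ?_⟩
    · have := hc.tendsto 0
      simp only [zero_smul, add_zero] at this
      exact this.mono_left nhdsWithin_le_nhds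
    · filter_upwards [self_mem_nhdsWithin] with t ht
      have : (0 : ℝ) ≤ t := ht
      rw [mem_range_halfSpace]
      simp only [PiLp.add_apply, PiLp.smul_apply, smul_eq_mul]
      positivity
  exact h1 (extChartAt_target_mem_nhdsWithin_of_mem hy)

/-- Comparison of difference quotients at `0`. It bounds the derivative of a boundary defining
function along an inward ray from below by a weight of a partition of unity. -/
theorem le_of_hasDerivWithinAt_of_le {g c : ℝ → ℝ} {L c₀ : ℝ}
    (h : HasDerivWithinAt g L (Ici 0) 0) (h0 : g 0 = 0)
    (hc : Filter.Tendsto c (𝓝[>] 0) (𝓝 c₀)) (hle : ∀ᶠ t in 𝓝[>] (0 : ℝ), t * c t ≤ g t) :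
    c₀ ≤ L := by
  have h1 := hasDerivWithinAt_iff_tendsto_slope.1 h
  rw [Ici_sdiff_left] at h1
  refine le_of_tendsto_of_tendsto hc h1 ?_
  filter_upwards [hle, self_mem_nhdsWithin] with t ht ht0
  have : (0 : ℝ) < t := ht0
  rw [slope_def_field, h0, sub_zero, sub_zero, le_div_iff₀ this]
  linarith

variable [IsManifold (𝓡∂ (k + 2)) ∞ N]

theorem mem_boundary_iff_extChartAt {x₀ x : N} (hx : x ∈ (extChartAt (𝓡∂ (k + 2)) x₀).source) :
    x ∈ (𝓡∂ (k + 2)).boundary N ↔ extChartAt (𝓡∂ (k + 2)) x₀ x 0 = 0 :=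
  mem_boundary_iff_of_mem_atlas (chart_mem_atlas _ x₀) (by simpa using hx)

theorem extChartAt_symm_mem_boundary_iff {x₀ : N} {y : EuclideanSpace ℝ (Fin (k + 2))}
    (hy : y ∈ (extChartAt (𝓡∂ (k + 2)) x₀).target) :
    (extChartAt (𝓡∂ (k + 2)) x₀).symm y ∈ (𝓡∂ (k + 2)).boundary N ↔ y 0 = 0 := by
  rw [mem_boundary_iff_extChartAt ((extChartAt (𝓡∂ (k + 2)) x₀).map_target hy),
    (extChartAt (𝓡∂ (k + 2)) x₀).right_inv hy]

theorem isClosed_boundary : IsClosed ((𝓡∂ (k + 2)).boundary N) := by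
  rw [← isOpen_compl_iff, isOpen_iff_mem_nhds]
  intro x hx
  have h1 := extChartAt_source_mem_nhds (I := 𝓡∂ (k + 2)) x
  have h2 : ∀ᶠ z in 𝓝 x, extChartAt (𝓡∂ (k + 2)) x z 0 ≠ 0 := by
    have hc : ContinuousAt (fun z => extChartAt (𝓡∂ (k + 2)) x z 0) x :=
      (normalCoord k).continuous.continuousAt.comp (continuousAt_extChartAt x)
    exact hc.eventually_ne ((mem_boundary_iff_extChartAt (mem_extChartAt_source x)).not.1 hx)
  filter_upwards [h1, h2] with z hz1 hz2
  exact (mem_boundary_iff_extChartAt hz1).not.2 hz2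

/-- Rays in a chart: for `v` pointing inward or along the boundary. -/
theorem hasDerivWithinAt_comp_ray {F : Type*} [NormedAddCommGroup F] [NormedSpace ℝ F]
    {g : EuclideanSpace ℝ (Fin (k + 2)) → F}
    {L : EuclideanSpace ℝ (Fin (k + 2)) →L[ℝ] F} {y v : EuclideanSpace ℝ (Fin (k + 2))}
    (hg : HasFDerivWithinAt g L (range (𝓡∂ (k + 2))) y) (hy : 0 ≤ y 0) (hv : 0 ≤ v 0) :
    HasDerivWithinAt (fun t : ℝ => g (y + t • v)) (L v) (Ici 0) 0 := by
  have h1 : HasDerivWithinAt (fun t : ℝ => y + t • v) v (Ici 0) 0 := by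
    simpa using ((hasDerivAt_id (0 : ℝ)).smul_const v |>.const_add y).hasDerivWithinAt
  have hg' : HasFDerivWithinAt g L (range (𝓡∂ (k + 2))) (y + (0 : ℝ) • v) := by simpa using hg
  refine hg'.comp_hasDerivWithinAt 0 h1 fun t ht => ?_
  rw [mem_range_halfSpace]
  have : (0 : ℝ) ≤ t := ht
  simp only [PiLp.add_apply, PiLp.smul_apply, smul_eq_mul]
  positivity

/-- A non-negative function vanishing on the boundary has derivative a non-negative multiple of
the normal coordinate. -/
theorem fderiv_eq_of_zero_on_boundary {f : N → ℝ} {p : N}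
    (hp : p ∈ (𝓡∂ (k + 2)).boundary N) (h0 : ∀ x ∈ (𝓡∂ (k + 2)).boundary N, f x = 0)
    (hnn : ∀ x, 0 ≤ f x) {L : EuclideanSpace ℝ (Fin (k + 2)) →L[ℝ] ℝ}
    (hL : HasFDerivWithinAt (fun y => f ((extChartAt (𝓡∂ (k + 2)) p).symm y)) L
      (range (𝓡∂ (k + 2))) (extChartAt (𝓡∂ (k + 2)) p p)) :
    ∃ c : ℝ, 0 ≤ c ∧ L = c • normalCoord k := by
  have hp0 : extChartAt (𝓡∂ (k + 2)) p p 0 = 0 :=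
    (mem_boundary_iff_extChartAt (mem_extChartAt_source p)).1 hp
  have hg0 : f ((extChartAt (𝓡∂ (k + 2)) p).symm (extChartAt (𝓡∂ (k + 2)) p p)) = 0 := by
    rw [extChartAt_to_inv, h0 p hp]
  -- Along the boundary `f` stays `0`, so `L` is determined by its value on the inward normal, which
  -- is non-negative because `f` is.
  have hz : ∀ v, v 0 = 0 → L v = 0 := by
    intro v hv
    have h1 := hasDerivWithinAt_comp_ray hL hp0.ge hv.ge
    have h2 : HasDerivWithinAt (fun _ : ℝ => (0 : ℝ)) (L v) (Ici 0) 0 := by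
      refine h1.congr_of_eventuallyEq ?_ ?_
      · filter_upwards [ray_eventually_mem_target (mem_extChartAt_target p) hv.ge] with t ht
        refine (h0 _ ((extChartAt_symm_mem_boundary_iff ht).2 ?_)).symm
        simp only [PiLp.add_apply, PiLp.smul_apply, hp0, hv, smul_zero, add_zero]
      · rw [zero_smul, add_zero, hg0]
    exact (uniqueDiffWithinAt_Ici (0 : ℝ)).eq_deriv _ h2 (hasDerivWithinAt_const _ _ _)
  refine ⟨L (inwardNormal k), ?_, ContinuousLinearMap.ext fun v => ?_⟩
  · refine le_of_hasDerivWithinAt_of_le (c := fun _ => 0) (hasDerivWithinAt_comp_ray hL hp0.ge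
      (v := inwardNormal k) (by simp [inwardNormal])) (by simpa using hg0) tendsto_const_nhds ?_
    filter_upwards with t
    rw [mul_zero]
    exact hnn _
  · have := hz (v - v 0 • inwardNormal k) (by simp [inwardNormal])
    rw [map_sub, map_smul, smul_eq_mul, sub_eq_zero] at this
    rw [this]
    simp [normalCoord_apply, mul_comm]

/-- A boundary defining function. -/
structure IsBoundaryDefining {k : ℕ} {N : Type*} [TopologicalSpace N]
    [ChartedSpace (EuclideanHalfSpace (k + 2)) N] (f : N → ℝ) : Prop where
  smooth : ContMDiff (𝓡∂ (k + 2)) 𝓘(ℝ, ℝ) ∞ f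
  nonneg : ∀ x, 0 ≤ f x
  zero_iff : ∀ x, f x = 0 ↔ x ∈ (𝓡∂ (k + 2)).boundary N
  deriv_ne_zero : ∀ x ∈ (𝓡∂ (k + 2)).boundary N, mfderiv (𝓡∂ (k + 2)) 𝓘(ℝ, ℝ) f x ≠ 0

omit [IsManifold (𝓡∂ (k + 2)) ∞ N] in
theorem hasFDerivWithinAt_mfderiv {F : Type*} [NormedAddCommGroup F] [NormedSpace ℝ F]
    {f : N → F} {p : N} (hf : MDifferentiableAt (𝓡∂ (k + 2)) 𝓘(ℝ, F) f p) :
    HasFDerivWithinAt (E := EuclideanSpace ℝ (Fin (k + 2))) (F := F)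
      (fun y => f ((extChartAt (𝓡∂ (k + 2)) p).symm y))
      (mfderiv (𝓡∂ (k + 2)) 𝓘(ℝ, F) f p : EuclideanSpace ℝ (Fin (k + 2)) →L[ℝ] F)
      (range (𝓡∂ (k + 2))) (extChartAt (𝓡∂ (k + 2)) p p) := by
  have := hf.hasMFDerivAt.2
  simp only [writtenInExtChartAt, extChartAt_model_space_eq_id, PartialEquiv.refl_coe,
    Function.id_comp] at this
  exact this

omit [IsManifold (𝓡∂ (k + 2)) ∞ N] in
theorem mfderiv_ne_zero_of_hasFDerivWithinAt {f : N → ℝ} {p : N}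
    (hf : MDifferentiableAt (𝓡∂ (k + 2)) 𝓘(ℝ, ℝ) f p)
    {L : EuclideanSpace ℝ (Fin (k + 2)) →L[ℝ] ℝ} (hL0 : L ≠ 0)
    (hL : HasFDerivWithinAt (fun y => f ((extChartAt (𝓡∂ (k + 2)) p).symm y)) L
      (range (𝓡∂ (k + 2))) (extChartAt (𝓡∂ (k + 2)) p p)) :
    mfderiv (𝓡∂ (k + 2)) 𝓘(ℝ, ℝ) f p ≠ 0 := by
  intro h
  have h1 := hasFDerivWithinAt_mfderiv hf
  rw [h] at h1
  exact hL0 (((𝓡∂ (k + 2)).uniqueDiffOn _ (mem_range_self _)).eq hL h1)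

theorem IsBoundaryDefining.exists_hasFDerivWithinAt {f : N → ℝ} (hf : IsBoundaryDefining (k := k) f) {p : N}
    (hp : p ∈ (𝓡∂ (k + 2)).boundary N) :
    ∃ c : ℝ, 0 < c ∧ HasFDerivWithinAt (fun y => f ((extChartAt (𝓡∂ (k + 2)) p).symm y))
      (c • normalCoord k) (range (𝓡∂ (k + 2))) (extChartAt (𝓡∂ (k + 2)) p p) := by
  have h1 := hasFDerivWithinAt_mfderiv (hf.smooth.mdifferentiableAt (by simp) (x := p))
  obtain ⟨c, hc, h2⟩ := fderiv_eq_of_zero_on_boundary hp (fun x hx => (hf.zero_iff x).2 hx)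
    hf.nonneg h1
  refine ⟨c, lt_of_le_of_ne hc fun h => hf.deriv_ne_zero p hp ?_, h2 ▸ h1⟩
  refine h2.trans ?_
  rw [← h, zero_smul]
  rfl

/-- A partition of unity glues the normal coordinates of the charts. All summands are non-negative,
so each of them bounds `f` from below; this gives both positivity inside and a non-zero derivative
on the boundary. -/
theorem exists_isBoundaryDefining (k : ℕ) (N : Type*) [TopologicalSpace N]
    [ChartedSpace (EuclideanHalfSpace (k + 2)) N] [IsManifold (𝓡∂ (k + 2)) ∞ N]
    [T2Space N] [SigmaCompactSpace N] :
    ∃ f : N → ℝ, IsBoundaryDefining (k := k) f := by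
  obtain ⟨ρ, hρ⟩ :=
    SmoothPartitionOfUnity.exists_isSubordinate_chartAt_source (𝓡∂ (k + 2)) N
  set g : N → N → ℝ := fun i x => extChartAt (𝓡∂ (k + 2)) i x 0 with hg
  set f : N → ℝ := fun x => ∑ᶠ i, ρ i x • g i x with hf
  have hgn : ∀ i x, 0 ≤ g i x := fun i x => mem_range_halfSpace.1 (mem_range_self _)
  have hs : ContMDiff (𝓡∂ (k + 2)) 𝓘(ℝ, ℝ) ∞ f := by
    refine ρ.contMDiff_finsum_smul fun i x hx => ?_
    have h1 : ContMDiffAt (𝓡∂ (k + 2)) 𝓘(ℝ, EuclideanSpace ℝ (Fin (k + 2))) ∞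
      (extChartAt (𝓡∂ (k + 2)) i) x := contMDiffAt_extChartAt' (hρ i hx)
    exact (normalCoord k).contDiff.contMDiff.contMDiffAt.comp x h1
  have hfin : ∀ x, (Function.support fun i => ρ i x • g i x).Finite := fun x =>
    (ρ.locallyFinite.point_finite x).subset fun i hi => by
      simp only [Function.mem_support, smul_eq_mul, mem_ofPred_eq] at hi ⊢
      exact fun h => hi (by simp [h])
  have hge : ∀ i x, ρ i x * g i x ≤ f x := fun i x =>
    single_le_finsum i (hfin x) fun j => mul_nonneg (ρ.nonneg j x) (hgn j x)
  have hzero : ∀ x ∈ (𝓡∂ (k + 2)).boundary N, f x = 0 := by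
    intro x h
    rw [hf]
    refine finsum_eq_zero_of_forall_eq_zero fun i => ?_
    by_cases hi : ρ i x = 0
    · simp [hi]
    · have hxi : x ∈ (extChartAt (𝓡∂ (k + 2)) i).source := by
        rw [extChartAt_source]
        exact hρ i (subset_tsupport _ hi)
      have h1 : g i x = 0 := (mem_boundary_iff_extChartAt hxi).1 h
      simp [h1]
  refine ⟨f, hs, fun x => finsum_nonneg fun i => mul_nonneg (ρ.nonneg i x) (hgn i x),
    fun x => ⟨fun h => ?_, fun h => ?_⟩, fun p hp h => ?_⟩
  · obtain ⟨i, hi⟩ := ρ.exists_pos_of_mem (mem_univ x)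
    have hxi : x ∈ (extChartAt (𝓡∂ (k + 2)) i).source := by
      rw [extChartAt_source]
      exact hρ i (subset_tsupport _ hi.ne')
    have := hge i x
    rw [h] at this
    rw [mem_boundary_iff_extChartAt hxi]
    refine le_antisymm ?_ (hgn i x)
    by_contra hc
    push Not at hc
    have := mul_pos hi hc
    linarith
  · exact hzero x h
  · obtain ⟨i, hi⟩ := ρ.exists_pos_of_mem (mem_univ p)
    have hpi : p ∈ (extChartAt (𝓡∂ (k + 2)) i).source := by
      rw [extChartAt_source]
      exact hρ i (subset_tsupport _ hi.ne')
    set φ := extChartAt (𝓡∂ (k + 2)) i with hφ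
    have hpt : φ p ∈ φ.target := φ.map_source hpi
    have hp0 : φ p 0 = 0 := (mem_boundary_iff_extChartAt hpi).1 hp
    have h1 : HasFDerivWithinAt (fun y => f (φ.symm y))
        (0 : EuclideanSpace ℝ (Fin (k + 2)) →L[ℝ] ℝ) (range (𝓡∂ (k + 2))) (φ p) := by
      have h2 : HasMFDerivAt (𝓡∂ (k + 2)) 𝓘(ℝ, ℝ) f (φ.symm (φ p))
          (0 : EuclideanSpace ℝ (Fin (k + 2)) →L[ℝ] ℝ) := by
        rw [φ.left_inv hpi]
        have h3 := (hs.mdifferentiableAt (by simp) (x := p)).hasMFDerivAt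
        rw [h] at h3
        exact h3
      have h3 := (mdifferentiableWithinAt_extChartAt_symm (I := 𝓡∂ (k + 2)) hpt).hasMFDerivWithinAt
      have h4 := (h2.comp_hasMFDerivWithinAt (φ p) h3).hasFDerivWithinAt
      exact h4.congr_fderiv (ContinuousLinearMap.zero_comp _)
    have h5 := hasDerivWithinAt_comp_ray h1 hp0.ge (v := inwardNormal k) (by simp [inwardNormal])
    have hcont : ContinuousWithinAt (fun t : ℝ => φ.symm (φ p + t • inwardNormal k)) (Ioi 0) 0 := by
      have h6 : ContinuousAt φ.symm (φ p + (0 : ℝ) • inwardNormal k) := by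
        rw [zero_smul, add_zero]
        exact continuousAt_extChartAt_symm' hpi
      exact ContinuousAt.continuousWithinAt (ContinuousAt.comp
        (f := fun t : ℝ => φ p + t • inwardNormal k) h6 (by fun_prop))
    have h7 : Filter.Tendsto (fun t : ℝ => ρ i (φ.symm (φ p + t • inwardNormal k))) (𝓝[>] 0)
        (𝓝 (ρ i p)) := by
      have h8 := (ρ i).contMDiff.continuous.continuousAt.comp_continuousWithinAt hcont
      unfold ContinuousWithinAt at h8
      simpa only [Function.comp_def, zero_smul, add_zero, φ.left_inv hpi] using h8
    -- If `df` vanished at `p`, comparing `f` with `ρ i * t` along the inward ray would give `ρ i p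
    -- ≤ 0`.
    have h9 := le_of_hasDerivWithinAt_of_le h5 (by
      rw [zero_smul, add_zero, φ.left_inv hpi]
      exact hzero p hp) h7 (by
      filter_upwards [self_mem_nhdsWithin, (ray_eventually_mem_target hpt
        (v := inwardNormal k) (by simp [inwardNormal])).filter_mono
        (nhdsWithin_mono _ Ioi_subset_Ici_self)] with t ht ht'
      refine le_trans (le_of_eq ?_) (hge i _)
      rw [mul_comm, hg]
      simp only
      rw [← hφ, φ.right_inv ht']
      simp [hp0, inwardNormal])
    simp only [zero_apply] at h9
    linarith

end HalfSpaceManifold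

/-! ### Invariant boundary defining functions and invariant neighbourhoods -/

namespace BoundaryCircleAction

variable {k : ℕ} {M : Type*} [TopologicalSpace M] [ChartedSpace (EuclideanHalfSpace (k + 2)) M]
  [IsManifold (𝓡∂ (k + 2)) ∞ M] (A : BoundaryCircleAction k M)

theorem continuousSMul : ContinuousSMul Circle A.U :=
  ContMDiffSMul.continuousSMul (I := 𝓡 1) (I' := 𝓡∂ (k + 2)) ∞

theorem contMDiff_smul' : ContMDiff ((𝓡 1).prod (𝓡∂ (k + 2))) (𝓡∂ (k + 2)) ∞
    (fun z : Circle × A.U => z.1 • z.2) := ContMDiffSMul.contMDiff_smul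

theorem contMDiff_const_smul (a : Circle) :
    ContMDiff (𝓡∂ (k + 2)) (𝓡∂ (k + 2)) ∞ (fun x : A.U => a • x) :=
  ContMDiffSMul.contMDiff_const_smul (I := 𝓡 1) a

theorem contMDiff_exp_smul : ContMDiff (𝓘(ℝ, ℝ).prod (𝓡∂ (k + 2))) (𝓡∂ (k + 2)) ∞
    (fun z : ℝ × A.U => Circle.exp z.1 • z.2) :=
  A.contMDiff_smul'.comp ((contMDiff_circleExp.comp contMDiff_fst).prodMk contMDiff_snd)

theorem mem_boundary_coe {x : A.U} :
    x ∈ (𝓡∂ (k + 2)).boundary A.U ↔ x.1 ∈ (𝓡∂ (k + 2)).boundary M := by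
  rw [ModelWithCorners.boundary_open]; rfl

theorem smul_mem_boundary_iff {a : Circle} {x : A.U} :
    (a • x).1 ∈ (𝓡∂ (k + 2)).boundary M ↔ x.1 ∈ (𝓡∂ (k + 2)).boundary M := by
  refine ⟨fun h => ?_, A.smul_mem_boundary a x⟩
  have := A.smul_mem_boundary a⁻¹ _ h
  rwa [inv_smul_smul] at this

end BoundaryCircleAction

/-- Multiplication by `a = exp(it)` shifts the interval of integration by `t`, and a periodic
function has the same integral over every period. -/
theorem integral_circle_shift {F : Type*} [NormedAddCommGroup F] [NormedSpace ℝ F]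
    (f : Circle → F) (a : Circle) :
    ∫ θ in (0 : ℝ)..2 * Real.pi, f (Circle.exp θ * a) =
      ∫ θ in (0 : ℝ)..2 * Real.pi, f (Circle.exp θ) := by
  obtain ⟨t, rfl⟩ := Circle.exp_surjective a
  have hp : Function.Periodic (fun θ : ℝ => f (Circle.exp θ)) (2 * Real.pi) := fun θ => by
    simp only [Circle.periodic_exp θ]
  simp only [← Circle.exp_add]
  rw [intervalIntegral.integral_comp_add_right (fun θ => f (Circle.exp θ)) t]
  have := hp.intervalIntegral_add_eq t 0
  rw [zero_add, add_comm (2 * Real.pi) t, this, zero_add]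

namespace BoundaryCircleAction

variable {k : ℕ} {M : Type*} [TopologicalSpace M] [ChartedSpace (EuclideanHalfSpace (k + 2)) M]
  [IsManifold (𝓡∂ (k + 2)) ∞ M] (A : BoundaryCircleAction k M)

theorem isBoundaryDefining_comp_smul {f : A.U → ℝ} (hf : IsBoundaryDefining (k := k) f)
    (a : Circle) : IsBoundaryDefining (k := k) fun x : A.U => f (a • x) := by
  refine ⟨hf.smooth.comp (A.contMDiff_const_smul a), fun x => hf.nonneg _, fun x => ?_,
    fun p hp h => ?_⟩
  · rw [hf.zero_iff, A.mem_boundary_coe, A.mem_boundary_coe, A.smul_mem_boundary_iff]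
  · have hq : a • p ∈ (𝓡∂ (k + 2)).boundary A.U :=
      A.mem_boundary_coe.2 (A.smul_mem_boundary a p (A.mem_boundary_coe.1 hp))
    refine hf.deriv_ne_zero (a • p) hq ?_
    have h1 : f = (fun x : A.U => f (a • x)) ∘ fun x : A.U => a⁻¹ • x := by
      ext x; simp
    have hs : ContMDiff (𝓡∂ (k + 2)) 𝓘(ℝ, ℝ) ∞ fun x : A.U => f (a • x) :=
      hf.smooth.comp (A.contMDiff_const_smul a)
    have h2 : HasMFDerivAt (𝓡∂ (k + 2)) 𝓘(ℝ, ℝ) (fun x : A.U => f (a • x)) (a⁻¹ • a • p)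
        (0 : EuclideanSpace ℝ (Fin (k + 2)) →L[ℝ] ℝ) := by
      rw [inv_smul_smul]
      have h3 := (hs.mdifferentiableAt (by simp) (x := p)).hasMFDerivAt
      rw [h] at h3
      exact h3
    have h4 := HasMFDerivAt.comp (a • p) h2
      ((A.contMDiff_const_smul a⁻¹).mdifferentiableAt (by simp)).hasMFDerivAt
    rw [← h1] at h4
    exact h4.mfderiv.trans (ContinuousLinearMap.zero_comp _)

/-- Average over orbits. The derivative survives because at a boundary point every translate has as
derivative a positive multiple of the same normal coordinate, so no cancellation can occur. -/
theorem exists_invariant_boundaryDefining [T2Space M] [SecondCountableTopology M] :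
    ∃ f : A.U → ℝ, IsBoundaryDefining (k := k) f ∧ ∀ (a : Circle) (x : A.U), f (a • x) = f x := by
  have : LocallyCompactSpace A.U :=
    Manifold.locallyCompact_of_finiteDimensional (𝓡∂ (k + 2))
  obtain ⟨f, hf⟩ := exists_isBoundaryDefining k A.U
  have hpi : (0 : ℝ) < 2 * Real.pi := by positivity
  have hF : ContMDiff (𝓘(ℝ, ℝ).prod (𝓡∂ (k + 2))) 𝓘(ℝ, ℝ) ∞
      (fun z : ℝ × A.U => f (Circle.exp z.1 • z.2)) := hf.smooth.comp A.contMDiff_exp_smul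
  have hs := contMDiff_intervalIntegral hF hpi
  have hcont : ∀ x : A.U, Continuous fun θ : ℝ => f (Circle.exp θ • x) := fun x =>
    hF.continuous.comp (f := fun θ : ℝ => (θ, x)) (by fun_prop)
  have hpos : ∀ x : A.U, x ∉ (𝓡∂ (k + 2)).boundary A.U →
      0 < ∫ θ in (0 : ℝ)..2 * Real.pi, f (Circle.exp θ • x) := by
    intro x hx
    refine intervalIntegral.intervalIntegral_pos_of_pos_on ((hcont x).intervalIntegrable _ _)
      (fun θ _ => ?_) hpi
    refine lt_of_le_of_ne (hf.nonneg _) fun h => hx ?_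
    have := (hf.zero_iff _).1 h.symm
    rwa [A.mem_boundary_coe, A.smul_mem_boundary_iff, ← A.mem_boundary_coe] at this
  have hzero : ∀ x : A.U, x ∈ (𝓡∂ (k + 2)).boundary A.U →
      ∫ θ in (0 : ℝ)..2 * Real.pi, f (Circle.exp θ • x) = 0 := by
    intro x hx
    have : ∀ θ : ℝ, f (Circle.exp θ • x) = 0 := fun θ => by
      rw [hf.zero_iff, A.mem_boundary_coe, A.smul_mem_boundary_iff, ← A.mem_boundary_coe]
      exact hx
    simp [this]
  refine ⟨fun x => ∫ θ in (0 : ℝ)..2 * Real.pi, f (Circle.exp θ • x),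
    ⟨hs, fun x => intervalIntegral.integral_nonneg hpi.le fun θ _ => hf.nonneg _, fun x => ?_,
      fun p hp => ?_⟩, fun a x => ?_⟩
  · refine ⟨fun h => ?_, hzero x⟩
    by_contra hx
    exact (hpos x hx).ne' h
  · obtain ⟨L, hLc, hL, hint⟩ := exists_hasFDerivWithinAt_intervalIntegral hF hpi p
    refine mfderiv_ne_zero_of_hasFDerivWithinAt (hs.mdifferentiableAt (by simp)) (fun h => ?_) hint
    have hLi : IntervalIntegrable L MeasureTheory.volume 0 (2 * Real.pi) := by
      apply ContinuousOn.intervalIntegrable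
      rwa [uIcc_of_le hpi.le]
    have h1 : (∫ θ in (0 : ℝ)..2 * Real.pi, L θ (inwardNormal k)) = 0 := by
      rw [← ContinuousLinearMap.intervalIntegral_apply hLi, h]
      rfl
    refine h1.not_gt (intervalIntegral.intervalIntegral_pos_of_pos_on
      ((hLc.clm_apply continuousOn_const).intervalIntegrable_of_Icc hpi.le) (fun θ hθ => ?_) hpi)
    obtain ⟨c, hc, h2⟩ := (A.isBoundaryDefining_comp_smul hf
      (Circle.exp θ)).exists_hasFDerivWithinAt hp
    rw [((𝓡∂ (k + 2)).uniqueDiffOn _ (mem_range_self _)).eq (hL θ ⟨hθ.1.le, hθ.2.le⟩) h2]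
    simpa [normalCoord_apply, inwardNormal] using hc
  · have := integral_circle_shift (fun b => f (b • x)) a
    simpa only [mul_smul] using this

/-- Every open neighbourhood of the boundary contains an invariant one. -/
theorem exists_isInvariantNhd {O : Set A.U} (hO : IsOpen O)
    (hb : ∀ x : A.U, x.1 ∈ (𝓡∂ (k + 2)).boundary M → x ∈ O) :
    A.IsInvariantNhd {x | ∀ a : Circle, a • x ∈ O} := by
  have := A.continuousSMul
  refine ⟨?_, fun x hx a => hb _ (A.smul_mem_boundary a x hx), fun a x hx b => ?_⟩
  -- The complement is the projection of a closed set along the compact circle, hence closed.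
  · have h1 : IsClosed (Prod.snd '' {z : Circle × A.U | z.1 • z.2 ∉ O}) :=
      isClosedMap_snd_of_compactSpace _ (hO.isClosed_compl.preimage continuous_smul)
    convert h1.isOpen_compl using 1
    ext x
    simp
  · rw [smul_smul]; exact hx (b * a)

open Classical in
/-- An invariant boundary defining function on `U` extends, after shrinking the neighbourhood on
which it is prescribed. -/
theorem exists_extension [T2Space M] [SecondCountableTopology M] {f : A.U → ℝ}
    (hf : IsBoundaryDefining (k := k) f) (hinv : ∀ (a : Circle) (x : A.U), f (a • x) = f x) :
    ∃ (f₀ : M → ℝ) (V : Set A.U), A.IsInvariantBoundaryDefining f₀ ∧ A.IsInvariantNhd V ∧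
      ∀ x ∈ V, f₀ x.1 = f x := by
  have : LocallyCompactSpace M :=
    Manifold.locallyCompact_of_finiteDimensional (𝓡∂ (k + 2))
  have hbU : (𝓡∂ (k + 2)).boundary M ⊆ (A.U : Set M) := fun x hx => A.boundary_subset x hx
  have hd : Disjoint ((A.U : Set M)ᶜ) ((𝓡∂ (k + 2)).boundary M) :=
    disjoint_left.2 fun x hx hx' => hx (hbU hx')
  obtain ⟨χ, h0, h1, h01⟩ := exists_contMDiffMap_zero_one_nhds_of_isClosed (𝓡∂ (k + 2)) (n := ⊤)
    A.U.isOpen.isClosed_compl (isClosed_boundary (k := k) (N := M)) hd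
  -- Interpolation between `f` near the boundary and the constant `1` away from it. Both summands
  -- are non-negative, so a zero forces `χ x = 1` and `f = 0`.
  set f₀ : M → ℝ := fun x => if h : x ∈ A.U then χ x * f ⟨x, h⟩ + (1 - χ x) else 1 with hf₀
  have hfU : ∀ x : A.U, f₀ x.1 = χ x.1 * f x + (1 - χ x.1) := fun x => by simp [hf₀]
  have hs : ContMDiff (𝓡∂ (k + 2)) 𝓘(ℝ, ℝ) ∞ f₀ := by
    intro x
    by_cases hx : x ∈ A.U
    · have h2 : ContMDiffAt (𝓡∂ (k + 2)) 𝓘(ℝ, ℝ) ∞ (fun y : A.U => f₀ y.1) ⟨x, hx⟩ := by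
        have hχ : ContMDiffAt (𝓡∂ (k + 2)) 𝓘(ℝ, ℝ) ∞ (fun y : A.U => χ y.1) ⟨x, hx⟩ :=
          (χ.contMDiff.comp contMDiff_subtype_val).contMDiffAt
        simp only [hfU]
        exact (hχ.mul hf.smooth.contMDiffAt).add (contMDiffAt_const.sub hχ)
      exact contMDiffAt_subtype_iff.1 h2
    · refine (contMDiffAt_const (c := (1 : ℝ))).congr_of_eventuallyEq ?_
      filter_upwards [h0.filter_mono (nhds_le_nhdsSet hx)] with y hy
      by_cases hyU : y ∈ A.U <;> simp [hf₀, hyU, hy]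
  have hO : IsOpen {x : A.U | ∀ᶠ y in 𝓝 x.1, χ y = 1} :=
    (isOpen_setOfPred_eventually_nhds (p := fun y : M => χ y = 1)).preimage continuous_subtype_val
  set V : Set A.U := {x | ∀ a : Circle, a • x ∈ {x : A.U | ∀ᶠ y in 𝓝 x.1, χ y = 1}} with hV
  have hVn : A.IsInvariantNhd V := A.exists_isInvariantNhd hO fun x hx =>
    h1.filter_mono (nhds_le_nhdsSet hx)
  have hVe : ∀ x ∈ V, f₀ x.1 = f x := by
    intro x hx
    have h2 := (hx 1).self_of_nhds
    rw [one_smul] at h2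
    rw [hfU, h2]
    ring
  refine ⟨f₀, V, ⟨hs, fun x => ?_, fun x => ?_, fun x hx h => ?_,
    ⟨V, hVn, fun a x hx => by rw [hVe _ (hVn.smul_mem a x hx), hVe x hx, hinv]⟩⟩, hVn, hVe⟩
  · by_cases hx : x ∈ A.U
    · rw [hfU ⟨x, hx⟩]
      have := h01 x
      have := mul_nonneg this.1 (hf.nonneg ⟨x, hx⟩)
      linarith [(h01 x).2]
    · simp [hf₀, hx]
  · refine ⟨fun h => ?_, fun h => ?_⟩
    · have hx : x ∈ A.U := by
        by_contra hx
        simp [hf₀, hx] at h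
      rw [hfU ⟨x, hx⟩] at h
      have h3 := mul_nonneg (h01 x).1 (hf.nonneg ⟨x, hx⟩)
      have h4 : χ x = 1 := by linarith [(h01 x).2]
      simp only [h4, one_mul, sub_self, add_zero] at h
      exact A.mem_boundary_coe.1 ((hf.zero_iff _).1 h)
    · have hx := hVn.boundary_subset ⟨x, hbU h⟩ h
      rw [hVe _ hx, hf.zero_iff, A.mem_boundary_coe]
      exact h
  · set x' : A.U := ⟨x, hbU hx⟩
    refine hf.deriv_ne_zero x' (A.mem_boundary_coe.2 hx) ?_
    have h2 : f =ᶠ[𝓝 x'] f₀ ∘ Subtype.val := by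
      filter_upwards [hVn.isOpen.mem_nhds (hVn.boundary_subset x' hx)] with y hy
      exact (hVe y hy).symm
    have h3 : HasMFDerivAt (𝓡∂ (k + 2)) 𝓘(ℝ, ℝ) f₀ x'.1
        (0 : EuclideanSpace ℝ (Fin (k + 2)) →L[ℝ] ℝ) := by
      have h4 := (hs.mdifferentiableAt (by simp) (x := x)).hasMFDerivAt
      rw [h] at h4
      exact h4
    have h5 := HasMFDerivAt.comp x' h3
      ((contMDiff_subtype_val (n := ∞)).mdifferentiableAt (by simp)).hasMFDerivAt
    exact (h5.congr_of_eventuallyEq h2).mfderiv.trans (ContinuousLinearMap.zero_comp _)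

end BoundaryCircleAction

end

noncomputable section

/-! ### The phase of a complex number -/

section UnitPart

/-- The phase of a complex number. -/
def unitPart (z : ℂ) : Circle := Circle.exp z.arg

theorem norm_mul_unitPart (z : ℂ) : (‖z‖ : ℂ) * (unitPart z : ℂ) = z := by
  rw [unitPart, Circle.coe_exp]
  exact Complex.norm_mul_exp_arg_mul_I z

theorem unitPart_eq_of_mul_eq {z : ℂ} {r : ℝ} (hr : 0 < r) {a : Circle} (h : (r : ℂ) * a = z) :
    unitPart z = a := by
  have h1 : ‖z‖ = r := by rw [← h, norm_mul, Circle.norm_coe, mul_one, Complex.norm_real, Real.norm_of_nonneg hr.le]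
  have h2 := norm_mul_unitPart z
  rw [h1] at h2
  have hr' : (r : ℂ) ≠ 0 := by exact_mod_cast hr.ne'
  exact Circle.coe_injective (mul_left_cancel₀ hr' (h2.trans h.symm))

theorem unitPart_circle_mul (a : Circle) {z : ℂ} (hz : z ≠ 0) :
    unitPart (a * z) = a * unitPart z := by
  refine unitPart_eq_of_mul_eq (norm_pos_iff.2 hz) ?_
  rw [Circle.coe_mul, mul_left_comm, norm_mul_unitPart]

theorem unitPart_ofReal_mul {r : ℝ} (hr : 0 < r) {z : ℂ} (hz : z ≠ 0) :
    unitPart (r * z) = unitPart z := by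
  refine unitPart_eq_of_mul_eq (mul_pos hr (norm_pos_iff.2 hz)) ?_
  rw [Complex.ofReal_mul, mul_assoc, norm_mul_unitPart]

theorem contDiffAt_arg {z : ℂ} (hz : z ∈ Complex.slitPlane) : ContDiffAt ℝ ∞ Complex.arg z := by
  have h1 : ContDiffAt ℝ ∞ Complex.log z := (Complex.contDiffAt_log hz).restrict_scalars ℝ
  have h2 : Complex.arg = fun z => Complex.imCLM (Complex.log z) := by
    ext z; simp [Complex.log_im]
  rw [h2]
  exact Complex.imCLM.contDiff.contDiffAt.comp z h1

/-- `arg` is smooth off the negative real axis; rotating by the inverse phase of `z` first brings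
the point onto the positive axis. -/
theorem contMDiffAt_unitPart {z : ℂ} (hz : z ≠ 0) :
    ContMDiffAt 𝓘(ℝ, ℂ) (𝓡 1) ∞ unitPart z := by
  set a := unitPart z with ha
  have h1 : ContMDiffAt 𝓘(ℝ, ℂ) (𝓡 1) ∞
      (fun y : ℂ => a * Circle.exp (Complex.arg ((a⁻¹ : Circle) * y))) z := by
    refine contMDiffAt_const.mul (contMDiff_circleExp.contMDiffAt.comp z ?_)
    refine ContDiffAt.contMDiffAt ?_
    refine ContDiffAt.comp (f := fun y : ℂ => ((a⁻¹ : Circle) : ℂ) * y) z (contDiffAt_arg ?_)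
      (by fun_prop)
    have h2 := norm_mul_unitPart z
    rw [← ha] at h2
    have h3 : ((a⁻¹ : Circle) : ℂ) * z = (‖z‖ : ℂ) := by
      rw [← h2, mul_left_comm, ← Circle.coe_mul, inv_mul_cancel, norm_mul, Circle.norm_coe]
      simp
    rw [h3]
    exact Complex.ofReal_mem_slitPlane.2 (norm_pos_iff.2 hz)
  refine h1.congr_of_eventuallyEq ?_
  filter_upwards [isOpen_ne.mem_nhds hz] with y hy
  change unitPart y = a * unitPart _
  rw [unitPart_circle_mul _ hy, mul_inv_cancel_left]

theorem contMDiff_circle_coe : ContMDiff (𝓡 1) 𝓘(ℝ, ℂ) ∞ (fun a : Circle => (a : ℂ)) := by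
  have : Fact (Module.finrank ℝ ℂ = 1 + 1) := finrank_real_complex_fact'
  exact contMDiff_coe_sphere (E := ℂ) (n := 1)

end UnitPart

/-! ### Equivariant complex-valued functions -/

namespace BoundaryCircleAction

variable {k : ℕ} {M : Type*} [TopologicalSpace M] [ChartedSpace (EuclideanHalfSpace (k + 2)) M]
  [IsManifold (𝓡∂ (k + 2)) ∞ M] (A : BoundaryCircleAction k M)

/-- Near each orbit there is a smooth equivariant map to `ℂ`. -/
theorem exists_equivariant_complex [T2Space M] [SecondCountableTopology M] (p : A.U) :
    ∃ w : A.U → ℂ, ContMDiff (𝓡∂ (k + 2)) 𝓘(ℝ, ℂ) ∞ w ∧ w p ≠ 0 ∧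
      ∀ (a : Circle) (x : A.U), w (a • x) = a * w x := by
  have := A.continuousSMul
  have : LocallyCompactSpace A.U :=
    Manifold.locallyCompact_of_finiteDimensional (𝓡∂ (k + 2))
  -- The far half of the orbit of `p`; freeness keeps `p` out of it. For `ψ` vanishing on `K` with
  -- `ψ p = 1`, the Fourier coefficient `∫ ψ(e^{iθ} x) e^{-iθ} dθ` is equivariant in `x`, and at `p`
  -- its real part `∫ ψ(e^{iθ} p) cos θ dθ` is positive.
  set K : Set A.U := (fun a : Circle => a • p) '' {a : Circle | (a : ℂ).re ≤ 0} with hK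
  have hKc : IsClosed K := by
    refine IsCompact.isClosed (IsCompact.image (IsClosed.isCompact ?_) (by fun_prop))
    exact isClosed_le (Complex.continuous_re.comp continuous_subtype_val) continuous_const
  have hpK : Disjoint K {p} := by
    rw [disjoint_singleton_right]
    rintro ⟨a, ha, hap⟩
    rw [A.free a p hap] at ha
    simp at ha
    linarith
  obtain ⟨ψ, hψ0, hψ1, hψ⟩ := exists_contMDiffMap_zero_one_of_isClosed (𝓡∂ (k + 2)) (n := ⊤)
    hKc isClosed_singleton hpK
  have hpi : (0 : ℝ) < 2 * Real.pi := by positivity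
  have hF : ContMDiff (𝓘(ℝ, ℝ).prod (𝓡∂ (k + 2))) 𝓘(ℝ, ℂ) ∞
      (fun z : ℝ × A.U => ψ (Circle.exp z.1 • z.2) • (((Circle.exp z.1)⁻¹ : Circle) : ℂ)) := by
    refine ContMDiff.smul (ψ.contMDiff.comp A.contMDiff_exp_smul) ?_
    exact contMDiff_circle_coe.comp ((contMDiff_circleExp.comp contMDiff_fst).inv)
  refine ⟨_, contMDiff_intervalIntegral hF hpi, fun h => ?_, fun a x => ?_⟩
  · have hc : Continuous fun θ : ℝ =>
        ψ (Circle.exp θ • p) • (((Circle.exp θ)⁻¹ : Circle) : ℂ) :=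
      hF.continuous.comp (f := fun θ : ℝ => (θ, p)) (by fun_prop)
    have h1 : (∫ θ in (0 : ℝ)..2 * Real.pi,
        Complex.reCLM (ψ (Circle.exp θ • p) • (((Circle.exp θ)⁻¹ : Circle) : ℂ))) = 0 := by
      rw [Complex.reCLM.intervalIntegral_comp_comm (hc.intervalIntegrable _ _), h, map_zero]
    refine h1.not_gt (intervalIntegral.integral_pos hpi
      ((Complex.reCLM.continuous.comp hc).continuousOn) (fun θ _ => ?_) ⟨0, ⟨le_rfl, hpi.le⟩, ?_⟩)
    · have h2 : Complex.reCLM (ψ (Circle.exp θ • p) • (((Circle.exp θ)⁻¹ : Circle) : ℂ)) =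
          ψ (Circle.exp θ • p) * (Circle.exp θ : ℂ).re := by
        rw [Circle.coe_inv_eq_conj]
        simp
      rw [h2]
      by_cases h3 : (Circle.exp θ : ℂ).re ≤ 0
      · rw [hψ0 ⟨_, h3, rfl⟩]; simp
      · exact mul_nonneg (hψ _).1 (not_le.1 h3).le
    · rw [Circle.exp_zero, one_smul, hψ1 rfl]
      simp
  · have h1 := integral_circle_shift (fun b => ψ (b • x) • ((a * b⁻¹ : Circle) : ℂ)) a
    have h2 : ∀ b : Circle, ψ (b • x) • ((a * b⁻¹ : Circle) : ℂ) =
        (a : ℂ) * (ψ (b • x) • ((b⁻¹ : Circle) : ℂ)) := fun b => by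
      simp only [Circle.coe_mul, Complex.real_smul]; ring
    simp only [h2, mul_smul] at h1
    rw [intervalIntegral.integral_const_mul (a : ℂ)] at h1
    have h3 : ∀ b : Circle, a * (b * a)⁻¹ = b⁻¹ := fun b => by
      rw [mul_inv_rev, mul_inv_cancel_left]
    simp only [h3] at h1
    exact h1

end BoundaryCircleAction

noncomputable section

/-! ### Slices for the circle action -/

section SliceCalculus

variable {E : Type*} [NormedAddCommGroup E] [NormedSpace ℝ E] [FiniteDimensional ℝ E]

/-- The quotient by the plane spanned by `u` and `v`, identified with `ℝᵏ`. It will supply the `k`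
coordinates transverse to the boundary normal and to the orbit. -/
theorem exists_clm_ker_le_span_pair {k : ℕ} (hE : Module.finrank ℝ E = k + 2) {u v : E}
    (huv : LinearIndependent ℝ ![u, v]) :
    ∃ L : E →L[ℝ] EuclideanSpace ℝ (Fin k), ∀ x, L x = 0 → ∃ a b : ℝ, x = a • u + b • v := by
  set S : Submodule ℝ E := Submodule.span ℝ (range ![u, v]) with hS
  have h1 : Module.finrank ℝ S = 2 := by
    rw [finrank_span_eq_card huv]; simp
  have h2 : Module.finrank ℝ (E ⧸ S) = Module.finrank ℝ (EuclideanSpace ℝ (Fin k)) := by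
    have := S.finrank_quotient_add_finrank
    rw [finrank_euclideanSpace_fin]
    omega
  let T : (E ⧸ S) ≃ₗ[ℝ] EuclideanSpace ℝ (Fin k) := LinearEquiv.ofFinrankEq _ _ h2
  refine ⟨LinearMap.toContinuousLinearMap (T.toLinearMap ∘ₗ S.mkQ), fun x hx => ?_⟩
  have h3 : S.mkQ x = 0 := T.map_eq_zero_iff.1 hx
  rw [Submodule.mkQ_apply, Submodule.Quotient.mk_eq_zero, hS] at h3
  simp only [Matrix.range_cons, Matrix.range_empty, union_empty, singleton_union] at h3
  obtain ⟨a, b, h⟩ := Submodule.mem_span_pair.1 h3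
  exact ⟨a, b, h.symm⟩

/-- The derivative of slice coordinates: `Ψ` is a flow with generator transverse to the level sets
of `α` and tangent to those of `ν`. -/
theorem exists_hasFDerivWithinAt_slice {k : ℕ} (hE : Module.finrank ℝ E = k + 2) {R : Set E}
    {y₀ e : E} (hR : UniqueDiffWithinAt ℝ R y₀) (hy₀ : y₀ ∈ R) {Ψ : ℝ × E → E} {DΨ : ℝ × E →L[ℝ] E}
    (hΨ : HasFDerivWithinAt Ψ DΨ (univ ×ˢ R) (0, y₀))
    (hΨR : ∀ θ, ∀ y ∈ R, Ψ (θ, y) ∈ R)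
    (hΨ0 : ∀ᶠ y in 𝓝[R] y₀, Ψ (0, y) = y) {α : E → ℝ} {dα : E →L[ℝ] ℝ}
    (hα : HasFDerivWithinAt α dα R y₀) (hα0 : α y₀ = 0)
    (hαΨ : ∀ᶠ θ in 𝓝 (0 : ℝ), α (Ψ (θ, y₀)) = θ) {ν : E →L[ℝ] ℝ} (hν : ν e = 1)
    (hνΨ : ∀ᶠ θ in 𝓝 (0 : ℝ), ν (Ψ (θ, y₀)) = ν y₀) {f : E → ℝ} {c : ℝ} (hc : c ≠ 0)
    (hf : HasFDerivWithinAt f (c • ν) R y₀) :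
    ∃ (L : E →L[ℝ] EuclideanSpace ℝ (Fin k)) (D : E ≃L[ℝ] EuclideanSpace ℝ (Fin k) × ℝ × ℝ),
      HasFDerivWithinAt (fun y => (L (Ψ (-α y, y)), f y, α y))
        (D : E →L[ℝ] EuclideanSpace ℝ (Fin k) × ℝ × ℝ) R y₀ := by
  have hΨy : Ψ (0, y₀) = y₀ := hΨ0.self_of_nhdsWithin hy₀
  -- The generator of the flow at `y₀`. Differentiating along the flow gives `dα X = 1` and `ν X =
  -- 0`, so `X` is independent of `e`.
  set X : E := DΨ (1, 0) with hX
  have hflow : HasDerivAt (fun θ => Ψ (θ, y₀)) X 0 := by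
    have h1 : HasDerivWithinAt (fun θ : ℝ => (θ, y₀)) ((1 : ℝ), (0 : E)) univ 0 :=
      ((hasDerivAt_id (0 : ℝ)).prodMk (hasDerivAt_const _ _)).hasDerivWithinAt
    have hm : MapsTo (fun θ : ℝ => (θ, y₀)) univ (univ ×ˢ R) := fun θ _ => ⟨mem_univ _, hy₀⟩
    exact (hΨ.comp_hasDerivWithinAt (0 : ℝ) h1 hm).hasDerivAt Filter.univ_mem
  have hD0 : ∀ v, DΨ (0, v) = v := by
    intro v
    have h1 : HasFDerivWithinAt (fun y => Ψ ((0 : ℝ), y)) (DΨ.comp (ContinuousLinearMap.inr ℝ ℝ E))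
        R y₀ :=
      hΨ.comp (f := fun y => ((0 : ℝ), y)) y₀ (hasFDerivAt_prodMk_right _ _).hasFDerivWithinAt
        fun y hy => ⟨mem_univ _, hy⟩
    have h2 : HasFDerivWithinAt (fun y => Ψ ((0 : ℝ), y)) (ContinuousLinearMap.id ℝ E) R y₀ :=
      (hasFDerivWithinAt_id y₀ R).congr_of_eventuallyEq hΨ0 hΨy
    exact DFunLike.congr_fun (hR.eq h1 h2) v
  have hαX : dα X = 1 := by
    have hα' : HasFDerivWithinAt α dα R (Ψ (0, y₀)) := by rwa [hΨy]
    have h1 := hα'.comp_hasDerivWithinAt (0 : ℝ) hflow.hasDerivWithinAt (s := univ)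
      fun θ _ => hΨR θ y₀ hy₀
    have h2 := h1.hasDerivAt Filter.univ_mem
    exact (h2.congr_of_eventuallyEq (hαΨ.mono fun θ h => h.symm)).unique (hasDerivAt_id _)
  have hνX : ν X = 0 := by
    have h1 := ν.hasFDerivAt.comp_hasDerivAt (0 : ℝ) hflow
    exact (h1.congr_of_eventuallyEq (hνΨ.mono fun θ h => h.symm)).unique
      (hasDerivAt_const _ (ν y₀))
  have hli : LinearIndependent ℝ ![e, X] := by
    rw [LinearIndependent.pair_iff]
    intro a b h
    have h1 := congrArg ν h
    have h2 := congrArg dα h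
    simp only [map_add, map_smul, hν, hνX, hαX, smul_eq_mul, mul_one, mul_zero, add_zero,
      map_zero] at h1 h2
    simp only [h1, zero_mul, zero_add] at h2
    exact ⟨h1, h2⟩
  -- `L` loses at most the directions `e` and `X`, which `c • ν` and `dα` detect; so the combined
  -- derivative is injective, and bijective by dimension.
  obtain ⟨L, hL⟩ := exists_clm_ker_le_span_pair hE hli
  have hρ : HasFDerivWithinAt (fun y => Ψ (-α y, y))
      (DΨ.comp ((-dα).prod (ContinuousLinearMap.id ℝ E))) R y₀ := by
    have h0 : HasFDerivWithinAt Ψ DΨ (univ ×ˢ R) (-α y₀, y₀) := by rwa [hα0, neg_zero]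
    exact h0.comp (f := fun y => (-α y, y)) y₀ (hα.neg.prodMk (hasFDerivWithinAt_id _ _))
      fun y hy => ⟨mem_univ _, hy⟩
  set D₀ : E →L[ℝ] EuclideanSpace ℝ (Fin k) × ℝ × ℝ :=
    (L.comp (DΨ.comp ((-dα).prod (ContinuousLinearMap.id ℝ E)))).prod ((c • ν).prod dα) with hD₀
  have hder : HasFDerivWithinAt (fun y => (L (Ψ (-α y, y)), f y, α y)) D₀ R y₀ :=
    (L.hasFDerivAt.comp_hasFDerivWithinAt y₀ hρ).prodMk (hf.prodMk hα)
  have hinj : Function.Injective D₀ := by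
    rw [injective_iff_map_eq_zero]
    intro v hv
    simp only [hD₀, ContinuousLinearMap.prod_apply, Prod.mk_eq_zero, ContinuousLinearMap.comp_apply,
      ContinuousLinearMap.id_apply, smul_apply, neg_apply, smul_eq_mul, mul_eq_zero, hc,
      false_or] at hv
    obtain ⟨h1, h2, h3⟩ := hv
    rw [h3, neg_zero, hD0] at h1
    obtain ⟨a, b, rfl⟩ := hL v h1
    simp only [map_add, map_smul, hν, hνX, hαX, smul_eq_mul, mul_one, mul_zero, add_zero] at h2 h3
    simp only [h2, zero_mul, zero_add] at h3
    simp [h2, h3]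
  have hfr : Module.finrank ℝ E = Module.finrank ℝ (EuclideanSpace ℝ (Fin k) × ℝ × ℝ) := by
    simp [hE]
  let D₁ : E ≃ₗ[ℝ] EuclideanSpace ℝ (Fin k) × ℝ × ℝ :=
    LinearMap.linearEquivOfInjective D₀.toLinearMap hinj hfr
  exact ⟨L, D₁.toContinuousLinearEquiv, hder⟩

end SliceCalculus

namespace BoundaryCircleAction

variable {k : ℕ} {M : Type*} [TopologicalSpace M] [ChartedSpace (EuclideanHalfSpace (k + 2)) M]
  [IsManifold (𝓡∂ (k + 2)) ∞ M] (A : BoundaryCircleAction k M)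

/-- A slice for the action near a boundary point, adapted to an invariant boundary defining
function `f`: invariant functions `s`, an equivariant map `w` to the circle, and a section `τ`. -/
structure Slice (f : A.U → ℝ) where
  W : Set A.U
  isOpen : IsOpen W
  smul_mem : ∀ (a : Circle), ∀ x ∈ W, a • x ∈ W
  s : A.U → EuclideanSpace ℝ (Fin k)
  smooth_s : ContMDiffOn (𝓡∂ (k + 2)) 𝓘(ℝ, EuclideanSpace ℝ (Fin k)) ∞ s W
  s_smul : ∀ (a : Circle), ∀ x ∈ W, s (a • x) = s x
  w : A.U → Circle
  smooth_w : ContMDiffOn (𝓡∂ (k + 2)) (𝓡 1) ∞ w W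
  w_smul : ∀ (a : Circle), ∀ x ∈ W, w (a • x) = a * w x
  B : Set (EuclideanSpace ℝ (Fin k))
  isOpen_B : IsOpen B
  convex_B : Convex ℝ B
  δ : ℝ
  δ_pos : 0 < δ
  τ : EuclideanSpace ℝ (Fin k) × ℝ → A.U
  smooth_τ : ContMDiffOn 𝓘(ℝ, EuclideanSpace ℝ (Fin k) × ℝ) (𝓡∂ (k + 2)) ∞ τ (B ×ˢ Ico 0 δ)
  τ_mem : ∀ y ∈ B ×ˢ Ico 0 δ, τ y ∈ W
  s_τ : ∀ y ∈ B ×ˢ Ico 0 δ, s (τ y) = y.1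
  w_τ : ∀ y ∈ B ×ˢ Ico 0 δ, w (τ y) = 1
  f_τ : ∀ y ∈ B ×ˢ Ico 0 δ, f (τ y) = y.2
  mem_B : ∀ x ∈ W, s x ∈ B
  lt_δ : ∀ x ∈ W, f x < δ
  eq_smul : ∀ x ∈ W, w x • τ (s x, f x) = x

/-- The phase `w` of an equivariant complex function yields the retraction `ρ x = w(x)⁻¹ • x` onto
`w = 1`. The coordinates `(L ∘ φ ∘ ρ, f, arg w)` have invertible derivative at `p`, and `f` plays
the role of the boundary coordinate, so the half-space inverse function theorem applies. The section
`τ` is the inverse with third coordinate `0`, and the decomposition of a point is `x = w(x) • ρ(x)`.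
-/
theorem exists_slice [T2Space M] [SecondCountableTopology M] {f : A.U → ℝ}
    (hf : IsBoundaryDefining (k := k) f) (hinv : ∀ (a : Circle) (x : A.U), f (a • x) = f x)
    {V : Set A.U} (hV : A.IsInvariantNhd V) (p : A.U) (hp : p ∈ (𝓡∂ (k + 2)).boundary A.U) :
    ∃ S : A.Slice f, p ∈ S.W ∧ S.W ⊆ V := by
  have := A.continuousSMul
  obtain ⟨w₀, hw₀, hw₀p, hw₀a⟩ := A.exists_equivariant_complex p
  -- Dividing by the phase at `p` arranges `w p = 1`, where `arg` is smooth and vanishes.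
  set w : A.U → Circle := fun x => unitPart (w₀ x) * (unitPart (w₀ p))⁻¹ with hw
  have hwp : w p = 1 := mul_inv_cancel _
  have hOw : IsOpen {x | w₀ x ≠ 0} := isOpen_ne_fun hw₀.continuous continuous_const
  have hws : ContMDiffOn (𝓡∂ (k + 2)) (𝓡 1) ∞ w {x | w₀ x ≠ 0} := fun x hx =>
    (((contMDiffAt_unitPart hx).comp x hw₀.contMDiffAt).mul contMDiffAt_const).contMDiffWithinAt
  have hwa : ∀ (a : Circle) (x : A.U), w₀ x ≠ 0 → w (a • x) = a * w x := fun a x hx => by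
    simp only [hw, hw₀a, unitPart_circle_mul a hx, mul_assoc]
  have hne : ∀ (a : Circle) (x : A.U), w₀ x ≠ 0 → w₀ (a • x) ≠ 0 := fun a x hx => by
    rw [hw₀a]; exact mul_ne_zero (Circle.coe_ne_zero a) hx
  set ρ : A.U → A.U := fun x => (w x)⁻¹ • x with hρ
  have hρs : ContMDiffOn (𝓡∂ (k + 2)) (𝓡∂ (k + 2)) ∞ ρ {x | w₀ x ≠ 0} :=
    A.contMDiff_smul'.comp_contMDiffOn (hws.inv.prodMk contMDiffOn_id)
  have hρp : ρ p = p := by simp [hρ, hwp]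
  have hρa : ∀ (a : Circle) (x : A.U), w₀ x ≠ 0 → ρ (a • x) = ρ x := fun a x hx => by
    simp only [hρ, hwa a x hx, smul_smul]
    rw [mul_inv_rev, mul_assoc, inv_mul_cancel, mul_one]
  set α : A.U → ℝ := fun x => Complex.arg (w x) with hα
  have hwα : ∀ x, Circle.exp (α x) = w x := fun x => Circle.exp_arg _
  set φ := extChartAt (𝓡∂ (k + 2)) p with hφ
  set R := range (𝓡∂ (k + 2)) with hRdef
  have hcw : ContinuousOn (fun x => (w x : ℂ)) {x | w₀ x ≠ 0} :=
    contMDiff_circle_coe.continuous.comp_continuousOn hws.continuousOn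
  -- the set on which everything is defined
  set G : Set A.U := ({x | w₀ x ≠ 0} ∩ (fun x => (w x : ℂ)) ⁻¹' Complex.slitPlane) ∩
    ({x | w₀ x ≠ 0} ∩ ρ ⁻¹' φ.source) ∩ (φ.source ∩ V) with hG
  have hGo : IsOpen G := ((hcw.isOpen_inter_preimage hOw Complex.isOpen_slitPlane).inter
    (hρs.continuousOn.isOpen_inter_preimage hOw (isOpen_extChartAt_source p))).inter
    ((isOpen_extChartAt_source p).inter hV.isOpen)
  have hpG : p ∈ G := by
    refine ⟨⟨⟨hw₀p, ?_⟩, hw₀p, ?_⟩, mem_extChartAt_source p,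
      hV.boundary_subset p (A.mem_boundary_coe.1 hp)⟩
    · simp [hwp]
    · rw [mem_preimage, hρp]; exact mem_extChartAt_source p
  have hαs : ContMDiffOn (𝓡∂ (k + 2)) 𝓘(ℝ, ℝ) ∞ α G := by
    intro x hx
    have h1 : ContMDiffAt (𝓡∂ (k + 2)) (𝓡 1) ∞ w x := (hws x hx.1.1.1).contMDiffAt
      (hOw.mem_nhds hx.1.1.1)
    exact ((contDiffAt_arg hx.1.1.2).contMDiffAt.comp x
      (contMDiff_circle_coe.contMDiffAt.comp x h1)).contMDiffWithinAt
  have hφρ : ContMDiffOn (𝓡∂ (k + 2)) 𝓘(ℝ, EuclideanSpace ℝ (Fin (k + 2))) ∞ (φ ∘ ρ)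
      ({x | w₀ x ≠ 0} ∩ ρ ⁻¹' φ.source) :=
    (contMDiffOn_extChartAt (n := ∞)).comp (hρs.mono inter_subset_left)
      fun x hx => by simpa [hφ] using hx.2
  -- the chart domain
  obtain ⟨O, hO, hpO, hOG⟩ : ∃ O : Set (EuclideanSpace ℝ (Fin (k + 2))), IsOpen O ∧ φ p ∈ O ∧
      ∀ y ∈ O ∩ R, y ∈ φ.target ∧ φ.symm y ∈ G := by
    have h1 : φ.symm ⁻¹' G ∈ 𝓝[R] (φ p) :=
      (continuousAt_extChartAt_symm p).continuousWithinAt.preimage_mem_nhdsWithin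
        (by rw [extChartAt_to_inv]; exact hGo.mem_nhds hpG)
    obtain ⟨O, hO, hpO, hOs⟩ := mem_nhdsWithin.1
      (Filter.inter_mem (extChartAt_target_mem_nhdsWithin (I := 𝓡∂ (k + 2)) p) h1)
    exact ⟨O, hO, hpO, fun y hy => hOs hy⟩
  -- the derivative of the slice coordinates
  have hφp : φ.symm (φ p) = p := extChartAt_to_inv p
  have hφp0 : φ p 0 = 0 := (mem_boundary_iff_extChartAt (mem_extChartAt_source p)).1 hp
  set Ψ : ℝ × EuclideanSpace ℝ (Fin (k + 2)) → EuclideanSpace ℝ (Fin (k + 2)) :=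
    fun z => φ (Circle.exp z.1 • φ.symm z.2) with hΨ
  have hΨd : DifferentiableWithinAt ℝ Ψ (univ ×ˢ R) (0, φ p) := by
    have h1 : ContMDiffWithinAt 𝓘(ℝ, ℝ × EuclideanSpace ℝ (Fin (k + 2)))
        (𝓘(ℝ, ℝ).prod (𝓡∂ (k + 2))) ∞
        (fun z : ℝ × EuclideanSpace ℝ (Fin (k + 2)) => (z.1, φ.symm z.2)) (univ ×ˢ R) (0, φ p) := by
      refine ContMDiffWithinAt.prodMk (contDiff_fst.contMDiff _).contMDiffWithinAt ?_
      exact (contMDiffWithinAt_extChartAt_symm_range_self p).comp (0, φ p)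
        (contDiff_snd.contMDiff _).contMDiffWithinAt fun z hz => hz.2
    have h2 := A.contMDiff_exp_smul.contMDiffAt.comp_contMDiffWithinAt _ h1
    have h3 : ContMDiffAt (𝓡∂ (k + 2)) 𝓘(ℝ, EuclideanSpace ℝ (Fin (k + 2))) ∞ φ
        (Circle.exp (0 : ℝ) • φ.symm (φ p)) := by
      rw [hφp, Circle.exp_zero, one_smul]; exact contMDiffAt_extChartAt
    have h4 := h3.comp_contMDiffWithinAt (0, φ p) h2
    exact h4.contDiffWithinAt.differentiableWithinAt (by simp)
  have hfl : ∀ᶠ θ in 𝓝 (0 : ℝ), Circle.exp θ • p ∈ φ.source := by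
    have hc : Continuous fun θ : ℝ => Circle.exp θ • p := by fun_prop
    refine hc.continuousAt.eventually_mem ((isOpen_extChartAt_source p).mem_nhds ?_)
    rw [Circle.exp_zero, one_smul]; exact mem_extChartAt_source p
  obtain ⟨c, hc, hfc⟩ := hf.exists_hasFDerivWithinAt hp
  have hαd := hasFDerivWithinAt_mfderiv
    ((hαs.contMDiffAt (hGo.mem_nhds hpG)).mdifferentiableAt (by simp))
  obtain ⟨L, D, hLD⟩ := exists_hasFDerivWithinAt_slice (k := k) (by simp) (R := R) (y₀ := φ p)
    (Ψ := Ψ) (α := fun y => α (φ.symm y))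
    ((𝓡∂ (k + 2)).uniqueDiffOn _ (mem_range_self _)) (mem_range_self _) (e := inwardNormal k)
    hΨd.hasFDerivWithinAt (fun θ y _ => mem_range_self _) (by
      filter_upwards [extChartAt_target_mem_nhdsWithin (I := 𝓡∂ (k + 2)) p] with y hy
      simp only [hΨ, Circle.exp_zero, one_smul]
      exact φ.right_inv hy) hαd (by rw [hφp]; simp [hα, hwp]) (by
      filter_upwards [hfl, Ioo_mem_nhds (neg_lt_zero.2 Real.pi_pos) Real.pi_pos] with θ h1 h2
      simp only [hΨ]
      rw [hφp, φ.left_inv h1, hα]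
      simp only
      rw [hwa _ _ hw₀p, hwp, mul_one, Circle.arg_exp h2.1 h2.2.le]) (ν := normalCoord k)
    (by simp [normalCoord_apply, inwardNormal]) (by
      filter_upwards [hfl] with θ h1
      simp only [hΨ, normalCoord_apply]
      rw [hφp, hφp0, ← mem_boundary_iff_extChartAt h1, A.mem_boundary_coe,
        A.smul_mem_boundary_iff, ← A.mem_boundary_coe]
      exact hp) hc.ne' hfc
  -- the inverse
  set F : EuclideanSpace ℝ (Fin (k + 2)) → EuclideanSpace ℝ (Fin k) × ℝ × ℝ := fun y =>
    (L (φ (ρ (φ.symm y))), f (φ.symm y), α (φ.symm y)) with hF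
  have hFD : HasFDerivWithinAt F (D : EuclideanSpace ℝ (Fin (k + 2)) →L[ℝ] _) R (φ p) := by
    -- Since `exp (i α) = w`, flowing for time `-α` is the retraction `ρ` read in the chart; this
    -- matches the shape treated in `exists_hasFDerivWithinAt_slice`.
    have : F = fun y => (L (Ψ (-α (φ.symm y), y)), f (φ.symm y), α (φ.symm y)) := by
      ext1 y
      simp only [hF, hΨ, hρ, Circle.exp_neg, hwα]
    rw [this]
    exact hLD
  have hRl : R = {y | 0 ≤ normalCoord k y} := by
    ext y; exact mem_range_halfSpace
  have hFs : ContDiffOn ℝ ∞ F (O ∩ {y | 0 ≤ normalCoord k y}) := by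
    rw [← hRl, ← contMDiffOn_iff_contDiffOn]
    have hsym : ContMDiffOn 𝓘(ℝ, EuclideanSpace ℝ (Fin (k + 2))) (𝓡∂ (k + 2)) ∞ φ.symm (O ∩ R) :=
      (contMDiffOn_extChartAt_symm p).mono fun y hy => (hOG y hy).1
    refine ContMDiffOn.prodMk_space ?_ (ContMDiffOn.prodMk_space ?_ ?_)
    · exact L.contMDiff.comp_contMDiffOn (hφρ.comp hsym fun y hy => (hOG y hy).2.1.2)
    · exact hf.smooth.comp_contMDiffOn hsym
    · exact hαs.comp hsym fun y hy => (hOG y hy).2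
  set m : EuclideanSpace ℝ (Fin k) × ℝ × ℝ →L[ℝ] ℝ := (ContinuousLinearMap.fst ℝ ℝ ℝ).comp
    (ContinuousLinearMap.snd ℝ (EuclideanSpace ℝ (Fin k)) (ℝ × ℝ)) with hm
  obtain ⟨O', hO'O, hO', hpO', T, hT, g, hg, hgT, hgO'⟩ := exists_contDiffOn_leftInverse_halfSpace
    (normalCoord k) (e := inwardNormal k) (by simp [normalCoord_apply, inwardNormal]) m hO hpO
    hφp0 hFs D (hFD.mono (by rw [hRl]; exact inter_subset_right)) (fun y _ _ => hf.nonneg _)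
    (fun y hy hy0 => by
      have hyR : y ∈ R := by rw [hRl]; exact hy0
      exact (hf.zero_iff _).trans (extChartAt_symm_mem_boundary_iff (hOG y ⟨hy, hyR⟩).1))
  have hFp : F (φ p) ∈ T := (hgO' _ hpO' hφp0.ge).1
  have hFp' : F (φ p) = (L (φ p), 0, 0) := by
    simp [hF, hφp, hρp, hα, hwp, (hf.zero_iff p).2 hp]
  rw [hFp'] at hFp
  obtain ⟨r, hr, hrT⟩ := Metric.isOpen_iff.1 hT _ hFp
  set B := Metric.ball (L (φ p)) r with hB
  have hBT : ∀ y ∈ B ×ˢ Ico 0 r, (y.1, y.2, (0 : ℝ)) ∈ T := by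
    rintro ⟨a, t⟩ ⟨h1, h2⟩
    apply hrT
    rw [← ball_prod_same, ← ball_prod_same]
    refine ⟨h1, ?_, Metric.mem_ball_self hr⟩
    rw [Metric.mem_ball, dist_zero_right, Real.norm_of_nonneg h2.1]
    exact h2.2
  set s : A.U → EuclideanSpace ℝ (Fin k) := fun x => L (φ (ρ x)) with hs
  set τ : EuclideanSpace ℝ (Fin k) × ℝ → A.U := fun y => φ.symm (g (y.1, y.2, 0)) with hτ
  have key : ∀ y ∈ B ×ˢ Ico 0 r, g (y.1, y.2, 0) ∈ O' ∧ g (y.1, y.2, 0) ∈ R ∧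
      φ (τ y) = g (y.1, y.2, 0) ∧ τ y ∈ G ∧ s (τ y) = y.1 ∧ f (τ y) = y.2 ∧ w (τ y) = 1 ∧
      ρ (τ y) = τ y := by
    intro y hy
    obtain ⟨h1, h2, h3⟩ := hgT _ (hBT y hy) hy.2.1
    have h2' : g (y.1, y.2, 0) ∈ R := by rw [hRl]; exact h2
    obtain ⟨h4, h5⟩ := hOG _ ⟨hO'O h1, h2'⟩
    simp only [hF, Prod.mk.injEq] at h3
    obtain ⟨h6, h7, h8⟩ := h3
    have h9 : w (τ y) = 1 := Circle.arg_eq_zero.1 h8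
    exact ⟨h1, h2', φ.right_inv h4, h5, h6, h7, h9, by simp only [hρ, h9, inv_one, one_smul]⟩
  have hW0 : IsOpen ({x | w₀ x ≠ 0} ∩ ρ ⁻¹' φ.source) :=
    hρs.continuousOn.isOpen_inter_preimage hOw (isOpen_extChartAt_source p)
  -- Every condition is invariant: those on chart and inverse domains are imposed on `ρ x` only,
  -- never on the phase of `x`. So `W` consists of whole orbits although the chart `φ` need not
  -- contain them.
  set W : Set A.U := V ∩ (({x | w₀ x ≠ 0} ∩ ρ ⁻¹' φ.source) ∩ (φ ∘ ρ) ⁻¹' (O' ∩ L ⁻¹' B)) ∩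
    f ⁻¹' Iio r with hW
  have hWsub : W ⊆ {x | w₀ x ≠ 0} ∩ ρ ⁻¹' φ.source := fun x hx => hx.1.2.1
  refine ⟨⟨W, ?_, ?_, s, ?_, ?_, w, hws.mono fun x hx => hx.1.2.1.1, fun a x hx => hwa a x
    hx.1.2.1.1, B, Metric.isOpen_ball, convex_ball _ _, r, hr, τ, ?_, ?_, fun y hy =>
    (key y hy).2.2.2.2.1, fun y hy => (key y hy).2.2.2.2.2.2.1, fun y hy =>
    (key y hy).2.2.2.2.2.1, fun x hx => hx.1.2.2.2, fun x hx => hx.2, ?_⟩, ?_, fun x hx => hx.1.1⟩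
  · exact (hV.isOpen.inter (hφρ.continuousOn.isOpen_inter_preimage hW0
      (hO'.inter (Metric.isOpen_ball.preimage L.continuous)))).inter
      (isOpen_Iio.preimage hf.smooth.continuous)
  · rintro a x ⟨⟨hxV, ⟨h1, h2⟩, h3⟩, h4⟩
    refine ⟨⟨hV.smul_mem a x hxV, ⟨hne a x h1, ?_⟩, ?_⟩, ?_⟩
    · rw [mem_preimage, hρa a x h1]; exact h2
    · rw [mem_preimage, Function.comp_apply, hρa a x h1]; exact h3
    · rw [mem_preimage, hinv]; exact h4
  · exact L.contMDiff.comp_contMDiffOn (hφρ.mono hWsub)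
  · intro a x hx
    simp only [hs, hρa a x hx.1.2.1.1]
  · refine (contMDiffOn_extChartAt_symm p).comp (t := φ.target) ?_ fun y hy => ?_
    · rw [contMDiffOn_iff_contDiffOn]
      refine hg.comp (f := fun y : EuclideanSpace ℝ (Fin k) × ℝ => (y.1, y.2, (0 : ℝ)))
        (by fun_prop) fun y hy => ⟨hBT y hy, hy.2.1⟩
    · obtain ⟨h1, h2, -⟩ := key y hy
      exact (hOG _ ⟨hO'O h1, h2⟩).1
  · intro y hy
    obtain ⟨h1, h2, h3, h4, h5, h6, h7, h8⟩ := key y hy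
    refine ⟨⟨h4.2.2, ⟨h4.1.1.1, ?_⟩, ?_⟩, ?_⟩
    · rw [mem_preimage, h8]; exact h4.2.1
    · rw [mem_preimage, Function.comp_apply, h8, h3]
      refine ⟨h1, ?_⟩
      have : s (τ y) = L (φ (τ y)) := by simp only [hs, h8]
      rw [mem_preimage, ← h3, ← this, h5]
      exact hy.1
    · rw [mem_preimage, h6]; exact hy.2.2
  · rintro x ⟨⟨hxV, ⟨h1, h2⟩, h3⟩, h4⟩
    have h5 : w (ρ x) = 1 := by simp only [hρ, hwa _ x h1, inv_mul_cancel]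
    have h6 : ρ (ρ x) = ρ x := by
      change (w (ρ x))⁻¹ • ρ x = ρ x
      rw [h5, inv_one, one_smul]
    have h7 : φ.symm (φ (ρ x)) = ρ x := φ.left_inv h2
    have h8 : F (φ (ρ x)) = (s x, f x, 0) := by
      simp only [hF, h7, h6, hα, h5, hs]
      simp only [hρ, hinv]
      simp
    have h9 : 0 ≤ normalCoord k (φ (ρ x)) := mem_range_halfSpace.1 (mem_range_self _)
    have h10 : g (F (φ (ρ x))) = φ (ρ x) := (hgO' _ h3.1 h9).2
    rw [h8] at h10
    simp only [hτ]
    rw [h10, h7, hρ]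
    simp
  · refine ⟨⟨hV.boundary_subset p (A.mem_boundary_coe.1 hp), ⟨hw₀p, ?_⟩, ?_⟩, ?_⟩
    · rw [mem_preimage, hρp]; exact mem_extChartAt_source p
    · rw [mem_preimage, Function.comp_apply, hρp]
      exact ⟨hpO', Metric.mem_ball_self hr⟩
    · rw [mem_preimage, (hf.zero_iff p).2 hp]; exact hr

end BoundaryCircleAction

end

/-! ### Charts on quotients; topology of the cut and reduced spaces -/

noncomputable section

/-- A chart on a quotient space, given by a function `F` on the total space which is constant on
fibres and a local inverse `G`. -/
def quotientChart {X Q T : Type*} [TopologicalSpace X] [TopologicalSpace Q] [TopologicalSpace T]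
    {c : X → Q} (hc : IsQuotientMap c) {W : Set X} (hW : IsOpen W) (hsat : c ⁻¹' (c '' W) = W)
    {F : X → T} (hF : ContinuousOn F W) {Y : Set T} (hY : IsOpen Y) {G : T → Q}
    (hG : ContinuousOn G Y) (hFY : ∀ x ∈ W, F x ∈ Y) (hGF : ∀ x ∈ W, G (F x) = c x)
    (hFG : ∀ y ∈ Y, ∃ x ∈ W, c x = G y ∧ F x = y)
    (hfib : ∀ x ∈ W, ∀ x' ∈ W, c x = c x' → F x = F x') : OpenPartialHomeomorph Q T where
  toFun q := F (Function.surjInv hc.surjective q)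
  invFun := G
  source := c '' W
  target := Y
  map_source' := by
    rintro _ ⟨x, hx, rfl⟩
    have h1 : Function.surjInv hc.surjective (c x) ∈ W := by
      rw [← hsat, mem_preimage, Function.surjInv_eq hc.surjective]; exact ⟨x, hx, rfl⟩
    exact hFY _ h1
  map_target' y hy := by
    obtain ⟨x, hx, h, -⟩ := hFG y hy
    exact ⟨x, hx, h⟩
  left_inv' := by
    rintro _ ⟨x, hx, rfl⟩
    have h1 : Function.surjInv hc.surjective (c x) ∈ W := by
      rw [← hsat, mem_preimage, Function.surjInv_eq hc.surjective]; exact ⟨x, hx, rfl⟩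
    rw [hGF _ h1, Function.surjInv_eq hc.surjective]
  right_inv' y hy := by
    obtain ⟨x, hx, h, h'⟩ := hFG y hy
    have h1 : Function.surjInv hc.surjective (c x) ∈ W := by
      rw [← hsat, mem_preimage, Function.surjInv_eq hc.surjective]; exact ⟨x, hx, rfl⟩
    rw [← h, ← h', hfib _ h1 x hx (Function.surjInv_eq _ _)]
  open_source := by
    rw [← hc.isOpen_preimage, hsat]; exact hW
  open_target := hY
  continuousOn_toFun := by
    have ho : IsOpen (c '' W) := by
      rw [← hc.isOpen_preimage, hsat]; exact hW
    rw [hc.continuousOn_isOpen_iff ho, hsat]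
    refine hF.congr fun x hx => ?_
    have h1 : Function.surjInv hc.surjective (c x) ∈ W := by
      rw [← hsat, mem_preimage, Function.surjInv_eq hc.surjective]; exact ⟨x, hx, rfl⟩
    exact hfib _ h1 x hx (Function.surjInv_eq _ _)
  continuousOn_invFun := hG

theorem quotientChart_apply {X Q T : Type*} [TopologicalSpace X] [TopologicalSpace Q]
    [TopologicalSpace T]
    {c : X → Q} (hc : IsQuotientMap c) {W : Set X} (hW : IsOpen W) (hsat : c ⁻¹' (c '' W) = W)
    {F : X → T} (hF : ContinuousOn F W) {Y : Set T} (hY : IsOpen Y) {G : T → Q}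
    (hG : ContinuousOn G Y) (hFY : ∀ x ∈ W, F x ∈ Y) (hGF : ∀ x ∈ W, G (F x) = c x)
    (hFG : ∀ y ∈ Y, ∃ x ∈ W, c x = G y ∧ F x = y)
    (hfib : ∀ x ∈ W, ∀ x' ∈ W, c x = c x' → F x = F x') {x : X} (hx : x ∈ W) :
    quotientChart hc hW hsat hF hY hG hFY hGF hFG hfib (c x) = F x := by
  have h1 : Function.surjInv hc.surjective (c x) ∈ W := by
    rw [← hsat, mem_preimage, Function.surjInv_eq hc.surjective]; exact ⟨x, hx, rfl⟩
  exact hfib _ h1 x hx (Function.surjInv_eq _ _)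

/-- A closed quotient map with compact fibres from a Hausdorff space has Hausdorff image. -/
theorem t2Space_of_isClosedMap_of_isCompact_fibre {X Q : Type*} [TopologicalSpace X]
    [TopologicalSpace Q] [T2Space X] {c : X → Q}
    (hclosed : IsClosedMap c) (hsurj : Function.Surjective c)
    (hfib : ∀ q, IsCompact (c ⁻¹' {q})) : T2Space Q := by
  refine ⟨fun q q' hqq' => ?_⟩
  have hd : Disjoint (c ⁻¹' {q}) (c ⁻¹' {q'}) :=
    Disjoint.preimage _ (disjoint_singleton.2 hqq')
  obtain ⟨U, V, hU, hV, hqU, hqV, hUV⟩ := SeparatedNhds.of_isCompact_isCompact (hfib q) (hfib q') hd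
  refine ⟨(c '' Uᶜ)ᶜ, (c '' Vᶜ)ᶜ, (hclosed _ hU.isClosed_compl).isOpen_compl,
    (hclosed _ hV.isClosed_compl).isOpen_compl, ?_, ?_, ?_⟩
  · rintro ⟨x, hx, rfl⟩; exact hx (hqU rfl)
  · rintro ⟨x, hx, rfl⟩; exact hx (hqV rfl)
  · rw [disjoint_left]
    intro z hz hz'
    obtain ⟨x, rfl⟩ := hsurj z
    have h1 : x ∈ U := by
      by_contra h; exact hz ⟨x, h, rfl⟩
    have h2 : x ∈ V := by
      by_contra h; exact hz' ⟨x, h, rfl⟩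
    exact disjoint_left.1 hUV h1 h2

namespace BoundaryCircleAction

variable {k : ℕ} {M : Type*} [TopologicalSpace M] [ChartedSpace (EuclideanHalfSpace (k + 2)) M]
  [IsManifold (𝓡∂ (k + 2)) ∞ M] (A : BoundaryCircleAction k M)

/-- A boundary point as a point of `U`. -/
def bdryToU (p : Bdry k M) : A.U := ⟨p.1, A.boundary_subset p.1 p.2⟩

theorem bdryAct_val (a : Circle) (p : Bdry k M) : (A.bdryAct a p).1 = (a • A.bdryToU p).1 := rfl

theorem isQuotientMap_toCut : IsQuotientMap A.toCut := isQuotientMap_quot_mk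

theorem isQuotientMap_toRed : IsQuotientMap A.toRed := isQuotientMap_quot_mk

theorem toRed_eq_iff {p q : Bdry k M} : A.toRed p = A.toRed q ↔ ∃ a, A.bdryAct a p = q :=
  Quotient.eq (r := A.redSetoid)

theorem toCut_eq_iff {x y : M} : A.toCut x = A.toCut y ↔
    x = y ∨ ∃ p q : Bdry k M, p.1 = x ∧ q.1 = y ∧ ∃ a : Circle, A.bdryAct a p = q :=
  Quotient.eq (r := A.cutSetoid)

theorem toCut_smul {x : A.U} (hx : x.1 ∈ (𝓡∂ (k + 2)).boundary M) (a : Circle) :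
    A.toCut (a • x).1 = A.toCut x.1 :=
  (A.toCut_eq_iff.2 (Or.inr ⟨⟨x.1, hx⟩, ⟨(a • x).1, A.smul_mem_boundary a x hx⟩, rfl, rfl, a, rfl⟩)).symm

theorem toCut_eq_coe_iff {x : A.U} {y : M} : A.toCut x.1 = A.toCut y ↔
    x.1 = y ∨ (x.1 ∈ (𝓡∂ (k + 2)).boundary M ∧ ∃ a : Circle, (a • x).1 = y) := by
  rw [A.toCut_eq_iff]
  refine or_congr_right ⟨?_, ?_⟩
  · rintro ⟨p, q, hp, rfl, a, rfl⟩
    obtain rfl : A.bdryToU p = x := Subtype.ext hp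
    exact ⟨p.2, a, rfl⟩
  · rintro ⟨hx, a, rfl⟩
    exact ⟨⟨x.1, hx⟩, ⟨_, A.smul_mem_boundary a x hx⟩, rfl, rfl, a, rfl⟩

theorem eq_of_toCut_eq {x y : M} (hx : x ∈ (𝓡∂ (k + 2)).interior M)
    (h : A.toCut x = A.toCut y) : x = y := by
  rcases A.toCut_eq_iff.1 h with h | ⟨p, q, rfl, -, -⟩
  · exact h
  · exact absurd hx (((𝓡∂ (k + 2)).disjoint_interior_boundary (M := M)).notMem_of_mem_right p.2)

theorem continuous_bdryAct : Continuous fun z : Circle × Bdry k M => A.bdryAct z.1 z.2 := by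
  have := A.continuousSMul
  refine Continuous.subtype_mk ?_ _
  refine continuous_subtype_val.comp (Continuous.smul continuous_fst ?_)
  exact (continuous_subtype_val.comp continuous_snd).subtype_mk _

/-- Saturating a closed set adds only the boundary points whose orbit meets it, and these form the
projection of a closed set along the compact circle. -/
theorem isClosedMap_toCut : IsClosedMap A.toCut := by
  intro F hF
  rw [← A.isQuotientMap_toCut.isClosed_preimage]
  have h1 : A.toCut ⁻¹' (A.toCut '' F) = F ∪ Subtype.val ''
      (Prod.snd '' {z : Circle × Bdry k M | (A.bdryAct z.1 z.2).1 ∈ F}) := by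
    ext y
    constructor
    · rintro ⟨x, hx, hxy⟩
      rcases A.toCut_eq_iff.1 hxy.symm with rfl | ⟨p, q, rfl, rfl, a, rfl⟩
      · exact Or.inl hx
      · exact Or.inr ⟨p, ⟨(a, p), hx, rfl⟩, rfl⟩
    · rintro (hy | ⟨_, ⟨⟨a, p⟩, ha, rfl⟩, rfl⟩)
      · exact ⟨y, hy, rfl⟩
      · exact ⟨_, ha, A.toCut_smul (x := A.bdryToU p) p.2 a⟩
  rw [h1]
  refine hF.union ?_
  refine isClosed_boundary.isClosedEmbedding_subtypeVal.isClosedMap _ ?_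
  exact isClosedMap_snd_of_compactSpace _
    (hF.preimage (continuous_subtype_val.comp A.continuous_bdryAct))

theorem continuous_toCut : Continuous A.toCut := continuous_quot_mk

theorem continuous_toRed : Continuous A.toRed := continuous_quot_mk

theorem t2Space_cut [T2Space M] : T2Space A.Cut := by
  refine t2Space_of_isClosedMap_of_isCompact_fibre A.isClosedMap_toCut
    A.isQuotientMap_toCut.surjective fun q => ?_
  obtain ⟨x, rfl⟩ := A.isQuotientMap_toCut.surjective q
  by_cases hx : x ∈ (𝓡∂ (k + 2)).boundary M
  · have h1 : A.toCut ⁻¹' {A.toCut x} = range fun a : Circle => (A.bdryAct a ⟨x, hx⟩).1 := by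
      ext y
      constructor
      · intro hy
        rcases (A.toCut_eq_coe_iff (x := A.bdryToU ⟨x, hx⟩)).1 hy.symm with rfl | ⟨-, a, rfl⟩
        · exact ⟨1, congrArg Subtype.val (A.bdryAct_one ⟨x, hx⟩)⟩
        · exact ⟨a, rfl⟩
      · rintro ⟨a, rfl⟩
        exact A.toCut_smul (x := A.bdryToU ⟨x, hx⟩) hx a
    rw [h1]
    exact isCompact_range (continuous_subtype_val.comp
      (A.continuous_bdryAct.comp (Continuous.prodMk_left _)))
  · have h1 : A.toCut ⁻¹' {A.toCut x} = {x} := by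
      ext y
      refine ⟨fun hy => ?_, fun hy => congrArg _ hy⟩
      refine (A.eq_of_toCut_eq ?_ hy.symm).symm
      rw [← ModelWithCorners.compl_boundary]; exact hx
    rw [h1]
    exact isCompact_singleton

/-- On the boundary the two equivalence relations coincide, whence injectivity; closedness is
inherited from `toCut`. The reduced space obtains its Hausdorff property and its second countability
from this embedding. -/
theorem isClosedEmbedding_redToCut : IsClosedEmbedding A.redToCut := by
  refine IsClosedEmbedding.of_continuous_injective_isClosedMap ?_ ?_ ?_
  · rw [A.isQuotientMap_toRed.continuous_iff]
    exact A.continuous_toCut.comp continuous_subtype_val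
  · intro q q' h
    obtain ⟨p, rfl⟩ := A.isQuotientMap_toRed.surjective q
    obtain ⟨p', rfl⟩ := A.isQuotientMap_toRed.surjective q'
    rcases A.toCut_eq_iff.1 h with h | ⟨p₁, q₁, h1, h2, a, h3⟩
    · rw [Subtype.ext h]
    · obtain rfl : p₁ = p := Subtype.ext h1
      obtain rfl : q₁ = p' := Subtype.ext h2
      exact A.toRed_eq_iff.2 ⟨a, h3⟩
  · intro C hC
    have h1 : A.redToCut '' C = A.toCut '' (Subtype.val '' (A.toRed ⁻¹' C)) := by
      ext q
      constructor
      · rintro ⟨r, hr, rfl⟩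
        obtain ⟨p, rfl⟩ := A.isQuotientMap_toRed.surjective r
        exact ⟨p.1, ⟨p, hr, rfl⟩, rfl⟩
      · rintro ⟨_, ⟨p, hp, rfl⟩, rfl⟩
        exact ⟨A.toRed p, hp, rfl⟩
    rw [h1]
    exact A.isClosedMap_toCut _ (isClosed_boundary.isClosedEmbedding_subtypeVal.isClosedMap _
      (hC.preimage A.continuous_toRed))

theorem t2Space_red [T2Space M] : T2Space A.Red :=
  have := A.t2Space_cut
  A.isClosedEmbedding_redToCut.isEmbedding.t2Space

/-- Sigma-compactness, unlike second countability, always passes to quotients, and the charts turn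
it back into second countability. -/
theorem secondCountable_cut [T2Space M] [SecondCountableTopology M]
    [ChartedSpace (EuclideanSpace ℝ (Fin (k + 2))) A.Cut] : SecondCountableTopology A.Cut := by
  have : LocallyCompactSpace M := Manifold.locallyCompact_of_finiteDimensional (𝓡∂ (k + 2))
  have h1 : SigmaCompactSpace A.Cut := by
    rw [← isSigmaCompact_univ_iff, ← A.isQuotientMap_toCut.surjective.range_eq]
    exact isSigmaCompact_range A.continuous_toCut
  exact ChartedSpace.secondCountable_of_sigmaCompact (EuclideanSpace ℝ (Fin (k + 2))) A.Cut

end BoundaryCircleAction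

end

noncomputable section

/-! ### Smooth maps from and to the boundary -/

section BdryMaps

variable {k : ℕ} {M : Type*} [TopologicalSpace M] [ChartedSpace (EuclideanHalfSpace (k + 2)) M]
  [IsManifold (𝓡∂ (k + 2)) ∞ M]

theorem extChartAt_bdry_apply (p q : Bdry k M) : extChartAt (𝓡 (k + 1)) p q =
    tailCoord k (extChartAt (𝓡∂ (k + 2)) p.1 q.1) := rfl

theorem contMDiff_bdryIncl : ContMDiff (𝓡 (k + 1)) (𝓡∂ (k + 2)) ∞ (bdryIncl k M) := by
  intro p
  rw [contMDiffAt_iff_target]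
  refine ⟨continuous_subtype_val.continuousAt, ?_⟩
  have h1 : ContMDiffAt (𝓡 (k + 1)) 𝓘(ℝ, EuclideanSpace ℝ (Fin (k + 2))) ∞
      (consZero k ∘ extChartAt (𝓡 (k + 1)) p) p :=
    (contDiff_consZero k).contMDiff.contMDiffAt.comp p contMDiffAt_extChartAt
  refine h1.congr_of_eventuallyEq ?_
  filter_upwards [extChartAt_source_mem_nhds (I := 𝓡 (k + 1)) p] with q hq
  have hq' : q.1 ∈ (extChartAt (𝓡∂ (k + 2)) p.1).source := by
    rw [extChartAt_source] at hq ⊢; exact hq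
  simp only [Function.comp_apply, extChartAt_bdry_apply]
  rw [consZero_tailCoord _ _ ((mem_boundary_iff_extChartAt hq').1 q.2)]
  rfl

variable {E H : Type*} [NormedAddCommGroup E] [NormedSpace ℝ E] [TopologicalSpace H]
  {I : ModelWithCorners ℝ E H} {N : Type*} [TopologicalSpace N] [ChartedSpace H N]

/-- A map to the boundary is smooth if it is smooth as a map to `M`. -/
theorem contMDiffWithinAt_bdry {g : N → Bdry k M} {s : Set N} {x : N}
    (hg : ContMDiffWithinAt I (𝓡∂ (k + 2)) ∞ (fun y => (g y).1) s x) :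
    ContMDiffWithinAt I (𝓡 (k + 1)) ∞ g s x := by
  rw [contMDiffWithinAt_iff_target]
  refine ⟨IsInducing.subtypeVal.continuousWithinAt_iff.2 hg.continuousWithinAt, ?_⟩
  have h1 : ContMDiffAt (𝓡∂ (k + 2)) 𝓘(ℝ, EuclideanSpace ℝ (Fin (k + 2))) ∞
      (extChartAt (𝓡∂ (k + 2)) (g x).1) (g x).1 := contMDiffAt_extChartAt
  have h2 : ContMDiffWithinAt I 𝓘(ℝ, EuclideanSpace ℝ (Fin (k + 2))) ∞
      (fun y => extChartAt (𝓡∂ (k + 2)) (g x).1 (g y).1) s x := h1.comp_contMDiffWithinAt x hg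
  exact (contDiff_tailCoord k).contMDiff.contMDiffAt.comp_contMDiffWithinAt x h2

theorem ContMDiffAt.complex_mul {g h : N → ℂ} {x : N} (hg : ContMDiffAt I 𝓘(ℝ, ℂ) ∞ g x)
    (hh : ContMDiffAt I 𝓘(ℝ, ℂ) ∞ h x) : ContMDiffAt I 𝓘(ℝ, ℂ) ∞ (fun y => g y * h y) x :=
  (contDiff_mul (𝕜 := ℝ) (𝔸 := ℂ)).contMDiff.contMDiffAt.comp x (hg.prodMk_space hh)

end BdryMaps

/-! ### Manifold structures determined by a notion of smooth function -/

section SmoothStructure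

variable {X : Type*} [TopologicalSpace X] {n : ℕ}

/-- A chart is compatible with a notion `Sm` of smoothness (at a point) of real-valued functions if
smoothness can be tested in the chart. -/
def IsCompatibleChart (Sm : (X → ℝ) → X → Prop)
    (φ : OpenPartialHomeomorph X (EuclideanSpace ℝ (Fin n))) : Prop :=
  ∀ q ∈ φ.source, ∀ h : X → ℝ, Sm h q ↔ ContDiffAt ℝ ∞ (h ∘ φ.symm) (φ q)

/-- The charted space structure consisting of all charts compatible with `Sm`. -/
@[reducible] def chartedSpaceOfCompatible (Sm : (X → ℝ) → X → Prop)
    (ch : X → OpenPartialHomeomorph X (EuclideanSpace ℝ (Fin n)))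
    (hmem : ∀ x, x ∈ (ch x).source) (hch : ∀ x, IsCompatibleChart Sm (ch x)) :
    ChartedSpace (EuclideanSpace ℝ (Fin n)) X where
  atlas := {φ | IsCompatibleChart Sm φ}
  chartAt := ch
  mem_chart_source := hmem
  chart_mem_atlas := hch

/-- Every component of one chart is smooth in the sense of `Sm`, hence smooth when read in the
other. Interior charts and slice charts thus never have to be compared explicitly. -/
theorem IsCompatibleChart.contDiffAt_transition {Sm : (X → ℝ) → X → Prop}
    {φ ψ : OpenPartialHomeomorph X (EuclideanSpace ℝ (Fin n))} (hφ : IsCompatibleChart Sm φ)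
    (hψ : IsCompatibleChart Sm ψ) {q : X} (hqφ : q ∈ φ.source) (hqψ : q ∈ ψ.source) :
    ContDiffAt ℝ ∞ (ψ ∘ φ.symm) (φ q) := by
  rw [contDiffAt_piLp]
  intro i
  refine (hφ q hqφ fun x => ψ x i).1 ((hψ q hqψ _).2 ?_)
  have h1 : ContDiffAt ℝ ∞ (fun y : EuclideanSpace ℝ (Fin n) => y i) (ψ q) := by fun_prop
  refine h1.congr_of_eventuallyEq ?_
  filter_upwards [ψ.open_target.mem_nhds (ψ.map_source hqψ)] with y hy
  simp [ψ.right_inv hy]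

theorem isManifold_of_compatible [ChartedSpace (EuclideanSpace ℝ (Fin n)) X]
    {Sm : (X → ℝ) → X → Prop}
    (h : ∀ φ ∈ atlas (EuclideanSpace ℝ (Fin n)) X, IsCompatibleChart Sm φ) :
    IsManifold (𝓡 n) ∞ X := by
  refine isManifold_of_contDiffOn _ _ _ fun φ ψ hφ hψ y hy => ?_
  simp only [modelWithCornersSelf_coe, modelWithCornersSelf_coe_symm, preimage_id, range_id,
    inter_univ, Function.comp_id, Function.id_comp] at hy ⊢
  have hy1 : y ∈ φ.target := hy.1
  have hy2 : φ.symm y ∈ ψ.source := hy.2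
  have := (h φ hφ).contDiffAt_transition (h ψ hψ) (φ.map_target hy1) hy2
  rw [φ.right_inv hy1] at this
  exact this.contDiffWithinAt

theorem contMDiffAt_iff_of_compatible [ChartedSpace (EuclideanSpace ℝ (Fin n)) X]
    {Sm : (X → ℝ) → X → Prop}
    (h : ∀ φ ∈ atlas (EuclideanSpace ℝ (Fin n)) X, IsCompatibleChart Sm φ) {g : X → ℝ} {q : X} :
    ContMDiffAt (𝓡 n) 𝓘(ℝ, ℝ) ∞ g q ↔ Sm g q := by
  have h1 := h _ (chart_mem_atlas _ q) q (mem_chart_source _ q) g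
  rw [h1, contMDiffAt_iff]
  have h2 : ContDiffWithinAt ℝ ∞ (extChartAt 𝓘(ℝ, ℝ) (g q) ∘ g ∘ (extChartAt (𝓡 n) q).symm)
      (range (𝓡 n)) (extChartAt (𝓡 n) q q) ↔
      ContDiffAt ℝ ∞ (g ∘ (chartAt (EuclideanSpace ℝ (Fin n)) q).symm)
        (chartAt (EuclideanSpace ℝ (Fin n)) q q) := by
    rw [← contDiffWithinAt_univ]
    simp only [modelWithCornersSelf_coe, range_id]
    rfl
  rw [h2]
  refine ⟨fun h => h.2, fun h => ⟨?_, h⟩⟩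
  have h3 := h.continuousAt.comp ((chartAt (EuclideanSpace ℝ (Fin n)) q).continuousAt
    (mem_chart_source _ q))
  refine h3.congr ?_
  filter_upwards [(chartAt (EuclideanSpace ℝ (Fin n)) q).open_source.mem_nhds
    (mem_chart_source _ q)] with x hx
  simp [(chartAt (EuclideanSpace ℝ (Fin n)) q).left_inv hx]

end SmoothStructure

/-! ### Slice coordinates `(s, z)` with `z = w √f` -/

namespace BoundaryCircleAction

variable {k : ℕ} {M : Type*} [TopologicalSpace M] [ChartedSpace (EuclideanHalfSpace (k + 2)) M]
  [IsManifold (𝓡∂ (k + 2)) ∞ M] {A : BoundaryCircleAction k M} {f : A.U → ℝ}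

namespace Slice

variable (S : A.Slice f)

/-- Coordinates on the cut space associated with a slice. -/
def coord (x : A.U) : EuclideanSpace ℝ (Fin k) × ℂ := (S.s x, S.w x * (√(f x) : ℝ))

/-- The inverse of `coord`, up to the action on the boundary. -/
def lift (y : EuclideanSpace ℝ (Fin k) × ℂ) : A.U := unitPart y.2 • S.τ (y.1, ‖y.2‖ ^ 2)

/-- The domain of `lift`. -/
def dom : Set (EuclideanSpace ℝ (Fin k) × ℂ) := {y | y.1 ∈ S.B ∧ ‖y.2‖ ^ 2 < S.δ}

theorem isOpen_dom : IsOpen S.dom :=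
  (S.isOpen_B.preimage continuous_fst).inter
    (isOpen_lt (continuous_snd.norm.pow 2) continuous_const)

theorem sq_mem {y : EuclideanSpace ℝ (Fin k) × ℂ} (hy : y ∈ S.dom) :
    (y.1, ‖y.2‖ ^ 2) ∈ S.B ×ˢ Ico 0 S.δ := ⟨hy.1, by positivity, hy.2⟩

theorem lift_mem {y : EuclideanSpace ℝ (Fin k) × ℂ} (hy : y ∈ S.dom) : S.lift y ∈ S.W :=
  S.smul_mem _ _ (S.τ_mem _ (S.sq_mem hy))

theorem f_lift (hinv : ∀ (a : Circle) (x : A.U), f (a • x) = f x)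
    {y : EuclideanSpace ℝ (Fin k) × ℂ} (hy : y ∈ S.dom) : f (S.lift y) = ‖y.2‖ ^ 2 := by
  rw [lift, hinv, S.f_τ _ (S.sq_mem hy)]

theorem coord_lift (hinv : ∀ (a : Circle) (x : A.U), f (a • x) = f x)
    {y : EuclideanSpace ℝ (Fin k) × ℂ} (hy : y ∈ S.dom) : S.coord (S.lift y) = y := by
  have h1 := S.sq_mem hy
  have h2 := S.τ_mem _ h1
  rw [coord, S.f_lift hinv hy, lift, S.s_smul _ _ h2, S.w_smul _ _ h2, S.s_τ _ h1, S.w_τ _ h1,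
    Real.sqrt_sq (norm_nonneg _), mul_one, mul_comm, norm_mul_unitPart]

theorem norm_coord (x : A.U) : ‖(S.coord x).2‖ = √(f x) := by
  rw [coord, norm_mul, Circle.norm_coe, one_mul, Complex.norm_real,
    Real.norm_of_nonneg (Real.sqrt_nonneg _)]

theorem coord_mem (hf : IsBoundaryDefining (k := k) f) {x : A.U} (hx : x ∈ S.W) :
    S.coord x ∈ S.dom := by
  refine ⟨S.mem_B x hx, ?_⟩
  rw [S.norm_coord, Real.sq_sqrt (hf.nonneg x)]
  exact S.lt_δ x hx

theorem lift_coord (hf : IsBoundaryDefining (k := k) f) {x : A.U} (hx : x ∈ S.W)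
    (h0 : 0 < f x) : S.lift (S.coord x) = x := by
  have h1 : unitPart (S.coord x).2 = S.w x :=
    unitPart_eq_of_mul_eq (Real.sqrt_pos.2 h0) (mul_comm _ _)
  rw [lift, h1, S.norm_coord, Real.sq_sqrt (hf.nonneg x)]
  exact S.eq_smul x hx

/-- At `f x = 0` the coordinate forgets the phase of `x`, and `lift` inserts the phase assigned to
`0` instead. The two points lie in one boundary orbit, so the cut space does not see the difference.
-/
theorem toCut_lift_coord (hf : IsBoundaryDefining (k := k) f) {x : A.U} (hx : x ∈ S.W) :
    A.toCut (S.lift (S.coord x)).1 = A.toCut x.1 := by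
  rcases (hf.nonneg x).lt_or_eq with h0 | h0
  · rw [S.lift_coord hf hx h0]
  · have h1 : (S.coord x).2 = 0 := by rw [coord, ← h0]; simp
    have h2 : (S.s x, f x) ∈ S.B ×ˢ Ico 0 S.δ :=
      ⟨S.mem_B x hx, hf.nonneg x, S.lt_δ x hx⟩
    have h3 : (S.τ (S.s x, f x)).1 ∈ (𝓡∂ (k + 2)).boundary M := by
      rw [← A.mem_boundary_coe, ← hf.zero_iff, S.f_τ _ h2, ← h0]
    have h4 : S.lift (S.coord x) = unitPart 0 • S.τ (S.s x, f x) := by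
      rw [lift, h1, ← h0]; simp [coord]
    rw [h4, A.toCut_smul h3]
    conv_rhs => rw [← S.eq_smul x hx]
    rw [A.toCut_smul h3]

theorem contMDiffAt_sqrt (hf : IsBoundaryDefining (k := k) f) {x : A.U} (h0 : f x ≠ 0) :
    ContMDiffAt (𝓡∂ (k + 2)) 𝓘(ℝ, ℝ) ∞ (fun y => √(f y)) x :=
  (Real.contDiffAt_sqrt h0).contMDiffAt.comp x hf.smooth.contMDiffAt

theorem continuousOn_coord (hf : IsBoundaryDefining (k := k) f) : ContinuousOn S.coord S.W := by
  refine S.smooth_s.continuousOn.prodMk (ContinuousOn.mul ?_ ?_)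
  · exact contMDiff_circle_coe.continuous.comp_continuousOn S.smooth_w.continuousOn
  · exact (Complex.continuous_ofReal.comp
      (Real.continuous_sqrt.comp hf.smooth.continuous)).continuousOn

theorem contMDiffAt_coord (hf : IsBoundaryDefining (k := k) f) {x : A.U} (hx : x ∈ S.W)
    (h0 : f x ≠ 0) :
    ContMDiffAt (𝓡∂ (k + 2)) 𝓘(ℝ, EuclideanSpace ℝ (Fin k) × ℂ) ∞ S.coord x := by
  have hW := S.isOpen.mem_nhds hx
  refine ContMDiffAt.prodMk_space (S.smooth_s.contMDiffAt hW) ?_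
  refine ContMDiffAt.complex_mul
    (contMDiff_circle_coe.contMDiffAt.comp x (S.smooth_w.contMDiffAt hW)) ?_
  exact Complex.ofRealCLM.contMDiff.contMDiffAt.comp x (contMDiffAt_sqrt hf h0)

theorem contMDiffAt_lift {y : EuclideanSpace ℝ (Fin k) × ℂ} (hy : y ∈ S.dom) (h0 : y.2 ≠ 0) :
    ContMDiffAt 𝓘(ℝ, EuclideanSpace ℝ (Fin k) × ℂ) (𝓡∂ (k + 2)) ∞ S.lift y := by
  have h1 : S.B ×ˢ Ico 0 S.δ ∈ 𝓝 (y.1, ‖y.2‖ ^ 2) :=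
    prod_mem_nhds (S.isOpen_B.mem_nhds hy.1) (Ico_mem_nhds (by positivity) hy.2)
  refine A.contMDiff_smul'.contMDiffAt.comp y (ContMDiffAt.prodMk ?_ ?_)
  · exact (contMDiffAt_unitPart h0).comp y contDiff_snd.contMDiff.contMDiffAt
  · refine (S.smooth_τ.contMDiffAt h1).comp y (ContDiffAt.contMDiffAt ?_)
    exact contDiffAt_fst.prodMk (contDiffAt_snd.norm_sq ℝ)

theorem contMDiffOn_τ_sq : ContMDiffOn 𝓘(ℝ, EuclideanSpace ℝ (Fin k) × ℂ) (𝓡∂ (k + 2)) ∞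
    (fun y => S.τ (y.1, ‖y.2‖ ^ 2)) S.dom := by
  refine S.smooth_τ.comp (ContDiff.contMDiff ?_).contMDiffOn fun y hy => S.sq_mem hy
  exact contDiff_fst.prodMk (contDiff_snd.norm_sq ℝ)

/-- The phase of `z` has no limit at `z = 0`, so continuity of `lift` is not available there. But
the points whose whole orbit maps into a given open set form an open set, by compactness of the
circle, and `τ(s, |z|²)` enters it whatever the phase. -/
theorem continuousOn_toCut_lift (hf : IsBoundaryDefining (k := k) f) :
    ContinuousOn (fun y => A.toCut (S.lift y).1) S.dom := by
  intro y hy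
  by_cases h0 : y.2 = 0
  · refine ContinuousAt.continuousWithinAt fun O hO => ?_
    obtain ⟨O', hO', hO'o, hyO'⟩ := mem_nhds_iff.1 hO
    have := A.continuousSMul
    set V : Set A.U := {x | ∀ a : Circle, a • x ∈ {x : A.U | A.toCut x.1 ∈ O'}} with hV
    have hVo : IsOpen V := by
      have h1 : IsClosed (Prod.snd '' {z : Circle × A.U | A.toCut (z.1 • z.2).1 ∉ O'}) :=
        isClosedMap_snd_of_compactSpace _ (hO'o.isClosed_compl.preimage
          (A.continuous_toCut.comp (continuous_subtype_val.comp continuous_smul)))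
      convert h1.isOpen_compl using 1
      ext x
      simp [hV]
    have h2 : S.τ (y.1, ‖y.2‖ ^ 2) ∈ V := by
      have h3 : (S.τ (y.1, ‖y.2‖ ^ 2)).1 ∈ (𝓡∂ (k + 2)).boundary M := by
        rw [← A.mem_boundary_coe, ← hf.zero_iff, S.f_τ _ (S.sq_mem hy), h0]; simp
      intro a
      have h4 : A.toCut (S.lift y).1 ∈ O' := hyO'
      rw [lift, A.toCut_smul h3] at h4
      simp only [mem_ofPred_eq, A.toCut_smul h3]
      exact h4
    have h5 := (S.contMDiffOn_τ_sq.continuousOn.continuousAt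
      (S.isOpen_dom.mem_nhds hy)).eventually_mem (hVo.mem_nhds h2)
    rw [Filter.mem_map]
    filter_upwards [h5] with z hz
    exact hO' (hz _)
  · exact (A.continuous_toCut.continuousAt.comp (continuous_subtype_val.continuousAt.comp
      (S.contMDiffAt_lift hy h0).continuousAt)).continuousWithinAt

end Slice

/-- Smoothness of a function on the cut space at a point, in terms of an invariant boundary
defining function `f`. -/
def CutSmoothAt (A : BoundaryCircleAction k M) (f : A.U → ℝ) (h : A.Cut → ℝ) (q : A.Cut) : Prop :=
  (∀ x ∈ (𝓡∂ (k + 2)).interior M, A.toCut x = q →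
    ContMDiffAt (𝓡∂ (k + 2)) 𝓘(ℝ, ℝ) ∞ (h ∘ A.toCut) x) ∧
  ∀ p : A.U, p.1 ∈ (𝓡∂ (k + 2)).boundary M → A.toCut p.1 = q → ∃ H : A.U × ℂ → ℝ,
    ContMDiffAt ((𝓡∂ (k + 2)).prod 𝓘(ℝ, ℂ)) 𝓘(ℝ, ℝ) ∞ H (p, 0) ∧
    ∀ᶠ x in 𝓝 p, ∀ a : Circle, h (A.toCut (a • x).1) = H (x, a * (√(f x) : ℝ))

/-- Smoothness of a function on the reduced space at a point. -/
def RedSmoothAt (A : BoundaryCircleAction k M) (h : A.Red → ℝ) (q : A.Red) : Prop :=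
  ∀ p : Bdry k M, A.toRed p = q → ContMDiffAt (𝓡 (k + 1)) 𝓘(ℝ, ℝ) ∞ (h ∘ A.toRed) p

namespace Slice

variable (S : A.Slice f)

theorem mem_W_of_toCut_eq {x x' : A.U} (hx : x ∈ S.W) (h : A.toCut x.1 = A.toCut x'.1) :
    x' ∈ S.W := by
  rcases A.toCut_eq_coe_iff.1 h with h | ⟨-, a, h⟩
  · rwa [← Subtype.ext h]
  · rw [← Subtype.ext h]; exact S.smul_mem a x hx

theorem coord_eq_of_toCut_eq (hf : IsBoundaryDefining (k := k) f)
    (hinv : ∀ (a : Circle) (x : A.U), f (a • x) = f x) {x x' : A.U} (hx : x ∈ S.W)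
    (h : A.toCut x.1 = A.toCut x'.1) : S.coord x = S.coord x' := by
  rcases A.toCut_eq_coe_iff.1 h with h | ⟨hb, a, h⟩
  · rw [Subtype.ext h]
  · rw [← Subtype.ext h, coord, coord, hinv, S.s_smul a x hx,
      (hf.zero_iff x).2 (A.mem_boundary_coe.2 hb)]
    simp

/-- Here the functions `H(x, z)` become ordinary functions of `(s, z)`. At `z = 0`, given `H`, the
expression `H(τ(s, |z|²), z)` is smooth in `(s, z)`; conversely `H(x, z)` is defined by evaluating
the coordinate expression of `h` at `(s x, w(x) z)`. At `z ≠ 0`, `lift` and `coord` are mutually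
inverse smooth maps. -/
theorem cutSmoothAt_iff (hf : IsBoundaryDefining (k := k) f)
    (hinv : ∀ (a : Circle) (x : A.U), f (a • x) = f x) {y : EuclideanSpace ℝ (Fin k) × ℂ}
    (hy : y ∈ S.dom) (h : A.Cut → ℝ) : A.CutSmoothAt f h (A.toCut (S.lift y).1) ↔
      ContDiffAt ℝ ∞ (fun z => h (A.toCut (S.lift z).1)) y := by
  by_cases h0 : y.2 = 0
  · have hτy : (S.τ (y.1, ‖y.2‖ ^ 2)).1 ∈ (𝓡∂ (k + 2)).boundary M := by
      rw [← A.mem_boundary_coe, ← hf.zero_iff, S.f_τ _ (S.sq_mem hy), h0]; simp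
    have hτc : A.toCut (S.τ (y.1, ‖y.2‖ ^ 2)).1 = A.toCut (S.lift y).1 := by
      rw [lift, A.toCut_smul hτy]
    have hτs := S.contMDiffOn_τ_sq.contMDiffAt (S.isOpen_dom.mem_nhds hy)
    constructor
    · rintro ⟨-, h2⟩
      obtain ⟨H, hH, hHe⟩ := h2 _ hτy hτc
      have h3 : ContMDiffAt 𝓘(ℝ, EuclideanSpace ℝ (Fin k) × ℂ) 𝓘(ℝ, ℝ) ∞
          (fun z => H (S.τ (z.1, ‖z.2‖ ^ 2), z.2)) y := by
        have h4 : ContMDiffAt ((𝓡∂ (k + 2)).prod 𝓘(ℝ, ℂ)) 𝓘(ℝ, ℝ) ∞ H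
          (S.τ (y.1, ‖y.2‖ ^ 2), y.2) := by rw [h0] at hH ⊢; exact hH
        exact h4.comp y (hτs.prodMk contDiff_snd.contMDiff.contMDiffAt)
      refine h3.contDiffAt.congr_of_eventuallyEq ?_
      filter_upwards [hτs.continuousAt.eventually hHe, S.isOpen_dom.mem_nhds hy] with z hz hzd
      rw [lift, hz, S.f_τ _ (S.sq_mem hzd), Real.sqrt_sq (norm_nonneg _), mul_comm,
        norm_mul_unitPart]
    · intro h1
      refine ⟨fun x hx hxy => ?_, fun p hp hpy => ?_⟩
      · rw [← hτc] at hxy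
        have := A.eq_of_toCut_eq hx hxy
        rw [this] at hx
        exact absurd hτy (((𝓡∂ (k + 2)).disjoint_interior_boundary (M := M)).notMem_of_mem_left hx)
      · have hpW : p ∈ S.W := S.mem_W_of_toCut_eq (S.lift_mem hy) hpy.symm
        have hpW' := S.isOpen.mem_nhds hpW
        have hsp : (S.s p, (S.w p : ℂ) * 0) = y := by
          have h2 := S.coord_eq_of_toCut_eq hf hinv (S.lift_mem hy) hpy.symm
          rw [S.coord_lift hinv hy] at h2
          rw [mul_zero, ← h0, h2]; rfl
        refine ⟨fun z => h (A.toCut (S.lift (S.s z.1, S.w z.1 * z.2)).1), ?_, ?_⟩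
        · have h3 : ContMDiffAt ((𝓡∂ (k + 2)).prod 𝓘(ℝ, ℂ)) 𝓘(ℝ, EuclideanSpace ℝ (Fin k) × ℂ) ∞
              (fun z : A.U × ℂ => (S.s z.1, (S.w z.1 : ℂ) * z.2)) (p, 0) := by
            refine ContMDiffAt.prodMk_space ((S.smooth_s.contMDiffAt hpW').comp (p, (0 : ℂ))
              contMDiffAt_fst) (ContMDiffAt.complex_mul ?_ contMDiffAt_snd)
            exact contMDiff_circle_coe.contMDiffAt.comp _ ((S.smooth_w.contMDiffAt hpW').comp
              (p, (0 : ℂ)) contMDiffAt_fst)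
          rw [← hsp] at h1
          exact ContMDiffAt.comp (g := fun z => h (A.toCut (S.lift z).1)) (p, (0 : ℂ))
            h1.contMDiffAt h3
        · filter_upwards [hpW'] with x hx a
          have h4 : S.coord (a • x) = (S.s x, (S.w x : ℂ) * ((a : ℂ) * ((√(f x) : ℝ) : ℂ))) := by
            rw [coord, hinv, S.s_smul a x hx, S.w_smul a x hx, Circle.coe_mul]
            congr 1; ring
          rw [← S.toCut_lift_coord hf (S.smul_mem a x hx), h4]
  · have hfy : f (S.lift y) ≠ 0 := by
      rw [S.f_lift hinv hy]; positivity
    have hyi : (S.lift y).1 ∈ (𝓡∂ (k + 2)).interior M := by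
      rw [← ModelWithCorners.compl_boundary]
      intro hb
      exact hfy ((hf.zero_iff _).2 (A.mem_boundary_coe.2 hb))
    constructor
    · rintro ⟨h1, -⟩
      exact ((h1 _ hyi rfl).comp y (contMDiff_subtype_val.contMDiffAt.comp y
        (S.contMDiffAt_lift hy h0))).contDiffAt
    · intro h1
      refine ⟨fun x hx hxy => ?_, fun p hp hpy => ?_⟩
      · rw [A.eq_of_toCut_eq hx hxy]
        rw [← contMDiffAt_subtype_iff]
        have h2 : ContMDiffAt (𝓡∂ (k + 2)) 𝓘(ℝ, ℝ) ∞
            ((fun z => h (A.toCut (S.lift z).1)) ∘ S.coord) (S.lift y) := by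
          refine ContMDiffAt.comp _ ?_ (S.contMDiffAt_coord hf (S.lift_mem hy) hfy)
          rw [S.coord_lift hinv hy]
          exact h1.contMDiffAt
        refine h2.congr_of_eventuallyEq ?_
        filter_upwards [S.isOpen.mem_nhds (S.lift_mem hy)] with z hz
        simp only [Function.comp_apply, S.toCut_lift_coord hf hz]
      · rw [A.eq_of_toCut_eq hyi hpy.symm] at hyi
        exact absurd hp (((𝓡∂ (k + 2)).disjoint_interior_boundary (M := M)).notMem_of_mem_left hyi)

end Slice

end BoundaryCircleAction

end

/-! ### Charts of the cut space and of the reduced space -/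

noncomputable section

/-- The identification of the model `ℝᵏ × ℂ` with `ℝᵏ⁺²`. -/
def modelEquiv (k : ℕ) :
    (EuclideanSpace ℝ (Fin k) × ℂ) ≃L[ℝ] EuclideanSpace ℝ (Fin (k + 2)) :=
  ContinuousLinearEquiv.ofFinrankEq (by simp)

namespace BoundaryCircleAction

variable {k : ℕ} {M : Type*} [TopologicalSpace M] [ChartedSpace (EuclideanHalfSpace (k + 2)) M]
  [IsManifold (𝓡∂ (k + 2)) ∞ M] {A : BoundaryCircleAction k M} {f : A.U → ℝ}

theorem contMDiff_bdryToU (A : BoundaryCircleAction k M) :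
    ContMDiff (𝓡 (k + 1)) (𝓡∂ (k + 2)) ∞ A.bdryToU :=
  (ContMDiff.subtypeVal_comp_iff _ _).1 contMDiff_bdryIncl

omit [IsManifold (𝓡∂ (k + 2)) ∞ M] in
theorem notMem_interior_of_mem_boundary {x : M} (hx : x ∈ (𝓡∂ (k + 2)).boundary M) :
    x ∉ (𝓡∂ (k + 2)).interior M :=
  ((𝓡∂ (k + 2)).disjoint_interior_boundary (M := M)).notMem_of_mem_right hx

theorem mem_interior_iff_extChartAt {x₀ x : M} (hx : x ∈ (extChartAt (𝓡∂ (k + 2)) x₀).source) :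
    x ∈ (𝓡∂ (k + 2)).interior M ↔ 0 < extChartAt (𝓡∂ (k + 2)) x₀ x 0 := by
  rw [← ModelWithCorners.compl_boundary, mem_compl_iff, mem_boundary_iff_extChartAt hx]
  exact (show (0 : ℝ) ≤ _ from mem_range_halfSpace.1 (mem_range_self _)).lt_iff_ne'.symm

omit [IsManifold (𝓡∂ (k + 2)) ∞ M] in
theorem isOpen_interior_coords (x : M) :
    IsOpen ((extChartAt (𝓡∂ (k + 2)) x).target ∩ {y | 0 < y 0}) := by
  have h1 : (extChartAt (𝓡∂ (k + 2)) x).target ∩ {y | 0 < y 0} =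
      (𝓡∂ (k + 2)).symm ⁻¹' (chartAt (EuclideanHalfSpace (k + 2)) x).target ∩ {y | 0 < y 0} := by
    rw [extChartAt_target]
    ext y
    constructor
    · rintro ⟨⟨h1, -⟩, h2⟩; exact ⟨h1, h2⟩
    · rintro ⟨h1, h2⟩; exact ⟨⟨h1, mem_range_halfSpace.2 (le_of_lt h2)⟩, h2⟩
  rw [h1]
  refine IsOpen.inter ((chartAt _ x).open_target.preimage (𝓡∂ (k + 2)).continuous_symm) ?_
  exact isOpen_lt continuous_const (normalCoord k).continuous

/-- The chart of the cut space around the image of an interior point. -/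
def interiorChart (A : BoundaryCircleAction k M) (x : M) :
    OpenPartialHomeomorph A.Cut (EuclideanSpace ℝ (Fin (k + 2))) :=
  quotientChart A.isQuotientMap_toCut
    (W := (extChartAt (𝓡∂ (k + 2)) x).source ∩ (𝓡∂ (k + 2)).interior M)
    ((isOpen_extChartAt_source x).inter (by
      rw [← ModelWithCorners.compl_boundary]; exact isClosed_boundary.isOpen_compl))
    (by
      refine subset_antisymm ?_ (subset_preimage_image _ _)
      rintro y ⟨z, hz, hzy⟩
      rwa [← A.eq_of_toCut_eq hz.2 hzy])
    (F := extChartAt (𝓡∂ (k + 2)) x) ((continuousOn_extChartAt x).mono inter_subset_left)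
    (isOpen_interior_coords x) (G := A.toCut ∘ (extChartAt (𝓡∂ (k + 2)) x).symm)
    (A.continuous_toCut.comp_continuousOn
      ((continuousOn_extChartAt_symm x).mono inter_subset_left))
    (fun z hz => ⟨(extChartAt (𝓡∂ (k + 2)) x).map_source hz.1,
      (mem_interior_iff_extChartAt hz.1).1 hz.2⟩)
    (fun z hz => by simp only [Function.comp_apply, (extChartAt (𝓡∂ (k + 2)) x).left_inv hz.1])
    (fun y hy => ⟨(extChartAt (𝓡∂ (k + 2)) x).symm y,
      ⟨(extChartAt (𝓡∂ (k + 2)) x).map_target hy.1, (mem_interior_iff_extChartAt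
        ((extChartAt (𝓡∂ (k + 2)) x).map_target hy.1)).2
        (by rw [(extChartAt (𝓡∂ (k + 2)) x).right_inv hy.1]; exact hy.2)⟩, rfl,
      (extChartAt (𝓡∂ (k + 2)) x).right_inv hy.1⟩)
    (fun z hz z' _ h => by rw [A.eq_of_toCut_eq hz.2 h])

theorem interiorChart_apply (A : BoundaryCircleAction k M) (x : M) {z : M}
    (hz : z ∈ (extChartAt (𝓡∂ (k + 2)) x).source ∩ (𝓡∂ (k + 2)).interior M) :
    A.interiorChart x (A.toCut z) = extChartAt (𝓡∂ (k + 2)) x z :=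
  quotientChart_apply _ _ _ _ _ _ _ _ _ _ hz

/-- An interior point is alone in its class, so only the first clause of `CutSmoothAt` is in force.
-/
theorem isCompatibleChart_interiorChart (A : BoundaryCircleAction k M) (f : A.U → ℝ) (x : M) :
    IsCompatibleChart (A.CutSmoothAt f) (A.interiorChart x) := by
  rintro _ ⟨z, hz, rfl⟩ h
  have hφz := (extChartAt (𝓡∂ (k + 2)) x).map_source hz.1
  have h0 := (mem_interior_iff_extChartAt hz.1).1 hz.2
  have hn : (extChartAt (𝓡∂ (k + 2)) x).target ∈ 𝓝 (extChartAt (𝓡∂ (k + 2)) x z) :=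
    Filter.mem_of_superset ((isOpen_interior_coords x).mem_nhds ⟨hφz, h0⟩) inter_subset_left
  rw [A.interiorChart_apply x hz]
  change _ ↔ ContDiffAt ℝ ∞ (h ∘ A.toCut ∘ (extChartAt (𝓡∂ (k + 2)) x).symm) _
  constructor
  · rintro ⟨h1, -⟩
    have h2 := (contMDiffOn_extChartAt_symm (I := 𝓡∂ (k + 2)) (n := ∞) x).contMDiffAt hn
    refine ContMDiffAt.contDiffAt (ContMDiffAt.comp (g := h ∘ A.toCut) _ ?_ h2)
    rw [(extChartAt (𝓡∂ (k + 2)) x).left_inv hz.1]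
    exact h1 z hz.2 rfl
  · intro h1
    refine ⟨fun y hy hyz => ?_, fun p hp hpz => ?_⟩
    · rw [A.eq_of_toCut_eq hy hyz]
      have h2 : ContMDiffAt (𝓡∂ (k + 2)) 𝓘(ℝ, EuclideanSpace ℝ (Fin (k + 2))) ∞
          (extChartAt (𝓡∂ (k + 2)) x) z := contMDiffAt_extChartAt' (by simpa using hz.1)
      have h3 := ContMDiffAt.comp z h1.contMDiffAt h2
      refine h3.congr_of_eventuallyEq ?_
      filter_upwards [(isOpen_extChartAt_source x).mem_nhds hz.1] with y hy
      simp only [Function.comp_apply, (extChartAt (𝓡∂ (k + 2)) x).left_inv hy]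
    · have h2 := A.eq_of_toCut_eq hz.2 hpz.symm
      exact absurd (h2 ▸ hz.2) (notMem_interior_of_mem_boundary hp)

namespace Slice

variable (S : A.Slice f)

open Classical in
/-- The chart of the cut space defined by a slice, with values in `ℝᵏ × ℂ`. -/
def cutChartAux (hf : IsBoundaryDefining (k := k) f)
    (hinv : ∀ (a : Circle) (x : A.U), f (a • x) = f x) :
    OpenPartialHomeomorph A.Cut (EuclideanSpace ℝ (Fin k) × ℂ) :=
  quotientChart A.isQuotientMap_toCut (W := Subtype.val '' S.W)
    (A.U.isOpen.isOpenMap_subtype_val _ S.isOpen)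
    (by
      refine subset_antisymm ?_ (subset_preimage_image _ _)
      rintro y ⟨_, ⟨x, hx, rfl⟩, hxy⟩
      rcases A.toCut_eq_coe_iff.1 hxy with h | ⟨-, a, h⟩
      · exact ⟨x, hx, h⟩
      · exact ⟨a • x, S.smul_mem a x hx, h⟩)
    (F := fun x => if h : x ∈ A.U then S.coord ⟨x, h⟩ else 0)
    (by
      rintro _ ⟨x, hx, rfl⟩
      refine ContinuousAt.continuousWithinAt ?_
      rw [← A.U.isOpen.isOpenEmbedding_subtypeVal.continuousAt_iff]
      refine ((S.continuousOn_coord hf).continuousAt (S.isOpen.mem_nhds hx)).congr ?_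
      filter_upwards with y
      simp)
    S.isOpen_dom (G := fun y => A.toCut (S.lift y).1) (S.continuousOn_toCut_lift hf)
    (by
      rintro _ ⟨x, hx, rfl⟩
      simpa using S.coord_mem hf hx)
    (by
      rintro _ ⟨x, hx, rfl⟩
      simpa using S.toCut_lift_coord hf hx)
    (fun y hy => ⟨_, ⟨_, S.lift_mem hy, rfl⟩, rfl, by simpa using S.coord_lift hinv hy⟩)
    (by
      rintro _ ⟨x, hx, rfl⟩ _ ⟨x', hx', rfl⟩ h
      simpa using S.coord_eq_of_toCut_eq hf hinv hx h)

/-- The chart of the cut space defined by a slice. -/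
def cutChart (hf : IsBoundaryDefining (k := k) f)
    (hinv : ∀ (a : Circle) (x : A.U), f (a • x) = f x) :
    OpenPartialHomeomorph A.Cut (EuclideanSpace ℝ (Fin (k + 2))) :=
  (S.cutChartAux hf hinv).transHomeomorph (modelEquiv k).toHomeomorph

variable (hf : IsBoundaryDefining (k := k) f)
  (hinv : ∀ (a : Circle) (x : A.U), f (a • x) = f x)

theorem mem_cutChart_source {x : A.U} (hx : x ∈ S.W) :
    A.toCut x.1 ∈ (S.cutChart hf hinv).source := ⟨x.1, ⟨x, hx, rfl⟩, rfl⟩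

theorem cutChart_target : (S.cutChart hf hinv).target = (modelEquiv k).symm ⁻¹' S.dom := rfl

theorem cutChart_apply {x : A.U} (hx : x ∈ S.W) :
    S.cutChart hf hinv (A.toCut x.1) = modelEquiv k (S.coord x) := by
  change modelEquiv k (S.cutChartAux hf hinv (A.toCut x.1)) = _
  have hx' : x.1 ∈ Subtype.val '' S.W := ⟨x, hx, rfl⟩
  refine congrArg (modelEquiv k) ((quotientChart_apply _ _ _ _ _ _ _ _ _ _ hx').trans ?_)
  simp

theorem isCompatibleChart_cutChart :
    IsCompatibleChart (A.CutSmoothAt f) (S.cutChart hf hinv) := by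
  rintro _ ⟨_, ⟨x, hx, rfl⟩, rfl⟩ h
  rw [S.cutChart_apply hf hinv hx]
  have h1 := S.cutSmoothAt_iff hf hinv (S.coord_mem hf hx) h
  rw [S.toCut_lift_coord hf hx] at h1
  rw [h1, ← (modelEquiv k).symm.contDiffAt_comp_iff]
  rfl

open Classical in
/-- The section of `∂M → M_red` defined by a slice; `p₀` is only used as a default value. -/
def bdryLift (p₀ : Bdry k M) (y : EuclideanSpace ℝ (Fin k)) : Bdry k M :=
  if h : (S.τ (y, 0)).1 ∈ (𝓡∂ (k + 2)).boundary M then ⟨(S.τ (y, 0)).1, h⟩ else p₀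

theorem zero_mem {y : EuclideanSpace ℝ (Fin k)} (hy : y ∈ S.B) : (y, (0 : ℝ)) ∈ S.B ×ˢ Ico 0 S.δ :=
  ⟨hy, le_rfl, S.δ_pos⟩

include hf in
theorem bdryToU_bdryLift (p₀ : Bdry k M) {y : EuclideanSpace ℝ (Fin k)} (hy : y ∈ S.B) :
    A.bdryToU (S.bdryLift p₀ y) = S.τ (y, 0) := by
  have h : (S.τ (y, 0)).1 ∈ (𝓡∂ (k + 2)).boundary M := by
    rw [← A.mem_boundary_coe, ← hf.zero_iff, S.f_τ _ (S.zero_mem hy)]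
  rw [bdryLift, dif_pos h]
  rfl

include hf in
theorem bdryLift_val (p₀ : Bdry k M) {y : EuclideanSpace ℝ (Fin k)} (hy : y ∈ S.B) :
    (S.bdryLift p₀ y).1 = (S.τ (y, 0)).1 := by
  have h : (S.τ (y, 0)).1 ∈ (𝓡∂ (k + 2)).boundary M := by
    rw [← A.mem_boundary_coe, ← hf.zero_iff, S.f_τ _ (S.zero_mem hy)]
  rw [bdryLift, dif_pos h]

theorem contMDiffOn_τ_zero :
    ContMDiffOn 𝓘(ℝ, EuclideanSpace ℝ (Fin k)) (𝓡∂ (k + 2)) ∞ (fun y => S.τ (y, 0)) S.B := by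
  have h : ContMDiff 𝓘(ℝ, EuclideanSpace ℝ (Fin k)) 𝓘(ℝ, EuclideanSpace ℝ (Fin k) × ℝ) ∞
      (fun y : EuclideanSpace ℝ (Fin k) => (y, (0 : ℝ))) := (contDiff_prodMk_left (0 : ℝ)).contMDiff
  exact S.smooth_τ.comp h.contMDiffOn fun y hy => S.zero_mem hy

include hf in
theorem contMDiffOn_bdryLift (p₀ : Bdry k M) :
    ContMDiffOn 𝓘(ℝ, EuclideanSpace ℝ (Fin k)) (𝓡 (k + 1)) ∞ (S.bdryLift p₀) S.B := by
  intro y hy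
  refine contMDiffWithinAt_bdry ?_
  have h1 : ContMDiffOn 𝓘(ℝ, EuclideanSpace ℝ (Fin k)) (𝓡∂ (k + 2)) ∞
      (fun y => (S.τ (y, 0)).1) S.B :=
    contMDiff_subtype_val.comp_contMDiffOn S.contMDiffOn_τ_zero
  exact (h1 y hy).congr_of_mem (fun z hz => S.bdryLift_val hf p₀ hz) hy

include hf in
theorem toRed_bdryLift (p₀ : Bdry k M) {p : Bdry k M} (hp : A.bdryToU p ∈ S.W) :
    A.toRed (S.bdryLift p₀ (S.s (A.bdryToU p))) = A.toRed p := by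
  refine A.toRed_eq_iff.2 ⟨S.w (A.bdryToU p), Subtype.ext ?_⟩
  rw [A.bdryAct_val, S.bdryToU_bdryLift hf p₀ (S.mem_B _ hp)]
  have hb : (A.bdryToU p).1 ∈ (𝓡∂ (k + 2)).boundary M := p.2
  have h0 : f (A.bdryToU p) = 0 := (hf.zero_iff _).2 (A.mem_boundary_coe.2 hb)
  have h1 := S.eq_smul _ hp
  rw [h0] at h1
  exact congrArg Subtype.val h1

theorem bdryToU_bdryAct (a : Circle) (p : Bdry k M) :
    A.bdryToU (A.bdryAct a p) = a • A.bdryToU p := rfl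

/-- The chart of the reduced space defined by a slice. -/
def redChart (p₀ : Bdry k M) : OpenPartialHomeomorph A.Red (EuclideanSpace ℝ (Fin k)) :=
  quotientChart A.isQuotientMap_toRed (W := A.bdryToU ⁻¹' S.W)
    (S.isOpen.preimage A.contMDiff_bdryToU.continuous)
    (by
      refine subset_antisymm ?_ (subset_preimage_image _ _)
      rintro q ⟨p, hp, hpq⟩
      obtain ⟨a, rfl⟩ := A.toRed_eq_iff.1 hpq
      exact S.smul_mem a _ hp)
    (F := fun p => S.s (A.bdryToU p))
    (S.smooth_s.continuousOn.comp A.contMDiff_bdryToU.continuous.continuousOn fun p hp => hp)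
    S.isOpen_B (G := fun y => A.toRed (S.bdryLift p₀ y))
    (A.continuous_toRed.comp_continuousOn (S.contMDiffOn_bdryLift hf p₀).continuousOn)
    (fun p hp => S.mem_B _ hp) (fun p hp => S.toRed_bdryLift hf p₀ hp)
    (fun y hy => ⟨_, by
      rw [mem_preimage, S.bdryToU_bdryLift hf p₀ hy]; exact S.τ_mem _ (S.zero_mem hy), rfl, by
      rw [S.bdryToU_bdryLift hf p₀ hy, S.s_τ _ (S.zero_mem hy)]⟩)
    (by
      intro p hp p' hp' h
      obtain ⟨a, rfl⟩ := A.toRed_eq_iff.1 h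
      rw [bdryToU_bdryAct, S.s_smul a _ hp])

theorem redChart_target (p₀ : Bdry k M) : (S.redChart hf p₀).target = S.B := rfl

theorem redChart_symm_apply (p₀ : Bdry k M) (y : EuclideanSpace ℝ (Fin k)) :
    (S.redChart hf p₀).symm y = A.toRed (S.bdryLift p₀ y) := rfl

theorem redChart_apply (p₀ : Bdry k M) {p : Bdry k M} (hp : A.bdryToU p ∈ S.W) :
    S.redChart hf p₀ (A.toRed p) = S.s (A.bdryToU p) :=
  quotientChart_apply _ _ _ _ _ _ _ _ _ _ hp

theorem contMDiffAt_s_bdryToU {p : Bdry k M} (hp : A.bdryToU p ∈ S.W) :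
    ContMDiffAt (𝓡 (k + 1)) 𝓘(ℝ, EuclideanSpace ℝ (Fin k)) ∞ (fun p => S.s (A.bdryToU p)) p :=
  (S.smooth_s.contMDiffAt (S.isOpen.mem_nhds hp)).comp p A.contMDiff_bdryToU.contMDiffAt

/-- One direction composes with the smooth section `bdryLift`, the other with the invariant smooth
map `s`. -/
theorem isCompatibleChart_redChart (p₀ : Bdry k M) :
    IsCompatibleChart A.RedSmoothAt (S.redChart hf p₀) := by
  rintro _ ⟨p, hp, rfl⟩ h
  have hp' : A.bdryToU p ∈ S.W := hp
  rw [S.redChart_apply hf p₀ hp']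
  change _ ↔ ContDiffAt ℝ ∞ (h ∘ A.toRed ∘ S.bdryLift p₀) _
  constructor
  · intro h1
    refine ContMDiffAt.contDiffAt (ContMDiffAt.comp (g := h ∘ A.toRed) _ ?_
      ((S.contMDiffOn_bdryLift hf p₀).contMDiffAt (S.isOpen_B.mem_nhds (S.mem_B _ hp'))))
    exact h1 _ (S.toRed_bdryLift hf p₀ hp')
  · intro h1 p' hpp'
    obtain ⟨a, rfl⟩ := A.toRed_eq_iff.1 hpp'.symm
    have hp2 : A.bdryToU (A.bdryAct a p) ∈ S.W := S.smul_mem a _ hp'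
    have h2 := S.contMDiffAt_s_bdryToU hp2
    rw [← S.s_smul a _ hp', ← bdryToU_bdryAct] at h1
    refine (ContMDiffAt.comp (A.bdryAct a p) h1.contMDiffAt h2).congr_of_eventuallyEq ?_
    filter_upwards [(S.isOpen.preimage A.contMDiff_bdryToU.continuous).mem_nhds hp2] with z hz
    simp only [Function.comp_apply, S.toRed_bdryLift hf p₀ hz]

end Slice

end BoundaryCircleAction

end

/-! ### The quotient map as a submersion, the reduced space as a submanifold -/

noncomputable section

/-- The identification of the model `ℝᵏ × ℝ` with `ℝᵏ⁺¹`. -/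
def bdryModelEquiv (k : ℕ) :
    (EuclideanSpace ℝ (Fin k) × ℝ) ≃L[ℝ] EuclideanSpace ℝ (Fin (k + 1)) :=
  ContinuousLinearEquiv.ofFinrankEq (by simp)

namespace BoundaryCircleAction

variable {k : ℕ} {M : Type*} [TopologicalSpace M] [ChartedSpace (EuclideanHalfSpace (k + 2)) M]
  [IsManifold (𝓡∂ (k + 2)) ∞ M] {A : BoundaryCircleAction k M} {f : A.U → ℝ}

theorem f_bdryToU (hf : IsBoundaryDefining (k := k) f) (p : Bdry k M) : f (A.bdryToU p) = 0 := by
  have hb : (A.bdryToU p).1 ∈ (𝓡∂ (k + 2)).boundary M := p.2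
  exact (hf.zero_iff _).2 (A.mem_boundary_coe.2 hb)

namespace Slice

variable (S : A.Slice f)

theorem bdryAct_bdryLift (hf : IsBoundaryDefining (k := k) f) (p₀ : Bdry k M) {p : Bdry k M}
    (hp : A.bdryToU p ∈ S.W) :
    A.bdryAct (S.w (A.bdryToU p)) (S.bdryLift p₀ (S.s (A.bdryToU p))) = p := by
  apply Subtype.ext
  rw [A.bdryAct_val, S.bdryToU_bdryLift hf p₀ (S.mem_B _ hp)]
  have h1 := S.eq_smul _ hp
  rw [f_bdryToU hf] at h1
  exact congrArg Subtype.val h1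

/-- The factor `a₀⁻¹` turns the branch cut of `arg` away from the phase `a₀`; letting `a₀` vary
covers whole orbits by charts. -/
theorem isOpen_phase_ne (a₀ : Circle) : IsOpen {p : Bdry k M | A.bdryToU p ∈ S.W ∧
    ((a₀⁻¹ * S.w (A.bdryToU p) : Circle) : ℂ) ∈ Complex.slitPlane} := by
  have h1 : ContinuousOn (fun p : Bdry k M => ((a₀⁻¹ * S.w (A.bdryToU p) : Circle) : ℂ))
      (A.bdryToU ⁻¹' S.W) :=
    contMDiff_circle_coe.continuous.comp_continuousOn (continuousOn_const.mul
      (S.smooth_w.continuousOn.comp A.contMDiff_bdryToU.continuous.continuousOn fun p hp => hp))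
  exact h1.isOpen_inter_preimage (S.isOpen.preimage A.contMDiff_bdryToU.continuous)
    Complex.isOpen_slitPlane

theorem contMDiffOn_phase (a₀ : Circle) : ContMDiffOn (𝓡 (k + 1)) 𝓘(ℝ, ℝ) ∞
    (fun p : Bdry k M => ((a₀⁻¹ * S.w (A.bdryToU p) : Circle) : ℂ).arg)
    {p : Bdry k M | A.bdryToU p ∈ S.W ∧
      ((a₀⁻¹ * S.w (A.bdryToU p) : Circle) : ℂ) ∈ Complex.slitPlane} := by
  intro p hp
  have h1 : ContMDiffAt (𝓡 (k + 1)) (𝓡 1) ∞ (fun p : Bdry k M => S.w (A.bdryToU p)) p :=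
    (S.smooth_w.contMDiffAt (S.isOpen.mem_nhds hp.1)).comp p A.contMDiff_bdryToU.contMDiffAt
  have h2 : ContMDiffAt (𝓡 (k + 1)) (𝓡 1) ∞ (fun p : Bdry k M => a₀⁻¹ * S.w (A.bdryToU p)) p :=
    contMDiffAt_const.mul h1
  exact ((contDiffAt_arg hp.2).contMDiffAt.comp p
    (contMDiff_circle_coe.contMDiffAt.comp p h2)).contMDiffWithinAt

theorem contMDiffOn_bdryAct_bdryLift (hf : IsBoundaryDefining (k := k) f) (p₀ : Bdry k M)
    (a₀ : Circle) : ContMDiffOn 𝓘(ℝ, EuclideanSpace ℝ (Fin k) × ℝ) (𝓡 (k + 1)) ∞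
      (fun y => A.bdryAct (a₀ * Circle.exp y.2) (S.bdryLift p₀ y.1)) (S.B ×ˢ univ) := by
  intro y hy
  refine contMDiffWithinAt_bdry ?_
  have h0 : ContMDiffWithinAt 𝓘(ℝ, EuclideanSpace ℝ (Fin k) × ℝ) 𝓘(ℝ, EuclideanSpace ℝ (Fin k)) ∞
      (fun y : EuclideanSpace ℝ (Fin k) × ℝ => y.1) (S.B ×ˢ univ) y :=
    contDiff_fst.contMDiff.contMDiffAt.contMDiffWithinAt
  have h1 : ContMDiffWithinAt 𝓘(ℝ, EuclideanSpace ℝ (Fin k) × ℝ) (𝓡∂ (k + 2)) ∞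
      (fun y : EuclideanSpace ℝ (Fin k) × ℝ => S.τ (y.1, 0)) (S.B ×ˢ univ) y :=
    (S.contMDiffOn_τ_zero y.1 hy.1).comp y h0 fun z hz => hz.1
  have h2 : ContMDiffWithinAt 𝓘(ℝ, EuclideanSpace ℝ (Fin k) × ℝ) (𝓡 1) ∞
      (fun y : EuclideanSpace ℝ (Fin k) × ℝ => a₀ * Circle.exp y.2) (S.B ×ˢ univ) y :=
    (contMDiffAt_const.mul (contMDiff_circleExp.contMDiffAt.comp y
      contDiff_snd.contMDiff.contMDiffAt)).contMDiffWithinAt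
  have h3 : ContMDiffWithinAt 𝓘(ℝ, EuclideanSpace ℝ (Fin k) × ℝ) (𝓡∂ (k + 2)) ∞
      (fun y : EuclideanSpace ℝ (Fin k) × ℝ => (a₀ * Circle.exp y.2) • S.τ (y.1, 0))
      (S.B ×ˢ univ) y :=
    A.contMDiff_smul'.contMDiffAt.comp_contMDiffWithinAt y (h2.prodMk h1)
  have h4 := contMDiff_subtype_val.contMDiffAt.comp_contMDiffWithinAt y h3
  refine h4.congr_of_mem (fun z hz => ?_) hy
  rw [A.bdryAct_val, S.bdryToU_bdryLift hf p₀ hz.1]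
  rfl

/-- The chart of the boundary adapted to the quotient map `∂M → M_red`. -/
def bdrySliceChart (hf : IsBoundaryDefining (k := k) f) (p₀ : Bdry k M) (a₀ : Circle) :
    OpenPartialHomeomorph (Bdry k M) (EuclideanSpace ℝ (Fin (k + 1))) where
  toFun p := bdryModelEquiv k (S.s (A.bdryToU p),
    ((a₀⁻¹ * S.w (A.bdryToU p) : Circle) : ℂ).arg)
  invFun y := A.bdryAct (a₀ * Circle.exp ((bdryModelEquiv k).symm y).2)
    (S.bdryLift p₀ ((bdryModelEquiv k).symm y).1)
  source := {p | A.bdryToU p ∈ S.W ∧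
    ((a₀⁻¹ * S.w (A.bdryToU p) : Circle) : ℂ) ∈ Complex.slitPlane}
  target := (bdryModelEquiv k).symm ⁻¹' (S.B ×ˢ Ioo (-Real.pi) Real.pi)
  map_source' p hp := by
    rw [mem_preimage, ContinuousLinearEquiv.symm_apply_apply]
    refine ⟨S.mem_B _ hp.1, Complex.neg_pi_lt_arg _, lt_of_le_of_ne (Complex.arg_le_pi _) ?_⟩
    exact (Complex.mem_slitPlane_iff_arg.1 hp.2).1
  map_target' y hy := by
    have h1 := S.bdryToU_bdryLift hf p₀ hy.1
    have h2 := S.τ_mem _ (S.zero_mem hy.1)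
    refine ⟨?_, ?_⟩
    · rw [bdryToU_bdryAct, h1]
      exact S.smul_mem _ _ h2
    · rw [bdryToU_bdryAct, h1, S.w_smul _ _ h2, S.w_τ _ (S.zero_mem hy.1), mul_one,
        inv_mul_cancel_left, Complex.mem_slitPlane_iff_arg]
      refine ⟨?_, Circle.coe_ne_zero _⟩
      rw [Circle.arg_exp hy.2.1 hy.2.2.le]
      exact hy.2.2.ne
  left_inv' p hp := by
    simp only [ContinuousLinearEquiv.symm_apply_apply]
    rw [Circle.exp_arg, mul_inv_cancel_left]
    exact S.bdryAct_bdryLift hf p₀ hp.1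
  right_inv' y hy := by
    have h1 := S.bdryToU_bdryLift hf p₀ hy.1
    have h2 := S.τ_mem _ (S.zero_mem hy.1)
    rw [bdryToU_bdryAct, h1, S.w_smul _ _ h2, S.w_τ _ (S.zero_mem hy.1), mul_one,
        inv_mul_cancel_left, Circle.arg_exp hy.2.1 hy.2.2.le, S.s_smul _ _ h2,
        S.s_τ _ (S.zero_mem hy.1)]
    exact (bdryModelEquiv k).apply_symm_apply y
  open_source := S.isOpen_phase_ne a₀
  open_target := (S.isOpen_B.prod isOpen_Ioo).preimage (bdryModelEquiv k).symm.continuous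
  continuousOn_toFun := (bdryModelEquiv k).continuous.comp_continuousOn
    ((S.smooth_s.continuousOn.comp A.contMDiff_bdryToU.continuous.continuousOn
      fun p hp => hp.1).prodMk (S.contMDiffOn_phase a₀).continuousOn)
  continuousOn_invFun := (S.contMDiffOn_bdryAct_bdryLift hf p₀ a₀).continuousOn.comp
    (bdryModelEquiv k).symm.continuous.continuousOn fun y hy => ⟨hy.1, mem_univ _⟩

theorem bdrySliceChart_mem_maximalAtlas (hf : IsBoundaryDefining (k := k) f) (p₀ : Bdry k M)
    (a₀ : Circle) :
    S.bdrySliceChart hf p₀ a₀ ∈ IsManifold.maximalAtlas (𝓡 (k + 1)) ∞ (Bdry k M) := by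
  refine OpenPartialHomeomorph.mem_maximalAtlas_of_contMDiffOn _ ?_ ?_
  · refine (bdryModelEquiv k).contDiff.contMDiff.comp_contMDiffOn
      (ContMDiffOn.prodMk_space (fun p hp => ?_) (S.contMDiffOn_phase a₀))
    exact (S.contMDiffAt_s_bdryToU hp.1).contMDiffWithinAt
  · exact (S.contMDiffOn_bdryAct_bdryLift hf p₀ a₀).comp
      (bdryModelEquiv k).symm.contDiff.contMDiff.contMDiffOn fun y hy => ⟨hy.1, mem_univ _⟩

end Slice

variable [T2Space M] [SecondCountableTopology M]

theorem exists_slice_bdry (hf : IsBoundaryDefining (k := k) f)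
    (hinv : ∀ (a : Circle) (x : A.U), f (a • x) = f x) {V : Set A.U} (hV : A.IsInvariantNhd V)
    (p : Bdry k M) : ∃ S : A.Slice f, A.bdryToU p ∈ S.W ∧ S.W ⊆ V :=
  A.exists_slice hf hinv hV _ (A.mem_boundary_coe.2 p.2)

omit [T2Space M] [SecondCountableTopology M] in
theorem isInvariantNhd_univ (A : BoundaryCircleAction k M) : A.IsInvariantNhd univ :=
  ⟨isOpen_univ, fun _ _ => mem_univ _, fun _ _ _ => mem_univ _⟩

theorem exists_isCompatibleChart_red (hf : IsBoundaryDefining (k := k) f)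
    (hinv : ∀ (a : Circle) (x : A.U), f (a • x) = f x) (q : A.Red) :
    ∃ φ : OpenPartialHomeomorph A.Red (EuclideanSpace ℝ (Fin k)), q ∈ φ.source ∧
      IsCompatibleChart A.RedSmoothAt φ := by
  obtain ⟨p, rfl⟩ := A.isQuotientMap_toRed.surjective q
  obtain ⟨S, hp, -⟩ := exists_slice_bdry hf hinv A.isInvariantNhd_univ p
  exact ⟨S.redChart hf p, ⟨p, hp, rfl⟩, S.isCompatibleChart_redChart hf p⟩

theorem exists_isCompatibleChart_cut (hf : IsBoundaryDefining (k := k) f)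
    (hinv : ∀ (a : Circle) (x : A.U), f (a • x) = f x) (q : A.Cut) :
    ∃ φ : OpenPartialHomeomorph A.Cut (EuclideanSpace ℝ (Fin (k + 2))), q ∈ φ.source ∧
      IsCompatibleChart (A.CutSmoothAt f) φ := by
  obtain ⟨x, rfl⟩ := A.isQuotientMap_toCut.surjective q
  by_cases hx : x ∈ (𝓡∂ (k + 2)).boundary M
  · obtain ⟨S, hp, -⟩ := exists_slice_bdry hf hinv A.isInvariantNhd_univ ⟨x, hx⟩
    exact ⟨S.cutChart hf hinv, S.mem_cutChart_source hf hinv hp,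
      S.isCompatibleChart_cutChart hf hinv⟩
  · rw [← mem_compl_iff, ModelWithCorners.compl_boundary] at hx
    exact ⟨A.interiorChart x, ⟨x, ⟨mem_extChartAt_source x, hx⟩, rfl⟩,
      A.isCompatibleChart_interiorChart f x⟩

/-- The manifold structure of the reduced space. -/
@[reducible] def redChartedSpace (hf : IsBoundaryDefining (k := k) f)
    (hinv : ∀ (a : Circle) (x : A.U), f (a • x) = f x) :
    ChartedSpace (EuclideanSpace ℝ (Fin k)) A.Red :=
  chartedSpaceOfCompatible A.RedSmoothAt
    (fun q => (exists_isCompatibleChart_red hf hinv q).choose)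
    (fun q => (exists_isCompatibleChart_red hf hinv q).choose_spec.1)
    (fun q => (exists_isCompatibleChart_red hf hinv q).choose_spec.2)

/-- The manifold structure of the cut space. -/
@[reducible] def cutChartedSpace (hf : IsBoundaryDefining (k := k) f)
    (hinv : ∀ (a : Circle) (x : A.U), f (a • x) = f x) :
    ChartedSpace (EuclideanSpace ℝ (Fin (k + 2))) A.Cut :=
  chartedSpaceOfCompatible (A.CutSmoothAt f)
    (fun q => (exists_isCompatibleChart_cut hf hinv q).choose)
    (fun q => (exists_isCompatibleChart_cut hf hinv q).choose_spec.1)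
    (fun q => (exists_isCompatibleChart_cut hf hinv q).choose_spec.2)

/-- In the coordinates (`s`, phase) upstairs and `s` downstairs the quotient map is a linear
projection with kernel `ℝ`. -/
theorem isSubmersion_toRed [ChartedSpace (EuclideanSpace ℝ (Fin k)) A.Red]
    (hr : ∀ φ, φ ∈ atlas (EuclideanSpace ℝ (Fin k)) A.Red ↔ IsCompatibleChart A.RedSmoothAt φ)
    (hf : IsBoundaryDefining (k := k) f) (hinv : ∀ (a : Circle) (x : A.U), f (a • x) = f x) :
    IsSubmersion (𝓡 (k + 1)) (𝓡 k) ∞ A.toRed := by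
  have : IsManifold (𝓡 k) ∞ A.Red := isManifold_of_compatible fun φ hφ => (hr φ).1 hφ
  refine IsSubmersionOfComplement.isSubmersion (F := ℝ) fun p => ?_
  obtain ⟨S, hp, -⟩ := exists_slice_bdry hf hinv A.isInvariantNhd_univ p
  refine IsSubmersionAtOfComplement.mk_of_charts (bdryModelEquiv k).symm
    (S.bdrySliceChart hf p (S.w (A.bdryToU p))) (S.redChart hf p) ⟨hp, ?_⟩ ⟨p, hp, rfl⟩
    (S.bdrySliceChart_mem_maximalAtlas hf p _)
    (IsManifold.subset_maximalAtlas ((hr _).2 (S.isCompatibleChart_redChart hf p)))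
    (fun p' hp' => ⟨p', hp'.1, rfl⟩) ?_
  · rw [inv_mul_cancel]; simp
  · intro y hy
    have hy' : y ∈ (S.bdrySliceChart hf p (S.w (A.bdryToU p))).target := by simpa using hy
    set p' := (S.bdrySliceChart hf p (S.w (A.bdryToU p))).symm y with hp'
    have h1 := (S.bdrySliceChart hf p (S.w (A.bdryToU p))).map_target hy'
    have h2 := (S.bdrySliceChart hf p (S.w (A.bdryToU p))).right_inv hy'
    have h3 : S.redChart hf p (A.toRed p') = S.s (A.bdryToU p') := S.redChart_apply hf p h1.1
    have h4 : bdryModelEquiv k (S.s (A.bdryToU p'),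
      (((S.w (A.bdryToU p))⁻¹ * S.w (A.bdryToU p') : Circle) : ℂ).arg) = y := h2
    change S.redChart hf p (A.toRed p') = ((bdryModelEquiv k).symm y).1
    rw [h3, ← h4, ContinuousLinearEquiv.symm_apply_apply]

theorem isReducedManifold [ChartedSpace (EuclideanSpace ℝ (Fin k)) A.Red]
    [ChartedSpace (EuclideanSpace ℝ (Fin (k + 2))) A.Cut]
    (hr : ∀ φ, φ ∈ atlas (EuclideanSpace ℝ (Fin k)) A.Red ↔ IsCompatibleChart A.RedSmoothAt φ)
    (hf : IsBoundaryDefining (k := k) f) (hinv : ∀ (a : Circle) (x : A.U), f (a • x) = f x) :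
    A.IsReducedManifold where
  t2 := A.t2Space_red
  secondCountable :=
    have := A.secondCountable_cut
    A.isClosedEmbedding_redToCut.isEmbedding.secondCountableTopology
  isManifold := isManifold_of_compatible fun φ hφ => (hr φ).1 hφ
  submersion := isSubmersion_toRed hr hf hinv

omit [T2Space M] [SecondCountableTopology M] in
theorem Slice.cutChart_redToCut (S : A.Slice f) (hf : IsBoundaryDefining (k := k) f)
    (hinv : ∀ (a : Circle) (x : A.U), f (a • x) = f x) {p : Bdry k M} (hp : A.bdryToU p ∈ S.W) :
    S.cutChart hf hinv (A.redToCut (A.toRed p)) = modelEquiv k (S.s (A.bdryToU p), 0) := by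
  refine (S.cutChart_apply hf hinv hp).trans ?_
  rw [coord, f_bdryToU hf]
  simp

/-- In slice charts the inclusion is `s ↦ (s, 0)`, with complement `ℂ`. -/
theorem isSmoothEmbedding_redToCut [ChartedSpace (EuclideanSpace ℝ (Fin k)) A.Red]
    [ChartedSpace (EuclideanSpace ℝ (Fin (k + 2))) A.Cut]
    (hr : ∀ φ, φ ∈ atlas (EuclideanSpace ℝ (Fin k)) A.Red ↔ IsCompatibleChart A.RedSmoothAt φ)
    (hc : ∀ φ, φ ∈ atlas (EuclideanSpace ℝ (Fin (k + 2))) A.Cut ↔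
      IsCompatibleChart (A.CutSmoothAt f) φ)
    (hf : IsBoundaryDefining (k := k) f) (hinv : ∀ (a : Circle) (x : A.U), f (a • x) = f x) :
    IsSmoothEmbedding (𝓡 k) (𝓡 (k + 2)) ∞ A.redToCut := by
  have : IsManifold (𝓡 k) ∞ A.Red := isManifold_of_compatible fun φ hφ => (hr φ).1 hφ
  have : IsManifold (𝓡 (k + 2)) ∞ A.Cut := isManifold_of_compatible fun φ hφ => (hc φ).1 hφ
  refine ⟨IsImmersionOfComplement.isImmersion (F := ℂ) fun q => ?_,
    A.isClosedEmbedding_redToCut.isEmbedding⟩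
  obtain ⟨p, rfl⟩ := A.isQuotientMap_toRed.surjective q
  obtain ⟨S, hp, -⟩ := exists_slice_bdry hf hinv A.isInvariantNhd_univ p
  refine IsImmersionAtOfComplement.mk_of_charts (modelEquiv k) (S.redChart hf p)
    (S.cutChart hf hinv) ⟨p, hp, rfl⟩ (S.mem_cutChart_source hf hinv hp)
    (IsManifold.subset_maximalAtlas ((hr _).2 (S.isCompatibleChart_redChart hf p)))
    (IsManifold.subset_maximalAtlas ((hc _).2 (S.isCompatibleChart_cutChart hf hinv))) ?_ ?_
  · rintro _ ⟨p', hp', rfl⟩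
    exact S.mem_cutChart_source hf hinv hp'
  · intro y hy
    have hy' : y ∈ S.B := by simpa [S.redChart_target] using hy
    have h1 := S.bdryToU_bdryLift hf p hy'
    have h2 : A.bdryToU (S.bdryLift p y) ∈ S.W := by rw [h1]; exact S.τ_mem _ (S.zero_mem hy')
    have h3 := S.cutChart_redToCut hf hinv h2
    rw [h1, S.s_τ _ (S.zero_mem hy')] at h3
    exact h3

end BoundaryCircleAction

end

/-! ### The smooth functions on the cut space are those of `ℱ_M` -/

noncomputable section

/-- Since `f₂` grows along `γ` at unit speed, `γ` leaves the boundary with positive normal velocity.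
Then `f₁` also grows at positive speed, and that speed is `u 0`. -/
theorem IsBoundaryDefining.pos_of_curve {k : ℕ} {N : Type*} [TopologicalSpace N]
    [ChartedSpace (EuclideanHalfSpace (k + 2)) N] [IsManifold (𝓡∂ (k + 2)) ∞ N] {f₁ f₂ : N → ℝ}
    (hf₁ : IsBoundaryDefining (k := k) f₁) (hf₂ : IsBoundaryDefining (k := k) f₂) {δ : ℝ}
    (hδ : 0 < δ) {γ : ℝ → N} (hγ : ContMDiffWithinAt 𝓘(ℝ, ℝ) (𝓡∂ (k + 2)) ∞ γ (Ico 0 δ) 0)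
    (h0 : γ 0 ∈ (𝓡∂ (k + 2)).boundary N) (h2 : ∀ᶠ t in 𝓝[Ico 0 δ] 0, f₂ (γ t) = t) {u : ℝ → ℝ}
    (hu : ContinuousWithinAt u (Ico 0 δ) 0) (h1 : ∀ t ∈ Ico 0 δ, f₁ (γ t) = t * u t) :
    0 < u 0 := by
  have h00 : (0 : ℝ) ∈ Ico 0 δ := ⟨le_rfl, hδ⟩
  obtain ⟨c₁, hc₁, hd₁⟩ := hf₁.exists_hasFDerivWithinAt h0
  obtain ⟨c₂, hc₂, hd₂⟩ := hf₂.exists_hasFDerivWithinAt h0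
  have hg : ContMDiffWithinAt 𝓘(ℝ, ℝ) 𝓘(ℝ, EuclideanSpace ℝ (Fin (k + 2))) ∞
      (fun t => extChartAt (𝓡∂ (k + 2)) (γ 0) (γ t)) (Ico 0 δ) 0 :=
    contMDiffAt_extChartAt.comp_contMDiffWithinAt 0 hγ
  have hg' := (hg.contDiffWithinAt.differentiableWithinAt (by simp)).hasDerivWithinAt
  set v := derivWithin (fun t => extChartAt (𝓡∂ (k + 2)) (γ 0) (γ t)) (Ico 0 δ) 0
  have hm : MapsTo (fun t => extChartAt (𝓡∂ (k + 2)) (γ 0) (γ t)) (Ico 0 δ)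
      (range (𝓡∂ (k + 2))) := fun t _ => mem_range_self _
  have he₁ := hd₁.comp_hasDerivWithinAt (0 : ℝ) hg' hm
  have he₂ := hd₂.comp_hasDerivWithinAt (0 : ℝ) hg' hm
  have hs : ∀ᶠ t in 𝓝[Ico 0 δ] 0, γ t ∈ (extChartAt (𝓡∂ (k + 2)) (γ 0)).source :=
    hγ.continuousWithinAt.eventually_mem (extChartAt_source_mem_nhds _)
  have hi₁ : HasDerivWithinAt (fun t => t * u t) ((c₁ • normalCoord k) v) (Ico 0 δ) 0 := by
    refine he₁.congr_of_eventuallyEq_of_mem ?_ h00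
    filter_upwards [hs, self_mem_nhdsWithin] with t ht ht'
    simp only [Function.comp_apply]
    rw [(extChartAt (𝓡∂ (k + 2)) (γ 0)).left_inv ht, h1 t ht']
  have hi₂ : HasDerivWithinAt (fun t => t) ((c₂ • normalCoord k) v) (Ico 0 δ) 0 := by
    refine he₂.congr_of_eventuallyEq_of_mem ?_ h00
    filter_upwards [hs, h2] with t ht ht'
    simp only [Function.comp_apply]
    rw [(extChartAt (𝓡∂ (k + 2)) (γ 0)).left_inv ht, ht']
  have hu' : HasDerivWithinAt (fun t => t * u t) (u 0) (Ico 0 δ) 0 := by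
    rw [hasDerivWithinAt_iff_tendsto_slope]
    have h3 : Filter.Tendsto u (𝓝[Ico 0 δ \ {0}] 0) (𝓝 (u 0)) :=
      hu.tendsto.mono_left (nhdsWithin_mono _ sdiff_subset)
    refine h3.congr' ?_
    filter_upwards [self_mem_nhdsWithin] with t ht
    have ht0 : t ≠ 0 := ht.2
    simp [slope_def_field, ht0]
  have hU : UniqueDiffWithinAt ℝ (Ico 0 δ) 0 := uniqueDiffOn_Ico 0 δ 0 h00
  have e₁ := hU.eq_deriv _ hi₁ hu'
  have e₂ := hU.eq_deriv _ hi₂ (hasDerivWithinAt_id 0 _)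
  rw [← e₁]
  have e₃ : c₂ * normalCoord k v = 1 := e₂
  have e₄ : 0 < normalCoord k v := by
    by_contra hn
    nlinarith [not_lt.1 hn]
  exact mul_pos hc₁ e₄

namespace BoundaryCircleAction

variable {k : ℕ} {M : Type*} [TopologicalSpace M] [ChartedSpace (EuclideanHalfSpace (k + 2)) M]
  [IsManifold (𝓡∂ (k + 2)) ∞ M] {A : BoundaryCircleAction k M} {f : A.U → ℝ}

theorem IsInvariantBoundaryDefining.isBoundaryDefining {f₀ : M → ℝ}
    (h : A.IsInvariantBoundaryDefining f₀) : IsBoundaryDefining (k := k) f₀ :=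
  ⟨h.smooth, h.nonneg, h.zero_iff, h.deriv_ne_zero⟩

theorem IsInvariantNhd.inter {V V' : Set A.U} (hV : A.IsInvariantNhd V)
    (hV' : A.IsInvariantNhd V') : A.IsInvariantNhd (V ∩ V') :=
  ⟨hV.isOpen.inter hV'.isOpen, fun x hx => ⟨hV.boundary_subset x hx, hV'.boundary_subset x hx⟩,
    fun a x hx => ⟨hV.smul_mem a x hx.1, hV'.smul_mem a x hx.2⟩⟩

theorem isOpen_interior : IsOpen ((𝓡∂ (k + 2)).interior M) := by
  rw [← ModelWithCorners.compl_boundary]; exact isClosed_boundary.isOpen_compl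

variable [T2Space M] [SecondCountableTopology M]

/-- The point is independence of the boundary defining function. On the slice `f₁ = t u(s, t)` with
`u > 0` at `t = 0`; hence `√f₁` times the phase is `√u(s, |z|²) z`, which is smooth although `√f₁`
is not. -/
theorem cutSmoothAt_of_mem_cutFunctions (hf : IsBoundaryDefining (k := k) f)
    (hinv : ∀ (a : Circle) (x : A.U), f (a • x) = f x) {h : A.Cut → ℝ} (hh : h ∈ A.cutFunctions)
    (q : A.Cut) : A.CutSmoothAt f h q := by
  obtain ⟨hint, f₁, hf₁, V, hV, H, hH, hHa, hHe⟩ := hh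
  obtain ⟨V₁, hV₁, hf₁V⟩ := hf₁.invariant
  obtain ⟨f₀, V₀, hf₀, hV₀, hf₀f⟩ := A.exists_extension hf hinv
  obtain ⟨x, rfl⟩ := A.isQuotientMap_toCut.surjective q
  by_cases hx : x ∈ (𝓡∂ (k + 2)).boundary M
  swap
  · rw [← mem_compl_iff, ModelWithCorners.compl_boundary] at hx
    refine ⟨fun y hy hyx => hint.contMDiffAt (isOpen_interior.mem_nhds hy), fun p hp hpx => ?_⟩
    have h2 := A.eq_of_toCut_eq hx hpx.symm
    exact absurd (h2 ▸ hx) (notMem_interior_of_mem_boundary hp)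
  obtain ⟨S, hp, hSV⟩ := exists_slice_bdry hf hinv ((hV.inter hV₁).inter hV₀) ⟨x, hx⟩
  set p : Bdry k M := ⟨x, hx⟩
  set y := S.coord (A.bdryToU p) with hy
  have hyd : y ∈ S.dom := S.coord_mem hf hp
  have hy2 : y.2 = 0 := by rw [hy, Slice.coord, f_bdryToU hf]; simp
  have hxy : A.toCut x = A.toCut (S.lift y).1 := (S.toCut_lift_coord hf hp).symm
  rw [hxy, S.cutSmoothAt_iff hf hinv hyd]
  have hτM : ContMDiffOn 𝓘(ℝ, EuclideanSpace ℝ (Fin k) × ℝ) (𝓡∂ (k + 2)) ∞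
      (fun z => (S.τ z).1) (S.B ×ˢ Ico 0 S.δ) :=
    contMDiff_subtype_val.comp_contMDiffOn S.smooth_τ
  have hτ0 : ∀ s ∈ S.B, (S.τ (s, 0)).1 ∈ (𝓡∂ (k + 2)).boundary M := fun s hs => by
    rw [← A.mem_boundary_coe, ← hf.zero_iff, S.f_τ _ (S.zero_mem hs)]
  obtain ⟨u, hu, hue⟩ := ContDiffOn.exists_eq_smul_of_eq_zero S.convex_B S.isOpen_B
    (f := fun z => f₁ (S.τ z).1) (hf₁.smooth.comp_contMDiffOn hτM).contDiffOn
    fun s hs => (hf₁.zero_iff _).2 (hτ0 s hs)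
  have hu0 : 0 < u (y.1, 0) := by
    have hl : ContMDiff 𝓘(ℝ, ℝ) 𝓘(ℝ, EuclideanSpace ℝ (Fin k) × ℝ) ∞
        (fun t : ℝ => (y.1, t)) := (contDiff_prodMk_right y.1).contMDiff
    refine hf₁.isBoundaryDefining.pos_of_curve hf₀.isBoundaryDefining S.δ_pos
      (γ := fun t => (S.τ (y.1, t)).1) (u := fun t => u (y.1, t))
      ((hτM.comp hl.contMDiffOn fun t ht => ⟨hyd.1, ht⟩) 0 ⟨le_rfl, S.δ_pos⟩)
      (hτ0 _ hyd.1) ?_ ?_ fun t ht => hue _ hyd.1 t ht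
    · filter_upwards [self_mem_nhdsWithin] with t ht
      have ht' : (y.1, t) ∈ S.B ×ˢ Ico 0 S.δ := ⟨hyd.1, ht⟩
      rw [hf₀f _ (hSV (S.τ_mem _ ht')).2, S.f_τ _ ht']
    · exact (hu.continuousOn.comp (Continuous.prodMk_right y.1).continuousOn
        fun t ht => ⟨hyd.1, ht⟩) 0 ⟨le_rfl, S.δ_pos⟩
  have hsq : ContDiff ℝ ∞ fun z : EuclideanSpace ℝ (Fin k) × ℂ => (z.1, ‖z.2‖ ^ 2) :=
    contDiff_fst.prodMk (contDiff_snd.norm_sq ℝ)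
  have hus : ContDiffAt ℝ ∞ (fun z : EuclideanSpace ℝ (Fin k) × ℂ => u (z.1, ‖z.2‖ ^ 2)) y :=
    (hu.comp hsq.contDiffOn fun z hz => S.sq_mem hz).contDiffAt (S.isOpen_dom.mem_nhds hyd)
  have hu0' : u (y.1, ‖y.2‖ ^ 2) ≠ 0 := by rw [hy2]; simpa using hu0.ne'
  have hroot : ContDiffAt ℝ ∞ (fun z : EuclideanSpace ℝ (Fin k) × ℂ =>
      ((√(u (z.1, ‖z.2‖ ^ 2)) : ℝ) : ℂ) * z.2) y :=
    (Complex.ofRealCLM.contDiff.contDiffAt.comp y (hus.sqrt hu0')).mul contDiffAt_snd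
  have hHy : ContMDiffAt ((𝓡∂ (k + 2)).prod 𝓘(ℝ, ℂ)) 𝓘(ℝ, ℝ) ∞ H
      (S.τ (y.1, ‖y.2‖ ^ 2), ((√(u (y.1, ‖y.2‖ ^ 2)) : ℝ) : ℂ) * y.2) :=
    hH.contMDiffAt (prod_mem_nhds (hV.isOpen.mem_nhds (hSV (S.τ_mem _ (S.sq_mem hyd))).1.1)
      Filter.univ_mem)
  have hcomp := hHy.comp y ((S.contMDiffOn_τ_sq.contMDiffAt (S.isOpen_dom.mem_nhds hyd)).prodMk
    hroot.contMDiffAt)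
  refine hcomp.contDiffAt.congr_of_eventuallyEq ?_
  filter_upwards [S.isOpen_dom.mem_nhds hyd] with z hz
  have hzW := S.τ_mem _ (S.sq_mem hz)
  have hzV := hSV hzW
  simp only [Function.comp_apply]
  -- Equivariance moves the phase of `z` from the first argument of `H` to the second, where it
  -- recombines with `|z|` to `z`.
  rw [hHe _ (hSV (S.lift_mem hz)).1.1, Slice.lift, hHa _ _ hzV.1.1, hf₁V _ _ hzV.1.2,
    show f₁ (S.τ (z.1, ‖z.2‖ ^ 2)).1 = ‖z.2‖ ^ 2 • u (z.1, ‖z.2‖ ^ 2) from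
      hue _ hz.1 _ ⟨by positivity, hz.2⟩, smul_eq_mul, Real.sqrt_mul (by positivity),
    Real.sqrt_sq (norm_nonneg _)]
  congr 2
  rw [Complex.ofReal_mul, mul_comm, mul_right_comm, norm_mul_unitPart, mul_comm]

/-- Values are prescribed only where `|z| = √f`. Off this closed set any function will do; over the
interior `z` determines the rotation `a`, namely as its phase; at the boundary slice coordinates
resolve the ambiguity at `z = 0`. -/
theorem exists_smooth_local_extension (hf : IsBoundaryDefining (k := k) f)
    (hinv : ∀ (a : Circle) (x : A.U), f (a • x) = f x) {h : A.Cut → ℝ}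
    (hh : ∀ q, A.CutSmoothAt f h q) (x₀ : A.U × ℂ) :
    ∃ O ∈ 𝓝 x₀, ∃ g : A.U × ℂ → ℝ,
      ContMDiffOn ((𝓡∂ (k + 2)).prod 𝓘(ℝ, ℂ)) 𝓘(ℝ, ℝ) ∞ g O ∧
      ∀ x ∈ O, ∀ a : Circle, x.2 = a * (√(f x.1) : ℝ) → g x = h (A.toCut (a • x.1).1) := by
  have hfs : Continuous fun x : A.U × ℂ => f x.1 := hf.smooth.continuous.comp continuous_fst
  have key : ∀ x : A.U × ℂ, ∀ a : Circle, x.2 = a * (√(f x.1) : ℝ) → ‖x.2‖ = √(f x.1) := by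
    intro x a hx
    rw [hx, norm_mul, Circle.norm_coe, one_mul, Complex.norm_real,
      Real.norm_of_nonneg (Real.sqrt_nonneg _)]
  by_cases h1 : ‖x₀.2‖ = √(f x₀.1)
  swap
  · refine ⟨{x | ‖x.2‖ ≠ √(f x.1)}, (isOpen_ne_fun (continuous_snd.norm)
      (Real.continuous_sqrt.comp hfs)).mem_nhds h1, fun _ => 0, contMDiffOn_const,
      fun x hx a hxa => absurd (key x a hxa) hx⟩
  rcases (hf.nonneg x₀.1).lt_or_eq with h0 | h0
  · refine ⟨{x | 0 < f x.1} ∩ {x | x.2 ≠ 0}, Filter.inter_mem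
      ((isOpen_lt continuous_const hfs).mem_nhds h0) ((isOpen_ne_fun continuous_snd
        continuous_const).mem_nhds ?_), fun x => h (A.toCut (unitPart x.2 • x.1).1), ?_, ?_⟩
    · change x₀.2 ≠ 0
      rw [← norm_pos_iff, h1]; exact Real.sqrt_pos.2 h0
    · rintro x ⟨hx1, hx2⟩
      have hx3 : (unitPart x.2 • x.1).1 ∈ (𝓡∂ (k + 2)).interior M := by
        rw [← ModelWithCorners.compl_boundary]
        intro hb
        rw [A.smul_mem_boundary_iff, ← A.mem_boundary_coe, ← hf.zero_iff] at hb
        exact (ne_of_gt hx1) hb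
      have h4 : ContMDiffAt ((𝓡∂ (k + 2)).prod 𝓘(ℝ, ℂ)) (𝓡∂ (k + 2)) ∞
          (fun x : A.U × ℂ => unitPart x.2 • x.1) x :=
        A.contMDiff_smul'.contMDiffAt.comp x (((contMDiffAt_unitPart hx2).comp x
          contMDiffAt_snd).prodMk contMDiffAt_fst)
      exact (((hh _).1 _ hx3 rfl).comp x
        (contMDiff_subtype_val.contMDiffAt.comp x h4)).contMDiffWithinAt
    · rintro x ⟨hx1, hx2⟩ a hxa
      have : unitPart x.2 = a := unitPart_eq_of_mul_eq (Real.sqrt_pos.2 hx1)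
        (by rw [hxa, mul_comm])
      simp only [this]
  · have hb : x₀.1.1 ∈ (𝓡∂ (k + 2)).boundary M := by
      rw [← A.mem_boundary_coe, ← hf.zero_iff, ← h0]
    have hz : x₀.2 = 0 := by rw [← norm_eq_zero, h1, ← h0, Real.sqrt_zero]
    obtain ⟨S, hp, -⟩ := exists_slice_bdry hf hinv A.isInvariantNhd_univ ⟨x₀.1.1, hb⟩
    have hp' : x₀.1 ∈ S.W := hp
    have hF : ContDiffOn ℝ ∞ (fun y => h (A.toCut (S.lift y).1)) S.dom := fun y hy =>
      ((S.cutSmoothAt_iff hf hinv hy h).1 (hh _)).contDiffWithinAt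
    have hm : ContMDiffOn ((𝓡∂ (k + 2)).prod 𝓘(ℝ, ℂ)) 𝓘(ℝ, EuclideanSpace ℝ (Fin k) × ℂ) ∞
        (fun x : A.U × ℂ => (S.s x.1, (S.w x.1 : ℂ) * x.2)) (S.W ×ˢ univ) := fun x hx => by
      have hW := S.isOpen.mem_nhds hx.1
      refine (ContMDiffAt.prodMk_space ((S.smooth_s.contMDiffAt hW).comp x
        contMDiffAt_fst) (ContMDiffAt.complex_mul ?_ contMDiffAt_snd)).contMDiffWithinAt
      exact contMDiff_circle_coe.contMDiffAt.comp _ ((S.smooth_w.contMDiffAt hW).comp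
        x contMDiffAt_fst)
    refine ⟨(S.W ×ˢ univ) ∩ (fun x : A.U × ℂ => (S.s x.1, (S.w x.1 : ℂ) * x.2)) ⁻¹' S.dom,
      (hm.continuousOn.isOpen_inter_preimage (S.isOpen.prod isOpen_univ) S.isOpen_dom).mem_nhds
        ⟨⟨hp', mem_univ _⟩, S.mem_B _ hp', ?_⟩,
      fun x => h (A.toCut (S.lift (S.s x.1, (S.w x.1 : ℂ) * x.2)).1), ?_, ?_⟩
    · simp only [hz, mul_zero, norm_zero]
      simpa using S.δ_pos
    · exact hF.contMDiffOn.comp (hm.mono inter_subset_left) fun x hx => hx.2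
    · rintro x ⟨hx, -⟩ a hxa
      have hxW : x.1 ∈ S.W := hx.1
      have h4 : S.coord (a • x.1) = (S.s x.1, (S.w x.1 : ℂ) * x.2) := by
        rw [hxa, Slice.coord, hinv, S.s_smul a _ hxW, S.w_smul a _ hxW, Circle.coe_mul]
        congr 1; ring
      simp only [← h4, S.toCut_lift_coord hf (S.smul_mem a _ hxW)]

/-- Prescribing values is a convex condition at each point, so a partition of unity glues the local
extensions to some `G`. Averaging `G(e^{iθ} x, e^{-iθ} z)` over `θ` creates the equivariance and
keeps the prescribed values, which are already compatible with it. -/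
theorem mem_cutFunctions_of_cutSmoothAt (hf : IsBoundaryDefining (k := k) f)
    (hinv : ∀ (a : Circle) (x : A.U), f (a • x) = f x) {h : A.Cut → ℝ}
    (hh : ∀ q, A.CutSmoothAt f h q) : h ∈ A.cutFunctions := by
  obtain ⟨f₀, V₀, hf₀, hV₀, hf₀f⟩ := A.exists_extension hf hinv
  refine ⟨fun x hx => ((hh _).1 x hx rfl).contMDiffWithinAt, f₀, hf₀, V₀, hV₀, ?_⟩
  have : LocallyCompactSpace M := Manifold.locallyCompact_of_finiteDimensional (𝓡∂ (k + 2))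
  have : LocallyCompactSpace A.U := A.U.isOpen.locallyCompactSpace
  obtain ⟨G, hG⟩ := exists_contMDiffMap_forall_mem_convex_of_local (n := ⊤)
    ((𝓡∂ (k + 2)).prod 𝓘(ℝ, ℂ)) (M := A.U × ℂ) (F := ℝ)
    (t := fun x => {y | ∀ a : Circle, x.2 = a * (√(f x.1) : ℝ) → y = h (A.toCut (a • x.1).1)})
    (fun x y hy z hz α γ hα hγ hαγ a ha => by
      rw [hy a ha, hz a ha, ← add_smul, hαγ, one_smul])
    (fun x => exists_smooth_local_extension hf hinv hh x)
  have hsm : ContMDiff (𝓘(ℝ, ℝ).prod ((𝓡∂ (k + 2)).prod 𝓘(ℝ, ℂ))) 𝓘(ℝ, ℝ) ∞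
      (fun z : ℝ × (A.U × ℂ) => G (Circle.exp z.1 • z.2.1, ((Circle.exp z.1)⁻¹ : Circle) * z.2.2)) := by
    have e1 : ContMDiff (𝓘(ℝ, ℝ).prod ((𝓡∂ (k + 2)).prod 𝓘(ℝ, ℂ))) (𝓡 1) ∞
        (fun z : ℝ × (A.U × ℂ) => Circle.exp z.1) := contMDiff_circleExp.comp contMDiff_fst
    have e2 : ContMDiff (𝓘(ℝ, ℝ).prod ((𝓡∂ (k + 2)).prod 𝓘(ℝ, ℂ))) (𝓡∂ (k + 2)) ∞
        (fun z : ℝ × (A.U × ℂ) => Circle.exp z.1 • z.2.1) :=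
      A.contMDiff_smul'.comp (e1.prodMk (contMDiff_fst.comp contMDiff_snd))
    have e3 : ContMDiff (𝓘(ℝ, ℝ).prod ((𝓡∂ (k + 2)).prod 𝓘(ℝ, ℂ))) 𝓘(ℝ, ℂ) ∞
        (fun z : ℝ × (A.U × ℂ) => (((Circle.exp z.1)⁻¹ : Circle) : ℂ) * z.2.2) := fun z =>
      ContMDiffAt.complex_mul (contMDiff_circle_coe.contMDiffAt.comp z e1.inv.contMDiffAt)
        (contMDiff_snd.comp contMDiff_snd).contMDiffAt
    exact G.contMDiff.comp (e2.prodMk e3)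
  have hpi : (0 : ℝ) < 2 * Real.pi := Real.two_pi_pos
  refine ⟨fun x => (2 * Real.pi)⁻¹ • ∫ θ in (0 : ℝ)..2 * Real.pi,
    G (Circle.exp θ • x.1, ((Circle.exp θ)⁻¹ : Circle) * x.2), ?_, ?_, ?_⟩
  · exact ((contDiff_const_smul (2 * Real.pi)⁻¹).contMDiff.comp
      (contMDiff_intervalIntegral hsm hpi)).contMDiffOn
  · intro a x _ z
    have h1 := integral_circle_shift
      (fun b : Circle => G (b • x, ((b⁻¹ : Circle) : ℂ) * ((a : ℂ) * z))) a
    simp only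
    rw [← h1]
    congr 2
    ext θ
    rw [smul_smul, mul_inv, Circle.coe_mul, mul_assoc, ← mul_assoc ((a⁻¹ : Circle) : ℂ),
      ← Circle.coe_mul, inv_mul_cancel, Circle.coe_one, one_mul]
  · intro x hx
    have h1 : ∀ θ : ℝ, G (Circle.exp θ • x,
        ((Circle.exp θ)⁻¹ : Circle) * ((√(f₀ x.1) : ℝ) : ℂ)) = h (A.toCut x.1) := fun θ => by
      have := hG (Circle.exp θ • x, ((Circle.exp θ)⁻¹ : Circle) * ((√(f₀ x.1) : ℝ) : ℂ))
        (Circle.exp θ)⁻¹ (by rw [hinv, hf₀f x hx])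
      rwa [inv_smul_smul] at this
    simp only [h1]
    rw [intervalIntegral.integral_const, sub_zero, smul_smul, inv_mul_cancel₀ hpi.ne', one_smul]

theorem isCutManifold [ChartedSpace (EuclideanSpace ℝ (Fin (k + 2))) A.Cut]
    (hc : ∀ φ, φ ∈ atlas (EuclideanSpace ℝ (Fin (k + 2))) A.Cut ↔
      IsCompatibleChart (A.CutSmoothAt f) φ)
    (hf : IsBoundaryDefining (k := k) f) (hinv : ∀ (a : Circle) (x : A.U), f (a • x) = f x) :
    A.IsCutManifold where
  t2 := A.t2Space_cut
  secondCountable := A.secondCountable_cut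
  isManifold := isManifold_of_compatible fun φ hφ => (hc φ).1 hφ
  smooth_iff h := by
    have h1 : ContMDiff (𝓡 (k + 2)) 𝓘(ℝ, ℝ) ∞ h ↔ ∀ q, A.CutSmoothAt f h q :=
      forall_congr' fun q => contMDiffAt_iff_of_compatible fun φ hφ => (hc φ).1 hφ
    rw [h1]
    exact ⟨mem_cutFunctions_of_cutSmoothAt hf hinv,
      fun hh q => cutSmoothAt_of_mem_cutFunctions hf hinv hh q⟩

end BoundaryCircleAction

end

/-! ### Linear algebra of the cut form -/

noncomputable section

section CutModel

variable {E : Type*} [NormedAddCommGroup E] [NormedSpace ℝ E]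

/-- Non-degeneracy of an alternating bilinear form. -/
def AltNondegenerate (α : E [⋀^Fin 2]→L[ℝ] ℝ) : Prop := ∀ v, (∀ w, α ![v, w] = 0) → v = 0

theorem AltNondegenerate.comp {F : Type*} [NormedAddCommGroup F] [NormedSpace ℝ F]
    {α : F [⋀^Fin 2]→L[ℝ] ℝ} (hα : AltNondegenerate α) {L : E →L[ℝ] F}
    (hL : Function.Bijective L) : AltNondegenerate (α.compContinuousLinearMap L) := by
  intro v hv
  refine hL.1 ((hα _ fun w => ?_).trans (map_zero L).symm)
  obtain ⟨w, rfl⟩ := hL.2 w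
  rw [← alt_comp_apply_two]
  exact hv w

/-- The direction of the circle action. -/
def angularVector (E : Type*) [NormedAddCommGroup E] : E × ℝ × ℝ := (0, 1, 0)

/-- The direction transversal to the boundary. -/
def radialVector (E : Type*) [NormedAddCommGroup E] : E × ℝ × ℝ := (0, 0, 1)

variable (E) in
/-- Multiplication by `z̄`, as a map `E × ℂ → ℂ`. -/
def conjMul (z : ℂ) : E × ℂ →L[ℝ] ℂ :=
  (ContinuousLinearMap.mul ℝ ℂ (Complex.conjCLE z)).comp (ContinuousLinearMap.snd ℝ E ℂ)

theorem conjMul_apply (z : ℂ) (v : E × ℂ) : conjMul E z v = starRingEnd ℂ z * v.2 := rfl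

variable (E) in
theorem contDiff_conjMul {n : WithTop ℕ∞} : ContDiff ℝ n (conjMul E) := by
  have h1 : ContDiff ℝ n fun z : ℂ => ContinuousLinearMap.mul ℝ ℂ (Complex.conjCLE z) :=
    (ContinuousLinearMap.mul ℝ ℂ).contDiff.comp Complex.conjCLE.contDiff
  exact h1.clm_comp contDiff_const

variable (E) in
/-- The derivative of `(s, z) ↦ (s, 0, |z|²)`. -/
def radialDeriv (z : ℂ) : E × ℂ →L[ℝ] E × ℝ × ℝ :=
  (ContinuousLinearMap.fst ℝ E ℂ).prod
    ((0 : E × ℂ →L[ℝ] ℝ).prod ((2 : ℝ) • Complex.reCLM.comp (conjMul E z)))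

theorem radialDeriv_apply (z : ℂ) (v : E × ℂ) :
    radialDeriv E z v = (v.1, 0, 2 * (starRingEnd ℂ z * v.2).re) := rfl

variable (E) in
theorem contDiff_radialDeriv {n : WithTop ℕ∞} : ContDiff ℝ n (radialDeriv E) := by
  have h1 : ContDiff ℝ n fun z : ℂ => (2 : ℝ) • Complex.reCLM.comp (conjMul E z) :=
    (contDiff_const.clm_comp (contDiff_conjMul E)).const_smul _
  have h2 : radialDeriv E = fun z => (ContinuousLinearMap.inl ℝ E (ℝ × ℝ)).comp
      (ContinuousLinearMap.fst ℝ E ℂ) + ((ContinuousLinearMap.inr ℝ E (ℝ × ℝ)).comp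
        (ContinuousLinearMap.inr ℝ ℝ ℝ)).comp ((2 : ℝ) • Complex.reCLM.comp (conjMul E z)) := by
    ext z v <;> simp [radialDeriv]
  rw [h2]
  exact contDiff_const.add (contDiff_const.clm_comp h1)

variable (E) in
/-- The derivative of `(s, z) ↦ (s, arg (z / z₀), |z|²)` at `z₀ = z`. -/
def polarDeriv (z : ℂ) : E × ℂ →L[ℝ] E × ℝ × ℝ :=
  (ContinuousLinearMap.fst ℝ E ℂ).prod
    (((‖z‖ ^ 2)⁻¹ • Complex.imCLM.comp (conjMul E z)).prod
      ((2 : ℝ) • Complex.reCLM.comp (conjMul E z)))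

theorem polarDeriv_apply (z : ℂ) (v : E × ℂ) : polarDeriv E z v =
    (v.1, (‖z‖ ^ 2)⁻¹ * (starRingEnd ℂ z * v.2).im, 2 * (starRingEnd ℂ z * v.2).re) := rfl

theorem polarDeriv_bijective [FiniteDimensional ℝ E] {z : ℂ} (hz : z ≠ 0) :
    Function.Bijective (polarDeriv E z) := by
  have h1 : Function.Injective (polarDeriv E z) := by
    rw [injective_iff_map_eq_zero]
    intro v hv
    rw [polarDeriv_apply, Prod.mk_eq_zero, Prod.mk_eq_zero] at hv
    obtain ⟨h1, h2, h3⟩ := hv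
    have hn : (‖z‖ ^ 2)⁻¹ ≠ 0 := by positivity
    have h4 : starRingEnd ℂ z * v.2 = 0 :=
      Complex.ext (by simpa using h3) (by simpa [hn] using h2)
    have h5 : v.2 = 0 := by simpa [hz] using h4
    exact Prod.ext h1 h5
  refine ⟨h1, (LinearMap.injective_iff_surjective_of_finrank_eq_finrank
    (f := (polarDeriv E z).toLinearMap) ?_).1 h1⟩
  simp

variable (E) in
/-- The standard area form on the `ℂ` factor. -/
def areaBilin : E × ℂ →L[ℝ] E × ℂ →L[ℝ] ℝ :=
  ((ContinuousLinearMap.compL ℝ (E × ℂ) ℂ ℝ).flip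
    ((Complex.conjCLE : ℂ →L[ℝ] ℂ).comp (ContinuousLinearMap.snd ℝ E ℂ))).comp
  ((ContinuousLinearMap.compL ℝ ℂ ℂ ℝ Complex.imCLM).comp
    ((ContinuousLinearMap.mul ℝ ℂ).comp (ContinuousLinearMap.snd ℝ E ℂ)))

theorem areaBilin_apply (v w : E × ℂ) : areaBilin E v w = (v.2 * starRingEnd ℂ w.2).im := rfl

/-- The expression of the cut form in the coordinates of a slice, at the point `z`. -/
def cutModel (σ : (E × ℝ × ℝ) [⋀^Fin 2]→L[ℝ] ℝ) (γ : E →L[ℝ] ℝ) (z : ℂ) :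
    (E × ℂ) [⋀^Fin 2]→L[ℝ] ℝ :=
  σ.compContinuousLinearMap (radialDeriv E z) + bilinToAlt (E × ℂ)
    ((2 : ℝ) • (Complex.imCLM.comp (conjMul E z)).smulRight
        (γ.comp (ContinuousLinearMap.fst ℝ E ℂ)) +
      (2 * altToBilin _ σ (angularVector E) (radialVector E)) • areaBilin E)

theorem cutModel_apply (σ : (E × ℝ × ℝ) [⋀^Fin 2]→L[ℝ] ℝ) (γ : E →L[ℝ] ℝ) (z : ℂ)
    (v w : E × ℂ) : cutModel σ γ z ![v, w] = σ ![radialDeriv E z v, radialDeriv E z w] +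
      ((starRingEnd ℂ z * v.2).im * γ w.1 - (starRingEnd ℂ z * w.2).im * γ v.1) +
      2 * σ ![angularVector E, radialVector E] * (v.2 * starRingEnd ℂ w.2).im := by
  have h1 : (w.2 * starRingEnd ℂ v.2).im = -(v.2 * starRingEnd ℂ w.2).im := by
    simp [Complex.mul_im]; ring
  rw [cutModel, ContinuousAlternatingMap.add_apply, alt_comp_apply_two, bilinToAlt_apply]
  simp only [add_apply, smul_apply,
    ContinuousLinearMap.smulRight_apply, ContinuousLinearMap.comp_apply, areaBilin_apply,
    conjMul_apply, Complex.imCLM_apply, ContinuousLinearMap.coe_fst', smul_eq_mul, h1,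
    altToBilin_apply]
  ring

theorem contDiffOn_cutModel {σ : E × ℝ → (E × ℝ × ℝ) [⋀^Fin 2]→L[ℝ] ℝ}
    {γ : E × ℝ → E →L[ℝ] ℝ} {B : Set E} {δ : ℝ} (hσ : ContDiffOn ℝ ∞ σ (B ×ˢ Ico 0 δ))
    (hγ : ContDiffOn ℝ ∞ γ (B ×ˢ Ico 0 δ)) :
    ContDiffOn ℝ ∞ (fun y : E × ℂ => cutModel (σ (y.1, ‖y.2‖ ^ 2)) (γ (y.1, ‖y.2‖ ^ 2)) y.2)
      {y | y.1 ∈ B ∧ ‖y.2‖ ^ 2 < δ} := by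
  have hsq : ContDiff ℝ ∞ fun z : E × ℂ => (z.1, ‖z.2‖ ^ 2) :=
    contDiff_fst.prodMk (contDiff_snd.norm_sq ℝ)
  have hm : MapsTo (fun z : E × ℂ => (z.1, ‖z.2‖ ^ 2)) {y | y.1 ∈ B ∧ ‖y.2‖ ^ 2 < δ}
      (B ×ˢ Ico 0 δ) := fun z hz => ⟨hz.1, by positivity, hz.2⟩
  have hσ' := hσ.comp hsq.contDiffOn hm
  have hγ' := hγ.comp hsq.contDiffOn hm
  intro y hy
  refine ContDiffWithinAt.add ((hσ' y hy).alt_two_comp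
    ((contDiff_radialDeriv E).comp contDiff_snd).contDiffWithinAt) ?_
  refine contDiff_bilinToAlt.comp_contDiffWithinAt (ContDiffWithinAt.add ?_ ?_)
  · refine ContDiffWithinAt.const_smul _ (ContDiffWithinAt.smulRight ?_ ?_)
    · exact contDiffWithinAt_const.clm_comp
        ((contDiff_conjMul E).comp contDiff_snd).contDiffWithinAt
    · exact (hγ' y hy).clm_comp contDiffWithinAt_const
  · have hs : ContDiffWithinAt ℝ ∞ (fun y : E × ℂ => altToBilin _ (σ (y.1, ‖y.2‖ ^ 2))
        (angularVector E) (radialVector E)) {y | y.1 ∈ B ∧ ‖y.2‖ ^ 2 < δ} y :=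
      ((contDiff_altToBilin.comp_contDiffWithinAt (hσ' y hy)).clm_apply
        contDiffWithinAt_const).clm_apply contDiffWithinAt_const
    have h2 : ContDiffWithinAt ℝ ∞ (fun _ : E × ℂ => (2 : ℝ))
        {y | y.1 ∈ B ∧ ‖y.2‖ ^ 2 < δ} y := contDiffWithinAt_const
    have h3 : ContDiff ℝ ∞ fun c : ℝ => c • areaBilin E := by
      change ContDiff ℝ ∞ fun c : ℝ => ContinuousLinearMap.toSpanSingleton ℝ (areaBilin E) c
      apply ContinuousLinearMap.contDiff
    exact h3.comp_contDiffWithinAt (h2.mul hs)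

/-- In polar coordinates `dθ = Im(z̄ dz) / |z|²` and `dt = 2 Re(z̄ dz)`. The denominator cancels
against `|z|² γ` in the mixed term, and against the factor `|z|²` of the determinant identity `hc`
in the `dθ ∧ dt` term. What remains has a meaning at `z = 0`. -/
theorem cutModel_eq_comp_polarDeriv {σ : (E × ℝ × ℝ) [⋀^Fin 2]→L[ℝ] ℝ} {γ : E →L[ℝ] ℝ} {z : ℂ}
    (hz : z ≠ 0) (h : ∀ v : E, σ ![angularVector E, (v, 0, 0)] = ‖z‖ ^ 2 * γ v) :
    cutModel σ γ z = σ.compContinuousLinearMap (polarDeriv E z) := by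
  refine alt_two_ext fun v w => ?_
  rw [cutModel_apply, alt_comp_apply_two]
  have hn : ‖z‖ ^ 2 ≠ 0 := by positivity
  have hp : ∀ v : E × ℂ, polarDeriv E z v = radialDeriv E z v +
      ((‖z‖ ^ 2)⁻¹ * (starRingEnd ℂ z * v.2).im) • angularVector E := fun v => by
    simp [polarDeriv_apply, radialDeriv_apply, angularVector]
  have hr : ∀ v : E × ℂ, radialDeriv E z v = (v.1, 0, 0) +
      (2 * (starRingEnd ℂ z * v.2).re) • radialVector E := fun v => by
    simp [radialDeriv_apply, radialVector]
  have hJ : ∀ v : E × ℂ, σ ![angularVector E, radialDeriv E z v] = ‖z‖ ^ 2 * γ v.1 +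
      2 * (starRingEnd ℂ z * v.2).re * σ ![angularVector E, radialVector E] := fun v => by
    rw [← h, hr]
    simp only [← altToBilin_apply, map_add, map_smul, smul_eq_mul]
  have hA : σ ![angularVector E, angularVector E] = 0 := alt_two_self _ _
  have hc : (starRingEnd ℂ z * v.2).im * (starRingEnd ℂ z * w.2).re -
      (starRingEnd ℂ z * w.2).im * (starRingEnd ℂ z * v.2).re =
      ‖z‖ ^ 2 * (v.2 * starRingEnd ℂ w.2).im := by
    rw [← Complex.normSq_eq_norm_sq, Complex.normSq_apply]
    simp [Complex.mul_im, Complex.mul_re]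
    ring
  have hexp : σ ![polarDeriv E z v, polarDeriv E z w] =
      σ ![radialDeriv E z v, radialDeriv E z w] +
      (‖z‖ ^ 2)⁻¹ * (starRingEnd ℂ z * v.2).im * σ ![angularVector E, radialDeriv E z w] -
      (‖z‖ ^ 2)⁻¹ * (starRingEnd ℂ z * w.2).im * σ ![angularVector E, radialDeriv E z v] := by
    have hs := alt_two_swap σ (radialDeriv E z v) (angularVector E)
    rw [hp v, hp w]
    simp only [← altToBilin_apply] at hs hA ⊢
    simp only [map_add, map_smul, add_apply, smul_apply,
      smul_eq_mul, hs, hA]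
    ring
  rw [hexp, hJ, hJ]
  field_simp
  linear_combination (-2 * σ ![angularVector E, radialVector E]) * hc

/-- Otherwise the angular vector would pair to zero with every vector. -/
theorem AltNondegenerate.angular_radial_ne_zero {σ : (E × ℝ × ℝ) [⋀^Fin 2]→L[ℝ] ℝ}
    (hσ : AltNondegenerate σ) (h : ∀ v : E, σ ![angularVector E, (v, 0, 0)] = 0) :
    σ ![angularVector E, radialVector E] ≠ 0 := by
  intro h0
  have h1 : angularVector E = 0 := hσ _ fun w => by
    have hw : w = (w.1, 0, 0) + w.2.1 • angularVector E + w.2.2 • radialVector E := by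
      simp [angularVector, radialVector]
    have hA : σ ![angularVector E, angularVector E] = 0 := alt_two_self _ _
    have h2 := h w.1
    rw [hw]
    simp only [← altToBilin_apply] at h0 hA h2 ⊢
    simp only [map_add, map_smul, h0, hA, h2]
    simp
  simp [angularVector] at h1

/-- The restriction of `σ` to the boundary directions has kernel exactly the angular line, so it is
non-degenerate on the quotient; this is why the reduced form is symplectic. -/
theorem AltNondegenerate.horizontal {σ : (E × ℝ × ℝ) [⋀^Fin 2]→L[ℝ] ℝ}
    (hσ : AltNondegenerate σ) (h : ∀ v : E, σ ![angularVector E, (v, 0, 0)] = 0) {v : E}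
    (hv : ∀ w : E, σ ![(v, 0, 0), (w, 0, 0)] = 0) : v = 0 := by
  have hg := hσ.angular_radial_ne_zero h
  -- This multiple of the angular vector corrects `v` so that it also pairs to zero with the radial
  -- vector.
  set a : ℝ := -(σ ![(v, 0, 0), radialVector E] / σ ![angularVector E, radialVector E]) with ha
  have h1 : ((v, 0, 0) : E × ℝ × ℝ) + a • angularVector E = 0 := hσ _ fun w => by
    have hw : w = (w.1, 0, 0) + w.2.1 • angularVector E + w.2.2 • radialVector E := by
      simp [angularVector, radialVector]
    have hA : σ ![angularVector E, angularVector E] = 0 := alt_two_self _ _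
    have h2 := h w.1
    have h3 := hv w.1
    have h4 := alt_two_swap σ (v, 0, 0) (angularVector E)
    rw [h v] at h4
    have h5 : a * σ ![angularVector E, radialVector E] = -σ ![(v, 0, 0), radialVector E] := by
      rw [ha]; field_simp
    rw [hw]
    simp only [← altToBilin_apply] at hA h2 h3 h4 h5 ⊢
    simp only [map_add, map_smul, add_apply, smul_apply,
      smul_eq_mul, hA, h2, h3, h4, h5]
    simp
  simpa [angularVector] using congrArg Prod.fst h1

theorem cutModel_zero_inl (σ : (E × ℝ × ℝ) [⋀^Fin 2]→L[ℝ] ℝ) (γ : E →L[ℝ] ℝ) (v w : E) :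
    cutModel σ γ 0 ![(v, 0), (w, 0)] = σ ![(v, 0, 0), (w, 0, 0)] := by
  rw [cutModel_apply, radialDeriv_apply, radialDeriv_apply]
  simp

/-- At `z = 0` the form is an orthogonal sum: the horizontal part of `σ`, and a non-zero multiple of
the area form on `ℂ`. -/
theorem AltNondegenerate.cutModel_zero {σ : (E × ℝ × ℝ) [⋀^Fin 2]→L[ℝ] ℝ}
    (hσ : AltNondegenerate σ) (h : ∀ v : E, σ ![angularVector E, (v, 0, 0)] = 0)
    (γ : E →L[ℝ] ℝ) : AltNondegenerate (cutModel σ γ 0) := by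
  intro v hv
  have hg := hσ.angular_radial_ne_zero h
  have hz : ∀ u : E × ℝ × ℝ, σ ![u, 0] = 0 := fun u => by
    rw [← altToBilin_apply, map_zero]
  have h1 : ∀ ζ : ℂ, (v.2 * starRingEnd ℂ ζ).im = 0 := fun ζ => by
    have h2 := hv (0, ζ)
    rw [cutModel_apply, radialDeriv_apply, radialDeriv_apply] at h2
    have h3 : σ ![(v.1, (0 : ℝ), 2 * (starRingEnd ℂ 0 * v.2).re),
        ((0 : E), (0 : ℝ), 2 * (starRingEnd ℂ 0 * ζ).re)] = 0 := by
      simpa using! hz (v.1, 0, 0)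
    simp only [h3] at h2
    simpa [hg] using h2
  have hv2 : v.2 = 0 := by
    have e1 := h1 1
    have e2 := h1 Complex.I
    refine Complex.ext ?_ ?_ <;> simp [Complex.mul_im] at e1 e2 ⊢ <;> assumption
  have hv1 : v.1 = 0 := hσ.horizontal h fun w => by
    have h2 := hv (w, 0)
    have h3 : v = (v.1, 0) := Prod.ext rfl hv2
    rw [h3, cutModel_zero_inl] at h2
    exact h2
  exact Prod.ext hv1 hv2

end CutModel

end

/-! ### Gluing forms from local expressions; the interior inside the cut space -/

noncomputable section

namespace DiffForm

variable {E : Type*} [NormedAddCommGroup E] [NormedSpace ℝ E] {N : Type*} [TopologicalSpace N]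
  [ChartedSpace E N] {m : ℕ}

theorem inMaxChart_congr {β β' : DiffForm 𝓘(ℝ, E) N m} {φ : OpenPartialHomeomorph N E} {q : N}
    (hq : q ∈ φ.source) (h : β q = β' q) : β.inMaxChart φ (φ q) = β'.inMaxChart φ (φ q) := by
  have h1 : ∀ q', q' = q → β q' = β' q' := by rintro _ rfl; exact h
  rw [inMaxChart_eq, inMaxChart_eq, h1 _ (φ.left_inv hq)]

theorem eq_of_eventually_eq_on_dense [IsManifold 𝓘(ℝ, E) ∞ N] {β β' : DiffForm 𝓘(ℝ, E) N m}
    {φ : OpenPartialHomeomorph N E} (hφ : φ ∈ IsManifold.maximalAtlas 𝓘(ℝ, E) ∞ N)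
    {q : N} (hq : q ∈ φ.source) (hβ : ContinuousAt (β.inMaxChart φ) (φ q))
    (hβ' : ContinuousAt (β'.inMaxChart φ) (φ q)) {D : Set N} (hD : Dense D)
    (h : ∀ᶠ q' in 𝓝[D] q, β q' = β' q') : β q = β' q := by
  refine eq_of_inMaxChart_eq hφ hq ?_
  have := mem_closure_iff_nhdsWithin_neBot.1 (hD q)
  have hc : Filter.Tendsto φ (𝓝[D] q) (𝓝 (φ q)) :=
    (φ.continuousAt hq).mono_left nhdsWithin_le_nhds
  refine tendsto_nhds_unique_of_eventuallyEq (hβ.tendsto.comp hc) (hβ'.tendsto.comp hc) ?_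
  filter_upwards [h, mem_nhdsWithin_of_mem_nhds (φ.open_source.mem_nhds hq)] with q' h1 h2
  exact inMaxChart_congr h2 h1

/-- The form with local expression `Ω` in the chart `φ`. -/
def ofChart (φ : OpenPartialHomeomorph N E) (Ω : E → E [⋀^Fin m]→L[ℝ] ℝ) :
    DiffForm 𝓘(ℝ, E) N m := fun q =>
  (Ω (φ q)).compContinuousLinearMap (mfderiv 𝓘(ℝ, E) 𝓘(ℝ, E) φ q : E →L[ℝ] E)

theorem inMaxChart_ofChart [IsManifold 𝓘(ℝ, E) ∞ N] {φ : OpenPartialHomeomorph N E}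
    (hφ : φ ∈ IsManifold.maximalAtlas 𝓘(ℝ, E) ∞ N) (Ω : E → E [⋀^Fin m]→L[ℝ] ℝ) {y : E}
    (hy : y ∈ φ.target) : (ofChart φ Ω).inMaxChart φ y = Ω y := by
  refine inMaxChart_eq_of_forall _ hφ hy ?_
  have h : ∀ y', y' = y → (Ω y').compContinuousLinearMap
      (mfderiv 𝓘(ℝ, E) 𝓘(ℝ, E) φ (φ.symm y) : E →L[ℝ] E) = (Ω y).compContinuousLinearMap
      (mfderiv 𝓘(ℝ, E) 𝓘(ℝ, E) φ (φ.symm y) : E →L[ℝ] E) := by rintro _ rfl; rfl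
  exact h _ (φ.right_inv hy)

theorem mfderiv_bijective_of_mem_maximalAtlas [IsManifold 𝓘(ℝ, E) ∞ N]
    {φ : OpenPartialHomeomorph N E} (hφ : φ ∈ IsManifold.maximalAtlas 𝓘(ℝ, E) ∞ N)
    {q : N} (hq : q ∈ φ.source) :
    Function.Bijective (mfderiv 𝓘(ℝ, E) 𝓘(ℝ, E) φ q : E →L[ℝ] E) := by
  have h : φ.MDifferentiable 𝓘(ℝ, E) 𝓘(ℝ, E) :=
    ⟨(contMDiffOn_of_mem_maximalAtlas hφ).mdifferentiableOn (by simp),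
      (contMDiffOn_symm_of_mem_maximalAtlas hφ).mdifferentiableOn (by simp)⟩
  exact h.mfderiv_bijective hq

/-- A symplectic form given by local expressions compatible on a dense set. -/
theorem exists_isSymplectic_of_local [IsManifold 𝓘(ℝ, E) ∞ N] {D : Set N} (hD : Dense D)
    (θ : DiffForm 𝓘(ℝ, E) N 2)
    (h : ∀ q : N, ∃ φ ∈ IsManifold.maximalAtlas 𝓘(ℝ, E) ∞ N, q ∈ φ.source ∧
      ∃ Ω : E → E [⋀^Fin 2]→L[ℝ] ℝ, ContDiffOn ℝ ∞ Ω φ.target ∧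
        (∀ y ∈ φ.target, extDeriv Ω y = 0) ∧ (∀ y ∈ φ.target, AltNondegenerate (Ω y)) ∧
        ∀ q' ∈ φ.source ∩ D, θ q' = ofChart φ Ω q') :
    ∃ β : DiffForm 𝓘(ℝ, E) N 2, β.IsSymplectic ∧
      ∀ φ ∈ IsManifold.maximalAtlas 𝓘(ℝ, E) ∞ N, ∀ Ω : E → E [⋀^Fin 2]→L[ℝ] ℝ,
        ContDiffOn ℝ ∞ Ω φ.target → (∀ q' ∈ φ.source ∩ D, θ q' = ofChart φ Ω q') →
        ∀ q ∈ φ.source, β q = ofChart φ Ω q := by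
  choose φ hφ hq Ω hs hc hn hθ using h
  set β : DiffForm 𝓘(ℝ, E) N 2 := fun q => ofChart (φ q) (Ω q) q with hβ
  -- Two smooth local expressions that both agree with `θ` on the dense set `D` agree wherever both
  -- are defined, by continuity. So the pointwise choice of a chart in `β` does not matter.
  have key : ∀ ψ ∈ IsManifold.maximalAtlas 𝓘(ℝ, E) ∞ N, ∀ Ξ : E → E [⋀^Fin 2]→L[ℝ] ℝ,
      ContDiffOn ℝ ∞ Ξ ψ.target → (∀ q' ∈ ψ.source ∩ D, θ q' = ofChart ψ Ξ q') →
      ∀ q ∈ ψ.source, β q = ofChart ψ Ξ q := by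
    intro ψ hψ Ξ hΞ hθΞ q hqψ
    change ofChart (φ q) (Ω q) q = ofChart ψ Ξ q
    have e1 : ContDiffOn ℝ ∞ ((ofChart ψ Ξ).inMaxChart ψ) ψ.target :=
      hΞ.congr fun y hy => inMaxChart_ofChart hψ Ξ hy
    have e2 : ContDiffOn ℝ ∞ ((ofChart (φ q) (Ω q)).inMaxChart (φ q)) (φ q).target :=
      (hs q).congr fun y hy => inMaxChart_ofChart (hφ q) (Ω q) hy
    refine eq_of_eventually_eq_on_dense hψ hqψ ?_ ?_ hD ?_
    · refine (contDiffOn_inMaxChart_of_change _ (hφ q) hψ e2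
        ⟨ψ.map_source hqψ, ?_⟩).continuousAt
      change ψ.symm (ψ q) ∈ (φ q).source
      rw [ψ.left_inv hqψ]
      exact hq q
    · exact e1.continuousOn.continuousAt (ψ.open_target.mem_nhds (ψ.map_source hqψ))
    · filter_upwards [self_mem_nhdsWithin,
        mem_nhdsWithin_of_mem_nhds (ψ.open_source.mem_nhds hqψ),
        mem_nhdsWithin_of_mem_nhds ((φ q).open_source.mem_nhds (hq q))] with q' h1 h2 h3
      rw [← hθ q q' ⟨h3, h1⟩, hθΞ q' ⟨h2, h1⟩]
  have hloc : ∀ q, EqOn (β.inMaxChart (φ q)) (Ω q) (φ q).target := fun q y hy => by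
    have hy' := (φ q).map_target hy
    have h1 := key _ (hφ q) _ (hs q) (hθ q) _ hy'
    have h2 := inMaxChart_congr hy' h1
    rw [(φ q).right_inv hy] at h2
    rw [h2, inMaxChart_ofChart (hφ q) _ hy]
  refine ⟨β, ⟨?_, ?_, ?_⟩, key⟩
  · exact isSmooth_of_inMaxChart _ fun q => ⟨φ q, hφ q, hq q, (hs q).congr (hloc q)⟩
  · refine isClosed_of_inMaxChart _ fun q => ⟨φ q, hφ q, hq q, (hs q).congr (hloc q),
      fun y hy => ?_⟩
    rw [((hloc q).eventuallyEq_of_mem ((φ q).open_target.mem_nhds hy)).extDeriv_eq, hc q y hy]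
  · intro q
    exact AltNondegenerate.comp (E := E) (hn q _ ((φ q).map_source (hq q)))
      (mfderiv_bijective_of_mem_maximalAtlas (hφ q) (hq q))

end DiffForm

section HalfSpace

variable {k : ℕ} {M : Type*} [TopologicalSpace M] [ChartedSpace (EuclideanHalfSpace (k + 2)) M]
  [IsManifold (𝓡∂ (k + 2)) ∞ M]

/-- Push the point along the inward normal in a chart. -/
theorem dense_interior : Dense ((𝓡∂ (k + 2)).interior M) := by
  intro x
  have h0 := mem_extChartAt_target (I := 𝓡∂ (k + 2)) x
  have h1 := ray_eventually_mem_target h0 (v := inwardNormal k)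
    (by rw [inwardNormal_zero]; exact zero_le_one)
  have hy0 : 0 ≤ extChartAt (𝓡∂ (k + 2)) x x 0 := mem_range_halfSpace.1 (mem_range_self _)
  have h2 : Filter.Tendsto (fun t : ℝ => (extChartAt (𝓡∂ (k + 2)) x).symm
      (extChartAt (𝓡∂ (k + 2)) x x + t • inwardNormal k)) (𝓝[>] 0) (𝓝 x) := by
    have hc : ContinuousWithinAt (extChartAt (𝓡∂ (k + 2)) x).symm
        (extChartAt (𝓡∂ (k + 2)) x).target (extChartAt (𝓡∂ (k + 2)) x x) :=
      (continuousOn_extChartAt_symm x) _ h0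
    have hl : Filter.Tendsto (fun t : ℝ => extChartAt (𝓡∂ (k + 2)) x x + t • inwardNormal k)
        (𝓝[>] 0) (𝓝[(extChartAt (𝓡∂ (k + 2)) x).target] (extChartAt (𝓡∂ (k + 2)) x x)) := by
      refine tendsto_nhdsWithin_iff.2 ⟨?_, h1.filter_mono (nhdsWithin_mono _ Ioi_subset_Ici_self)⟩
      have hc' : Continuous fun t : ℝ => extChartAt (𝓡∂ (k + 2)) x x + t • inwardNormal k := by
        fun_prop
      have := hc'.tendsto 0
      simp only [zero_smul, add_zero] at this
      exact this.mono_left nhdsWithin_le_nhds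
    have := hc.tendsto.comp hl
    rwa [(extChartAt (𝓡∂ (k + 2)) x).left_inv (mem_extChartAt_source x)] at this
  refine mem_closure_of_tendsto h2 ?_
  filter_upwards [self_mem_nhdsWithin, h1.filter_mono (nhdsWithin_mono _ Ioi_subset_Ici_self)]
    with t ht ht'
  rw [← ModelWithCorners.compl_boundary, mem_compl_iff, extChartAt_symm_mem_boundary_iff ht']
  have ht0 : (0 : ℝ) < t := ht
  rw [PiLp.add_apply, PiLp.smul_apply, inwardNormal_zero, smul_eq_mul, mul_one]
  exact ne_of_gt (by linarith)

end HalfSpace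

namespace BoundaryCircleAction

variable {k : ℕ} {M : Type*} [TopologicalSpace M] [ChartedSpace (EuclideanHalfSpace (k + 2)) M]
  [IsManifold (𝓡∂ (k + 2)) ∞ M] {A : BoundaryCircleAction k M} {f : A.U → ℝ}

theorem dense_toCut_interior : Dense (A.toCut '' (𝓡∂ (k + 2)).interior M) :=
  A.isQuotientMap_toCut.surjective.denseRange.dense_image A.continuous_toCut dense_interior

variable [ChartedSpace (EuclideanSpace ℝ (Fin (k + 2))) A.Cut] [IsManifold (𝓡 (k + 2)) ∞ A.Cut]

theorem contMDiffAt_toCut (hc : ∀ φ, φ ∈ atlas (EuclideanSpace ℝ (Fin (k + 2))) A.Cut ↔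
    IsCompatibleChart (A.CutSmoothAt f) φ) {x : M} (hx : x ∈ (𝓡∂ (k + 2)).interior M) :
    ContMDiffAt (𝓡∂ (k + 2)) (𝓡 (k + 2)) ∞ A.toCut x := by
  have hψ : A.interiorChart x ∈ IsManifold.maximalAtlas (𝓡 (k + 2)) ∞ A.Cut :=
    IsManifold.subset_maximalAtlas ((hc _).2 (A.isCompatibleChart_interiorChart f x))
  have hy : extChartAt (𝓡∂ (k + 2)) x x ∈ (A.interiorChart x).target :=
    ⟨mem_extChartAt_target x, (mem_interior_iff_extChartAt (mem_extChartAt_source x)).1 hx⟩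
  have h1 := (contMDiffAt_symm_of_mem_maximalAtlas hψ hy).comp x
    (contMDiffAt_extChartAt (I := 𝓡∂ (k + 2)) (n := ∞))
  refine h1.congr_of_eventuallyEq ?_
  filter_upwards [extChartAt_source_mem_nhds (I := 𝓡∂ (k + 2)) x] with z hz
  change A.toCut z = A.toCut ((extChartAt (𝓡∂ (k + 2)) x).symm (extChartAt (𝓡∂ (k + 2)) x z))
  rw [(extChartAt (𝓡∂ (k + 2)) x).left_inv hz]

theorem surjective_mfderiv_toCut (hc : ∀ φ, φ ∈ atlas (EuclideanSpace ℝ (Fin (k + 2))) A.Cut ↔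
    IsCompatibleChart (A.CutSmoothAt f) φ) {x : M} (hx : x ∈ (𝓡∂ (k + 2)).interior M) :
    Function.Surjective (mfderiv (𝓡∂ (k + 2)) (𝓡 (k + 2)) A.toCut x :
      EuclideanSpace ℝ (Fin (k + 2)) →L[ℝ] EuclideanSpace ℝ (Fin (k + 2))) := by
  have hψ : A.interiorChart x ∈ IsManifold.maximalAtlas (𝓡 (k + 2)) ∞ A.Cut :=
    IsManifold.subset_maximalAtlas ((hc _).2 (A.isCompatibleChart_interiorChart f x))
  have hxs : A.toCut x ∈ (A.interiorChart x).source := ⟨x, ⟨mem_extChartAt_source x, hx⟩, rfl⟩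
  have h1 : HasMFDerivAt (𝓡∂ (k + 2)) (𝓡 (k + 2)) A.toCut x _ :=
    ((contMDiffAt_toCut hc hx).mdifferentiableAt (by simp)).hasMFDerivAt
  have h2 : HasMFDerivAt (𝓡 (k + 2)) (𝓡 (k + 2)) (A.interiorChart x) (A.toCut x) _ :=
    ((contMDiffAt_of_mem_maximalAtlas hψ hxs).mdifferentiableAt (by simp)).hasMFDerivAt
  have h3 := h2.comp x h1
  have h4 : A.interiorChart x ∘ A.toCut =ᶠ[𝓝 x] extChartAt (𝓡∂ (k + 2)) x := by
    filter_upwards [extChartAt_source_mem_nhds (I := 𝓡∂ (k + 2)) x, isOpen_interior.mem_nhds hx]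
      with z hz hz'
    exact A.interiorChart_apply x ⟨hz, hz'⟩
  have h5 := (h3.congr_of_eventuallyEq h4.symm).mfderiv
  have h6 := (isInvertible_mfderiv_extChartAt (I := 𝓡∂ (k + 2)) (mem_extChartAt_source x)).bijective.2
  have h7 := DiffForm.mfderiv_bijective_of_mem_maximalAtlas hψ hxs
  intro u
  obtain ⟨v, hv⟩ := h6 ((mfderiv (𝓡 (k + 2)) (𝓡 (k + 2)) (A.interiorChart x) (A.toCut x) :
    EuclideanSpace ℝ (Fin (k + 2)) →L[ℝ] EuclideanSpace ℝ (Fin (k + 2))) u)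
  refine ⟨v, h7.1 ?_⟩
  rw [h5] at hv
  exact hv

end BoundaryCircleAction

end

/-! ### The form in the coordinates `(s, θ, t)` of a slice -/

noncomputable section

theorem injective_mfderivWithin_of_leftInverse {F E H N : Type*} [NormedAddCommGroup F]
    [NormedSpace ℝ F] [NormedAddCommGroup E] [NormedSpace ℝ E] [TopologicalSpace H]
    {I : ModelWithCorners ℝ E H} [TopologicalSpace N] [ChartedSpace H N] {g : F → N} {D : Set F}
    {y : F} (hg : MDifferentiableWithinAt 𝓘(ℝ, F) I g D y) {r : N → F}
    (hr : MDifferentiableAt I 𝓘(ℝ, F) r (g y)) (hu : UniqueDiffWithinAt ℝ D y)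
    (h : ∀ᶠ z in 𝓝[D] y, r (g z) = z) (hy : y ∈ D) :
    Function.Injective (mfderivWithin 𝓘(ℝ, F) I g D y : F →L[ℝ] E) := by
  have h1 := hr.hasMFDerivAt.comp_hasMFDerivWithinAt y hg.hasMFDerivWithinAt
  have h2 : HasMFDerivWithinAt 𝓘(ℝ, F) 𝓘(ℝ, F) (id : F → F) D y
      (ContinuousLinearMap.id ℝ F : F →L[ℝ] F) := (hasMFDerivAt_id y).hasMFDerivWithinAt
  have h3 := h2.congr_of_eventuallyEq (f₁ := r ∘ g) h (h.self_of_nhdsWithin hy)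
  have h4 := hu.uniqueMDiffWithinAt.eq h1 h3
  have h5 : ((mfderiv I 𝓘(ℝ, F) r (g y) : E →L[ℝ] F).comp
    (mfderivWithin 𝓘(ℝ, F) I g D y : F →L[ℝ] E)) = ContinuousLinearMap.id ℝ F := h4
  exact Function.LeftInverse.injective fun v => DFunLike.congr_fun h5 v

theorem ContinuousLinearMap.bijective_of_injective_of_finrank_eq {E F : Type*}
    [NormedAddCommGroup E] [NormedSpace ℝ E] [NormedAddCommGroup F] [NormedSpace ℝ F]
    [FiniteDimensional ℝ E] [FiniteDimensional ℝ F] (L : E →L[ℝ] F)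
    (h : Module.finrank ℝ E = Module.finrank ℝ F) (hL : Function.Injective L) :
    Function.Bijective L :=
  ⟨hL, (LinearMap.injective_iff_surjective_of_finrank_eq_finrank (f := L.toLinearMap) h).1 hL⟩

namespace BoundaryCircleAction

variable {k : ℕ} {M : Type*} [TopologicalSpace M] [ChartedSpace (EuclideanHalfSpace (k + 2)) M]
  [IsManifold (𝓡∂ (k + 2)) ∞ M] {A : BoundaryCircleAction k M} {f : A.U → ℝ}

/-- `β` is invariant at the points of `V`. -/
def IsInvariantOn (A : BoundaryCircleAction k M) (β : DiffForm (𝓡∂ (k + 2)) M 2) (V : Set A.U) :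
    Prop := ∀ (a : Circle), ∀ x ∈ V,
  DiffForm.pullback (𝓡∂ (k + 2)) (𝓡∂ (k + 2)) (fun y : A.U => a • y)
    (DiffForm.pullback (𝓡∂ (k + 2)) (𝓡∂ (k + 2)) (fun y : A.U => y.1) β) x =
  DiffForm.pullback (𝓡∂ (k + 2)) (𝓡∂ (k + 2)) (fun y : A.U => y.1) β x

theorem mdifferentiableAt_val (x : A.U) :
    MDifferentiableAt (𝓡∂ (k + 2)) (𝓡∂ (k + 2)) (fun y : A.U => y.1) x :=
  (contMDiff_subtype_val (n := ∞)).mdifferentiableAt (by simp)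

theorem IsInvariantOn.param_smul {β : DiffForm (𝓡∂ (k + 2)) M 2} {V : Set A.U}
    (hV : A.IsInvariantOn β V) {F : Type*} [NormedAddCommGroup F] [NormedSpace ℝ F] {g : F → A.U}
    {D : Set F} {y : F} (hg : MDifferentiableWithinAt 𝓘(ℝ, F) (𝓡∂ (k + 2)) g D y)
    (hu : UniqueDiffWithinAt ℝ D y) (hy : g y ∈ V) (a : Circle) :
    β.param (fun z => (a • g z).1) D y = β.param (fun z => (g z).1) D y := by
  have ha : MDifferentiableAt (𝓡∂ (k + 2)) (𝓡∂ (k + 2)) (fun x : A.U => a • x) (g y) :=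
    (A.contMDiff_const_smul a).mdifferentiableAt (by simp)
  have h1 := DiffForm.param_pullback (F := F) β (f := fun y : A.U => y.1)
    (mdifferentiableAt_val _) (ha.comp_mdifferentiableWithinAt y hg) hu
  have h2 := DiffForm.param_pullback (F := F) (DiffForm.pullback (𝓡∂ (k + 2)) (𝓡∂ (k + 2))
    (fun y : A.U => y.1) β) (f := fun x : A.U => a • x) ha hg hu
  have h3 := DiffForm.param_pullback (F := F) β (f := fun y : A.U => y.1)
    (mdifferentiableAt_val _) hg hu
  refine h1.symm.trans (h2.symm.trans (Eq.trans ?_ h3))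
  unfold DiffForm.param
  rw [hV a _ hy]

namespace Slice

variable (S : A.Slice f)

/-- The parametrization of the neighbourhood of an orbit given by a slice. -/
def polar (y : EuclideanSpace ℝ (Fin k) × ℝ × ℝ) : A.U := Circle.exp y.2.1 • S.τ (y.1, y.2.2)

/-- The domain of `polar`. -/
def polarDom : Set (EuclideanSpace ℝ (Fin k) × ℝ × ℝ) := S.B ×ˢ univ ×ˢ Ico 0 S.δ

theorem uniqueDiffOn_polarDom : UniqueDiffOn ℝ S.polarDom :=
  S.isOpen_B.uniqueDiffOn.prod (uniqueDiffOn_univ.prod (uniqueDiffOn_Ico 0 S.δ))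

theorem contMDiffOn_polar : ContMDiffOn 𝓘(ℝ, EuclideanSpace ℝ (Fin k) × ℝ × ℝ) (𝓡∂ (k + 2)) ∞
    S.polar S.polarDom := by
  have h1 : ContMDiff 𝓘(ℝ, EuclideanSpace ℝ (Fin k) × ℝ × ℝ) 𝓘(ℝ, EuclideanSpace ℝ (Fin k) × ℝ) ∞
      (fun y : EuclideanSpace ℝ (Fin k) × ℝ × ℝ => (y.1, y.2.2)) :=
    (contDiff_fst.prodMk (contDiff_snd.comp contDiff_snd)).contMDiff
  have h2 : ContMDiff 𝓘(ℝ, EuclideanSpace ℝ (Fin k) × ℝ × ℝ) 𝓘(ℝ, ℝ) ∞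
      (fun y : EuclideanSpace ℝ (Fin k) × ℝ × ℝ => y.2.1) :=
    (contDiff_fst.comp contDiff_snd).contMDiff
  exact A.contMDiff_smul'.comp_contMDiffOn ((contMDiff_circleExp.comp h2).contMDiffOn.prodMk
    (S.smooth_τ.comp h1.contMDiffOn fun y hy => ⟨hy.1, hy.2.2⟩))

theorem contMDiffOn_polar_val :
    ContMDiffOn 𝓘(ℝ, EuclideanSpace ℝ (Fin k) × ℝ × ℝ) (𝓡∂ (k + 2)) ∞
      (fun y => (S.polar y).1) S.polarDom :=
  contMDiff_subtype_val.comp_contMDiffOn S.contMDiffOn_polar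

/-- The form `β` in the coordinates `polar`, along the slice. -/
def sliceForm (β : DiffForm (𝓡∂ (k + 2)) M 2) (y : EuclideanSpace ℝ (Fin k) × ℝ) :
    (EuclideanSpace ℝ (Fin k) × ℝ × ℝ) [⋀^Fin 2]→L[ℝ] ℝ :=
  β.param (fun z => (S.polar z).1) S.polarDom (y.1, 0, y.2)

theorem mem_polarDom {y : EuclideanSpace ℝ (Fin k) × ℝ} (hy : y ∈ S.B ×ˢ Ico 0 S.δ) (θ : ℝ) :
    (y.1, θ, y.2) ∈ S.polarDom := ⟨hy.1, mem_univ _, hy.2⟩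

theorem contDiffOn_sliceForm {β : DiffForm (𝓡∂ (k + 2)) M 2} (hβ : β.IsSmooth) :
    ContDiffOn ℝ ∞ (S.sliceForm β) (S.B ×ˢ Ico 0 S.δ) := by
  have h1 : ContDiff ℝ ∞ (fun y : EuclideanSpace ℝ (Fin k) × ℝ => (y.1, (0 : ℝ), y.2)) := by
    fun_prop
  exact (hβ.contDiffOn_param S.uniqueDiffOn_polarDom S.contMDiffOn_polar_val).comp
    h1.contDiffOn fun y hy => S.mem_polarDom hy 0

theorem bijective_mfderivWithin_polar (hf : IsBoundaryDefining (k := k) f)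
    (hinv : ∀ (a : Circle) (x : A.U), f (a • x) = f x)
    {y : EuclideanSpace ℝ (Fin k) × ℝ} (hy : y ∈ S.B ×ˢ Ico 0 S.δ) :
    Function.Bijective (mfderivWithin 𝓘(ℝ, EuclideanSpace ℝ (Fin k) × ℝ × ℝ) (𝓡∂ (k + 2))
      (fun z => (S.polar z).1) S.polarDom (y.1, 0, y.2) :
      EuclideanSpace ℝ (Fin k) × ℝ × ℝ →L[ℝ] EuclideanSpace ℝ (Fin (k + 2))) := by
  classical
  have hyD := S.mem_polarDom hy 0
  have hτW := S.τ_mem y hy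
  -- A left inverse of `polar` near angle `0`, smooth there because `w = 1` on the slice. It gives
  -- injectivity of the derivative, and equality of dimensions does the rest.
  set r₀ : A.U → EuclideanSpace ℝ (Fin k) × ℝ × ℝ :=
    fun x => (S.s x, (S.w x : ℂ).arg, f x) with hr₀
  set r : M → EuclideanSpace ℝ (Fin k) × ℝ × ℝ :=
    fun x => if h : x ∈ A.U then r₀ ⟨x, h⟩ else 0 with hr
  have hrr : ∀ x : A.U, r x.1 = r₀ x := fun x => by simp [hr]
  have hp : S.polar (y.1, 0, y.2) = S.τ y := by simp [polar]
  have hsm : ContMDiffAt (𝓡∂ (k + 2)) 𝓘(ℝ, EuclideanSpace ℝ (Fin k) × ℝ × ℝ) ∞ r₀ (S.τ y) := by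
    refine ContMDiffAt.prodMk_space (S.smooth_s.contMDiffAt (S.isOpen.mem_nhds hτW))
      (ContMDiffAt.prodMk_space ?_ hf.smooth.contMDiffAt)
    have h1 : ((S.w (S.τ y) : Circle) : ℂ) ∈ Complex.slitPlane := by
      rw [S.w_τ y hy]; simp
    exact (contDiffAt_arg h1).contMDiffAt.comp (S.τ y) (contMDiff_circle_coe.contMDiffAt.comp
      (S.τ y) (S.smooth_w.contMDiffAt (S.isOpen.mem_nhds hτW)))
  have hrs : ContMDiffAt (𝓡∂ (k + 2)) 𝓘(ℝ, EuclideanSpace ℝ (Fin k) × ℝ × ℝ) ∞ r (S.τ y).1 := by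
    rw [← contMDiffAt_subtype_iff]
    exact hsm.congr_of_eventuallyEq (Filter.Eventually.of_forall hrr)
  have hinj := injective_mfderivWithin_of_leftInverse
    ((S.contMDiffOn_polar_val _ hyD).mdifferentiableWithinAt (by simp)) (r := r)
    (by rw [hp]; exact hrs.mdifferentiableAt (by simp)) (S.uniqueDiffOn_polarDom _ hyD) ?_ hyD
  · exact ContinuousLinearMap.bijective_of_injective_of_finrank_eq
      (E := EuclideanSpace ℝ (Fin k) × ℝ × ℝ) (F := EuclideanSpace ℝ (Fin (k + 2))) _ (by simp) hinj
  · have hO : {z : EuclideanSpace ℝ (Fin k) × ℝ × ℝ | z.2.1 ∈ Ioo (-Real.pi) Real.pi} ∈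
        𝓝 (y.1, (0 : ℝ), y.2) :=
      (isOpen_Ioo.preimage (continuous_fst.comp continuous_snd)).mem_nhds
        ⟨neg_lt_zero.2 Real.pi_pos, Real.pi_pos⟩
    filter_upwards [self_mem_nhdsWithin, mem_nhdsWithin_of_mem_nhds hO] with z hz hzO
    have hz' : (z.1, z.2.2) ∈ S.B ×ˢ Ico 0 S.δ := ⟨hz.1, hz.2.2⟩
    have h2 := S.τ_mem _ hz'
    rw [hrr, hr₀, polar]
    simp only [hinv, S.s_smul _ _ h2, S.w_smul _ _ h2, S.w_τ _ hz', S.s_τ _ hz', S.f_τ _ hz',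
      mul_one, Circle.arg_exp hzO.1 hzO.2.le]

theorem sliceForm_nondegenerate (hf : IsBoundaryDefining (k := k) f)
    (hinv : ∀ (a : Circle) (x : A.U), f (a • x) = f x)
    {β : DiffForm (𝓡∂ (k + 2)) M 2} (hβ : β.IsNondegenerate)
    {y : EuclideanSpace ℝ (Fin k) × ℝ} (hy : y ∈ S.B ×ˢ Ico 0 S.δ) :
    AltNondegenerate (S.sliceForm β y) :=
  AltNondegenerate.comp (F := EuclideanSpace ℝ (Fin (k + 2)))
    (α := β (S.polar (y.1, 0, y.2)).1) (hβ (S.polar (y.1, 0, y.2)).1)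
    (S.bijective_mfderivWithin_polar hf hinv hy)

/-- The contraction of a basic form with the generating vector field vanishes, in coordinates. -/
theorem param_bdryAct_bdryLift_apply (hf : IsBoundaryDefining (k := k) f)
    {α : DiffForm (𝓡 (k + 1)) (Bdry k M) 2} (hα : DiffForm.IsBasic A.bdryAct α) (p₀ : Bdry k M)
    (a₀ : Circle) {s : EuclideanSpace ℝ (Fin k)} (hs : s ∈ S.B)
    (v : EuclideanSpace ℝ (Fin k) × ℝ) :
    α.param (fun y => A.bdryAct (a₀ * Circle.exp y.2) (S.bdryLift p₀ y.1)) (S.B ×ˢ univ) (s, 0)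
      ![(0, 1), v] = 0 := by
  set h := fun y : EuclideanSpace ℝ (Fin k) × ℝ =>
    A.bdryAct (a₀ * Circle.exp y.2) (S.bdryLift p₀ y.1) with hh
  have hmem : ((s, 0) : EuclideanSpace ℝ (Fin k) × ℝ) ∈ S.B ×ˢ (univ : Set ℝ) := ⟨hs, mem_univ _⟩
  have h1 : HasMFDerivWithinAt 𝓘(ℝ, EuclideanSpace ℝ (Fin k) × ℝ) (𝓡 (k + 1)) h (S.B ×ˢ univ)
      (s, 0) _ := ((S.contMDiffOn_bdryAct_bdryLift hf p₀ a₀ _ hmem).mdifferentiableWithinAt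
        (by simp)).hasMFDerivWithinAt
  have hO : S.B ×ˢ (univ : Set ℝ) ∈ 𝓝 (s, (0 : ℝ)) := (S.isOpen_B.prod isOpen_univ).mem_nhds hmem
  have h2 := h1.hasMFDerivAt hO
  have h3 : HasMFDerivAt 𝓘(ℝ, ℝ) 𝓘(ℝ, EuclideanSpace ℝ (Fin k) × ℝ) (fun t : ℝ => (s, t)) 0
      (ContinuousLinearMap.inr ℝ (EuclideanSpace ℝ (Fin k)) ℝ) :=
    (hasFDerivAt_prodMk_right s (0 : ℝ)).hasMFDerivAt
  have h4 := HasMFDerivAt.comp (g := h) (0 : ℝ) h2 h3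
  -- The coordinate line in the angular direction is an orbit, so its velocity is the generating
  -- field.
  have h5 : h ∘ (fun t : ℝ => (s, t)) = fun t : ℝ => A.bdryAct (Circle.exp t) (h (s, 0)) := by
    ext1 t
    simp only [hh, Function.comp_apply, Circle.exp_zero, mul_one]
    rw [← A.bdryAct_mul, mul_comm]
  rw [h5] at h4
  have h6 : (generatingField (𝓡 (k + 1)) A.bdryAct (h (s, 0)) : EuclideanSpace ℝ (Fin (k + 1))) =
      (mfderivWithin 𝓘(ℝ, EuclideanSpace ℝ (Fin k) × ℝ) (𝓡 (k + 1)) h (S.B ×ˢ univ) (s, 0) :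
        EuclideanSpace ℝ (Fin k) × ℝ →L[ℝ] EuclideanSpace ℝ (Fin (k + 1))) (0, 1) := by
    have h7 := DFunLike.congr_fun h4.mfderiv (1 : ℝ)
    exact h7
  have h8 := hα.horizontal (h (s, 0)) ![(mfderivWithin 𝓘(ℝ, EuclideanSpace ℝ (Fin k) × ℝ)
    (𝓡 (k + 1)) h (S.B ×ˢ univ) (s, 0) :
      EuclideanSpace ℝ (Fin k) × ℝ →L[ℝ] EuclideanSpace ℝ (Fin (k + 1))) v]
  refine (alt_comp_apply_two (F := EuclideanSpace ℝ (Fin (k + 1))) (α (h (s, 0))) _ _ _).trans ?_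
  have h9 : ∀ u : EuclideanSpace ℝ (Fin (k + 1)),
      u = generatingField (𝓡 (k + 1)) A.bdryAct (h (s, 0)) →
      (α (h (s, 0)) : EuclideanSpace ℝ (Fin (k + 1)) [⋀^Fin 2]→L[ℝ] ℝ) ![u,
        (mfderivWithin 𝓘(ℝ, EuclideanSpace ℝ (Fin k) × ℝ) (𝓡 (k + 1)) h (S.B ×ˢ univ) (s, 0) :
          EuclideanSpace ℝ (Fin k) × ℝ →L[ℝ] EuclideanSpace ℝ (Fin (k + 1))) v] = 0 := by
    rintro _ rfl
    exact h8
  exact h9 _ h6.symm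

end Slice

end BoundaryCircleAction

end

/-! ### Consequences of basicness, and passage to complex coordinates -/

noncomputable section

namespace BoundaryCircleAction

variable {k : ℕ} {M : Type*} [TopologicalSpace M] [ChartedSpace (EuclideanHalfSpace (k + 2)) M]
  [IsManifold (𝓡∂ (k + 2)) ∞ M] {A : BoundaryCircleAction k M} {f : A.U → ℝ}

namespace Slice

variable (S : A.Slice f)

/-- The inclusion `(s, θ) ↦ (s, θ, 0)`. -/
def bdryPolar (k : ℕ) :
    EuclideanSpace ℝ (Fin k) × ℝ →L[ℝ] EuclideanSpace ℝ (Fin k) × ℝ × ℝ :=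
  (ContinuousLinearMap.fst ℝ (EuclideanSpace ℝ (Fin k)) ℝ).prod
    ((ContinuousLinearMap.snd ℝ (EuclideanSpace ℝ (Fin k)) ℝ).prod 0)

theorem bdryPolar_apply (y : EuclideanSpace ℝ (Fin k) × ℝ) : bdryPolar k y = (y.1, y.2, 0) := rfl

theorem param_bdryAct_bdryLift (hf : IsBoundaryDefining (k := k) f)
    (β : DiffForm (𝓡∂ (k + 2)) M 2) (p₀ : Bdry k M) {s : EuclideanSpace ℝ (Fin k)} (hs : s ∈ S.B) :
    (DiffForm.pullback (𝓡 (k + 1)) (𝓡∂ (k + 2)) (bdryIncl k M) β).param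
      (fun y => A.bdryAct (1 * Circle.exp y.2) (S.bdryLift p₀ y.1)) (S.B ×ˢ univ) (s, 0) =
    (S.sliceForm β (s, 0)).compContinuousLinearMap (bdryPolar k) := by
  have hmem : ((s, 0) : EuclideanSpace ℝ (Fin k) × ℝ) ∈ S.B ×ˢ (univ : Set ℝ) := ⟨hs, mem_univ _⟩
  have hu : UniqueDiffWithinAt ℝ (S.B ×ˢ (univ : Set ℝ)) (s, 0) :=
    (S.isOpen_B.prod isOpen_univ).uniqueDiffWithinAt hmem
  have h1 := DiffForm.param_pullback (F := EuclideanSpace ℝ (Fin k) × ℝ) β (f := bdryIncl k M)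
    (contMDiff_bdryIncl.mdifferentiableAt (by simp))
    ((S.contMDiffOn_bdryAct_bdryLift hf p₀ 1 _ hmem).mdifferentiableWithinAt (by simp)) hu
  rw [h1]
  have heq : ∀ y ∈ S.B ×ˢ (univ : Set ℝ), (bdryIncl k M ∘ fun y =>
      A.bdryAct (1 * Circle.exp y.2) (S.bdryLift p₀ y.1)) y =
      ((fun z => (S.polar z).1) ∘ bdryPolar k) y := by
    intro y hy
    simp only [Function.comp_apply, bdryPolar_apply, polar, bdryIncl]
    rw [A.bdryAct_val, S.bdryToU_bdryLift hf p₀ hy.1, one_mul]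
  have h2 := β.param_congr (g := bdryIncl k M ∘ fun y =>
      A.bdryAct (1 * Circle.exp y.2) (S.bdryLift p₀ y.1))
    (g' := (fun z => (S.polar z).1) ∘ bdryPolar k) (D := S.B ×ˢ (univ : Set ℝ)) (y := (s, 0))
    (Filter.eventually_of_mem self_mem_nhdsWithin heq) (heq _ hmem)
  rw [h2]
  have hmp : MapsTo (bdryPolar k) (S.B ×ˢ univ) S.polarDom := fun y hy =>
    ⟨hy.1, mem_univ _, le_rfl, S.δ_pos⟩
  have h3 := β.param_comp (g := fun z => (S.polar z).1) (D := S.polarDom) (h := bdryPolar k)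
    (D' := S.B ×ˢ (univ : Set ℝ)) (y := (s, 0))
    ((S.contMDiffOn_polar_val _ (hmp hmem)).mdifferentiableWithinAt (by simp))
    (bdryPolar k).differentiableAt.differentiableWithinAt
    (Filter.mem_of_superset self_mem_nhdsWithin hmp) hu
  rw [h3, (bdryPolar k).fderivWithin hu]
  rfl

/-- This is horizontality of the boundary pullback. It concerns only vectors tangent to the
boundary, so the pairing of the angular with the radial vector is not affected. -/
theorem sliceForm_angular (hf : IsBoundaryDefining (k := k) f)
    {β : DiffForm (𝓡∂ (k + 2)) M 2} (hb : A.BasicOnBoundary β)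
    {s : EuclideanSpace ℝ (Fin k)} (hs : s ∈ S.B) (v : EuclideanSpace ℝ (Fin k)) :
    S.sliceForm β (s, 0) ![angularVector _, (v, 0, 0)] = 0 := by
  have h : (S.τ (s, 0)).1 ∈ (𝓡∂ (k + 2)).boundary M := by
    rw [← A.mem_boundary_coe, ← hf.zero_iff, S.f_τ _ (S.zero_mem hs)]
  have h1 := S.param_bdryAct_bdryLift_apply hf hb ⟨_, h⟩ 1 hs (v, 0)
  rw [S.param_bdryAct_bdryLift hf β ⟨_, h⟩ hs, alt_comp_apply_two] at h1
  exact h1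

/-- The contraction of `β` with the angular direction is divisible by `t` along the slice. -/
theorem exists_sliceForm_angular_eq (hf : IsBoundaryDefining (k := k) f)
    {β : DiffForm (𝓡∂ (k + 2)) M 2} (hβ : β.IsSmooth) (hb : A.BasicOnBoundary β) :
    ∃ γ : EuclideanSpace ℝ (Fin k) × ℝ → EuclideanSpace ℝ (Fin k) →L[ℝ] ℝ,
      ContDiffOn ℝ ∞ γ (S.B ×ˢ Ico 0 S.δ) ∧ ∀ y ∈ S.B ×ˢ Ico 0 S.δ, ∀ v,
        S.sliceForm β y ![angularVector _, (v, 0, 0)] = y.2 * γ y v := by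
  have h1 : ContDiffOn ℝ ∞ (fun y => (altToBilin _ (S.sliceForm β y) (angularVector _)).comp
      (ContinuousLinearMap.inl ℝ (EuclideanSpace ℝ (Fin k)) (ℝ × ℝ))) (S.B ×ˢ Ico 0 S.δ) :=
    ((contDiff_altToBilin.comp_contDiffOn (S.contDiffOn_sliceForm hβ)).clm_apply
      contDiffOn_const).clm_comp contDiffOn_const
  obtain ⟨γ, hγ, he⟩ := h1.exists_eq_smul_of_eq_zero S.convex_B S.isOpen_B fun s hs => by
    ext v
    exact (altToBilin_apply _ _ _).trans (S.sliceForm_angular hf hb hs v)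
  refine ⟨γ, hγ, fun y hy v => ?_⟩
  have h2 := DFunLike.congr_fun (he y.1 hy.1 y.2 hy.2) v
  exact (altToBilin_apply _ _ _).symm.trans h2

/-- Polar coordinates around `z₀`. -/
def polarMap (z₀ : ℂ) (y : EuclideanSpace ℝ (Fin k) × ℂ) : EuclideanSpace ℝ (Fin k) × ℝ × ℝ :=
  (y.1, (starRingEnd ℂ z₀ * y.2).arg, ‖y.2‖ ^ 2)

/-- The angle is measured relative to `z₀`: then `z̄₀ z₀ = |z₀|²` is on the positive axis, where
`arg = Im log` is differentiable. -/
theorem hasFDerivAt_polarMap (s : EuclideanSpace ℝ (Fin k)) {z₀ : ℂ} (hz : z₀ ≠ 0) :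
    HasFDerivAt (polarMap z₀) (polarDeriv (EuclideanSpace ℝ (Fin k)) z₀) (s, z₀) := by
  have hmul : starRingEnd ℂ z₀ * z₀ = ((‖z₀‖ ^ 2 : ℝ) : ℂ) := by
    rw [Complex.conj_mul']; simp
  have h1 : HasFDerivAt (fun y : EuclideanSpace ℝ (Fin k) × ℂ => y.1)
      (ContinuousLinearMap.fst ℝ (EuclideanSpace ℝ (Fin k)) ℂ) (s, z₀) := hasFDerivAt_fst
  have h2 : HasFDerivAt (fun y : EuclideanSpace ℝ (Fin k) × ℂ => starRingEnd ℂ z₀ * y.2)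
      (conjMul (EuclideanSpace ℝ (Fin k)) z₀) (s, z₀) :=
    (conjMul (EuclideanSpace ℝ (Fin k)) z₀).hasFDerivAt
  have h3 : HasFDerivAt Complex.log
      (((ContinuousLinearMap.toSpanSingleton ℂ ((starRingEnd ℂ z₀ * z₀)⁻¹)).restrictScalars ℝ))
      (starRingEnd ℂ z₀ * z₀) := by
    refine HasFDerivAt.restrictScalars ℝ (Complex.hasDerivAt_log ?_).hasFDerivAt
    rw [hmul]
    exact Complex.ofReal_mem_slitPlane.2 (by positivity)
  have h4 : HasFDerivAt (fun y : EuclideanSpace ℝ (Fin k) × ℂ => (starRingEnd ℂ z₀ * y.2).arg)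
      ((‖z₀‖ ^ 2)⁻¹ • Complex.imCLM.comp (conjMul (EuclideanSpace ℝ (Fin k)) z₀)) (s, z₀) := by
    have h5 := Complex.imCLM.hasFDerivAt.comp (s, z₀) (HasFDerivAt.comp (s, z₀) h3 h2)
    have h6 : (fun y : EuclideanSpace ℝ (Fin k) × ℂ => (starRingEnd ℂ z₀ * y.2).arg) =
        Complex.imCLM ∘ (Complex.log ∘ fun y : EuclideanSpace ℝ (Fin k) × ℂ =>
          starRingEnd ℂ z₀ * y.2) := by
      ext y; simp [Complex.log_im]
    rw [h6]
    refine h5.congr_fderiv ?_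
    refine ContinuousLinearMap.ext fun v => ?_
    simp only [ContinuousLinearMap.comp_apply, ContinuousLinearMap.coe_restrictScalars',
      ContinuousLinearMap.toSpanSingleton_apply, smul_apply, smul_eq_mul,
      Complex.imCLM_apply, hmul]
    rw [← Complex.ofReal_inv, Complex.im_mul_ofReal, mul_comm]
  have h7 : HasFDerivAt (fun y : EuclideanSpace ℝ (Fin k) × ℂ => ‖y.2‖ ^ 2)
      ((2 : ℝ) • Complex.reCLM.comp (conjMul (EuclideanSpace ℝ (Fin k)) z₀)) (s, z₀) := by
    have h8 : HasFDerivAt (fun y : EuclideanSpace ℝ (Fin k) × ℂ => y.2)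
      (ContinuousLinearMap.snd ℝ (EuclideanSpace ℝ (Fin k)) ℂ) (s, z₀) := hasFDerivAt_snd
    refine h8.norm_sq.congr_fderiv ?_
    refine ContinuousLinearMap.ext fun v => ?_
    simp [conjMul_apply, Complex.inner]
    ring
  exact h1.prodMk (h4.prodMk h7)

theorem unitPart_mul_exp_arg {z₀ z : ℂ} (hz₀ : z₀ ≠ 0) (hz : z ≠ 0) :
    unitPart z₀ * Circle.exp (starRingEnd ℂ z₀ * z).arg = unitPart z := by
  have h1 : starRingEnd ℂ z₀ = ((‖z₀‖ : ℝ) : ℂ) * ((unitPart z₀)⁻¹ : Circle) := by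
    conv_lhs => rw [← norm_mul_unitPart z₀]
    rw [map_mul, Complex.conj_ofReal, Circle.coe_inv_eq_conj]
  have h2 : unitPart (starRingEnd ℂ z₀ * z) = (unitPart z₀)⁻¹ * unitPart z := by
    rw [h1, mul_assoc, unitPart_ofReal_mul (norm_pos_iff.2 hz₀)
      (mul_ne_zero (Circle.coe_ne_zero _) hz), unitPart_circle_mul _ hz]
  rw [← unitPart, h2, mul_inv_cancel_left]

/-- The form `β` in the coordinates `lift`, away from the origin. -/
theorem param_lift (β : DiffForm (𝓡∂ (k + 2)) M 2) {V : Set A.U} (hV : A.IsInvariantOn β V)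
    (hSV : S.W ⊆ V) {y : EuclideanSpace ℝ (Fin k) × ℂ} (hy : y ∈ S.dom) (h0 : y.2 ≠ 0) :
    β.param (fun z => (S.lift z).1) univ y =
      (S.sliceForm β (y.1, ‖y.2‖ ^ 2)).compContinuousLinearMap (polarDeriv _ y.2) := by
  have hsq := S.sq_mem hy
  have hP : polarMap y.2 y = (y.1, 0, ‖y.2‖ ^ 2) := by
    have : starRingEnd ℂ y.2 * y.2 = ((‖y.2‖ ^ 2 : ℝ) : ℂ) := by
      rw [Complex.conj_mul']; simp
    rw [polarMap, this, Complex.arg_ofReal_of_nonneg (by positivity)]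
  have hd := hasFDerivAt_polarMap y.1 h0
  have hn : S.polarDom ∈ 𝓝 (polarMap y.2 y) := by
    rw [hP]
    exact prod_mem_nhds (S.isOpen_B.mem_nhds hy.1) (prod_mem_nhds Filter.univ_mem
      (Ico_mem_nhds (by positivity) hy.2))
  have hD : polarMap y.2 y ∈ S.polarDom := mem_of_mem_nhds hn
  have hpd : MDifferentiableWithinAt 𝓘(ℝ, EuclideanSpace ℝ (Fin k) × ℝ × ℝ) (𝓡∂ (k + 2))
      S.polar S.polarDom (polarMap y.2 y) :=
    (S.contMDiffOn_polar _ hD).mdifferentiableWithinAt (by simp)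
  have hg : MDifferentiableWithinAt 𝓘(ℝ, EuclideanSpace ℝ (Fin k) × ℂ) (𝓡∂ (k + 2))
      (S.polar ∘ polarMap y.2) univ y :=
    (hpd.mdifferentiableAt hn).comp_mdifferentiableWithinAt y
      hd.differentiableAt.mdifferentiableAt.mdifferentiableWithinAt
  -- Up to the fixed rotation by the phase of `y.2`, `lift` is `polar` after polar coordinates
  -- around `y.2`. Invariance of `β` discards the rotation, and what is left is `β` on the slice at
  -- angle `0`.
  have hl : ∀ z : EuclideanSpace ℝ (Fin k) × ℂ, z.2 ≠ 0 →
      (S.lift z).1 = (unitPart y.2 • (S.polar ∘ polarMap y.2) z).1 := fun z hz => by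
    simp only [lift, polar, polarMap, Function.comp_apply]
    rw [smul_smul, unitPart_mul_exp_arg h0 hz]
  have h1 : β.param (fun z => (S.lift z).1) univ y =
      β.param (fun z => (unitPart y.2 • (S.polar ∘ polarMap y.2) z).1) univ y := by
    refine β.param_congr ?_ (hl y h0)
    rw [nhdsWithin_univ]
    filter_upwards [(isOpen_ne_fun continuous_snd continuous_const).mem_nhds h0] with z hz
    exact hl z hz
  have hVy : (S.polar ∘ polarMap y.2) y ∈ V := by
    simp only [Function.comp_apply, hP, polar, Circle.exp_zero, one_smul]
    exact hSV (S.τ_mem _ hsq)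
  have h2 := β.param_comp (g := fun z => (S.polar z).1) (D := S.polarDom) (h := polarMap y.2)
    (D' := univ) (y := y) ((S.contMDiffOn_polar_val _ hD).mdifferentiableWithinAt (by simp))
    hd.differentiableAt.differentiableWithinAt (by
      rw [nhdsWithin_univ]; exact hd.continuousAt hn) uniqueDiffWithinAt_univ
  rw [h1, hV.param_smul hg uniqueDiffWithinAt_univ hVy]
  refine h2.trans ?_
  rw [fderivWithin_univ, hd.fderiv, hP]
  rfl

end Slice

end BoundaryCircleAction

end

/-! ### The local cut form: smooth, closed, non-degenerate -/

noncomputable section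

namespace BoundaryCircleAction

variable {k : ℕ} {M : Type*} [TopologicalSpace M] [ChartedSpace (EuclideanHalfSpace (k + 2)) M]
  [IsManifold (𝓡∂ (k + 2)) ∞ M] {A : BoundaryCircleAction k M} {f : A.U → ℝ}

namespace Slice

variable (S : A.Slice f)

/-- The local expression of the cut form in the coordinates of a slice. -/
def cutLocal (β : DiffForm (𝓡∂ (k + 2)) M 2)
    (γ : EuclideanSpace ℝ (Fin k) × ℝ → EuclideanSpace ℝ (Fin k) →L[ℝ] ℝ)
    (y : EuclideanSpace ℝ (Fin k) × ℂ) : (EuclideanSpace ℝ (Fin k) × ℂ) [⋀^Fin 2]→L[ℝ] ℝ :=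
  cutModel (S.sliceForm β (y.1, ‖y.2‖ ^ 2)) (γ (y.1, ‖y.2‖ ^ 2)) y.2

variable {β : DiffForm (𝓡∂ (k + 2)) M 2}
  {γ : EuclideanSpace ℝ (Fin k) × ℝ → EuclideanSpace ℝ (Fin k) →L[ℝ] ℝ}

theorem contDiffOn_cutLocal (hβ : β.IsSmooth) (hγ : ContDiffOn ℝ ∞ γ (S.B ×ˢ Ico 0 S.δ)) :
    ContDiffOn ℝ ∞ (S.cutLocal β γ) S.dom :=
  contDiffOn_cutModel (S.contDiffOn_sliceForm hβ) hγ

theorem cutLocal_eq_comp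
    (he : ∀ y ∈ S.B ×ˢ Ico 0 S.δ, ∀ v,
      S.sliceForm β y ![angularVector _, (v, 0, 0)] = y.2 * γ y v)
    {y : EuclideanSpace ℝ (Fin k) × ℂ} (hy : y ∈ S.dom) (h0 : y.2 ≠ 0) :
    S.cutLocal β γ y =
      (S.sliceForm β (y.1, ‖y.2‖ ^ 2)).compContinuousLinearMap (polarDeriv _ y.2) :=
  cutModel_eq_comp_polarDeriv h0 fun v => he _ (S.sq_mem hy) v

/-- Away from `z = 0` it is the pullback of a non-degenerate form by a bijection. At `z = 0` the
factor `t` kills the pairing of the angular vector with `ℝᵏ`, and `AltNondegenerate.cutModel_zero`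
applies. -/
theorem cutLocal_nondegenerate (hf : IsBoundaryDefining (k := k) f)
    (hinv : ∀ (a : Circle) (x : A.U), f (a • x) = f x) (hβ : β.IsNondegenerate)
    (he : ∀ y ∈ S.B ×ˢ Ico 0 S.δ, ∀ v,
      S.sliceForm β y ![angularVector _, (v, 0, 0)] = y.2 * γ y v)
    {y : EuclideanSpace ℝ (Fin k) × ℂ} (hy : y ∈ S.dom) : AltNondegenerate (S.cutLocal β γ y) := by
  have h1 := S.sliceForm_nondegenerate hf hinv hβ (S.sq_mem hy)
  by_cases h0 : y.2 = 0
  · rw [cutLocal, h0]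
    rw [h0] at h1
    refine h1.cutModel_zero (fun v => ?_) _
    have h2 := he _ (S.sq_mem hy) v
    rw [h0] at h2
    simpa using h2
  · rw [S.cutLocal_eq_comp he hy h0]
    exact h1.comp (polarDeriv_bijective h0)

theorem contMDiffAt_lift_val {y : EuclideanSpace ℝ (Fin k) × ℂ} (hy : y ∈ S.dom) (h0 : y.2 ≠ 0) :
    ContMDiffAt 𝓘(ℝ, EuclideanSpace ℝ (Fin k) × ℂ) (𝓡∂ (k + 2)) ∞ (fun z => (S.lift z).1) y :=
  contMDiff_subtype_val.contMDiffAt.comp y (S.contMDiffAt_lift hy h0)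

theorem bijective_mfderiv_lift (hf : IsBoundaryDefining (k := k) f)
    (hinv : ∀ (a : Circle) (x : A.U), f (a • x) = f x)
    {y : EuclideanSpace ℝ (Fin k) × ℂ} (hy : y ∈ S.dom) (h0 : y.2 ≠ 0) :
    Function.Bijective (mfderivWithin 𝓘(ℝ, EuclideanSpace ℝ (Fin k) × ℂ) (𝓡∂ (k + 2))
      (fun z => (S.lift z).1) univ y :
      EuclideanSpace ℝ (Fin k) × ℂ →L[ℝ] EuclideanSpace ℝ (Fin (k + 2))) := by
  classical
  set r : M → EuclideanSpace ℝ (Fin k) × ℂ :=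
    fun x => if h : x ∈ A.U then S.coord ⟨x, h⟩ else 0 with hr
  have hrr : ∀ x : A.U, r x.1 = S.coord x := fun x => by simp [hr]
  have hfy : f (S.lift y) ≠ 0 := by
    rw [S.f_lift hinv hy]; positivity
  have hrs : ContMDiffAt (𝓡∂ (k + 2)) 𝓘(ℝ, EuclideanSpace ℝ (Fin k) × ℂ) ∞ r (S.lift y).1 := by
    rw [← contMDiffAt_subtype_iff]
    exact (S.contMDiffAt_coord hf (S.lift_mem hy) hfy).congr_of_eventuallyEq
      (Filter.Eventually.of_forall hrr)
  refine ContinuousLinearMap.bijective_of_injective_of_finrank_eq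
    (E := EuclideanSpace ℝ (Fin k) × ℂ) (F := EuclideanSpace ℝ (Fin (k + 2))) _ (by simp) ?_
  refine injective_mfderivWithin_of_leftInverse
    ((S.contMDiffAt_lift_val hy h0).mdifferentiableAt (by simp)).mdifferentiableWithinAt (r := r)
    (hrs.mdifferentiableAt (by simp)) uniqueDiffWithinAt_univ ?_ (mem_univ _)
  rw [nhdsWithin_univ]
  filter_upwards [S.isOpen_dom.mem_nhds hy] with z hz
  rw [hrr, S.coord_lift hinv hz]

/-- Where `z ≠ 0` the expression is a pullback of the closed form `β`. Being smooth across `z = 0`,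
it has a continuous exterior derivative, which therefore vanishes in the limit as well. -/
theorem extDeriv_cutLocal (hβ : β.IsSmooth) (hβc : β.IsClosed) {V : Set A.U}
    (hV : A.IsInvariantOn β V) (hSV : S.W ⊆ V) (hγ : ContDiffOn ℝ ∞ γ (S.B ×ˢ Ico 0 S.δ))
    (he : ∀ y ∈ S.B ×ˢ Ico 0 S.δ, ∀ v,
      S.sliceForm β y ![angularVector _, (v, 0, 0)] = y.2 * γ y v)
    {y : EuclideanSpace ℝ (Fin k) × ℂ} (hy : y ∈ S.dom) :
    extDeriv (S.cutLocal β γ) y = 0 := by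
  have hO : IsOpen (S.dom ∩ {z | z.2 ≠ 0}) :=
    S.isOpen_dom.inter (isOpen_ne_fun continuous_snd continuous_const)
  have key : ∀ z ∈ S.dom ∩ {z | z.2 ≠ 0}, extDeriv (S.cutLocal β γ) z = 0 := by
    intro z hz
    have h1 : S.cutLocal β γ =ᶠ[𝓝 z] β.param (fun z => (S.lift z).1) (S.dom ∩ {z | z.2 ≠ 0}) := by
      filter_upwards [hO.mem_nhds hz] with u hu
      rw [S.cutLocal_eq_comp he hu.1 hu.2, ← S.param_lift β hV hSV hu.1 hu.2]
      exact β.param_congr_set (Filter.eventuallyEq_set.2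
        (by filter_upwards [hO.mem_nhds hu] with w hw using by simp [hw]))
    have h2 := DiffForm.IsClosed.extDerivWithin_param hβ hβc hO.uniqueDiffOn
      (fun u hu => (S.contMDiffAt_lift_val hu.1 hu.2).contMDiffWithinAt) hz
      (subset_closure (by rwa [hO.interior_eq]))
    rw [h1.extDeriv_eq, extDeriv, ← fderivWithin_of_isOpen hO hz]
    exact h2
  have hcont : ContinuousOn (extDeriv (S.cutLocal β γ)) S.dom := by
    have h1 := (S.contDiffOn_cutLocal hβ hγ).continuousOn_fderiv_of_isOpen S.isOpen_dom (by simp)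
    exact (ContinuousAlternatingMap.alternatizeUncurryFinCLM ℝ
      (EuclideanSpace ℝ (Fin k) × ℂ) ℝ).continuous.comp_continuousOn h1
  by_cases h0 : y.2 = 0
  swap
  · exact key y ⟨hy, h0⟩
  have hl : Continuous fun t : ℝ => ((y.1, (t : ℂ)) : EuclideanSpace ℝ (Fin k) × ℂ) := by fun_prop
  have hl0 : ((y.1, ((0 : ℝ) : ℂ)) : EuclideanSpace ℝ (Fin k) × ℂ) = y :=
    Prod.ext rfl (by rw [h0]; simp)
  have hlt : Filter.Tendsto (fun t : ℝ => ((y.1, (t : ℂ)) : EuclideanSpace ℝ (Fin k) × ℂ))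
      (𝓝[>] 0) (𝓝 y) := by
    have := hl.tendsto 0
    rw [hl0] at this
    exact this.mono_left nhdsWithin_le_nhds
  have hc := (hcont.continuousAt (S.isOpen_dom.mem_nhds hy)).tendsto.comp hlt
  refine tendsto_nhds_unique_of_eventuallyEq hc tendsto_const_nhds ?_
  filter_upwards [self_mem_nhdsWithin, hlt (S.isOpen_dom.mem_nhds hy)] with t ht ht'
  have ht0 : (0 : ℝ) < t := ht
  exact key _ ⟨ht', by simpa using ht0.ne'⟩

/-- The local expression of the cut form in the chart of a slice. -/
def cutChartForm (β : DiffForm (𝓡∂ (k + 2)) M 2)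
    (γ : EuclideanSpace ℝ (Fin k) × ℝ → EuclideanSpace ℝ (Fin k) →L[ℝ] ℝ)
    (y : EuclideanSpace ℝ (Fin (k + 2))) : EuclideanSpace ℝ (Fin (k + 2)) [⋀^Fin 2]→L[ℝ] ℝ :=
  (S.cutLocal β γ ((modelEquiv k).symm y)).compContinuousLinearMap
    ((modelEquiv k).symm : EuclideanSpace ℝ (Fin (k + 2)) →L[ℝ] EuclideanSpace ℝ (Fin k) × ℂ)

theorem contDiffOn_cutChartForm (hβ : β.IsSmooth) (hγ : ContDiffOn ℝ ∞ γ (S.B ×ˢ Ico 0 S.δ)) :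
    ContDiffOn ℝ ∞ (S.cutChartForm β γ) ((modelEquiv k).symm ⁻¹' S.dom) := fun y hy =>
  ContDiffWithinAt.alt_two_comp (((S.contDiffOn_cutLocal hβ hγ) _ hy).comp y
    (modelEquiv k).symm.contDiff.contDiffWithinAt fun _ h => h) contDiffWithinAt_const

theorem extDeriv_cutChartForm (hβ : β.IsSmooth) (hβc : β.IsClosed) {V : Set A.U}
    (hV : A.IsInvariantOn β V) (hSV : S.W ⊆ V) (hγ : ContDiffOn ℝ ∞ γ (S.B ×ˢ Ico 0 S.δ))
    (he : ∀ y ∈ S.B ×ˢ Ico 0 S.δ, ∀ v,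
      S.sliceForm β y ![angularVector _, (v, 0, 0)] = y.2 * γ y v)
    {y : EuclideanSpace ℝ (Fin (k + 2))} (hy : (modelEquiv k).symm y ∈ S.dom) :
    extDeriv (S.cutChartForm β γ) y = 0 := by
  have h1 : DifferentiableAt ℝ (S.cutLocal β γ) ((modelEquiv k).symm y) :=
    ((S.contDiffOn_cutLocal hβ hγ).contDiffAt (S.isOpen_dom.mem_nhds hy)).differentiableAt (by simp)
  have h2 := extDeriv_pullback (r := ∞) h1 (modelEquiv k).symm.contDiff.contDiffAt
    (by simp [ENat.LEInfty.out])
  have h3 : S.cutChartForm β γ = fun z => (S.cutLocal β γ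
      ((modelEquiv k).symm z)).compContinuousLinearMap (fderiv ℝ (modelEquiv k).symm z) := by
    ext1 z
    rw [ContinuousLinearEquiv.fderiv]
    rfl
  rw [h3, h2, S.extDeriv_cutLocal hβ hβc hV hSV hγ he hy]
  ext; simp

theorem cutChartForm_nondegenerate (hf : IsBoundaryDefining (k := k) f)
    (hinv : ∀ (a : Circle) (x : A.U), f (a • x) = f x) (hβ : β.IsNondegenerate)
    (he : ∀ y ∈ S.B ×ˢ Ico 0 S.δ, ∀ v,
      S.sliceForm β y ![angularVector _, (v, 0, 0)] = y.2 * γ y v)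
    {y : EuclideanSpace ℝ (Fin (k + 2))} (hy : (modelEquiv k).symm y ∈ S.dom) :
    AltNondegenerate (S.cutChartForm β γ y) :=
  (S.cutLocal_nondegenerate hf hinv hβ he hy).comp (modelEquiv k).symm.bijective

theorem cutChartForm_comp_modelEquiv (y : EuclideanSpace ℝ (Fin k) × ℂ) :
    (S.cutChartForm β γ (modelEquiv k y)).compContinuousLinearMap
      (modelEquiv k : EuclideanSpace ℝ (Fin k) × ℂ →L[ℝ] EuclideanSpace ℝ (Fin (k + 2))) =
      S.cutLocal β γ y := by
  refine alt_two_ext fun v w => ?_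
  rw [alt_comp_apply_two, cutChartForm, alt_comp_apply_two]
  simp

end Slice

/-! ### Transport of the form to the cut space -/

section CutForm

variable [ChartedSpace (EuclideanSpace ℝ (Fin (k + 2))) A.Cut] [IsManifold (𝓡 (k + 2)) ∞ A.Cut]

/-- Over the interior the derivative of `toCut` is invertible and `β` is transported pointwise;
elsewhere the value is `0` by default. No smoothness is claimed: the form is only a reference
against which local expressions are compared on a dense set. -/
theorem exists_interior_form (hc : ∀ φ, φ ∈ atlas (EuclideanSpace ℝ (Fin (k + 2))) A.Cut ↔
    IsCompatibleChart (A.CutSmoothAt f) φ) (β : DiffForm (𝓡∂ (k + 2)) M 2) :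
    ∃ θ : DiffForm (𝓡 (k + 2)) A.Cut 2, ∀ x ∈ (𝓡∂ (k + 2)).interior M,
      DiffForm.pullback (𝓡∂ (k + 2)) (𝓡 (k + 2)) A.toCut θ x = β x := by
  have h1 : ∀ q : A.Cut, ∃ θ : EuclideanSpace ℝ (Fin (k + 2)) [⋀^Fin 2]→L[ℝ] ℝ,
      ∀ x ∈ (𝓡∂ (k + 2)).interior M, A.toCut x = q → θ.compContinuousLinearMap
        (mfderiv (𝓡∂ (k + 2)) (𝓡 (k + 2)) A.toCut x :
          EuclideanSpace ℝ (Fin (k + 2)) →L[ℝ] EuclideanSpace ℝ (Fin (k + 2))) = β x := by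
    intro q
    by_cases hq : ∃ x ∈ (𝓡∂ (k + 2)).interior M, A.toCut x = q
    · obtain ⟨x, hx, rfl⟩ := hq
      set L : EuclideanSpace ℝ (Fin (k + 2)) →L[ℝ] EuclideanSpace ℝ (Fin (k + 2)) :=
        mfderiv (𝓡∂ (k + 2)) (𝓡 (k + 2)) A.toCut x with hL
      have hs : Function.Surjective L := surjective_mfderiv_toCut hc hx
      let e := LinearEquiv.ofBijective L.toLinearMap
        ⟨LinearMap.injective_iff_surjective.2 hs, hs⟩
      let e' := e.toContinuousLinearEquiv
      refine ⟨(β x : EuclideanSpace ℝ (Fin (k + 2)) [⋀^Fin 2]→L[ℝ] ℝ).compContinuousLinearMap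
        (e'.symm : EuclideanSpace ℝ (Fin (k + 2)) →L[ℝ] EuclideanSpace ℝ (Fin (k + 2))),
        fun z hz hzx => ?_⟩
      obtain rfl := A.eq_of_toCut_eq hz hzx
      refine alt_two_ext (E := EuclideanSpace ℝ (Fin (k + 2))) fun v w => ?_
      have h2 : ∀ v, e'.symm (L v) = v := fun v => e'.symm_apply_apply v
      let β₀ : EuclideanSpace ℝ (Fin (k + 2)) [⋀^Fin 2]→L[ℝ] ℝ := β z
      refine (alt_comp_apply_two (β₀.compContinuousLinearMap (e'.symm :
        EuclideanSpace ℝ (Fin (k + 2)) →L[ℝ] EuclideanSpace ℝ (Fin (k + 2)))) L v w).trans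
        ((alt_comp_apply_two β₀ _ _ _).trans ?_)
      simp only [ContinuousLinearEquiv.coe_coe, h2]
      rfl
    · exact ⟨0, fun x hx hxq => absurd ⟨x, hx, hxq⟩ hq⟩
  choose θ hθ using h1
  exact ⟨θ, fun x hx => hθ _ x hx rfl⟩

/-- A form at a point is determined by its pullback along a parametrization with surjective
derivative. When `ψ` reads the parametrization as a linear map `L`, this pullback is computed from
`Ω` through `L`. -/
theorem eq_ofChart_of_param (hc : ∀ φ, φ ∈ atlas (EuclideanSpace ℝ (Fin (k + 2))) A.Cut ↔
    IsCompatibleChart (A.CutSmoothAt f) φ) {β : DiffForm (𝓡∂ (k + 2)) M 2}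
    {θ : DiffForm (𝓡 (k + 2)) A.Cut 2} {x : M} (hx : x ∈ (𝓡∂ (k + 2)).interior M)
    (hθ : DiffForm.pullback (𝓡∂ (k + 2)) (𝓡 (k + 2)) A.toCut θ x = β x)
    {ψ : OpenPartialHomeomorph A.Cut (EuclideanSpace ℝ (Fin (k + 2)))}
    (hψ : ψ ∈ IsManifold.maximalAtlas (𝓡 (k + 2)) ∞ A.Cut) (hxψ : A.toCut x ∈ ψ.source)
    {Ω : EuclideanSpace ℝ (Fin (k + 2)) → EuclideanSpace ℝ (Fin (k + 2)) [⋀^Fin 2]→L[ℝ] ℝ}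
    {F : Type*} [NormedAddCommGroup F] [NormedSpace ℝ F] {g : F → M} {y : F}
    (hg : MDifferentiableAt 𝓘(ℝ, F) (𝓡∂ (k + 2)) g y) (hy : g y = x)
    (hs : Function.Surjective (mfderivWithin 𝓘(ℝ, F) (𝓡∂ (k + 2)) g univ y :
      F →L[ℝ] EuclideanSpace ℝ (Fin (k + 2))))
    {L : F →L[ℝ] EuclideanSpace ℝ (Fin (k + 2))} (hL : ψ ∘ A.toCut ∘ g =ᶠ[𝓝 y] L)
    (hΩ : (Ω (L y)).compContinuousLinearMap L = β.param g univ y) :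
    θ (A.toCut x) = DiffForm.ofChart ψ Ω (A.toCut x) := by
  subst hy
  have h1 : HasMFDerivAt (𝓡∂ (k + 2)) (𝓡 (k + 2)) A.toCut (g y) _ :=
    ((contMDiffAt_toCut hc hx).mdifferentiableAt (by simp)).hasMFDerivAt
  have h2 : HasMFDerivAt (𝓡 (k + 2)) (𝓡 (k + 2)) ψ (A.toCut (g y)) _ :=
    ((contMDiffAt_of_mem_maximalAtlas hψ hxψ).mdifferentiableAt (by simp)).hasMFDerivAt
  have h3 := h2.comp y (h1.comp y hg.hasMFDerivAt)
  have h4 : HasMFDerivAt 𝓘(ℝ, F) (𝓡 (k + 2)) (ψ ∘ A.toCut ∘ g) y L :=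
    L.hasFDerivAt.hasMFDerivAt.congr_of_eventuallyEq hL
  have h5 := hasMFDerivAt_unique h3 h4
  set dc : EuclideanSpace ℝ (Fin (k + 2)) →L[ℝ] EuclideanSpace ℝ (Fin (k + 2)) :=
    mfderiv (𝓡∂ (k + 2)) (𝓡 (k + 2)) A.toCut (g y) with hdc
  set dψ : EuclideanSpace ℝ (Fin (k + 2)) →L[ℝ] EuclideanSpace ℝ (Fin (k + 2)) :=
    mfderiv (𝓡 (k + 2)) (𝓡 (k + 2)) ψ (A.toCut (g y)) with hdψ
  set dg : F →L[ℝ] EuclideanSpace ℝ (Fin (k + 2)) :=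
    mfderivWithin 𝓘(ℝ, F) (𝓡∂ (k + 2)) g univ y with hdg
  have hdg' : dg = mfderiv 𝓘(ℝ, F) (𝓡∂ (k + 2)) g y := by rw [hdg, mfderivWithin_univ]
  have h5' : dψ.comp (dc.comp dg) = L := by rw [hdg']; exact h5
  have hdcs : Function.Surjective dc := surjective_mfderiv_toCut hc hx
  have hLy : ψ (A.toCut (g y)) = L y := hL.self_of_nhds
  set θ₀ : EuclideanSpace ℝ (Fin (k + 2)) [⋀^Fin 2]→L[ℝ] ℝ := θ (A.toCut (g y)) with hθ₀
  set β₀ : EuclideanSpace ℝ (Fin (k + 2)) [⋀^Fin 2]→L[ℝ] ℝ := β (g y) with hβ₀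
  have hθ' : θ₀.compContinuousLinearMap dc = β₀ := hθ
  have hΩ' : (Ω (L y)).compContinuousLinearMap L = β₀.compContinuousLinearMap dg := hΩ
  change θ₀ = (Ω (ψ (A.toCut (g y)))).compContinuousLinearMap dψ
  rw [hLy]
  refine alt_two_ext fun v w => ?_
  obtain ⟨v', rfl⟩ := hdcs v
  obtain ⟨w', rfl⟩ := hdcs w
  obtain ⟨v'', rfl⟩ := hs v'
  obtain ⟨w'', rfl⟩ := hs w'
  have e1 : θ₀ ![dc (dg v''), dc (dg w'')] = β₀ ![dg v'', dg w''] := by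
    rw [← hθ', alt_comp_apply_two]
  have e2 : (Ω (L y)) ![L v'', L w''] = β₀ ![dg v'', dg w''] := by
    have := congrArg (fun α : F [⋀^Fin 2]→L[ℝ] ℝ => α ![v'', w'']) hΩ'
    exact (alt_comp_apply_two (Ω (L y)) L v'' w'').symm.trans
      (this.trans (alt_comp_apply_two β₀ dg v'' w''))
  rw [alt_comp_apply_two]
  refine e1.trans (e2.symm.trans ?_)
  rw [← h5']
  rfl

end CutForm

end BoundaryCircleAction

end

noncomputable section

theorem alt_comp_injective {E F : Type*} [NormedAddCommGroup E] [NormedSpace ℝ E]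
    [NormedAddCommGroup F] [NormedSpace ℝ F] {m : ℕ} {L : E →L[ℝ] F} (hL : Function.Surjective L) :
    Function.Injective fun α : F [⋀^Fin m]→L[ℝ] ℝ => α.compContinuousLinearMap L := by
  intro α α' h
  ext v
  obtain ⟨u, rfl⟩ : ∃ u, v = L ∘ u := ⟨fun i => (hL (v i)).choose, funext fun i => (hL (v i)).choose_spec.symm⟩
  exact DFunLike.congr_fun h u

namespace BoundaryCircleAction

variable {k : ℕ} {M : Type*} [TopologicalSpace M] [ChartedSpace (EuclideanHalfSpace (k + 2)) M]
  [IsManifold (𝓡∂ (k + 2)) ∞ M] {A : BoundaryCircleAction k M} {f : A.U → ℝ}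
  [ChartedSpace (EuclideanSpace ℝ (Fin (k + 2))) A.Cut] [IsManifold (𝓡 (k + 2)) ∞ A.Cut]
  {β : DiffForm (𝓡∂ (k + 2)) M 2} {θ : DiffForm (𝓡 (k + 2)) A.Cut 2}

/-- The parametrization is `lift`: the slice chart reads it as `modelEquiv`, and `β` along it is
`cutLocal` where `z ≠ 0`. -/
theorem Slice.interior_form_eq_ofChart (S : A.Slice f)
    (hc : ∀ φ, φ ∈ atlas (EuclideanSpace ℝ (Fin (k + 2))) A.Cut ↔
      IsCompatibleChart (A.CutSmoothAt f) φ)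
    (hf : IsBoundaryDefining (k := k) f) (hinv : ∀ (a : Circle) (x : A.U), f (a • x) = f x)
    {V : Set A.U} (hV : A.IsInvariantOn β V) (hSV : S.W ⊆ V)
    {γ : EuclideanSpace ℝ (Fin k) × ℝ → EuclideanSpace ℝ (Fin k) →L[ℝ] ℝ}
    (he : ∀ y ∈ S.B ×ˢ Ico 0 S.δ, ∀ v,
      S.sliceForm β y ![angularVector _, (v, 0, 0)] = y.2 * γ y v)
    (hθ : ∀ x ∈ (𝓡∂ (k + 2)).interior M,
      DiffForm.pullback (𝓡∂ (k + 2)) (𝓡 (k + 2)) A.toCut θ x = β x) :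
    ∀ q ∈ (S.cutChart hf hinv).source ∩ A.toCut '' (𝓡∂ (k + 2)).interior M,
      θ q = DiffForm.ofChart (S.cutChart hf hinv) (S.cutChartForm β γ) q := by
  rintro _ ⟨⟨_, ⟨x, hxW, rfl⟩, rfl⟩, x', hx', hxx'⟩
  obtain rfl := A.eq_of_toCut_eq hx' hxx'
  have hfx : 0 < f x := lt_of_le_of_ne (hf.nonneg x) fun h => by
    have := (hf.zero_iff x).1 h.symm
    rw [A.mem_boundary_coe] at this
    exact notMem_interior_of_mem_boundary this hx'
  have hy := S.coord_mem hf hxW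
  have h0 : (S.coord x).2 ≠ 0 := by
    rw [← norm_pos_iff, S.norm_coord]
    exact Real.sqrt_pos.2 hfx
  refine eq_ofChart_of_param hc hx' (hθ _ hx')
    (IsManifold.subset_maximalAtlas ((hc _).2 (S.isCompatibleChart_cutChart hf hinv)))
    (S.mem_cutChart_source hf hinv hxW) (F := EuclideanSpace ℝ (Fin k) × ℂ)
    (g := fun z => (S.lift z).1) (y := S.coord x)
    ((S.contMDiffAt_lift_val hy h0).mdifferentiableAt (by simp))
    (by rw [S.lift_coord hf hxW hfx]) (S.bijective_mfderiv_lift hf hinv hy h0).2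
    (L := (modelEquiv k : EuclideanSpace ℝ (Fin k) × ℂ →L[ℝ] EuclideanSpace ℝ (Fin (k + 2))))
    ?_ ?_
  · filter_upwards [S.isOpen_dom.mem_nhds hy] with z hz
    exact (S.cutChart_apply hf hinv (S.lift_mem hz)).trans (by rw [S.coord_lift hinv hz]; rfl)
  · exact (S.cutChartForm_comp_modelEquiv _).trans ((S.cutLocal_eq_comp he hy h0).trans
      (S.param_lift β hV hSV hy h0).symm)

theorem interior_form_eq_ofChart_interiorChart
    (hc : ∀ φ, φ ∈ atlas (EuclideanSpace ℝ (Fin (k + 2))) A.Cut ↔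
      IsCompatibleChart (A.CutSmoothAt f) φ)
    (hθ : ∀ x ∈ (𝓡∂ (k + 2)).interior M,
      DiffForm.pullback (𝓡∂ (k + 2)) (𝓡 (k + 2)) A.toCut θ x = β x) (x₀ : M) :
    ∀ q ∈ (A.interiorChart x₀).source,
      θ q = DiffForm.ofChart (A.interiorChart x₀) (β.inChart x₀) q := by
  rintro _ ⟨x, hx, rfl⟩
  have hy := (extChartAt (𝓡∂ (k + 2)) x₀).map_source hx.1
  have hO : (extChartAt (𝓡∂ (k + 2)) x₀).target ∩ {y | 0 < y 0} ∈
      𝓝 (extChartAt (𝓡∂ (k + 2)) x₀ x) :=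
    (isOpen_interior_coords x₀).mem_nhds ⟨hy, (mem_interior_iff_extChartAt hx.1).1 hx.2⟩
  have hr : range (𝓡∂ (k + 2)) ∈ 𝓝 (extChartAt (𝓡∂ (k + 2)) x₀ x) :=
    Filter.mem_of_superset hO (inter_subset_left.trans (extChartAt_target_subset_range x₀))
  refine eq_ofChart_of_param hc hx.2 (hθ _ hx.2)
    (IsManifold.subset_maximalAtlas ((hc _).2 (A.isCompatibleChart_interiorChart f x₀)))
    ⟨x, hx, rfl⟩ (F := EuclideanSpace ℝ (Fin (k + 2))) (g := (extChartAt (𝓡∂ (k + 2)) x₀).symm)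
    (y := extChartAt (𝓡∂ (k + 2)) x₀ x)
    (((contMDiffOn_extChartAt_symm (n := ∞) x₀).contMDiffAt
      (Filter.mem_of_superset hO inter_subset_left)).mdifferentiableAt (by simp))
    ((extChartAt (𝓡∂ (k + 2)) x₀).left_inv hx.1) ?_
    (L := ContinuousLinearMap.id ℝ _) ?_ ?_
  · have h1 : ((mfderivWithin 𝓘(ℝ, EuclideanSpace ℝ (Fin (k + 2))) (𝓡∂ (k + 2))
      (extChartAt (𝓡∂ (k + 2)) x₀).symm (range (𝓡∂ (k + 2))) (extChartAt (𝓡∂ (k + 2)) x₀ x) :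
        EuclideanSpace ℝ (Fin (k + 2)) →L[ℝ] EuclideanSpace ℝ (Fin (k + 2)))).IsInvertible :=
      isInvertible_mfderivWithin_extChartAt_symm hy
    rw [mfderivWithin_of_mem_nhds hr, ← mfderivWithin_univ] at h1
    exact h1.bijective.2
  · filter_upwards [hO] with z hz
    have h1 := (extChartAt (𝓡∂ (k + 2)) x₀).map_target hz.1
    have h2 := (extChartAt (𝓡∂ (k + 2)) x₀).right_inv hz.1
    refine (A.interiorChart_apply x₀ ⟨h1, ?_⟩).trans h2
    rw [mem_interior_iff_extChartAt h1, h2]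
    exact hz.2
  · rw [← DiffForm.param_congr_set β (D := range (𝓡∂ (k + 2))) (D' := univ)]
    · rfl
    · exact Filter.eventuallyEq_univ.2 hr

omit [ChartedSpace (EuclideanSpace ℝ (Fin (k + 2))) A.Cut] [IsManifold (𝓡 (k + 2)) ∞ A.Cut] in
theorem inChart_interior_properties (hβ : β.IsSymplectic) (x₀ : M)
    {y : EuclideanSpace ℝ (Fin (k + 2))} (hy : y ∈ (A.interiorChart x₀).target) :
    extDeriv (β.inChart x₀) y = 0 ∧ AltNondegenerate (β.inChart x₀ y) := by
  have hr : range (𝓡∂ (k + 2)) ∈ 𝓝 y := Filter.mem_of_superset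
    ((isOpen_interior_coords x₀).mem_nhds hy)
    (inter_subset_left.trans (extChartAt_target_subset_range x₀))
  constructor
  · rw [← hβ.closed x₀ y hy.1, extDeriv, extDerivWithin, fderivWithin_of_mem_nhds hr]
  · have h1 : ((mfderivWithin 𝓘(ℝ, EuclideanSpace ℝ (Fin (k + 2))) (𝓡∂ (k + 2))
      (extChartAt (𝓡∂ (k + 2)) x₀).symm (range (𝓡∂ (k + 2))) y :
        EuclideanSpace ℝ (Fin (k + 2)) →L[ℝ] EuclideanSpace ℝ (Fin (k + 2)))).IsInvertible :=
      isInvertible_mfderivWithin_extChartAt_symm hy.1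
    exact AltNondegenerate.comp (E := EuclideanSpace ℝ (Fin (k + 2)))
      (F := EuclideanSpace ℝ (Fin (k + 2))) (hβ.nondegenerate _) h1.bijective

variable [T2Space M] [SecondCountableTopology M]

/-- The explicit expression in every slice chart is kept in the conclusion because the reduced form
is read off from it at `z = 0`. -/
theorem exists_cutForm (hc : ∀ φ, φ ∈ atlas (EuclideanSpace ℝ (Fin (k + 2))) A.Cut ↔
      IsCompatibleChart (A.CutSmoothAt f) φ)
    (hf : IsBoundaryDefining (k := k) f) (hinv : ∀ (a : Circle) (x : A.U), f (a • x) = f x)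
    (hβ : β.IsSymplectic) (hb : A.BasicOnBoundary β) {V : Set A.U} (hVn : A.IsInvariantNhd V)
    (hV : A.IsInvariantOn β V) :
    ∃ βcut : DiffForm (𝓡 (k + 2)) A.Cut 2, βcut.IsSymplectic ∧ A.IsCutForm β βcut ∧
      ∀ S : A.Slice f, S.W ⊆ V →
        ∀ γ : EuclideanSpace ℝ (Fin k) × ℝ → EuclideanSpace ℝ (Fin k) →L[ℝ] ℝ,
        ContDiffOn ℝ ∞ γ (S.B ×ˢ Ico 0 S.δ) → (∀ y ∈ S.B ×ˢ Ico 0 S.δ, ∀ v,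
          S.sliceForm β y ![angularVector _, (v, 0, 0)] = y.2 * γ y v) →
        ∀ y ∈ (S.cutChart hf hinv).target,
          βcut.inMaxChart (S.cutChart hf hinv) y = S.cutChartForm β γ y := by
  obtain ⟨θ, hθ⟩ := exists_interior_form hc β
  have hmax : ∀ φ, IsCompatibleChart (A.CutSmoothAt f) φ →
      φ ∈ IsManifold.maximalAtlas (𝓡 (k + 2)) ∞ A.Cut :=
    fun φ hφ => IsManifold.subset_maximalAtlas ((hc φ).2 hφ)
  have hsm : ∀ x₀, ContDiffOn ℝ ∞ (β.inChart x₀) (A.interiorChart x₀).target :=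
    fun x₀ => (hβ.smooth x₀).mono inter_subset_left
  obtain ⟨βcut, hs, he⟩ := DiffForm.exists_isSymplectic_of_local
    (N := A.Cut) (dense_toCut_interior (A := A)) θ fun q => by
      obtain ⟨x, rfl⟩ := A.isQuotientMap_toCut.surjective q
      by_cases hx : x ∈ (𝓡∂ (k + 2)).boundary M
      · obtain ⟨S, hp, hSV⟩ := exists_slice_bdry hf hinv hVn ⟨x, hx⟩
        obtain ⟨γ, hγ, hγe⟩ := S.exists_sliceForm_angular_eq hf hβ.smooth hb
        exact ⟨S.cutChart hf hinv, hmax _ (S.isCompatibleChart_cutChart hf hinv),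
          S.mem_cutChart_source hf hinv hp, S.cutChartForm β γ,
          S.contDiffOn_cutChartForm hβ.smooth hγ,
          fun y hy => S.extDeriv_cutChartForm hβ.smooth hβ.closed hV hSV hγ hγe hy,
          fun y hy => S.cutChartForm_nondegenerate hf hinv hβ.nondegenerate hγe hy,
          S.interior_form_eq_ofChart hc hf hinv hV hSV hγe hθ⟩
      · rw [← mem_compl_iff, ModelWithCorners.compl_boundary] at hx
        exact ⟨A.interiorChart x, hmax _ (A.isCompatibleChart_interiorChart f x),
          ⟨x, ⟨mem_extChartAt_source x, hx⟩, rfl⟩, β.inChart x, hsm x,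
          fun y hy => (inChart_interior_properties hβ x hy).1,
          fun y hy => (inChart_interior_properties hβ x hy).2,
          fun q hq => interior_form_eq_ofChart_interiorChart hc hθ x q hq.1⟩
  refine ⟨βcut, hs, ⟨hs.smooth, fun x hx => ?_⟩, fun S hSV γ hγ hγe y hy => ?_⟩
  · have hq : A.toCut x ∈ (A.interiorChart x).source := ⟨x, ⟨mem_extChartAt_source x, hx⟩, rfl⟩
    have h1 := interior_form_eq_ofChart_interiorChart hc hθ x
    have h2 : βcut (A.toCut x) = θ (A.toCut x) :=
      (he _ (hmax _ (A.isCompatibleChart_interiorChart f x)) _ (hsm x) (fun q hq => h1 q hq.1) _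
        hq).trans (h1 _ hq).symm
    rw [← hθ x hx, DiffForm.pullback, DiffForm.pullback, h2]
  · have hm := hmax _ (S.isCompatibleChart_cutChart hf hinv)
    rw [← DiffForm.inMaxChart_ofChart hm (S.cutChartForm β γ) hy]
    have h1 := DiffForm.inMaxChart_congr ((S.cutChart hf hinv).map_target hy)
      (he _ hm _ (S.contDiffOn_cutChartForm hβ.smooth hγ)
        (S.interior_form_eq_ofChart hc hf hinv hV hSV hγe hθ) _
        ((S.cutChart hf hinv).map_target hy))
    rwa [(S.cutChart hf hinv).right_inv hy] at h1

-- Both forms are determined on the image of the interior, where `toCut` has surjective derivative;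
-- this image is dense, and smooth forms are continuous.
omit [T2Space M] [SecondCountableTopology M] in
theorem IsCutForm.unique (hc : ∀ φ, φ ∈ atlas (EuclideanSpace ℝ (Fin (k + 2))) A.Cut ↔
      IsCompatibleChart (A.CutSmoothAt f) φ) {β' β'' : DiffForm (𝓡 (k + 2)) A.Cut 2}
    (h' : A.IsCutForm β β') (h'' : A.IsCutForm β β'') : β' = β'' := by
  funext q
  have hm : chartAt (EuclideanSpace ℝ (Fin (k + 2))) q ∈
      IsManifold.maximalAtlas (𝓡 (k + 2)) ∞ A.Cut := IsManifold.chart_mem_maximalAtlas q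
  have hq := mem_chart_source (EuclideanSpace ℝ (Fin (k + 2))) q
  have hn := (chartAt (EuclideanSpace ℝ (Fin (k + 2))) q).open_target.mem_nhds
    ((chartAt (EuclideanSpace ℝ (Fin (k + 2))) q).map_source hq)
  refine DiffForm.eq_of_eventually_eq_on_dense hm hq
    ((h'.smooth.contDiffOn_inMaxChart hm).continuousOn.continuousAt hn)
    ((h''.smooth.contDiffOn_inMaxChart hm).continuousOn.continuousAt hn)
    (dense_toCut_interior (A := A)) ?_
  refine eventually_mem_nhdsWithin.mono ?_
  rintro _ ⟨x, hx, rfl⟩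
  have h1 := (h'.pullback_eq x hx).trans (h''.pullback_eq x hx).symm
  exact alt_comp_injective (E := EuclideanSpace ℝ (Fin (k + 2)))
    (F := EuclideanSpace ℝ (Fin (k + 2))) (surjective_mfderiv_toCut hc hx) h1

end BoundaryCircleAction

end

/-! ### The reduced form -/

noncomputable section

theorem extDeriv_comp_clm {E F : Type*} [NormedAddCommGroup E] [NormedSpace ℝ E]
    [NormedAddCommGroup F] [NormedSpace ℝ F] {m : ℕ} {Ω : F → F [⋀^Fin m]→L[ℝ] ℝ} (L : E →L[ℝ] F)
    {y : E} (h : DifferentiableAt ℝ Ω (L y)) :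
    extDeriv (fun z => (Ω (L z)).compContinuousLinearMap L) y =
      (extDeriv Ω (L y)).compContinuousLinearMap L := by
  have h1 := extDeriv_pullback (r := ∞) h L.contDiff.contDiffAt (by simp [ENat.LEInfty.out])
  simpa only [ContinuousLinearMap.fderiv] using h1

namespace BoundaryCircleAction

variable {k : ℕ} {M : Type*} [TopologicalSpace M] [ChartedSpace (EuclideanHalfSpace (k + 2)) M]
  [IsManifold (𝓡∂ (k + 2)) ∞ M] {A : BoundaryCircleAction k M} {f : A.U → ℝ}
  {β : DiffForm (𝓡∂ (k + 2)) M 2}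
  {γ : EuclideanSpace ℝ (Fin k) × ℝ → EuclideanSpace ℝ (Fin k) →L[ℝ] ℝ}

theorem contMDiff_bdryAct (A : BoundaryCircleAction k M) (a : Circle) :
    ContMDiff (𝓡 (k + 1)) (𝓡 (k + 1)) ∞ (A.bdryAct a) := fun p => by
  refine contMDiffWithinAt_univ.1 (contMDiffWithinAt_bdry ?_)
  exact (contMDiff_subtype_val.comp ((A.contMDiff_const_smul a).comp
    A.contMDiff_bdryToU)).contMDiffAt.contMDiffWithinAt

namespace Slice

variable (S : A.Slice f)

/-- The local expression of the reduced form in the coordinates of a slice. -/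
def redLocal (β : DiffForm (𝓡∂ (k + 2)) M 2)
    (γ : EuclideanSpace ℝ (Fin k) × ℝ → EuclideanSpace ℝ (Fin k) →L[ℝ] ℝ)
    (y : EuclideanSpace ℝ (Fin k)) : EuclideanSpace ℝ (Fin k) [⋀^Fin 2]→L[ℝ] ℝ :=
  (S.cutLocal β γ (ContinuousLinearMap.inl ℝ _ ℂ y)).compContinuousLinearMap
    (ContinuousLinearMap.inl ℝ _ ℂ)

theorem redLocal_apply (y v w : EuclideanSpace ℝ (Fin k)) :
    S.redLocal β γ y ![v, w] = S.sliceForm β (y, 0) ![(v, 0, 0), (w, 0, 0)] := by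
  rw [redLocal, alt_comp_apply_two, cutLocal]
  have h : ‖(ContinuousLinearMap.inl ℝ (EuclideanSpace ℝ (Fin k)) ℂ y).2‖ ^ 2 = 0 := by simp
  rw [h]
  exact cutModel_zero_inl _ _ v w

theorem inl_mem_dom {y : EuclideanSpace ℝ (Fin k)} (hy : y ∈ S.B) :
    ContinuousLinearMap.inl ℝ (EuclideanSpace ℝ (Fin k)) ℂ y ∈ S.dom :=
  ⟨hy, by simpa using S.δ_pos⟩

theorem contDiffOn_redLocal (hβ : β.IsSmooth) (hγ : ContDiffOn ℝ ∞ γ (S.B ×ˢ Ico 0 S.δ)) :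
    ContDiffOn ℝ ∞ (S.redLocal β γ) S.B := fun y hy =>
  ContDiffWithinAt.alt_two_comp ((S.contDiffOn_cutLocal hβ hγ _ (S.inl_mem_dom hy)).comp y
    (ContinuousLinearMap.contDiff _).contDiffWithinAt fun _ h => S.inl_mem_dom h)
    contDiffWithinAt_const

/-- `redLocal` is the pullback of the closed form `cutLocal` by `s ↦ (s, 0)`. -/
theorem extDeriv_redLocal (hβ : β.IsSmooth) (hβc : β.IsClosed) {V : Set A.U}
    (hV : A.IsInvariantOn β V) (hSV : S.W ⊆ V) (hγ : ContDiffOn ℝ ∞ γ (S.B ×ˢ Ico 0 S.δ))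
    (he : ∀ y ∈ S.B ×ˢ Ico 0 S.δ, ∀ v,
      S.sliceForm β y ![angularVector _, (v, 0, 0)] = y.2 * γ y v)
    {y : EuclideanSpace ℝ (Fin k)} (hy : y ∈ S.B) : extDeriv (S.redLocal β γ) y = 0 := by
  have hy' := S.inl_mem_dom hy
  refine (extDeriv_comp_clm (Ω := S.cutLocal β γ) _ (((S.contDiffOn_cutLocal hβ hγ).contDiffAt
    (S.isOpen_dom.mem_nhds hy')).differentiableAt (by simp))).trans ?_
  rw [S.extDeriv_cutLocal hβ hβc hV hSV hγ he hy']
  ext; simp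

theorem redLocal_nondegenerate (hf : IsBoundaryDefining (k := k) f)
    (hinv : ∀ (a : Circle) (x : A.U), f (a • x) = f x) (hβ : β.IsNondegenerate)
    (hb : A.BasicOnBoundary β) {y : EuclideanSpace ℝ (Fin k)} (hy : y ∈ S.B) :
    AltNondegenerate (S.redLocal β γ y) := fun v hv =>
  (S.sliceForm_nondegenerate hf hinv hβ (S.zero_mem hy)).horizontal
    (S.sliceForm_angular hf hb hy) fun w => (S.redLocal_apply y v w).symm.trans (hv w)

theorem toRed_bdryAct_bdryLift (hf : IsBoundaryDefining (k := k) f) (p₀ : Bdry k M) (a : Circle)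
    (y : EuclideanSpace ℝ (Fin k)) :
    A.toRed (A.bdryAct a (S.bdryLift p₀ y)) = (S.redChart hf p₀).symm y :=
  (A.toRed_eq_iff.2 ⟨a, rfl⟩).symm

theorem redToCut_redChart_symm (hf : IsBoundaryDefining (k := k) f)
    (hinv : ∀ (a : Circle) (x : A.U), f (a • x) = f x) (p₀ : Bdry k M)
    {y : EuclideanSpace ℝ (Fin k)} (hy : y ∈ S.B) :
    A.redToCut ((S.redChart hf p₀).symm y) = (S.cutChart hf hinv).symm (modelEquiv k (y, 0)) := by
  have h1 := S.bdryToU_bdryLift hf p₀ hy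
  have h2 : A.bdryToU (S.bdryLift p₀ y) ∈ S.W := by rw [h1]; exact S.τ_mem _ (S.zero_mem hy)
  have h3 := S.cutChart_redToCut hf hinv h2
  rw [h1, S.s_τ _ (S.zero_mem hy)] at h3
  rw [← h3, S.redChart_symm_apply]
  exact ((S.cutChart hf hinv).left_inv (S.mem_cutChart_source hf hinv h2)).symm

/-- Both halves of basicness enter: invariance reduces to `a = 1`, and horizontality removes the
angular components, leaving a form in `s` alone. -/
theorem param_bdry_eq (hf : IsBoundaryDefining (k := k) f) (hb : A.BasicOnBoundary β)
    (p₀ : Bdry k M) (a : Circle) {s : EuclideanSpace ℝ (Fin k)} (hs : s ∈ S.B) :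
    (DiffForm.pullback (𝓡 (k + 1)) (𝓡∂ (k + 2)) (bdryIncl k M) β).param
      (fun y => A.bdryAct (a * Circle.exp y.2) (S.bdryLift p₀ y.1)) (S.B ×ˢ univ) (s, 0) =
    (S.redLocal β γ s).compContinuousLinearMap
      (ContinuousLinearMap.fst ℝ (EuclideanSpace ℝ (Fin k)) ℝ) := by
  have hmem : ((s, 0) : EuclideanSpace ℝ (Fin k) × ℝ) ∈ S.B ×ˢ (univ : Set ℝ) := ⟨hs, mem_univ _⟩
  have hu : UniqueDiffWithinAt ℝ (S.B ×ˢ (univ : Set ℝ)) (s, 0) :=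
    (S.isOpen_B.prod isOpen_univ).uniqueDiffWithinAt hmem
  have hact := contMDiff_bdryAct A a
  have h1 : (fun y : EuclideanSpace ℝ (Fin k) × ℝ =>
      A.bdryAct (a * Circle.exp y.2) (S.bdryLift p₀ y.1)) =
      A.bdryAct a ∘ fun y => A.bdryAct (1 * Circle.exp y.2) (S.bdryLift p₀ y.1) := by
    funext y
    rw [Function.comp_apply, ← A.bdryAct_mul, one_mul]
  rw [h1, ← DiffForm.param_pullback _ (hact.mdifferentiableAt (by simp))
    ((S.contMDiffOn_bdryAct_bdryLift hf p₀ 1 _ hmem).mdifferentiableWithinAt (by simp)) hu,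
    hb.invariant a, S.param_bdryAct_bdryLift hf β p₀ hs]
  refine alt_two_ext fun v w => ?_
  rw [alt_comp_apply_two, alt_comp_apply_two, redLocal_apply, bdryPolar_apply, bdryPolar_apply]
  set σ := S.sliceForm β (s, 0) with hσ
  have h2 : ∀ v, altToBilin _ σ (angularVector _) (v, 0, 0) = 0 := fun v =>
    (altToBilin_apply _ _ _).trans (S.sliceForm_angular hf hb hs v)
  have h3 : ∀ v, altToBilin _ σ (v, 0, 0) (angularVector _) = 0 := fun v => by
    rw [altToBilin_apply, alt_two_swap, S.sliceForm_angular hf hb hs v, neg_zero]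
  have h4 : altToBilin _ σ (angularVector _) (angularVector _) = 0 := by
    rw [altToBilin_apply, alt_two_self]
  have h5 : ∀ v : EuclideanSpace ℝ (Fin k) × ℝ,
      ((v.1, v.2, 0) : EuclideanSpace ℝ (Fin k) × ℝ × ℝ) =
        (v.1, 0, 0) + v.2 • angularVector _ := fun v => by
    simp [angularVector]
  rw [← altToBilin_apply, ← altToBilin_apply, h5 v, h5 w]
  simp [h2, h3, h4]

end Slice

variable [T2Space M] [SecondCountableTopology M]
  [ChartedSpace (EuclideanSpace ℝ (Fin k)) A.Red] [IsManifold (𝓡 k) ∞ A.Red]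

/-- Rotate the local section so that it passes through `p`; followed by `toRed` it becomes an
inverse chart of the reduced space, whose derivative is onto. -/
theorem surjective_mfderiv_toRed
    (hr : ∀ φ, φ ∈ atlas (EuclideanSpace ℝ (Fin k)) A.Red ↔ IsCompatibleChart A.RedSmoothAt φ)
    (hf : IsBoundaryDefining (k := k) f) (hinv : ∀ (a : Circle) (x : A.U), f (a • x) = f x)
    (p : Bdry k M) : Function.Surjective (mfderiv (𝓡 (k + 1)) (𝓡 k) A.toRed p :
      EuclideanSpace ℝ (Fin (k + 1)) →L[ℝ] EuclideanSpace ℝ (Fin k)) := by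
  obtain ⟨S, hp, -⟩ := exists_slice_bdry hf hinv A.isInvariantNhd_univ p
  have hφ := IsManifold.subset_maximalAtlas (I := 𝓡 k) (n := ∞)
    ((hr _).2 (S.isCompatibleChart_redChart hf p))
  have hq : A.toRed p ∈ (S.redChart hf p).source := ⟨p, hp, rfl⟩
  have hs : S.s (A.bdryToU p) ∈ S.B := S.mem_B _ hp
  have hg := ((S.contMDiffOn_bdryLift hf p).contMDiffAt (S.isOpen_B.mem_nhds hs))
  set a := S.w (A.bdryToU p) with ha
  set g := fun y => A.bdryAct a (S.bdryLift p y) with hgdef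
  have hgp : g (S.s (A.bdryToU p)) = p := S.bdryAct_bdryLift hf p hp
  have hg' : HasMFDerivAt 𝓘(ℝ, EuclideanSpace ℝ (Fin k)) (𝓡 (k + 1)) g (S.s (A.bdryToU p)) _ :=
    (((contMDiff_bdryAct A a).contMDiffAt.comp _ hg).mdifferentiableAt (by simp)).hasMFDerivAt
  have hπ : HasMFDerivAt (𝓡 (k + 1)) (𝓡 k) A.toRed (g (S.s (A.bdryToU p))) _ :=
    ((isSubmersion_toRed hr hf hinv).contMDiff.mdifferentiableAt (by simp)).hasMFDerivAt
  have h1 := hπ.comp _ hg'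
  have h2 : HasMFDerivAt 𝓘(ℝ, EuclideanSpace ℝ (Fin k)) (𝓡 k) (S.redChart hf p).symm
      (S.s (A.bdryToU p)) _ :=
    ((contMDiffAt_symm_of_mem_maximalAtlas hφ hs).mdifferentiableAt (by simp)).hasMFDerivAt
  have h3 : A.toRed ∘ g = (S.redChart hf p).symm :=
    funext fun y => S.toRed_bdryAct_bdryLift hf p a y
  rw [h3] at h1
  have h4 := hasMFDerivAt_unique h1 h2
  have h5 := DiffForm.mfderiv_symm_comp_mfderiv hφ hq
  rw [S.redChart_apply hf p hp] at h5
  intro v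
  have h6 := DFunLike.congr_fun h5 v
  have h7 := DFunLike.congr_fun h4 (mfderiv (𝓡 k) 𝓘(ℝ, EuclideanSpace ℝ (Fin k))
    (S.redChart hf p) (A.toRed p) v)
  rw [hgp] at h7
  exact ⟨_, h7.trans h6⟩

omit [T2Space M] [SecondCountableTopology M] [ChartedSpace (EuclideanSpace ℝ (Fin k)) A.Red]
  [IsManifold (𝓡 k) ∞ A.Red] in
theorem Slice.form_eq_of_param_eq (S : A.Slice f) (hf : IsBoundaryDefining (k := k) f)
    {α α' : DiffForm (𝓡 (k + 1)) (Bdry k M) 2} (p₀ : Bdry k M) {p : Bdry k M}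
    (hp : A.bdryToU p ∈ S.W)
    (h : α.param (fun y => A.bdryAct (S.w (A.bdryToU p) * Circle.exp y.2) (S.bdryLift p₀ y.1))
        (S.B ×ˢ univ) (S.s (A.bdryToU p), 0) =
      α'.param (fun y => A.bdryAct (S.w (A.bdryToU p) * Circle.exp y.2) (S.bdryLift p₀ y.1))
        (S.B ×ˢ univ) (S.s (A.bdryToU p), 0)) : α p = α' p := by
  have hmem : ((S.s (A.bdryToU p), 0) : EuclideanSpace ℝ (Fin k) × ℝ) ∈
    S.B ×ˢ (univ : Set ℝ) := ⟨S.mem_B _ hp, mem_univ _⟩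
  set φ := S.bdrySliceChart hf p₀ (S.w (A.bdryToU p)) with hφ
  have hpφ : p ∈ φ.source := ⟨hp, by rw [inv_mul_cancel]; simp⟩
  have hφp : (bdryModelEquiv k).symm (φ p) = (S.s (A.bdryToU p), 0) := by
    have : φ p = bdryModelEquiv k (S.s (A.bdryToU p),
      (((S.w (A.bdryToU p))⁻¹ * S.w (A.bdryToU p) : Circle) : ℂ).arg) := rfl
    rw [this, ContinuousLinearEquiv.symm_apply_apply, inv_mul_cancel]
    simp
  refine DiffForm.eq_of_inMaxChart_eq (S.bdrySliceChart_mem_maximalAtlas hf p₀ _) hpφ ?_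
  have key : ∀ α : DiffForm (𝓡 (k + 1)) (Bdry k M) 2, α.inMaxChart φ (φ p) =
      (α.param (fun y => A.bdryAct (S.w (A.bdryToU p) * Circle.exp y.2) (S.bdryLift p₀ y.1))
        (S.B ×ˢ univ) (S.s (A.bdryToU p), 0)).compContinuousLinearMap
        (fderivWithin ℝ (bdryModelEquiv k).symm univ (φ p)) := fun α => by
    have h1 := DiffForm.param_comp α (D := S.B ×ˢ univ) (D' := univ) (y := φ p)
      (h := (bdryModelEquiv k).symm)
      (g := fun y : EuclideanSpace ℝ (Fin k) × ℝ =>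
        A.bdryAct (S.w (A.bdryToU p) * Circle.exp y.2) (S.bdryLift p₀ y.1))
      (by rw [hφp]; exact (S.contMDiffOn_bdryAct_bdryLift hf p₀ _ _ hmem).mdifferentiableWithinAt
            (by simp))
      (bdryModelEquiv k).symm.differentiableAt.differentiableWithinAt
      (by
        rw [nhdsWithin_univ]
        refine (bdryModelEquiv k).symm.continuous.continuousAt.preimage_mem_nhds ?_
        rw [hφp]
        exact (S.isOpen_B.prod isOpen_univ).mem_nhds hmem)
      uniqueDiffWithinAt_univ
    rw [hφp] at h1
    exact h1
  rw [key, key, h]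

theorem Slice.pullback_toRed_eq (S : A.Slice f)
    (hr : ∀ φ, φ ∈ atlas (EuclideanSpace ℝ (Fin k)) A.Red ↔ IsCompatibleChart A.RedSmoothAt φ)
    (hf : IsBoundaryDefining (k := k) f) (hinv : ∀ (a : Circle) (x : A.U), f (a • x) = f x)
    (hb : A.BasicOnBoundary β) {βred : DiffForm (𝓡 k) A.Red 2} {p : Bdry k M}
    (hp : A.bdryToU p ∈ S.W)
    (h : βred.inMaxChart (S.redChart hf p) (S.s (A.bdryToU p)) =
      S.redLocal β γ (S.s (A.bdryToU p))) :
    DiffForm.pullback (𝓡 (k + 1)) (𝓡 k) A.toRed βred p =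
      DiffForm.pullback (𝓡 (k + 1)) (𝓡∂ (k + 2)) (bdryIncl k M) β p := by
  have hφ := IsManifold.subset_maximalAtlas (I := 𝓡 k) (n := ∞)
    ((hr _).2 (S.isCompatibleChart_redChart hf p))
  have hs : S.s (A.bdryToU p) ∈ S.B := S.mem_B _ hp
  have hmem : ((S.s (A.bdryToU p), 0) : EuclideanSpace ℝ (Fin k) × ℝ) ∈
    S.B ×ˢ (univ : Set ℝ) := ⟨hs, mem_univ _⟩
  have hu : UniqueDiffWithinAt ℝ (S.B ×ˢ (univ : Set ℝ)) (S.s (A.bdryToU p), (0 : ℝ)) :=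
    (S.isOpen_B.prod isOpen_univ).uniqueDiffWithinAt hmem
  refine S.form_eq_of_param_eq hf p hp ?_
  rw [S.param_bdry_eq (γ := γ) hf hb p _ hs, DiffForm.param_pullback _
    ((isSubmersion_toRed hr hf hinv).contMDiff.mdifferentiableAt (by simp))
    ((S.contMDiffOn_bdryAct_bdryLift hf p _ _ hmem).mdifferentiableWithinAt (by simp)) hu, ← h]
  have h1 : (A.toRed ∘ fun y : EuclideanSpace ℝ (Fin k) × ℝ =>
      A.bdryAct (S.w (A.bdryToU p) * Circle.exp y.2) (S.bdryLift p y.1)) =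
      (S.redChart hf p).symm ∘ ContinuousLinearMap.fst ℝ (EuclideanSpace ℝ (Fin k)) ℝ :=
    funext fun y => S.toRed_bdryAct_bdryLift hf p _ _
  have h2 := DiffForm.param_comp βred (D := univ) (D' := S.B ×ˢ univ)
    (y := (S.s (A.bdryToU p), (0 : ℝ))) (g := (S.redChart hf p).symm)
    (h := ContinuousLinearMap.fst ℝ (EuclideanSpace ℝ (Fin k)) ℝ)
    ((contMDiffAt_symm_of_mem_maximalAtlas hφ hs).mdifferentiableAt
      (by simp)).mdifferentiableWithinAt
    (ContinuousLinearMap.differentiableWithinAt _) (by simp) hu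
  rw [ContinuousLinearMap.fderivWithin _ hu] at h2
  rw [h1, h2]
  rfl

variable [ChartedSpace (EuclideanSpace ℝ (Fin (k + 2))) A.Cut] [IsManifold (𝓡 (k + 2)) ∞ A.Cut]

/-- In slice charts `redToCut` is the linear map `s ↦ (s, 0)`, so the restriction of the cut form is
`redLocal` by construction. -/
theorem Slice.inMaxChart_pullback_redToCut (S : A.Slice f)
    (hr : ∀ φ, φ ∈ atlas (EuclideanSpace ℝ (Fin k)) A.Red ↔ IsCompatibleChart A.RedSmoothAt φ)
    (hc : ∀ φ, φ ∈ atlas (EuclideanSpace ℝ (Fin (k + 2))) A.Cut ↔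
      IsCompatibleChart (A.CutSmoothAt f) φ)
    (hf : IsBoundaryDefining (k := k) f) (hinv : ∀ (a : Circle) (x : A.U), f (a • x) = f x)
    {βcut : DiffForm (𝓡 (k + 2)) A.Cut 2}
    (h : ∀ y ∈ (S.cutChart hf hinv).target,
      βcut.inMaxChart (S.cutChart hf hinv) y = S.cutChartForm β γ y)
    (p₀ : Bdry k M) {y : EuclideanSpace ℝ (Fin k)} (hy : y ∈ S.B) :
    (DiffForm.pullback (𝓡 k) (𝓡 (k + 2)) A.redToCut βcut).inMaxChart (S.redChart hf p₀) y =
      S.redLocal β γ y := by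
  have hφ := IsManifold.subset_maximalAtlas (I := 𝓡 k) (n := ∞)
    ((hr _).2 (S.isCompatibleChart_redChart hf p₀))
  have hψ := IsManifold.subset_maximalAtlas (I := 𝓡 (k + 2)) (n := ∞)
    ((hc _).2 (S.isCompatibleChart_cutChart hf hinv))
  let L : EuclideanSpace ℝ (Fin k) →L[ℝ] EuclideanSpace ℝ (Fin (k + 2)) :=
    (modelEquiv k : EuclideanSpace ℝ (Fin k) × ℂ →L[ℝ] EuclideanSpace ℝ (Fin (k + 2))).comp
      (ContinuousLinearMap.inl ℝ _ ℂ)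
  have hLt : L y ∈ (S.cutChart hf hinv).target := by
    rw [S.cutChart_target, mem_preimage]
    simpa [L] using S.inl_mem_dom hy
  have h1 : MDifferentiableAt (𝓡 k) (𝓡 (k + 2)) A.redToCut ((S.redChart hf p₀).symm y) :=
    (isSmoothEmbedding_redToCut hr hc hf hinv).contMDiff.mdifferentiableAt (by simp)
  have h2 : MDifferentiableAt 𝓘(ℝ, EuclideanSpace ℝ (Fin k)) (𝓡 k) (S.redChart hf p₀).symm y :=
    (contMDiffAt_symm_of_mem_maximalAtlas hφ hy).mdifferentiableAt (by simp)
  have h3 : MDifferentiableAt 𝓘(ℝ, EuclideanSpace ℝ (Fin (k + 2))) (𝓡 (k + 2))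
      (S.cutChart hf hinv).symm (L y) :=
    (contMDiffAt_symm_of_mem_maximalAtlas hψ hLt).mdifferentiableAt (by simp)
  rw [DiffForm.inMaxChart, DiffForm.param_pullback _ h1 h2.mdifferentiableWithinAt
    uniqueDiffWithinAt_univ, DiffForm.param_congr (g' := (S.cutChart hf hinv).symm ∘ L),
    DiffForm.param_comp (D := univ) _ h3.mdifferentiableWithinAt L.differentiableWithinAt
      (by simp) uniqueDiffWithinAt_univ, fderivWithin_univ, L.fderiv]
  · have h4 := h _ hLt
    rw [DiffForm.inMaxChart] at h4
    rw [h4]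
    refine alt_two_ext fun v w => ?_
    rw [redLocal, ← S.cutChartForm_comp_modelEquiv, alt_comp_apply_two, alt_comp_apply_two,
      alt_comp_apply_two]
    rfl
  · rw [nhdsWithin_univ]
    filter_upwards [S.isOpen_B.mem_nhds hy] with z hz
    exact S.redToCut_redChart_symm hf hinv p₀ hz
  · exact S.redToCut_redChart_symm hf hinv p₀ hy

end BoundaryCircleAction

end

/-! ### Both forms together, and the conclusion -/

noncomputable section

namespace BoundaryCircleAction

variable {k : ℕ} {M : Type*} [TopologicalSpace M] [ChartedSpace (EuclideanHalfSpace (k + 2)) M]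
  [IsManifold (𝓡∂ (k + 2)) ∞ M] {A : BoundaryCircleAction k M} {f : A.U → ℝ}
  {β : DiffForm (𝓡∂ (k + 2)) M 2} [T2Space M] [SecondCountableTopology M]
  [ChartedSpace (EuclideanSpace ℝ (Fin k)) A.Red] [IsManifold (𝓡 k) ∞ A.Red]

theorem IsReducedForm.unique
    (hr : ∀ φ, φ ∈ atlas (EuclideanSpace ℝ (Fin k)) A.Red ↔ IsCompatibleChart A.RedSmoothAt φ)
    (hf : IsBoundaryDefining (k := k) f) (hinv : ∀ (a : Circle) (x : A.U), f (a • x) = f x)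
    {β' β'' : DiffForm (𝓡 k) A.Red 2} (h' : A.IsReducedForm β β') (h'' : A.IsReducedForm β β'') :
    β' = β'' := by
  funext q
  obtain ⟨p, rfl⟩ := A.isQuotientMap_toRed.surjective q
  have h1 := congrFun (h'.pullback_eq.trans h''.pullback_eq.symm) p
  exact alt_comp_injective (E := EuclideanSpace ℝ (Fin (k + 1)))
    (F := EuclideanSpace ℝ (Fin k)) (surjective_mfderiv_toRed hr hf hinv p) h1

variable [ChartedSpace (EuclideanSpace ℝ (Fin (k + 2))) A.Cut] [IsManifold (𝓡 (k + 2)) ∞ A.Cut]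

/-- Taking the restriction of the cut form as the reduced form makes their compatibility automatic.
That it is symplectic and pulls back to `β` on the boundary is checked slice by slice on `redLocal`.
-/
theorem exists_symplectic_cut_and_reduced_forms
    (hr : ∀ φ, φ ∈ atlas (EuclideanSpace ℝ (Fin k)) A.Red ↔ IsCompatibleChart A.RedSmoothAt φ)
    (hc : ∀ φ, φ ∈ atlas (EuclideanSpace ℝ (Fin (k + 2))) A.Cut ↔
      IsCompatibleChart (A.CutSmoothAt f) φ)
    (hf : IsBoundaryDefining (k := k) f) (hinv : ∀ (a : Circle) (x : A.U), f (a • x) = f x)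
    (hβ : β.IsSymplectic) (hb : A.BasicOnBoundary β) (hβinv : A.InvariantNearBoundary β) :
    ∃ βcut : DiffForm (𝓡 (k + 2)) A.Cut 2, βcut.IsSymplectic ∧ A.IsCutForm β βcut ∧
      (DiffForm.pullback (𝓡 k) (𝓡 (k + 2)) A.redToCut βcut).IsSymplectic ∧
      A.IsReducedForm β (DiffForm.pullback (𝓡 k) (𝓡 (k + 2)) A.redToCut βcut) := by
  obtain ⟨V, hVn, hV⟩ := hβinv
  obtain ⟨βcut, hs, hcut, he⟩ := exists_cutForm hc hf hinv hβ hb hVn hV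
  set βred := DiffForm.pullback (𝓡 k) (𝓡 (k + 2)) A.redToCut βcut with hβred
  have key : ∀ p : Bdry k M, ∃ S : A.Slice f,
      ∃ γ : EuclideanSpace ℝ (Fin k) × ℝ → EuclideanSpace ℝ (Fin k) →L[ℝ] ℝ,
      A.bdryToU p ∈ S.W ∧ ContDiffOn ℝ ∞ (S.redLocal β γ) S.B ∧
      (∀ y ∈ S.B, extDeriv (S.redLocal β γ) y = 0) ∧
      (∀ y ∈ S.B, AltNondegenerate (S.redLocal β γ y)) ∧
      ∀ y ∈ S.B, βred.inMaxChart (S.redChart hf p) y = S.redLocal β γ y := fun p => by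
    obtain ⟨S, hp, hSV⟩ := exists_slice_bdry hf hinv hVn p
    obtain ⟨γ, hγ, hγe⟩ := S.exists_sliceForm_angular_eq hf hβ.smooth hb
    exact ⟨S, γ, hp, S.contDiffOn_redLocal hβ.smooth hγ,
      fun y hy => S.extDeriv_redLocal hβ.smooth hβ.closed hV hSV hγ hγe hy,
      fun y hy => S.redLocal_nondegenerate hf hinv hβ.nondegenerate hb hy,
      fun y hy => S.inMaxChart_pullback_redToCut hr hc hf hinv (he S hSV γ hγ hγe) p hy⟩
  have hmax : ∀ (S : A.Slice f) (p : Bdry k M),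
      S.redChart hf p ∈ IsManifold.maximalAtlas (𝓡 k) ∞ A.Red := fun S p =>
    IsManifold.subset_maximalAtlas ((hr _).2 (S.isCompatibleChart_redChart hf p))
  have hsm : βred.IsSmooth := DiffForm.isSmooth_of_inMaxChart _ fun q => by
    obtain ⟨p, rfl⟩ := A.isQuotientMap_toRed.surjective q
    obtain ⟨S, γ, hp, h1, -, -, h2⟩ := key p
    exact ⟨S.redChart hf p, hmax S p, ⟨p, hp, rfl⟩, h1.congr h2⟩
  refine ⟨βcut, hs, hcut, ⟨hsm, ?_, fun q => ?_⟩, hsm, funext fun p => ?_⟩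
  · refine DiffForm.isClosed_of_inMaxChart _ fun q => ?_
    obtain ⟨p, rfl⟩ := A.isQuotientMap_toRed.surjective q
    obtain ⟨S, γ, hp, h1, h3, -, h2⟩ := key p
    refine ⟨S.redChart hf p, hmax S p, ⟨p, hp, rfl⟩, h1.congr h2, fun y hy => ?_⟩
    have h4 : βred.inMaxChart (S.redChart hf p) =ᶠ[𝓝 y] S.redLocal β γ :=
      Filter.eventually_of_mem (S.isOpen_B.mem_nhds hy) h2
    rw [h4.extDeriv_eq]
    exact h3 y hy
  · obtain ⟨p, rfl⟩ := A.isQuotientMap_toRed.surjective q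
    obtain ⟨S, γ, hp, -, -, h3, h2⟩ := key p
    have hq : A.toRed p ∈ (S.redChart hf p).source := ⟨p, hp, rfl⟩
    have h4 := βred.eq_inMaxChart_comp (hmax S p) hq
    have hy : S.redChart hf p (A.toRed p) ∈ S.B := (S.redChart hf p).map_source hq
    rw [h2 _ hy] at h4
    have h5 := AltNondegenerate.comp (E := EuclideanSpace ℝ (Fin k)) (h3 _ hy)
      (DiffForm.mfderiv_bijective_of_mem_maximalAtlas (hmax S p) hq)
    have h6 : AltNondegenerate (βred (A.toRed p) :
        EuclideanSpace ℝ (Fin k) [⋀^Fin 2]→L[ℝ] ℝ) := Eq.mpr (congrArg AltNondegenerate h4) h5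
    exact h6
  · obtain ⟨S, γ, hp, -, -, -, h2⟩ := key p
    exact S.pullback_toRed_eq (γ := γ) hr hf hinv hb hp (h2 _ (S.mem_B _ hp))

end BoundaryCircleAction

end

theorem mainTheorem7 (k : ℕ) (M : Type*) [TopologicalSpace M] [T2Space M]
    [SecondCountableTopology M] [ChartedSpace (EuclideanHalfSpace (k + 2)) M]
    [IsManifold (𝓡∂ (k + 2)) ∞ M] (A : BoundaryCircleAction k M)
    (β : DiffForm (𝓡∂ (k + 2)) M 2) (hβ : β.IsSymplectic)
    (hbasic : A.BasicOnBoundary β) (hinv : A.InvariantNearBoundary β) :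
    ∃ (_ : ChartedSpace (EuclideanSpace ℝ (Fin k)) A.Red)
      (_ : ChartedSpace (EuclideanSpace ℝ (Fin (k + 2))) A.Cut),
      A.IsReducedManifold ∧ A.IsCutManifold ∧
      ∃ (βred : DiffForm (𝓡 k) A.Red 2) (βcut : DiffForm (𝓡 (k + 2)) A.Cut 2),
        (A.IsReducedForm β βred ∧ ∀ β', A.IsReducedForm β β' → β' = βred) ∧
        (A.IsCutForm β βcut ∧ ∀ β', A.IsCutForm β β' → β' = βcut) ∧
        βred.IsSymplectic ∧
        IsSmoothEmbedding (𝓡 k) (𝓡 (k + 2)) ∞ A.redToCut ∧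
        βcut.IsSymplectic ∧
        DiffForm.pullback (𝓡 k) (𝓡 (k + 2)) A.redToCut βcut = βred := by
  obtain ⟨f, hf, hfi⟩ := A.exists_invariant_boundaryDefining
  let _ := BoundaryCircleAction.redChartedSpace hf hfi
  let _ := BoundaryCircleAction.cutChartedSpace hf hfi
  -- The atlases consist of all compatible charts, so membership is compatibility by definition.
  have hr : ∀ φ, φ ∈ atlas (EuclideanSpace ℝ (Fin k)) A.Red ↔
    IsCompatibleChart A.RedSmoothAt φ := fun _ => Iff.rfl
  have hc : ∀ φ, φ ∈ atlas (EuclideanSpace ℝ (Fin (k + 2))) A.Cut ↔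
    IsCompatibleChart (A.CutSmoothAt f) φ := fun _ => Iff.rfl
  have hred := BoundaryCircleAction.isReducedManifold hr hf hfi
  have hcut := BoundaryCircleAction.isCutManifold hc hf hfi
  have := hred.isManifold
  have := hcut.isManifold
  obtain ⟨βcut, hs, hβcut, hs', hβred⟩ :=
    BoundaryCircleAction.exists_symplectic_cut_and_reduced_forms hr hc hf hfi hβ hbasic hinv
  exact ⟨inferInstance, inferInstance, hred, hcut, _, βcut,
    ⟨hβred, fun β' h' => BoundaryCircleAction.IsReducedForm.unique hr hf hfi h' hβred⟩,
    ⟨hβcut, fun β' h' => BoundaryCircleAction.IsCutForm.unique hc h' hβcut⟩, hs',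
    BoundaryCircleAction.isSmoothEmbedding_redToCut hr hc hf hfi, hs, rfl⟩
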